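/- **Notation.** Let $r\ge 1$ and $m\ge 0$ be integers. $l_0$ denotes finitely supported and $l$ arbitrary sequences on $\mathbb Z$ (with values in the indicated matrices); for a finitely supported $u$, $\hat u(\xi)=\sum_k u(k)e^{-ik\xi}$. For smooth $f,g$, the relation $f(\xi)=g(\xi)+O(|\xi|^{n})$ stands for $f^{(j)}(0)=g^{(j)}(0)$, $0\le j<n$. For a mask $a\in l_0(\mathbb Z)^{r\times r}$ the subdivision operator is $(S_a w)(j)=2\sum_k w(k)a(j-2k)$, the convolution is $(w*u)(j)=\sum_k w(j-k)u(k)$, and $\delta$ is the Dirac sequence. An order $n$ matching filter of $a$ is $v\in l_0(\mathbb Z)^{1\times r}$ with $\hat v(0)\ne0$ and $\hat v(2\xi)\hat a(\xi)=\hat v(\xi)+O(|\xi|^{n})$; $a$ has order $n$ sum rules with $v$ if moreover $\hat v(2\xi)\hat a(\xi+\pi)=O(|\xi|^{n})$, and $\mathrm{sr}(a)$ is the largest such $n$ (over all $v$). Put $\mathscr V_{j-1,v}=\{u\in l_0(\mathbb Z)^{r}:\hat v(\xi)\hat u(\xi)=O(|\xi|^{j})\}$, $$\rho_j(a,v)_\infty=\sup_{u\in\mathscr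 V_{j-1,v}}\limsup_{n\to\infty}\|(S_a^n(\delta I_r))*u\|_{\ell_\infty}^{1/n},\qquad \mathrm{sm}_\infty(a)=-\log_2\rho_{\mathrm{sr}(a)}(a,v)_\infty,$$ where $a$ has order $\mathrm{sr}(a)$ sum rules with $v$ (the value does not depend on $v$). For $u\in l_0(\mathbb Z)^r$ let $\mathrm{ld}_m(\hat v\hat u)$ be the smallest $j\in\{0,\dots,m\}$ with $[\hat v\hat u]^{(j)}(0)\neq0$, and $m$ if there is none, and let $\beta_j(u)=[\hat v\hat u]^{(j)}(0)/(i^jj!)$. The Fourier transform is $\hat f(\xi)=\int f(x)e^{-ix\xi}\,dx$, extended to compactly supported distributions. The vector cascade algorithm with mask $a$ and order $m+1$ matching filter $v$ is $C^m$ convergent if, with $C_af=2\sum_k a(k)f(2\cdot-k)$, the sequence $(C_a^nf)_n$ is Cauchy in $(C^m)^r$, with the norm $\sum_{j\le m}\sup_x\|f^{(j)}(x)\|$, for every compactly supported $f\in (C^m)^r$ with $\hat v(0)\hat f(0)=1$ and $\hat v(\xi)\hat f(\xi+2\pi k)=O(|\xi|^{m+1})$ for all $k\in\mathbb Z\setminus\{0\}$.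 For $w_0\in l(\mathbb Z)^{1\times r}$, $u\in l_0(\mathbb Z)^r$ and $\eta\in C^m(\mathbb R)$ consider, for $K>0$, the condition $$(\ast)\quad \lim_{n\to\infty}\max_{k\in\mathbb Z\cap[-2^nK,2^nK]}\bigl|[(S_a^nw_0)*u](k)\,2^{jn}-\beta_j(u)\,\eta^{(j)}(2^{-n}k)\bigr|=0,\qquad j=\mathrm{ld}_m(\hat v\hat u).$$ The vector subdivision scheme with mask $a$ (and matching filter $v$) is $C^m$ convergent if for every $w_0\in l(\mathbb Z)^{1\times r}$ there is a $C^m$ function $\eta:\mathbb R\to\mathbb C$ such that $(\ast)$ holds for all $K>0$ and all $u\in l_0(\mathbb Z)^r$. **Theorem.** Let $a\in l_0(\mathbb Z)^{r\times r}$ and let $v\in l_0(\mathbb Z)^{1\times r}$ be an order $m+1$ matching filter of $a$. Let $\mathscr B\subseteq\mathscr V_{m-1,v}$ be such that $\mathscr V_{m,v}\subseteq\mathrm{span}\{u(\cdot-k):u\in\mathscr B,\ k\in\mathbb Z\}$. Suppose that $1$ is a simple eigenvalue of $\hat a(0)$ (of algebraic multiplicity one) and that no $2^k$ with $k\in\{1,2,\dots\}$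 is an eigenvalue of $\hat a(0)$. Then there is a unique vector $\phi$ of $r$ compactly supported distributions with $\hat\phi(2\xi)=\hat a(\xi)\hat\phi(\xi)$ and $\hat v(0)\hat\phi(0)=1$, and the following statements are equivalent: 1. $\mathrm{sm}_\infty(a)>m$; or, equivalently, the vector cascade algorithm with mask $a$ and matching filter $v$ is $C^m$ convergent. 2. $\phi\in(C^m)^r$, and for all $u\in l_0(\mathbb Z)^r$, with $j=\mathrm{ld}_m(\hat v\hat u)$, $$\lim_{n\to\infty}\bigl\|[(S_a^n(\delta I_r))*u](\cdot)\,2^{jn}-\beta_j(u)\,\phi^{(j)}(2^{-n}\cdot)\bigr\|_{(\ell_\infty)^r}=0 .$$ 3. The vector subdivision scheme with mask $a$ is $C^m$ convergent. 4. For every $w_0\in l(\mathbb Z)^{1\times r}$ there is a $C^m$ function $\eta:\mathbb R\to\mathbb C$ such that $(\ast)$ holds for all $K>0$ and all $u\in\mathscr B$. 5. $\phi\in(C^m)^r$ (this is not required if $[\hat v\hat u]^{(m)}(0)=0$ for all $u\in\mathscr B$), and for all $u\in\mathscr B$, $$\lim_{n\to\infty}\bigl\|[(S_a^n(\delta I_r))*u](\cdot)\,2^{mn}-\beta_m(u)\,\phi^{(m)}(2^{-n}\cdot)\bigr\|_{(\ell_\infty)^r}=0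 .$$ Moreover, all of 1–5 hold if $\phi\in(C^m)^r$ and the integer shifts of $\phi$ are stable, i.e. $\mathrm{span}\{\hat\phi(\xi+2\pi k):k\in\mathbb Z\}=\mathbb C^r$ for all $\xi\in\mathbb R$. -/

import Mathlib

open Filter Topology Matrix
open scoped ContDiff ENNReal

noncomputable section

namespace VectorSubdivision

/-- Order of contact at the origin: `f(ξ) = g(ξ) + O(|ξ|^n)` as `ξ → 0`, in the convention that
this stands for the equality of the derivatives of orders `0, …, n - 1` at `0`
(it is only used for smooth `f` and `g`). -/
def AgreeAtZero {E : Type*} [NormedAddCommGroup E] [NormedSpace ℝ E]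
    (n : ℕ) (f g : ℝ → E) : Prop :=
  ∀ j < n, iteratedDeriv j f 0 = iteratedDeriv j g 0

/-- The Fourier series `û(ξ) = ∑ₖ u(k) e^{-ikξ}` of a finitely supported sequence. -/
def symbol {M : Type*} [AddCommGroup M] [Module ℂ M] (u : ℤ →₀ M) (ξ : ℝ) : M :=
  u.sum fun k c => Complex.exp (-(Complex.I * (k : ℂ) * (ξ : ℂ))) • c

variable {r : ℕ}

/-- `v` is an order `n` matching filter of the mask `a`:
`v̂(0) ≠ 0` and `v̂(2ξ) â(ξ) = v̂(ξ) + O(|ξ|^n)`. -/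
def IsMatchingFilter (a : ℤ →₀ Matrix (Fin r) (Fin r) ℂ) (v : ℤ →₀ (Fin r → ℂ)) (n : ℕ) : Prop :=
  symbol v 0 ≠ 0 ∧
    AgreeAtZero n (fun ξ => symbol v (2 * ξ) ᵥ* symbol a ξ) (fun ξ => symbol v ξ)

/-- The mask `a` has order `n` sum rules with the matching filter `v`. -/
def HasSumRules (a : ℤ →₀ Matrix (Fin r) (Fin r) ℂ) (v : ℤ →₀ (Fin r → ℂ)) (n : ℕ) : Prop :=
  IsMatchingFilter a v n ∧
    AgreeAtZero n (fun ξ => symbol v (2 * ξ) ᵥ* symbol a (ξ + Real.pi)) (fun _ => 0)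

/-- `sr(a)`: the largest `n` such that `a` has order `n` sum rules with some matching filter. -/
def sumRuleOrder (a : ℤ →₀ Matrix (Fin r) (Fin r) ℂ) : ℕ :=
  sSup {n | ∃ v : ℤ →₀ (Fin r → ℂ), HasSumRules a v n}

/-- The function `v̂ û` for a row sequence `v` and a column sequence `u`. -/
def rowCol (v u : ℤ →₀ (Fin r → ℂ)) (ξ : ℝ) : ℂ := symbol v ξ ⬝ᵥ symbol u ξ

/-- `vanishing v j` is the space `𝒱_{j-1,v}` of all `u` with `v̂(ξ) û(ξ) = O(|ξ|^j)`;
for `j = 0` it consists of all finitely supported `u`. -/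
def vanishing (v : ℤ →₀ (Fin r → ℂ)) (j : ℕ) : Set (ℤ →₀ (Fin r → ℂ)) :=
  {u | AgreeAtZero j (rowCol v u) (fun _ => 0)}

/-- `ld_m(f)`: the smallest `j ≤ m` with `f^{(j)}(0) ≠ 0`, and `m` if there is none. -/
def ld (m : ℕ) (f : ℝ → ℂ) : ℕ := sInf {j | j = m ∨ iteratedDeriv j f 0 ≠ 0}

/-- `β_j = [v̂ û]^{(j)}(0) / (i^j j!)`. -/
def beta (v u : ℤ →₀ (Fin r → ℂ)) (j : ℕ) : ℂ :=
  iteratedDeriv j (rowCol v u) 0 / (Complex.I ^ j * (j.factorial : ℂ))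

/-- The subdivision operator `(S_a w)(j) = 2 ∑ₖ w(k) a(j - 2k)` on arbitrary sequences of `s × r`
matrices; the sum is finite because `a` is finitely supported. -/
def sd {s : ℕ} (a : ℤ →₀ Matrix (Fin r) (Fin r) ℂ) (w : ℤ → Matrix (Fin s) (Fin r) ℂ) :
    ℤ → Matrix (Fin s) (Fin r) ℂ :=
  fun j => (2 : ℂ) • ∑ᶠ k : ℤ, w k * a (j - 2 * k)

/-- The convolution `[w * u](j) = ∑ₖ w(j - k) u(k)` with a finitely supported column sequence. -/
def conv {s : ℕ} (w : ℤ → Matrix (Fin s) (Fin r) ℂ) (u : ℤ →₀ (Fin r → ℂ)) : ℤ → (Fin s → ℂ) :=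
  fun j => u.sum fun k c => w (j - k) *ᵥ c

/-- The sequence `δ I_r`. -/
def deltaId (r : ℕ) : ℤ → Matrix (Fin r) (Fin r) ℂ := fun k => if k = 0 then 1 else 0

/-- `ρ_j(a, v)_∞`, the supremum over `u ∈ 𝒱_{j-1,v}` of
`limsup_n ‖(S_a^n (δ I_r)) * u‖_∞^{1/n}`. -/
def rho (a : ℤ →₀ Matrix (Fin r) (Fin r) ℂ) (v : ℤ →₀ (Fin r → ℂ)) (j : ℕ) : ℝ≥0∞ :=
  ⨆ u ∈ vanishing v j,
    limsup (fun n : ℕ => (⨆ k : ℤ, ‖conv ((sd a)^[n] (deltaId r)) u k‖ₑ) ^ (1 / (n : ℝ))) atTop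

/-- `sm_∞(a) = - log₂ ρ_{sr(a)}(a, v)_∞`, where `v` is a filter with which `a` has order `sr(a)`
sum rules. The value does not depend on `v`; to avoid a choice, the supremum over all such `v`
is taken. -/
def smInf (a : ℤ →₀ Matrix (Fin r) (Fin r) ℂ) : EReal :=
  ⨆ v ∈ {v : ℤ →₀ (Fin r → ℂ) | HasSumRules a v (sumRuleOrder a)},
    -(ENNReal.log (rho a v (sumRuleOrder a)) / ((Real.log 2 : ℝ) : EReal))

/-- The refinement operator `C_a f = 2 ∑ₖ a(k) f(2 · - k)`. -/
def cascade (a : ℤ →₀ Matrix (Fin r) (Fin r) ℂ) (f : ℝ → (Fin r → ℂ)) : ℝ → (Fin r → ℂ) :=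
  fun x => (2 : ℂ) • a.sum fun k A => A *ᵥ f (2 * x - (k : ℝ))

/-- The Fourier transform `∫ f(x) e^{-ixξ} dx` of a vector function
(used for compactly supported continuous functions). -/
def fourierFun (f : ℝ → (Fin r → ℂ)) (ξ : ℝ) : Fin r → ℂ :=
  ∫ x : ℝ, Complex.exp (-(Complex.I * (x : ℂ) * (ξ : ℂ))) • f x

/-- The `C^m` norm `∑_{j ≤ m} sup_x ‖f^{(j)}(x)‖`. -/
def cmNorm (m : ℕ) (f : ℝ → (Fin r → ℂ)) : ℝ≥0∞ :=
  ∑ j ∈ Finset.range (m + 1), ⨆ x : ℝ, ‖iteratedDeriv j f x‖ₑ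

/-- Admissible initial functions of the vector cascade algorithm: compactly supported `C^m` vector
functions `f` with `v̂(0) f̂(0) = 1` and `v̂(ξ) f̂(ξ + 2πk) = O(|ξ|^{m+1})` for `k ≠ 0`. -/
def IsAdmissibleInitial (v : ℤ →₀ (Fin r → ℂ)) (m : ℕ) (f : ℝ → (Fin r → ℂ)) : Prop :=
  ContDiff ℝ m f ∧ HasCompactSupport f ∧
    symbol v 0 ⬝ᵥ fourierFun f 0 = 1 ∧
    ∀ k : ℤ, k ≠ 0 →
      AgreeAtZero (m + 1) (fun ξ => symbol v ξ ⬝ᵥ fourierFun f (ξ + 2 * Real.pi * (k : ℝ)))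
        (fun _ => 0)

/-- `C^m` convergence of the vector cascade algorithm: `(C_a^n f)_n` is a Cauchy sequence in
`(C^m)^r` for every admissible initial function `f`. -/
def CascadeConverges (a : ℤ →₀ Matrix (Fin r) (Fin r) ℂ) (v : ℤ →₀ (Fin r → ℂ)) (m : ℕ) : Prop :=
  ∀ f : ℝ → (Fin r → ℂ), IsAdmissibleInitial v m f →
    ∀ ε : ℝ≥0∞, 0 < ε → ∃ N : ℕ, ∀ n ≥ N, ∀ n' ≥ N,
      cmNorm m (fun x => (cascade a)^[n] f x - (cascade a)^[n'] f x) < ε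

/-- Convergence of scalar data on compact sets: for every `K > 0`,
`max_{k ∈ ℤ ∩ [-2^n K, 2^n K]} |[(S_a^n w₀) * u](k) 2^{jn} - β_j η^{(j)}(2^{-n} k)| → 0`,
with `j = ld_m(v̂ û)`. -/
def DataConverges (a : ℤ →₀ Matrix (Fin r) (Fin r) ℂ) (v : ℤ →₀ (Fin r → ℂ)) (m : ℕ)
    (w₀ : ℤ → Matrix (Fin 1) (Fin r) ℂ) (u : ℤ →₀ (Fin r → ℂ)) (η : ℝ → ℂ) : Prop :=
  ∀ K : ℝ, 0 < K →
    Tendsto (fun n : ℕ => ⨆ (k : ℤ) (_ : |(k : ℝ)| ≤ 2 ^ n * K),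
      ‖conv ((sd a)^[n] w₀) u k 0 * 2 ^ (ld m (rowCol v u) * n)
        - beta v u (ld m (rowCol v u))
          * iteratedDeriv (ld m (rowCol v u)) η ((k : ℝ) / 2 ^ n)‖ₑ) atTop (𝓝 0)

/-- The vector subdivision scheme with mask `a` and matching filter `v` is `C^m` convergent. -/
def SubdivisionConverges (a : ℤ →₀ Matrix (Fin r) (Fin r) ℂ) (v : ℤ →₀ (Fin r → ℂ))
    (m : ℕ) : Prop :=
  ∀ w₀ : ℤ → Matrix (Fin 1) (Fin r) ℂ, ∃ η : ℝ → ℂ, ContDiff ℝ m η ∧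
    ∀ u : ℤ →₀ (Fin r → ℂ), DataConverges a v m w₀ u η

/-- `‖[(S_a^n (δ I_r)) * u](·) 2^{jn} - β_j g^{(j)}(2^{-n} ·)‖_{(ℓ_∞)^r} → 0`. -/
def BasisDataConverges (a : ℤ →₀ Matrix (Fin r) (Fin r) ℂ) (v : ℤ →₀ (Fin r → ℂ))
    (u : ℤ →₀ (Fin r → ℂ)) (j : ℕ) (g : ℝ → (Fin r → ℂ)) : Prop :=
  Tendsto (fun n : ℕ => ⨆ k : ℤ,
    ‖(2 : ℂ) ^ (j * n) • conv ((sd a)^[n] (deltaId r)) u k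
      - beta v u j • iteratedDeriv j g ((k : ℝ) / 2 ^ n)‖ₑ) atTop (𝓝 0)

/-- The space `C^∞(ℝ)` of smooth complex-valued functions. -/
def SmoothFun : Submodule ℂ (ℝ → ℂ) where
  carrier := {f | ContDiff ℝ ∞ f}
  add_mem' := by
    intro f g hf hg
    exact ContDiff.add (Set.mem_ofPred.mp hf) (Set.mem_ofPred.mp hg)
  zero_mem' := by
    show ContDiff ℝ ∞ (fun _ : ℝ => (0 : ℂ))
    exact contDiff_const
  smul_mem' := by
    intro c f hf
    exact ContDiff.smul (contDiff_const (c := c)) (Set.mem_ofPred.mp hf)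

/-- Compactly supported distributions on `ℝ`, as the continuous linear functionals on `C^∞(ℝ)`:
those that are bounded by a multiple of
`max_{j ≤ N} sup_{|x| ≤ R} |f^{(j)}(x)|` for some `N` and `R`. -/
@[ext]
structure CompactDistribution where
  toLin : SmoothFun →ₗ[ℂ] ℂ
  bound : ∃ (N : ℕ) (R C : ℝ), ∀ (f : SmoothFun) (M : ℝ),
    (∀ j ≤ N, ∀ x : ℝ, |x| ≤ R → ‖iteratedDeriv j (f : ℝ → ℂ) x‖ ≤ M) → ‖toLin f‖ ≤ C * M

/-- The smooth function `x ↦ e^{-ixξ}`. -/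
def expFun (ξ : ℝ) : SmoothFun :=
  ⟨fun x => Complex.exp (-(Complex.I * (x : ℂ) * (ξ : ℂ))), by
    have h : ContDiff ℝ ∞ fun x : ℝ => (x : ℂ) := Complex.ofRealCLM.contDiff
    exact (((contDiff_const.mul h).mul contDiff_const).neg).cexp⟩

/-- The Fourier transform `φ̂(ξ) = ⟨φ, e^{-i·ξ}⟩` of a vector of compactly supported
distributions. -/
def fourierDist (φ : Fin r → CompactDistribution) (ξ : ℝ) : Fin r → ℂ :=
  fun i => (φ i).toLin (expFun ξ)

/-- `φ̂(2ξ) = â(ξ) φ̂(ξ)` for all `ξ`, and `v̂(0) φ̂(0) = 1`. -/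
def IsNormalizedRefinable (a : ℤ →₀ Matrix (Fin r) (Fin r) ℂ) (v : ℤ →₀ (Fin r → ℂ))
    (φ : Fin r → CompactDistribution) : Prop :=
  (∀ ξ : ℝ, fourierDist φ (2 * ξ) = symbol a ξ *ᵥ fourierDist φ ξ) ∧
    symbol v 0 ⬝ᵥ fourierDist φ 0 = 1

/-- `φ` belongs to `(C^m)^r`, being given by the `C^m` vector function `g`. -/
def IsCmFunction (m : ℕ) (φ : Fin r → CompactDistribution) (g : ℝ → (Fin r → ℂ)) : Prop :=
  ContDiff ℝ m g ∧ HasCompactSupport g ∧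
    ∀ (i : Fin r) (f : SmoothFun), (φ i).toLin f = ∫ x : ℝ, g x i * (f : ℝ → ℂ) x

/-- Stability of the integer shifts: `span {φ̂(ξ + 2πk) : k ∈ ℤ} = ℂ^r` for all `ξ ∈ ℝ`. -/
def StableShifts (φ : Fin r → CompactDistribution) : Prop :=
  ∀ ξ : ℝ, Submodule.span ℂ
    (Set.range fun k : ℤ => fourierDist φ (ξ + 2 * Real.pi * (k : ℝ))) = ⊤

end VectorSubdivision

end

open VectorSubdivision

/-!
The whole theorem is about the decay of the data `W_n u = (S_a^n (δ I_r)) * u`. They are computed by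
the two transition operators `T_0`, `T_1`, which act on finitely supported sequences: `W_{n+1} u` is,
on the even and on the odd integers, `W_n (T_0 u)` and `W_n (T_1 u)`. All the equivalent statements
are compared with one property, `ExpDecay`: for some `lam < 2^{-m}`, `‖W_n u‖_∞ = O(lam^n)` for every
`u` in `𝒱_{m,v}`.

*Qualitative decay is exponential* (`expDecay_of_decay`). Suppose `‖W_n u‖_∞ = o(2^{-mn})` on
`𝒱_{m,v}`. As `W_n u` is supported in an interval of length `O(2^n)`, its moments of order `l ≤ m`,
weighted with `v̂(2^n ξ)`, are `o(2^{(l+1-m)n})`, hence `o(2^n)`. By the matching relation the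
alternating ones among them are `2^n` times the Taylor coefficients of
`v̂(2ξ) â(ξ + π) û(ξ + π)`, which therefore vanish. This yields the sum rules of order `m + 1`
(`hasSumRules_of_decay`), so `T_0` and `T_1` preserve `𝒱_{m,v}`. They also shrink supports into a
fixed interval, and on the resulting finite-dimensional invariant space a contraction at one level
gives a geometric rate.

*The smoothness exponent* (`lt_smInf_of_expDecay`, `expDecay_of_lt_smInf`). Decay forces the matching
filters to agree up to a scalar (`matching_unique`), the order of sum rules is bounded
(`bddAbove_sumRules`), and the growth rates on the spaces of orders `j` and `j + 1` differ only by
the eigenvalue `2^{-j}` of `T_γ` on the quotient (`expDecaySeq_descend`), which is harmless for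
`j ≥ m + 1`.

*Exponential decay gives convergence.* The samples `f(y + j)` of a function with
`v̂(ξ) f̂(ξ + 2πk) = O(|ξ|^{m+1})` for all `k` have vanishing moments, by Poisson summation
(`X_pow_dvd_jet_mul_rc_sample_sub`), and the refinement operator acts on samples through the
transition operators. Hence the cascade iterates converge to a refinable `C^m` function
(`exists_isRefinableFun`), and so do those of every admissible function
(`cascadeConverges_of_expDecay`). The refinable function has `v̂ φ̂ = 1 + O(|ξ|^{m+1})` at `0`, and
`O(|ξ|^{m+1})` at the other multiples of `2π` (`IsRefinableFun.rf_of_ne_zero`); every `u` is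
therefore a combination of samples of the derivatives of `φ` up to an element of `𝒱_{m,v}`, which
gives the asymptotics of the data (`basisDataConverges_of_expDecay`) and the convergence of the
subdivision scheme (`subdivisionConverges_of_basis`).

*Convergence gives decay.* Each convergence statement on `𝓑` passes to shifts and linear combinations
and says, on `𝒱_{m,v}`, where `β_m` vanishes, that the data are `o(2^{-mn})`
(`decay_of_dataConverges`, `decay_of_basisDataConverges`). For the cascade algorithm, perturb an
admissible function by `∑ₗ u(l) b(· - l)` with a bump `b` (`decay_of_cascadeConverges`).

*Stability gives decay* (`decay_of_stable`). For stable shifts, inverting a Gram matrix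
(`exists_dual_symbol`) represents `u` as the samples of `φ` averaged by a rapidly decreasing kernel.
For `u` in `𝒱_{m,v}` this kernel has vanishing moments up to order `m`, so Taylor's formula for `φ`
bounds the data.

*The refinable distribution.* A compactly supported distribution is determined by its moments
(`CompactDistribution.ext_of_moments`), and the lowest moment in which two normalized solutions
differ would be an eigenvector of `â(0)` for an excluded eigenvalue
(`IsNormalizedRefinable.unique`). A solution is the limit of the iterates of the transposed
refinement operator on a combination of derivatives at `0` with the right moments
(`exists_isNormalizedRefinable`).
-/

noncomputable section

namespace VectorSubdivision

variable {r : ℕ}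

/-! ### Jets at the origin as formal power series -/

/-- The Taylor series at the origin of a smooth function, as a formal power series. -/
def jet (f : ℝ → ℂ) : PowerSeries ℂ :=
  PowerSeries.mk fun n => iteratedDeriv n f 0 / (n.factorial : ℂ)

lemma coeff_jet (n : ℕ) (f : ℝ → ℂ) :
    PowerSeries.coeff n (jet f) = iteratedDeriv n f 0 / (n.factorial : ℂ) := by
  simp [jet]

lemma X_pow_dvd_jet_iff (n : ℕ) (f : ℝ → ℂ) :
    PowerSeries.X ^ n ∣ jet f ↔ ∀ j < n, iteratedDeriv j f 0 = 0 := by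
  rw [PowerSeries.X_pow_dvd_iff]
  simp [coeff_jet, Nat.factorial_ne_zero]

lemma jet_add {f g : ℝ → ℂ} (hf : ContDiff ℝ ∞ f) (hg : ContDiff ℝ ∞ g) :
    jet (fun x => f x + g x) = jet f + jet g := by
  ext n
  have := iteratedDeriv_add (n := n) (x := (0 : ℝ)) (hf.of_le (by exact_mod_cast le_top)).contDiffAt
    (hg.of_le (by exact_mod_cast le_top)).contDiffAt
  simp only [map_add, coeff_jet, ← add_div]
  rw [← this]; rfl

lemma jet_sub {f g : ℝ → ℂ} (hf : ContDiff ℝ ∞ f) (hg : ContDiff ℝ ∞ g) :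
    jet (fun x => f x - g x) = jet f - jet g := by
  ext n
  have := iteratedDeriv_sub (n := n) (x := (0 : ℝ)) (hf.of_le (by exact_mod_cast le_top)).contDiffAt
    (hg.of_le (by exact_mod_cast le_top)).contDiffAt
  simp only [map_sub, coeff_jet, ← sub_div]
  rw [← this]; rfl

lemma jet_mul {f g : ℝ → ℂ} (hf : ContDiff ℝ ∞ f) (hg : ContDiff ℝ ∞ g) :
    jet (fun x => f x * g x) = jet f * jet g := by
  ext n
  have h := iteratedDeriv_mul (n := n) (x := (0 : ℝ)) (hf.of_le (by exact_mod_cast le_top)).contDiffAt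
    (hg.of_le (by exact_mod_cast le_top)).contDiffAt
  have h' : iteratedDeriv n (fun x => f x * g x) 0 = _ := h
  rw [PowerSeries.coeff_mul, coeff_jet, h', Finset.Nat.sum_antidiagonal_eq_sum_range_succ_mk,
    Finset.sum_div]
  refine Finset.sum_congr rfl fun i hi => ?_
  have hin : i ≤ n := Nat.lt_succ_iff.mp (Finset.mem_range.mp hi)
  simp only [coeff_jet]
  rw [Nat.cast_choose ℂ hin]
  have h1 : (n.factorial : ℂ) ≠ 0 := by exact_mod_cast n.factorial_ne_zero
  have h2 : (i.factorial : ℂ) ≠ 0 := by exact_mod_cast i.factorial_ne_zero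
  have h3 : ((n - i).factorial : ℂ) ≠ 0 := by exact_mod_cast (n - i).factorial_ne_zero
  field_simp

lemma jet_const (c : ℂ) : jet (fun _ => c) = PowerSeries.C c := by
  ext n
  rw [coeff_jet, iteratedDeriv_const, PowerSeries.coeff_C]
  split_ifs with h <;> simp [h]

lemma jet_zero : jet (fun _ => (0 : ℂ)) = 0 := by simp [jet_const]

lemma jet_one : jet (fun _ => (1 : ℂ)) = 1 := by simp [jet_const]

lemma jet_const_mul {f : ℝ → ℂ} (c : ℂ) (hf : ContDiff ℝ ∞ f) :
    jet (fun x => c * f x) = PowerSeries.C c * jet f := by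
  rw [jet_mul contDiff_const hf, jet_const]

lemma jet_sum {ι : Type*} (s : Finset ι) {f : ι → ℝ → ℂ} (hf : ∀ i ∈ s, ContDiff ℝ ∞ (f i)) :
    jet (fun x => ∑ i ∈ s, f i x) = ∑ i ∈ s, jet (f i) := by
  classical
  induction s using Finset.induction_on with
  | empty => simp [jet_zero]
  | insert i s hi ih =>
    simp only [Finset.sum_insert hi]
    rw [jet_add (hf i (by simp)) (ContDiff.sum fun j hj => hf j (by simp [hj])),
      ih fun j hj => hf j (by simp [hj])]

lemma jet_comp_mul {f : ℝ → ℂ} (c : ℝ) (hf : ContDiff ℝ ∞ f) :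
    jet (fun x => f (c * x)) = PowerSeries.rescale (c : ℂ) (jet f) := by
  ext n
  have := congrFun (iteratedDeriv_comp_const_smul (n := n)
    (hf.of_le (by exact_mod_cast le_top)) c) 0
  rw [PowerSeries.coeff_rescale, coeff_jet, coeff_jet, this]
  simp [mul_div_assoc]

lemma coeff_zero_jet (f : ℝ → ℂ) : PowerSeries.coeff 0 (jet f) = f 0 := by simp [coeff_jet]

lemma iteratedDeriv_cexp_mul_ofReal (n : ℕ) (c : ℂ) (x : ℝ) :
    iteratedDeriv n (fun x : ℝ => Complex.exp (c * x)) x = c ^ n * Complex.exp (c * x) := by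
  induction n generalizing x with
  | zero => simp
  | succ n ih =>
    rw [iteratedDeriv_succ, funext ih]
    have h : HasDerivAt (fun x : ℝ => c * (x : ℂ)) c x := by
      simpa using (Complex.ofRealCLM.hasDerivAt (x := x)).const_mul c
    rw [(h.cexp.const_mul (c ^ n)).deriv]; ring

lemma contDiff_cexp_mul (c : ℂ) : ContDiff ℝ ∞ fun x : ℝ => Complex.exp (c * x) := by
  have h : ContDiff ℝ ∞ fun x : ℝ => (x : ℂ) := Complex.ofRealCLM.contDiff
  exact (contDiff_const.mul h).cexp

lemma coeff_jet_cexp (n : ℕ) (c : ℂ) :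
    PowerSeries.coeff n (jet fun x : ℝ => Complex.exp (c * x)) = c ^ n / (n.factorial : ℂ) := by
  rw [coeff_jet, iteratedDeriv_cexp_mul_ofReal]; simp

lemma iteratedDeriv_apply {F : ℝ → (Fin r → ℂ)} {n : ℕ} (hF : ContDiff ℝ n F) (x : ℝ) (i : Fin r) :
    iteratedDeriv n F x i = iteratedDeriv n (fun x => F x i) x := by
  induction n generalizing F with
  | zero => simp
  | succ n ih =>
    rw [iteratedDeriv_succ', iteratedDeriv_succ', ih (by
      exact_mod_cast (contDiff_succ_iff_deriv.mp (by exact_mod_cast hF)).2.2)]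
    congr 1
    funext y
    have hd : DifferentiableAt ℝ F y := (hF.differentiable (by simp)) y
    rw [deriv_pi fun i => (differentiableAt_pi.mp hd) i]

/-- The componentwise Taylor series of a vector function. -/
def vjet (F : ℝ → (Fin r → ℂ)) : Fin r → PowerSeries ℂ := fun i => jet fun x => F x i

/-- The entrywise Taylor series of a matrix function. -/
def mjet (F : ℝ → Matrix (Fin r) (Fin r) ℂ) : Matrix (Fin r) (Fin r) (PowerSeries ℂ) :=
  fun i j => jet fun x => F x i j

/-- Congruence modulo `X ^ n` of vectors of power series. -/
def EqMod (n : ℕ) (p q : Fin r → PowerSeries ℂ) : Prop := ∀ i, PowerSeries.X ^ n ∣ p i - q i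

lemma EqMod.refl (n : ℕ) (p : Fin r → PowerSeries ℂ) : EqMod n p p := fun _ => by simp

lemma EqMod.trans {n : ℕ} {p q s : Fin r → PowerSeries ℂ} (h : EqMod n p q) (h' : EqMod n q s) :
    EqMod n p s := fun i => by simpa using dvd_add (h i) (h' i)

lemma EqMod.mono {n n' : ℕ} (hn : n' ≤ n) {p q : Fin r → PowerSeries ℂ} (h : EqMod n p q) :
    EqMod n' p q := fun i => (pow_dvd_pow _ hn).trans (h i)

lemma EqMod.dotProduct {n : ℕ} {p q : Fin r → PowerSeries ℂ} (h : EqMod n p q)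
    (s : Fin r → PowerSeries ℂ) : PowerSeries.X ^ n ∣ p ⬝ᵥ s - q ⬝ᵥ s := by
  rw [← sub_dotProduct]
  exact Finset.dvd_sum fun i _ => (h i).mul_right _

lemma EqMod.vecMul {n : ℕ} {p q : Fin r → PowerSeries ℂ} (h : EqMod n p q)
    (M : Matrix (Fin r) (Fin r) (PowerSeries ℂ)) : EqMod n (p ᵥ* M) (q ᵥ* M) :=
  fun _ => h.dotProduct _

lemma X_pow_dvd_rescale {n : ℕ} {p : PowerSeries ℂ} (c : ℂ) (h : PowerSeries.X ^ n ∣ p) :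
    PowerSeries.X ^ n ∣ PowerSeries.rescale c p := by
  rw [PowerSeries.X_pow_dvd_iff] at h ⊢
  intro m hm
  rw [PowerSeries.coeff_rescale, h m hm, mul_zero]

lemma agreeAtZero_iff_eqMod {n : ℕ} {F G : ℝ → (Fin r → ℂ)} (hF : ContDiff ℝ ∞ F)
    (hG : ContDiff ℝ ∞ G) : AgreeAtZero n F G ↔ EqMod n (vjet F) (vjet G) := by
  have key : ∀ i, vjet F i - vjet G i = jet fun x => F x i - G x i := fun i =>
    (jet_sub (contDiff_pi.mp hF i) (contDiff_pi.mp hG i)).symm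
  simp only [EqMod, key, X_pow_dvd_jet_iff, AgreeAtZero]
  have h2 : ∀ j i, iteratedDeriv j (fun x => F x i - G x i) 0
      = iteratedDeriv j F 0 i - iteratedDeriv j G 0 i := by
    intro j i
    rw [iteratedDeriv_apply (hF.of_le (by exact_mod_cast le_top)),
      iteratedDeriv_apply (hG.of_le (by exact_mod_cast le_top))]
    exact iteratedDeriv_sub ((contDiff_pi.mp hF i).of_le (by exact_mod_cast le_top)).contDiffAt
      ((contDiff_pi.mp hG i).of_le (by exact_mod_cast le_top)).contDiffAt
  simp only [h2, sub_eq_zero]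
  exact ⟨fun h i j hj => by rw [h j hj], fun h j hj => funext fun i => h i j hj⟩

lemma agreeAtZero_zero_iff {n : ℕ} {f : ℝ → ℂ} :
    AgreeAtZero n f (fun _ => 0) ↔ PowerSeries.X ^ n ∣ jet f := by
  rw [X_pow_dvd_jet_iff]
  simp [AgreeAtZero]

lemma vjet_vecMul {F : ℝ → (Fin r → ℂ)} {M : ℝ → Matrix (Fin r) (Fin r) ℂ} (hF : ContDiff ℝ ∞ F)
    (hM : ∀ i j, ContDiff ℝ ∞ fun x => M x i j) :
    vjet (fun x => F x ᵥ* M x) = vjet F ᵥ* mjet M := by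
  funext i
  simp only [vjet, Matrix.vecMul, dotProduct, mjet]
  rw [jet_sum _ fun j _ => (contDiff_pi.mp hF j).mul (hM j i)]
  exact Finset.sum_congr rfl fun j _ => jet_mul (contDiff_pi.mp hF j) (hM j i)

lemma jet_dotProduct {F G : ℝ → (Fin r → ℂ)} (hF : ContDiff ℝ ∞ F) (hG : ContDiff ℝ ∞ G) :
    jet (fun x => F x ⬝ᵥ G x) = vjet F ⬝ᵥ vjet G := by
  simp only [vjet, dotProduct]
  rw [jet_sum _ fun j _ => (contDiff_pi.mp hF j).mul (contDiff_pi.mp hG j)]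
  exact Finset.sum_congr rfl fun j _ => jet_mul (contDiff_pi.mp hF j) (contDiff_pi.mp hG j)

lemma vjet_comp_mul {F : ℝ → (Fin r → ℂ)} (c : ℝ) (hF : ContDiff ℝ ∞ F) :
    vjet (fun x => F (c * x)) = fun i => PowerSeries.rescale (c : ℂ) (vjet F i) :=
  funext fun i => jet_comp_mul c (contDiff_pi.mp hF i)

lemma contDiff_vecMul {F : ℝ → (Fin r → ℂ)} {M : ℝ → Matrix (Fin r) (Fin r) ℂ}
    (hF : ContDiff ℝ ∞ F) (hM : ∀ i j, ContDiff ℝ ∞ fun x => M x i j) :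
    ContDiff ℝ ∞ fun x => F x ᵥ* M x :=
  contDiff_pi.mpr fun i => by
    simp only [Matrix.vecMul, dotProduct]
    exact ContDiff.sum fun j _ => (contDiff_pi.mp hF j).mul (hM j i)

lemma contDiff_mulVec {F : ℝ → (Fin r → ℂ)} {M : ℝ → Matrix (Fin r) (Fin r) ℂ}
    (hF : ContDiff ℝ ∞ F) (hM : ∀ i j, ContDiff ℝ ∞ fun x => M x i j) :
    ContDiff ℝ ∞ fun x => M x *ᵥ F x :=
  contDiff_pi.mpr fun i => by
    simp only [Matrix.mulVec, dotProduct]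
    exact ContDiff.sum fun j _ => (hM i j).mul (contDiff_pi.mp hF j)

lemma contDiff_dotProduct {F G : ℝ → (Fin r → ℂ)} (hF : ContDiff ℝ ∞ F) (hG : ContDiff ℝ ∞ G) :
    ContDiff ℝ ∞ fun x => F x ⬝ᵥ G x :=
  ContDiff.sum fun j _ => (contDiff_pi.mp hF j).mul (contDiff_pi.mp hG j)

lemma EqMod.rescale {n : ℕ} {p q : Fin r → PowerSeries ℂ} (h : EqMod n p q) (c : ℂ) :
    EqMod n (fun i => PowerSeries.rescale c (p i)) (fun i => PowerSeries.rescale c (q i)) :=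
  fun i => by rw [← map_sub]; exact X_pow_dvd_rescale c (h i)

/-! ### Symbols of finitely supported sequences -/

/-- The exponential `e^{-ikξ}`. -/
def ek (k : ℤ) (ξ : ℝ) : ℂ := Complex.exp (-(Complex.I * (k : ℂ) * (ξ : ℂ)))

lemma ek_add (k l : ℤ) (ξ : ℝ) : ek (k + l) ξ = ek k ξ * ek l ξ := by
  simp only [ek, ← Complex.exp_add]; congr 1; push_cast; ring

lemma ek_two_mul (k : ℤ) (ξ : ℝ) : ek (2 * k) ξ = ek k (2 * ξ) := by
  simp only [ek]; congr 1; push_cast; ring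

lemma ek_zero_right (k : ℤ) : ek k 0 = 1 := by simp [ek]

lemma ek_zero_left (ξ : ℝ) : ek 0 ξ = 1 := by simp [ek]

lemma ek_add_right (k : ℤ) (x y : ℝ) : ek k (x + y) = ek k x * ek k y := by
  simp only [ek, ← Complex.exp_add]; congr 1; push_cast; ring

lemma ek_two_pi_mul (k l : ℤ) : ek k (2 * Real.pi * l) = 1 := by
  rw [ek, Complex.exp_eq_one_iff]
  exact ⟨-(k * l), by push_cast; ring⟩

lemma ek_two_pi (k : ℤ) : ek k (2 * Real.pi) = 1 := by
  simpa using ek_two_pi_mul k 1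

lemma norm_ek (k : ℤ) (ξ : ℝ) : ‖ek k ξ‖ = 1 := by
  rw [ek, show -(Complex.I * (k : ℂ) * (ξ : ℂ)) = ((-(k * ξ) : ℝ) : ℂ) * Complex.I by
    push_cast; ring, Complex.norm_exp_ofReal_mul_I]

lemma ek_one_pi : ek 1 Real.pi = -1 := by
  rw [ek, show -(Complex.I * ((1 : ℤ) : ℂ) * (Real.pi : ℂ)) = -(Real.pi * Complex.I) by
    push_cast; ring, Complex.exp_neg, Complex.exp_pi_mul_I]
  norm_num

lemma contDiff_ek (k : ℤ) : ContDiff ℝ ∞ (ek k) := by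
  have := contDiff_cexp_mul (-(Complex.I * k))
  have e : ek k = fun x : ℝ => Complex.exp (-(Complex.I * k) * x) := by
    funext x; rw [ek, neg_mul]
  rw [e]; exact this

lemma coeff_jet_ek (n : ℕ) (k : ℤ) :
    PowerSeries.coeff n (jet (ek k)) = (-(Complex.I * k)) ^ n / (n.factorial : ℂ) := by
  rw [← coeff_jet_cexp]; congr 3; funext x; simp [ek]

section symbol

variable {M : Type*} [AddCommGroup M] [Module ℂ M]

lemma symbol_eq_sum (u : ℤ →₀ M) (ξ : ℝ) : symbol u ξ = u.sum fun k c => ek k ξ • c := rfl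

lemma symbol_add (u w : ℤ →₀ M) (ξ : ℝ) : symbol (u + w) ξ = symbol u ξ + symbol w ξ := by
  classical
  simp only [symbol_eq_sum]
  exact Finsupp.sum_add_index' (by simp) (by simp)

lemma symbol_smul (c : ℂ) (u : ℤ →₀ M) (ξ : ℝ) : symbol (c • u) ξ = c • symbol u ξ := by
  simp only [symbol_eq_sum, Finsupp.smul_sum]
  rw [Finsupp.sum_smul_index' (by simp)]
  simp only [Finsupp.sum, smul_comm c]

lemma symbol_single (k : ℤ) (c : M) (ξ : ℝ) : symbol (Finsupp.single k c) ξ = ek k ξ • c := by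
  rw [symbol_eq_sum, Finsupp.sum_single_index (by simp)]

lemma symbol_zero (ξ : ℝ) : symbol (0 : ℤ →₀ M) ξ = 0 := by simp [symbol]

lemma symbol_neg (u : ℤ →₀ M) (ξ : ℝ) : symbol (-u) ξ = -symbol u ξ := by
  rw [← neg_one_smul ℂ u, symbol_smul, neg_one_smul]

lemma symbol_sub (u w : ℤ →₀ M) (ξ : ℝ) : symbol (u - w) ξ = symbol u ξ - symbol w ξ := by
  rw [sub_eq_add_neg, symbol_add, symbol_neg, sub_eq_add_neg]

lemma symbol_sum {ι : Type*} (s : Finset ι) (u : ι → (ℤ →₀ M)) (ξ : ℝ) :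
    symbol (∑ i ∈ s, u i) ξ = ∑ i ∈ s, symbol (u i) ξ := by
  classical
  induction s using Finset.induction_on with
  | empty => simp [symbol_zero]
  | insert i s hi ih => rw [Finset.sum_insert hi, Finset.sum_insert hi, symbol_add, ih]

lemma symbol_add_two_pi_mul (u : ℤ →₀ M) (ξ : ℝ) (k : ℤ) :
    symbol u (ξ + 2 * Real.pi * k) = symbol u ξ := by
  simp only [symbol_eq_sum, ek_add_right, ek_two_pi_mul, mul_one]

lemma symbol_add_two_pi (u : ℤ →₀ M) (ξ : ℝ) : symbol u (ξ + 2 * Real.pi) = symbol u ξ := by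
  simpa using symbol_add_two_pi_mul u ξ 1

end symbol

lemma contDiff_symbol_comp_add (u : ℤ →₀ (Fin r → ℂ)) (θ : ℝ) :
    ContDiff ℝ ∞ fun ξ => symbol u (ξ + θ) := by
  simp only [symbol_eq_sum, Finsupp.sum]
  exact ContDiff.sum fun k _ =>
    ((contDiff_ek k).comp (contDiff_id.add contDiff_const)).smul contDiff_const

lemma contDiff_symbol (u : ℤ →₀ (Fin r → ℂ)) : ContDiff ℝ ∞ (symbol u) := by
  simpa using contDiff_symbol_comp_add u 0

lemma contDiff_symbol_mat (a : ℤ →₀ Matrix (Fin r) (Fin r) ℂ) (θ : ℝ) (i j : Fin r) :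
    ContDiff ℝ ∞ fun ξ => symbol a (ξ + θ) i j := by
  simp only [symbol_eq_sum, Finsupp.sum, Matrix.sum_apply, Matrix.smul_apply]
  exact ContDiff.sum fun k _ =>
    ((contDiff_ek k).comp (contDiff_id.add contDiff_const)).smul contDiff_const

lemma contDiff_symbol_mat' (a : ℤ →₀ Matrix (Fin r) (Fin r) ℂ) (i j : Fin r) :
    ContDiff ℝ ∞ fun ξ => symbol a ξ i j := by
  simpa using contDiff_symbol_mat a 0 i j

lemma contDiff_symbol_scalar (p : ℤ →₀ ℂ) : ContDiff ℝ ∞ (symbol p) := by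
  have : symbol p = fun ξ => ∑ k ∈ p.support, ek k ξ * p k := by
    funext ξ; simp [symbol_eq_sum, Finsupp.sum]
  rw [this]
  exact ContDiff.sum fun k _ => (contDiff_ek k).mul contDiff_const

lemma contDiff_rowCol (v u : ℤ →₀ (Fin r → ℂ)) : ContDiff ℝ ∞ (rowCol v u) :=
  contDiff_dotProduct (contDiff_symbol v) (contDiff_symbol u)

lemma jet_rowCol (v u : ℤ →₀ (Fin r → ℂ)) :
    jet (rowCol v u) = vjet (symbol v) ⬝ᵥ vjet (symbol u) :=
  jet_dotProduct (contDiff_symbol v) (contDiff_symbol u)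

lemma mem_vanishing_iff {v u : ℤ →₀ (Fin r → ℂ)} {n : ℕ} :
    u ∈ vanishing v n ↔ PowerSeries.X ^ n ∣ vjet (symbol v) ⬝ᵥ vjet (symbol u) := by
  rw [← jet_rowCol]; exact agreeAtZero_zero_iff

lemma isMatchingFilter_iff {a : ℤ →₀ Matrix (Fin r) (Fin r) ℂ} {v : ℤ →₀ (Fin r → ℂ)} {n : ℕ} :
    IsMatchingFilter a v n ↔ symbol v 0 ≠ 0 ∧
      EqMod n ((fun i => PowerSeries.rescale (2 : ℂ) (vjet (symbol v) i)) ᵥ* mjet (symbol a))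
        (vjet (symbol v)) := by
  have h1 : ContDiff ℝ ∞ fun ξ : ℝ => symbol v (2 * ξ) :=
    (contDiff_symbol v).comp (contDiff_const.mul contDiff_id)
  have h2 := vjet_vecMul h1 (contDiff_symbol_mat' a)
  rw [vjet_comp_mul 2 (contDiff_symbol v)] at h2
  rw [IsMatchingFilter, agreeAtZero_iff_eqMod (contDiff_vecMul h1 (contDiff_symbol_mat' a))
    (contDiff_symbol v), h2]
  simp

lemma hasSumRules_iff {a : ℤ →₀ Matrix (Fin r) (Fin r) ℂ} {v : ℤ →₀ (Fin r → ℂ)} {n : ℕ} :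
    HasSumRules a v n ↔ IsMatchingFilter a v n ∧
      EqMod n ((fun i => PowerSeries.rescale (2 : ℂ) (vjet (symbol v) i)) ᵥ*
        mjet (fun ξ => symbol a (ξ + Real.pi))) 0 := by
  have h1 : ContDiff ℝ ∞ fun ξ : ℝ => symbol v (2 * ξ) :=
    (contDiff_symbol v).comp (contDiff_const.mul contDiff_id)
  have h2 := vjet_vecMul h1 (contDiff_symbol_mat a Real.pi)
  rw [vjet_comp_mul 2 (contDiff_symbol v)] at h2
  have h3 : vjet (fun _ : ℝ => (0 : Fin r → ℂ)) = 0 := funext fun i => by simp [vjet, jet_zero]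
  rw [HasSumRules, agreeAtZero_iff_eqMod (contDiff_vecMul h1 (contDiff_symbol_mat a Real.pi))
    contDiff_const, h2, h3]
  simp

section shift

variable {M : Type*} [AddCommGroup M]

/-- The shifted sequence `u(· - l)`. -/
def shift (l : ℤ) (u : ℤ →₀ M) : ℤ →₀ M := u.mapDomain (· + l)

lemma shift_apply (l : ℤ) (u : ℤ →₀ M) (k : ℤ) : shift l u k = u (k - l) := by
  have := Finsupp.mapDomain_apply (add_left_injective l) u (k - l)
  simpa [shift] using this

lemma symbol_shift [Module ℂ M] (l : ℤ) (u : ℤ →₀ M) (ξ : ℝ) :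
    symbol (shift l u) ξ = ek l ξ • symbol u ξ := by
  rw [symbol_eq_sum, shift, Finsupp.sum_mapDomain_index (by simp) (by simp [smul_add]),
    symbol_eq_sum, Finsupp.smul_sum]
  simp only [ek_add, mul_comm (ek _ _) (ek l ξ), mul_smul]

/-- The `n`-th backward difference of the Dirac sequence, with symbol `(1 - e^{-iξ})^n`. -/
def diffSeq : ℕ → (ℤ →₀ ℂ)
  | 0 => Finsupp.single 0 1
  | n + 1 => diffSeq n - shift 1 (diffSeq n)

end shift

lemma symbol_diffSeq (n : ℕ) (ξ : ℝ) : symbol (diffSeq n) ξ = (1 - ek 1 ξ) ^ n := by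
  induction n with
  | zero => simp [diffSeq, symbol_single, ek_zero_left]
  | succ n ih => rw [diffSeq, symbol_sub, symbol_shift, ih, smul_eq_mul]; ring

/-- At the origin `1 - e^{-iξ} = ξ g(ξ)` with `g(0) = i`. -/
lemma exists_jet_diffSeq : ∃ g : PowerSeries ℂ, PowerSeries.constantCoeff g = Complex.I ∧
    ∀ n, jet (symbol (diffSeq n)) = PowerSeries.X ^ n * g ^ n := by
  have hE : ContDiff ℝ ∞ fun ξ => 1 - ek 1 ξ := contDiff_const.sub (contDiff_ek 1)
  have h0 : jet (fun ξ => 1 - ek 1 ξ) = 1 - jet (ek 1) := by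
    rw [jet_sub contDiff_const (contDiff_ek 1), jet_one]
  obtain ⟨g, hg⟩ : PowerSeries.X ∣ jet (fun ξ => 1 - ek 1 ξ) := by
    rw [PowerSeries.X_dvd_iff, ← PowerSeries.coeff_zero_eq_constantCoeff_apply, coeff_zero_jet,
      ek_zero_right, sub_self]
  refine ⟨g, ?_, fun n => ?_⟩
  · have h1 := congrArg (PowerSeries.coeff 1) hg
    rw [h0, map_sub, coeff_jet_ek, PowerSeries.coeff_one, ← zero_add 1,
      PowerSeries.coeff_succ_X_mul, PowerSeries.coeff_zero_eq_constantCoeff_apply] at h1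
    simpa using h1.symm
  · rw [← mul_pow, ← hg]
    induction n with
    | zero => simp [funext fun ξ => symbol_diffSeq 0 ξ, jet_one]
    | succ n ih =>
      rw [pow_succ, ← ih, ← jet_mul (contDiff_symbol_scalar _) hE]
      congr 1
      funext ξ
      rw [symbol_diffSeq, symbol_diffSeq, pow_succ]

/-- Every power series is, to any finite order, the jet of a trigonometric polynomial. -/
lemma exists_symbol_jet (q : PowerSeries ℂ) (n : ℕ) :
    ∃ p : ℤ →₀ ℂ, PowerSeries.X ^ n ∣ jet (symbol p) - q := by
  obtain ⟨g, hg, hj⟩ := exists_jet_diffSeq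
  induction n with
  | zero => exact ⟨0, by simp⟩
  | succ n ih =>
    obtain ⟨p, s, hs⟩ := ih
    refine ⟨p - (PowerSeries.constantCoeff s / Complex.I ^ n) • diffSeq n, ?_⟩
    have e : jet (symbol (p - (PowerSeries.constantCoeff s / Complex.I ^ n) • diffSeq n))
        = jet (symbol p) - PowerSeries.C (PowerSeries.constantCoeff s / Complex.I ^ n)
          * jet (symbol (diffSeq n)) := by
      rw [← jet_const_mul _ (contDiff_symbol_scalar _), ← jet_sub (contDiff_symbol_scalar _)
        (contDiff_const.mul (contDiff_symbol_scalar _))]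
      congr 1; funext ξ; rw [symbol_sub, symbol_smul, smul_eq_mul]
    rw [e, hj, show ∀ A B : PowerSeries ℂ, A - B - q = A - q - B from fun A B => by ring, hs,
      mul_left_comm, ← mul_sub, pow_succ]
    refine mul_dvd_mul_left _ ?_
    rw [PowerSeries.X_dvd_iff, map_sub, map_mul, map_pow, hg, PowerSeries.constantCoeff_C,
      div_mul_cancel₀ _ (pow_ne_zero _ Complex.I_ne_zero), sub_self]

/-- The sequence `k ↦ p(k) y` for a scalar sequence `p` and a vector `y`. -/
def smulSeq (p : ℤ →₀ ℂ) (y : Fin r → ℂ) : ℤ →₀ (Fin r → ℂ) :=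
  p.mapRange (fun c => c • y) (zero_smul _ _)

lemma symbol_smulSeq (p : ℤ →₀ ℂ) (y : Fin r → ℂ) (ξ : ℝ) :
    symbol (smulSeq p y) ξ = symbol p ξ • y := by
  rw [symbol_eq_sum, smulSeq, Finsupp.sum_mapRange_index (by simp), symbol_eq_sum, Finsupp.sum,
    Finsupp.sum, Finset.sum_smul]
  simp [mul_smul]

lemma vjet_smulSeq (p : ℤ →₀ ℂ) (y : Fin r → ℂ) :
    vjet (symbol (smulSeq p y)) = fun i => jet (symbol p) * PowerSeries.C (y i) := by
  funext i
  simp only [vjet, symbol_smulSeq, Pi.smul_apply, smul_eq_mul]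
  rw [jet_mul (contDiff_symbol_scalar p) contDiff_const, jet_const]

lemma vjet_add {F G : ℝ → (Fin r → ℂ)} (hF : ContDiff ℝ ∞ F) (hG : ContDiff ℝ ∞ G) :
    vjet (fun x => F x + G x) = vjet F + vjet G :=
  funext fun i => jet_add (contDiff_pi.mp hF i) (contDiff_pi.mp hG i)

lemma vjet_symbol_add (u w : ℤ →₀ (Fin r → ℂ)) :
    vjet (symbol (u + w)) = vjet (symbol u) + vjet (symbol w) := by
  rw [← vjet_add (contDiff_symbol u) (contDiff_symbol w)]
  exact congrArg vjet (funext fun ξ => symbol_add u w ξ)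

lemma vjet_symbol_smul (c : ℂ) (u : ℤ →₀ (Fin r → ℂ)) :
    vjet (symbol (c • u)) = PowerSeries.C c • vjet (symbol u) := by
  funext i
  rw [Pi.smul_apply, smul_eq_mul, vjet, vjet,
    ← jet_const_mul c (contDiff_pi.mp (contDiff_symbol u) i)]
  exact congrArg jet (funext fun ξ => by rw [symbol_smul]; rfl)

lemma vjet_symbol_single_zero (c : Fin r → ℂ) :
    vjet (symbol (Finsupp.single 0 c)) = fun i => PowerSeries.C (c i) := by
  funext i
  rw [← jet_const]
  exact congrArg jet (funext fun ξ => by simp [symbol_single, ek_zero_left])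

/-- `vanishing v n` as a submodule. -/
def vanishingSub (v : ℤ →₀ (Fin r → ℂ)) (n : ℕ) : Submodule ℂ (ℤ →₀ (Fin r → ℂ)) where
  carrier := vanishing v n
  add_mem' := by
    intro u w hu hw
    rw [mem_vanishing_iff] at *
    rw [vjet_symbol_add, dotProduct_add]; exact dvd_add hu hw
  zero_mem' := by
    rw [mem_vanishing_iff]
    simp [funext (symbol_zero (M := Fin r → ℂ)), vjet, jet_zero, dotProduct]
  smul_mem' := by
    intro c u hu
    rw [mem_vanishing_iff] at *
    rw [vjet_symbol_smul, dotProduct_smul]; exact hu.mul_left _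

lemma mem_vanishingSub {v u : ℤ →₀ (Fin r → ℂ)} {n : ℕ} :
    u ∈ vanishingSub v n ↔ u ∈ vanishing v n := Iff.rfl

/-! ### Transition operators and the iterated scheme -/

/-- The convolution of a matrix mask with a vector sequence. -/
def aconv (a : ℤ →₀ Matrix (Fin r) (Fin r) ℂ) (u : ℤ →₀ (Fin r → ℂ)) : ℤ →₀ (Fin r → ℂ) :=
  a.sum fun l A => u.sum fun j c => Finsupp.single (l + j) (A *ᵥ c)

lemma symbol_aconv (a : ℤ →₀ Matrix (Fin r) (Fin r) ℂ) (u : ℤ →₀ (Fin r → ℂ)) (ξ : ℝ) :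
    symbol (aconv a u) ξ = symbol a ξ *ᵥ symbol u ξ := by
  simp only [aconv, Finsupp.sum, symbol_sum, symbol_single]
  rw [symbol_eq_sum a, symbol_eq_sum u, Finsupp.sum, Finsupp.sum, Matrix.sum_mulVec]
  refine Finset.sum_congr rfl fun l _ => ?_
  rw [Matrix.mulVec_sum]
  refine Finset.sum_congr rfl fun j _ => ?_
  rw [Matrix.smul_mulVec, Matrix.mulVec_smul, smul_smul, ek_add]

lemma aconv_apply' (a : ℤ →₀ Matrix (Fin r) (Fin r) ℂ) (u : ℤ →₀ (Fin r → ℂ)) (k : ℤ) :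
    aconv a u k = u.sum fun j c => a (k - j) *ᵥ c := by
  classical
  have h : aconv a u = u.sum fun j c => a.sum fun l A => Finsupp.single (l + j) (A *ᵥ c) :=
    Finset.sum_comm
  rw [h]
  simp only [Finsupp.sum, Finsupp.finsetSum_apply]
  refine Finset.sum_congr rfl fun j _ => ?_
  rw [Finset.sum_eq_single (k - j)]
  · simp
  · intro l _ hl
    rw [Finsupp.single_eq_of_ne (by omega)]
  · intro hl
    simp [Finsupp.notMem_support_iff.mp hl]

lemma aconv_apply (a : ℤ →₀ Matrix (Fin r) (Fin r) ℂ) (u : ℤ →₀ (Fin r → ℂ)) (k : ℤ) :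
    aconv a u k = a.sum fun l A => A *ᵥ u (k - l) := by
  classical
  simp only [aconv, Finsupp.sum, Finsupp.finsetSum_apply]
  refine Finset.sum_congr rfl fun l _ => ?_
  rw [Finset.sum_eq_single (k - l)]
  · simp
  · intro j _ hj
    rw [Finsupp.single_eq_of_ne (by omega)]
  · intro hl
    simp [Finsupp.notMem_support_iff.mp hl]

lemma injective_two_mul_add (γ : ℤ) : Function.Injective fun k : ℤ => 2 * k + γ :=
  fun x y h => by simpa using h

/-- The transition operator `(T_γ u)(k) = 2 ∑ₗ a(l) u(2k + γ - l)`. -/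
def T (a : ℤ →₀ Matrix (Fin r) (Fin r) ℂ) (γ : ℤ) : (ℤ →₀ (Fin r → ℂ)) →ₗ[ℂ] (ℤ →₀ (Fin r → ℂ)) where
  toFun u := (2 : ℂ) • (aconv a u).comapDomain (fun k => 2 * k + γ)
    (injective_two_mul_add γ).injOn
  map_add' u w := by
    ext1 k
    simp [aconv_apply, Finsupp.sum, Matrix.mulVec_add, Finset.sum_add_distrib]
  map_smul' c u := by
    ext1 k
    simp [aconv_apply, Finsupp.sum, Matrix.mulVec_smul, Finset.smul_sum, smul_comm c]

lemma T_apply (a : ℤ →₀ Matrix (Fin r) (Fin r) ℂ) (γ : ℤ) (u : ℤ →₀ (Fin r → ℂ)) (k : ℤ) :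
    T a γ u k = (2 : ℂ) • a.sum fun l A => A *ᵥ u (2 * k + γ - l) := by
  simp [T, aconv_apply]

lemma T_apply' (a : ℤ →₀ Matrix (Fin r) (Fin r) ℂ) (γ : ℤ) (u : ℤ →₀ (Fin r → ℂ)) (k : ℤ) :
    T a γ u k = (2 : ℂ) • u.sum fun j c => a (2 * k + γ - j) *ᵥ c := by
  simp [T, aconv_apply']

/-- The subdivision data `(S_a^n (δ I_r)) * u`, computed through the transition operators. -/
def W (a : ℤ →₀ Matrix (Fin r) (Fin r) ℂ) : ℕ → (ℤ →₀ (Fin r → ℂ)) →ₗ[ℂ] (ℤ →₀ (Fin r → ℂ))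
  | 0 => LinearMap.id
  | n + 1 => (Finsupp.lmapDomain (Fin r → ℂ) ℂ fun k : ℤ => 2 * k + 0) ∘ₗ W a n ∘ₗ T a 0
      + (Finsupp.lmapDomain (Fin r → ℂ) ℂ fun k : ℤ => 2 * k + 1) ∘ₗ W a n ∘ₗ T a 1

lemma W_zero (a : ℤ →₀ Matrix (Fin r) (Fin r) ℂ) (u : ℤ →₀ (Fin r → ℂ)) : W a 0 u = u := rfl

lemma W_succ_zero (a : ℤ →₀ Matrix (Fin r) (Fin r) ℂ) (n : ℕ) (u : ℤ →₀ (Fin r → ℂ)) (k : ℤ) :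
    W a (n + 1) u (2 * k) = W a n (T a 0 u) k := by
  have h1 := Finsupp.mapDomain_apply (injective_two_mul_add 0) (W a n (T a 0 u)) k
  have h2 := Finsupp.mapDomain_of_notMem_range (f := fun k : ℤ => 2 * k + 1) (W a n (T a 1 u)) (2 * k)
    (by rintro ⟨x, hx⟩; simp only at hx; omega)
  simp only [add_zero] at h1
  simp [W, h1, h2]

lemma W_succ_one (a : ℤ →₀ Matrix (Fin r) (Fin r) ℂ) (n : ℕ) (u : ℤ →₀ (Fin r → ℂ)) (k : ℤ) :
    W a (n + 1) u (2 * k + 1) = W a n (T a 1 u) k := by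
  have h1 := Finsupp.mapDomain_apply (injective_two_mul_add 1) (W a n (T a 1 u)) k
  have h2 := Finsupp.mapDomain_of_notMem_range (f := fun k : ℤ => 2 * k) (W a n (T a 0 u)) (2 * k + 1)
    (by rintro ⟨x, hx⟩; simp only at hx; omega)
  simp [W, h1, h2]

/-- A property of integers holds if it holds for even and for odd ones. -/
lemma int_parity {P : ℤ → Prop} (h0 : ∀ k, P (2 * k)) (h1 : ∀ k, P (2 * k + 1)) (k : ℤ) : P k := by
  obtain ⟨l, hl | hl⟩ := Int.even_or_odd' k
  · exact hl ▸ h0 l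
  · exact hl ▸ h1 l

lemma symbol_mapDomain (γ : ℤ) (u : ℤ →₀ (Fin r → ℂ)) (ξ : ℝ) :
    symbol (u.mapDomain fun k : ℤ => 2 * k + γ) ξ = ek γ ξ • symbol u (2 * ξ) := by
  rw [symbol_eq_sum, Finsupp.sum_mapDomain_index (by simp) (by simp [smul_add]),
    symbol_eq_sum, Finsupp.smul_sum]
  simp only [ek_add, ek_two_mul, mul_comm (ek _ (2 * ξ)) (ek γ ξ), mul_smul]

lemma symbol_T_add (a : ℤ →₀ Matrix (Fin r) (Fin r) ℂ) (u : ℤ →₀ (Fin r → ℂ)) (ξ : ℝ) :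
    symbol (T a 0 u) (2 * ξ) + ek 1 ξ • symbol (T a 1 u) (2 * ξ)
      = (2 : ℂ) • (symbol a ξ *ᵥ symbol u ξ) := by
  have h : W a 1 u = (2 : ℂ) • aconv a u := by
    ext1 k
    revert k
    refine int_parity (fun k => ?_) fun k => ?_
    · rw [W_succ_zero, W_zero, T_apply, Finsupp.smul_apply, aconv_apply]; simp
    · rw [W_succ_one, W_zero, T_apply, Finsupp.smul_apply, aconv_apply]
  rw [← symbol_aconv, ← symbol_smul 2 (aconv a u), ← h]
  have h0 := symbol_mapDomain 0 (T a 0 u) ξ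
  have h1 := symbol_mapDomain 1 (T a 1 u) ξ
  rw [ek_zero_left, one_smul] at h0
  rw [← h0, ← h1, ← symbol_add]
  rfl

lemma ek_add_pi_one (ξ : ℝ) : ek 1 (ξ + Real.pi) = -ek 1 ξ := by
  rw [ek_add_right, ek_one_pi]; ring

lemma symbol_two_mul_add_pi {M : Type*} [AddCommGroup M] [Module ℂ M] (u : ℤ →₀ M) (ξ : ℝ) :
    symbol u (2 * (ξ + Real.pi)) = symbol u (2 * ξ) := by
  rw [mul_add, symbol_add_two_pi]

lemma symbol_T_zero (a : ℤ →₀ Matrix (Fin r) (Fin r) ℂ) (u : ℤ →₀ (Fin r → ℂ)) (ξ : ℝ) :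
    symbol (T a 0 u) (2 * ξ) = symbol a ξ *ᵥ symbol u ξ
      + symbol a (ξ + Real.pi) *ᵥ symbol u (ξ + Real.pi) := by
  have h1 := symbol_T_add a u ξ
  have h2 := symbol_T_add a u (ξ + Real.pi)
  rw [symbol_two_mul_add_pi, symbol_two_mul_add_pi, ek_add_pi_one] at h2
  have h3 : (2 : ℂ) • symbol (T a 0 u) (2 * ξ) = (2 : ℂ) • (symbol a ξ *ᵥ symbol u ξ
      + symbol a (ξ + Real.pi) *ᵥ symbol u (ξ + Real.pi)) := by
    rw [smul_add, ← h1, ← h2, two_smul]; simp only [neg_smul]; abel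
  exact smul_right_injective _ two_ne_zero h3

lemma symbol_T_one (a : ℤ →₀ Matrix (Fin r) (Fin r) ℂ) (u : ℤ →₀ (Fin r → ℂ)) (ξ : ℝ) :
    ek 1 ξ • symbol (T a 1 u) (2 * ξ) = symbol a ξ *ᵥ symbol u ξ
      - symbol a (ξ + Real.pi) *ᵥ symbol u (ξ + Real.pi) := by
  have h1 := symbol_T_add a u ξ
  rw [symbol_T_zero] at h1
  rw [← sub_eq_iff_eq_add'.mpr h1.symm, two_smul]; abel

/-- The product `â(2^{n-1}ξ) ⋯ â(2ξ) â(ξ)`. -/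
def symProd (a : ℤ →₀ Matrix (Fin r) (Fin r) ℂ) : ℕ → ℝ → Matrix (Fin r) (Fin r) ℂ
  | 0, _ => 1
  | n + 1, ξ => symProd a n (2 * ξ) * symbol a ξ

/-- In the Fourier domain, `n` subdivision steps multiply `û(ξ)` by
`2^n â(2^{n-1} ξ) ⋯ â(2 ξ) â(ξ)`. -/
lemma symbol_W (a : ℤ →₀ Matrix (Fin r) (Fin r) ℂ) (n : ℕ) (u : ℤ →₀ (Fin r → ℂ)) (ξ : ℝ) :
    symbol (W a n u) ξ = (2 : ℂ) ^ n • (symProd a n ξ *ᵥ symbol u ξ) := by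
  induction n generalizing u ξ with
  | zero => simp [W, symProd]
  | succ n ih =>
    have h0 := symbol_mapDomain 0 (W a n (T a 0 u)) ξ
    have h1 := symbol_mapDomain 1 (W a n (T a 1 u)) ξ
    have : symbol (W a (n + 1) u) ξ = symbol (W a n (T a 0 u)) (2 * ξ)
        + ek 1 ξ • symbol (W a n (T a 1 u)) (2 * ξ) := by
      rw [ek_zero_left, one_smul] at h0
      rw [← h0, ← h1, ← symbol_add]; rfl
    rw [this, ih, ih, smul_comm, ← smul_add, ← Matrix.mulVec_smul, ← Matrix.mulVec_add,
      symbol_T_add, symProd, Matrix.mulVec_smul, smul_smul, ← pow_succ, Matrix.mulVec_mulVec]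

lemma contDiff_symProd (a : ℤ →₀ Matrix (Fin r) (Fin r) ℂ) (n : ℕ) (i j : Fin r) :
    ContDiff ℝ ∞ fun ξ => symProd a n ξ i j := by
  induction n generalizing i j with
  | zero => exact contDiff_const
  | succ n ih =>
    simp only [symProd, Matrix.mul_apply]
    exact ContDiff.sum fun k _ =>
      ((ih i k).comp (contDiff_const.mul contDiff_id)).mul (contDiff_symbol_mat' a k j)

/-- `u` is supported in `[-L, L]`. -/
def SuppIn (L : ℕ) {M : Type*} [Zero M] (u : ℤ →₀ M) : Prop := ∀ k, u k ≠ 0 → |k| ≤ L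

lemma exists_suppIn {M : Type*} [Zero M] (u : ℤ →₀ M) : ∃ L : ℕ, SuppIn L u := by
  refine ⟨u.support.sup fun k => k.natAbs, fun k hk => ?_⟩
  have := Finset.le_sup (f := fun k : ℤ => k.natAbs) (Finsupp.mem_support_iff.mpr hk)
  rw [Int.abs_eq_natAbs]; exact_mod_cast this

lemma SuppIn.mono {L L' : ℕ} (h : L ≤ L') {M : Type*} [Zero M] {u : ℤ →₀ M} (hu : SuppIn L u) :
    SuppIn L' u := fun k hk => (hu k hk).trans (by exact_mod_cast h)

lemma T_bound {a : ℤ →₀ Matrix (Fin r) (Fin r) ℂ} {N L : ℕ} (ha : SuppIn N a)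
    {u : ℤ →₀ (Fin r → ℂ)} (hu : SuppIn L u) {γ : ℤ} (hγ : γ = 0 ∨ γ = 1) (k : ℤ)
    (hk : T a γ u k ≠ 0) : 2 * |k| ≤ N + L + 1 := by
  rw [T_apply] at hk
  have h1 : a.sum (fun l A => A *ᵥ u (2 * k + γ - l)) ≠ 0 := fun h => hk (by rw [h, smul_zero])
  obtain ⟨l, hl, hl'⟩ := Finset.exists_ne_zero_of_sum_ne_zero h1
  have h2 := ha l (Finsupp.mem_support_iff.mp hl)
  have h3 := hu (2 * k + γ - l) fun h => hl' (by simp only [h, Matrix.mulVec_zero])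
  rw [abs_le] at h2 h3
  rcases abs_cases k with ⟨h, -⟩ | ⟨h, -⟩ <;> omega

lemma suppIn_T {a : ℤ →₀ Matrix (Fin r) (Fin r) ℂ} {N L : ℕ} (ha : SuppIn N a) (hL : N + 1 ≤ L)
    {u : ℤ →₀ (Fin r → ℂ)} (hu : SuppIn L u) {γ : ℤ} (hγ : γ = 0 ∨ γ = 1) :
    SuppIn L (T a γ u) := fun k hk => by
  have := T_bound ha hu hγ k hk
  omega

lemma suppIn_W {a : ℤ →₀ Matrix (Fin r) (Fin r) ℂ} {N L : ℕ} (ha : SuppIn N a) (hL : N + 1 ≤ L)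
    {u : ℤ →₀ (Fin r → ℂ)} (hu : SuppIn L u) (n : ℕ) : ∀ k, W a n u k ≠ 0 →
    |k| + 1 ≤ 2 ^ n * (L + 1) := by
  induction n generalizing u with
  | zero => intro k hk; have := hu k hk; simpa using this
  | succ n ih =>
    refine int_parity (fun k hk => ?_) fun k hk => ?_
    · rw [W_succ_zero] at hk
      have := ih (suppIn_T ha hL hu (.inl rfl)) k hk
      rw [pow_succ]
      rw [abs_mul, abs_two]; linarith
    · rw [W_succ_one] at hk
      have := ih (suppIn_T ha hL hu (.inr rfl)) k hk
      have h2 := abs_add_le (2 * k) 1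
      rw [abs_mul, abs_two, abs_one] at h2
      rw [pow_succ]; linarith

section conv

variable {s : ℕ}

lemma conv_eq_finsum (w : ℤ → Matrix (Fin s) (Fin r) ℂ) (u : ℤ →₀ (Fin r → ℂ)) (k : ℤ) :
    conv w u k = ∑ᶠ l, w l *ᵥ u (k - l) := by
  have h1 : conv w u k = ∑ᶠ j, w (k - j) *ᵥ u j := by
    rw [conv, Finsupp.sum, finsum_eq_sum_of_support_subset]
    intro j hj
    simp only [Function.mem_support] at hj
    simp only [Finset.mem_coe, Finsupp.mem_support_iff]
    exact fun h => hj (by rw [h, Matrix.mulVec_zero])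
  rw [h1]
  have := finsum_comp_equiv (Equiv.subLeft k) (f := fun l => w l *ᵥ u (k - l))
  rw [← this]
  simp

/-- Subdividing `w` and convolving with `u` amounts, on the integers of parity `γ`, to convolving
`w` itself with `T_γ u`. -/
lemma conv_sd (a : ℤ →₀ Matrix (Fin r) (Fin r) ℂ) (w : ℤ → Matrix (Fin s) (Fin r) ℂ)
    (u : ℤ →₀ (Fin r → ℂ)) (γ k : ℤ) : conv (sd a w) u (2 * k + γ) = conv w (T a γ u) k := by
  rw [conv_eq_finsum w]
  simp only [conv, sd, T_apply', Finsupp.sum]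
  have hfin : ∀ j : ℤ, (Function.support fun l : ℤ => w l * a (2 * k + γ - j - 2 * l)).Finite := by
    intro j
    have hinj : Function.Injective fun l : ℤ => 2 * k + γ - j - 2 * l := fun x y h => by
      simp only at h; omega
    refine (a.hasFiniteSupport.preimage hinj.injOn).subset fun l hl => ?_
    simp only [Set.mem_preimage, Function.mem_support] at hl ⊢
    exact fun h => hl (by rw [h, Matrix.mul_zero])
  have h1 : ∀ j : ℤ, ((2 : ℂ) • ∑ᶠ l : ℤ, w l * a (2 * k + γ - j - 2 * l)) *ᵥ u j
      = ∑ᶠ l : ℤ, (2 : ℂ) • ((w l * a (2 * k + γ - j - 2 * l)) *ᵥ u j) := by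
    intro j
    have := (AddMonoidHom.mk' (fun M : Matrix (Fin s) (Fin r) ℂ => (2 : ℂ) • (M *ᵥ u j))
      fun A B => by rw [Matrix.add_mulVec, smul_add]).map_finsum (hfin j)
    rw [Matrix.smul_mulVec]
    exact this
  simp only [h1]
  rw [← finsum_sum_comm]
  · refine finsum_congr fun l => ?_
    rw [Matrix.mulVec_smul, Matrix.mulVec_sum, Finset.smul_sum]
    refine Finset.sum_congr rfl fun j _ => ?_
    rw [Matrix.mulVec_mulVec]
    congr 4; ring
  · intro j _
    refine (hfin j).subset fun l hl => ?_
    simp only [Function.mem_support] at hl ⊢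
    exact fun h => hl (by rw [h, Matrix.zero_mulVec, smul_zero])

/-- The data produced from an arbitrary sequence `w` are superpositions of the translates by
`2^n l` of the data produced from `δ I_r`. -/
lemma conv_sd_iterate (a : ℤ →₀ Matrix (Fin r) (Fin r) ℂ) (w : ℤ → Matrix (Fin s) (Fin r) ℂ) (n : ℕ)
    (u : ℤ →₀ (Fin r → ℂ)) (k : ℤ) :
    conv ((sd a)^[n] w) u k = ∑ᶠ l, w l *ᵥ W a n u (k - 2 ^ n * l) := by
  induction n generalizing u k with
  | zero => simp [conv_eq_finsum, W]
  | succ n ih =>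
    rw [Function.iterate_succ_apply']
    revert k
    refine int_parity (fun k => ?_) fun k => ?_
    · have := conv_sd a ((sd a)^[n] w) u 0 k
      rw [add_zero] at this
      rw [this, ih]
      refine finsum_congr fun l => ?_
      rw [← W_succ_zero]; congr 2; ring
    · rw [conv_sd, ih]
      refine finsum_congr fun l => ?_
      rw [← W_succ_one]; congr 2; ring

lemma conv_deltaId (a : ℤ →₀ Matrix (Fin r) (Fin r) ℂ) (n : ℕ) (u : ℤ →₀ (Fin r → ℂ)) (k : ℤ) :
    conv ((sd a)^[n] (deltaId r)) u k = W a n u k := by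
  rw [conv_sd_iterate, finsum_eq_single _ 0]
  · simp [deltaId]
  · intro l hl
    simp [deltaId, hl]

end conv

/-! ### Moments of the subdivision data -/

lemma symProd_add_two_pi_mul (a : ℤ →₀ Matrix (Fin r) (Fin r) ℂ) (n : ℕ) (ξ : ℝ) (k : ℤ) :
    symProd a n (ξ + 2 * Real.pi * k) = symProd a n ξ := by
  induction n generalizing ξ k with
  | zero => rfl
  | succ n ih =>
    have h := ih (2 * ξ) (2 * k)
    rw [symProd, symProd, symbol_add_two_pi_mul, ← h]
    congr 2; push_cast; ring

lemma symProd_zero_right (a : ℤ →₀ Matrix (Fin r) (Fin r) ℂ) (n : ℕ) :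
    symProd a n 0 = symbol a 0 ^ n := by
  induction n with
  | zero => rfl
  | succ n ih => rw [symProd, mul_zero, ih, pow_succ]

lemma contDiff_comp_mul {E : Type*} [NormedAddCommGroup E] [NormedSpace ℝ E] {F : ℝ → E}
    (hF : ContDiff ℝ ∞ F) (c : ℝ) : ContDiff ℝ ∞ fun ξ => F (c * ξ) :=
  hF.comp (contDiff_const.mul contDiff_id)

/-- A matching filter of order `K` is matched by all products `â(2^{n-1}ξ) ⋯ â(ξ)`. -/
lemma matching_symProd {a : ℤ →₀ Matrix (Fin r) (Fin r) ℂ} {v : ℤ →₀ (Fin r → ℂ)} {K : ℕ}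
    (hv : IsMatchingFilter a v K) (n : ℕ) :
    EqMod K (vjet fun ξ => symbol v (2 ^ n * ξ) ᵥ* symProd a n ξ) (vjet (symbol v)) := by
  induction n with
  | zero => simpa [symProd] using EqMod.refl K (vjet (symbol v))
  | succ n ih =>
    have hF : ContDiff ℝ ∞ fun ξ => symbol v (2 ^ n * ξ) ᵥ* symProd a n ξ :=
      contDiff_vecMul (contDiff_comp_mul (contDiff_symbol v) _) (contDiff_symProd a n)
    have e : (fun ξ => symbol v (2 ^ (n + 1) * ξ) ᵥ* symProd a (n + 1) ξ)
        = fun ξ => (fun ξ => symbol v (2 ^ n * ξ) ᵥ* symProd a n ξ) (2 * ξ) ᵥ* symbol a ξ := by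
      funext ξ
      simp only [symProd, Matrix.vecMul_vecMul, pow_succ, mul_assoc]
    rw [e, vjet_vecMul (contDiff_comp_mul hF 2) (contDiff_symbol_mat' a), vjet_comp_mul 2 hF]
    refine ((ih.rescale _).vecMul _).trans ?_
    simpa using (isMatchingFilter_iff.mp hv).2

/-- At `ξ + π` all factors of the product but the innermost have `2π`-periodic arguments, so they
are absorbed by the matching relation; only `v̂(2ξ) â(ξ + π)` remains. -/
lemma matching_symProd_pi {a : ℤ →₀ Matrix (Fin r) (Fin r) ℂ} {v : ℤ →₀ (Fin r → ℂ)} {K : ℕ}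
    (hv : IsMatchingFilter a v K) (n : ℕ) :
    EqMod K (vjet fun ξ => symbol v (2 ^ (n + 1) * ξ) ᵥ* symProd a (n + 1) (ξ + Real.pi))
      ((fun i => PowerSeries.rescale (2 : ℂ) (vjet (symbol v) i)) ᵥ*
        mjet fun ξ => symbol a (ξ + Real.pi)) := by
  have hF : ContDiff ℝ ∞ fun ξ => symbol v (2 ^ n * ξ) ᵥ* symProd a n ξ :=
    contDiff_vecMul (contDiff_comp_mul (contDiff_symbol v) _) (contDiff_symProd a n)
  have e : (fun ξ => symbol v (2 ^ (n + 1) * ξ) ᵥ* symProd a (n + 1) (ξ + Real.pi))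
      = fun ξ => (fun ξ => symbol v (2 ^ n * ξ) ᵥ* symProd a n ξ) (2 * ξ) ᵥ*
        symbol a (ξ + Real.pi) := by
    funext ξ
    have := symProd_add_two_pi_mul a n (2 * ξ) 1
    simp only [Int.cast_one, mul_one] at this
    simp only [symProd, Matrix.vecMul_vecMul, pow_succ, mul_assoc, mul_add, this]
  rw [e, vjet_vecMul (contDiff_comp_mul hF 2) (contDiff_symbol_mat a _), vjet_comp_mul 2 hF]
  simpa using ((matching_symProd hv n).rescale 2).vecMul (mjet fun ξ => symbol a (ξ + Real.pi))

lemma coeff_vjet_symbol_add (u : ℤ →₀ (Fin r → ℂ)) (θ : ℝ) (s : ℕ) (i : Fin r) :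
    PowerSeries.coeff s (vjet (fun ξ => symbol u (ξ + θ)) i)
      = ∑ k ∈ u.support, u k i * ek k θ * ((-(Complex.I * k)) ^ s / (s.factorial : ℂ)) := by
  have e : (fun ξ => symbol u (ξ + θ) i) = fun ξ => ∑ k ∈ u.support, (u k i * ek k θ) * ek k ξ := by
    funext ξ
    simp only [symbol_eq_sum, Finsupp.sum, Finset.sum_apply, Pi.smul_apply, smul_eq_mul,
      ek_add_right]
    exact Finset.sum_congr rfl fun k _ => by ring
  rw [vjet, e, jet_sum _ fun k _ => contDiff_const.mul (contDiff_ek k), map_sum]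
  refine Finset.sum_congr rfl fun k _ => ?_
  rw [jet_const_mul _ (contDiff_ek k), PowerSeries.coeff_C_mul, coeff_jet_ek]

/-- A Taylor coefficient of `û` is a moment of `u`, a sum of at most `2M + 1 ≤ 3M` terms
`k^s u(k)`. -/
lemma norm_coeff_vjet_symbol_le {u : ℤ →₀ (Fin r → ℂ)} {M : ℕ} (hM : 1 ≤ M) (hu : SuppIn M u)
    {S : ℝ} (hS : ∀ k, ‖u k‖ ≤ S) (θ : ℝ) (s : ℕ) (i : Fin r) :
    ‖PowerSeries.coeff s (vjet (fun ξ => symbol u (ξ + θ)) i)‖ ≤ 3 * (M : ℝ) ^ (s + 1) * S := by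
  have hS0 : 0 ≤ S := (norm_nonneg _).trans (hS 0)
  have hM' : (1 : ℝ) ≤ M := by exact_mod_cast hM
  rw [coeff_vjet_symbol_add]
  have hsub : u.support ⊆ Finset.Icc (-(M : ℤ)) M := fun k hk => by
    rw [Finset.mem_Icc, ← abs_le]; exact hu k (Finsupp.mem_support_iff.mp hk)
  have hcard : (u.support.card : ℝ) ≤ 3 * M := by
    have h1 := Finset.card_le_card hsub
    rw [Int.card_Icc] at h1
    have h2 : u.support.card ≤ 3 * M := by omega
    exact_mod_cast h2
  calc _ ≤ ∑ k ∈ u.support, S * (M : ℝ) ^ s := by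
        refine norm_sum_le_of_le _ fun k hk => ?_
        rw [norm_mul, norm_mul, norm_ek, mul_one, norm_div, norm_pow, norm_neg, norm_mul,
          Complex.norm_I, one_mul]
        refine mul_le_mul ((norm_le_pi_norm (u k) i).trans (hS k)) ?_ (by positivity) hS0
        have h1 : ‖(k : ℂ)‖ ≤ M := by
          rw [Complex.norm_intCast]
          exact_mod_cast hu k (Finsupp.mem_support_iff.mp hk)
        have h2 : (1 : ℝ) ≤ ‖(s.factorial : ℂ)‖ := by
          rw [Complex.norm_natCast]; exact_mod_cast s.factorial_pos
        exact (div_le_self (by positivity) h2).trans (pow_le_pow_left₀ (norm_nonneg _) h1 s)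
    _ = u.support.card * (S * (M : ℝ) ^ s) := by rw [Finset.sum_const, nsmul_eq_mul]
    _ ≤ 3 * M * (S * (M : ℝ) ^ s) := by gcongr
    _ = _ := by ring

/-- The sequence `u` belongs to the space on which the scheme decays like `o(2^{-mn})`. -/
def DecaySeq (a : ℤ →₀ Matrix (Fin r) (Fin r) ℂ) (m : ℕ) (u : ℤ →₀ (Fin r → ℂ)) : Prop :=
  ∀ ε > 0, ∀ᶠ n : ℕ in atTop, ∀ k, 2 ^ (m * n) * ‖W a n u k‖ ≤ ε

lemma exists_suppIn_W (a : ℤ →₀ Matrix (Fin r) (Fin r) ℂ) (u : ℤ →₀ (Fin r → ℂ)) :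
    ∃ L : ℕ, 1 ≤ L ∧ ∀ n, SuppIn (2 ^ n * L) (W a n u) := by
  obtain ⟨N, hN⟩ := exists_suppIn a
  obtain ⟨L, hL⟩ := exists_suppIn u
  refine ⟨max L (N + 1) + 1, by omega, fun n k hk => ?_⟩
  have := suppIn_W hN (le_max_right L (N + 1)) (hL.mono (le_max_left _ _)) n k hk
  push_cast at this ⊢
  linarith

/-- The moment bound: the `l`-th Taylor coefficient of `v̂(2^n ξ)` times the symbol of the data at
level `n` is at most of the order `2^{n(l+1)}` times the size of the data. -/
lemma exists_coeff_bound (a : ℤ →₀ Matrix (Fin r) (Fin r) ℂ) (v u : ℤ →₀ (Fin r → ℂ)) (θ : ℝ)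
    (l : ℕ) : ∃ C : ℝ, 0 ≤ C ∧ ∀ (n : ℕ) (S : ℝ), (∀ k, ‖W a n u k‖ ≤ S) →
      ‖PowerSeries.coeff l (jet fun ξ => symbol v (2 ^ n * ξ) ⬝ᵥ symbol (W a n u) (ξ + θ))‖
        ≤ C * 2 ^ (n * (l + 1)) * S := by
  obtain ⟨L, hL, hsupp⟩ := exists_suppIn_W a u
  refine ⟨∑ i, ∑ p ∈ Finset.HasAntidiagonal.antidiagonal l,
    ‖PowerSeries.coeff p.1 (vjet (symbol v) i)‖ * (3 * (L : ℝ) ^ (p.2 + 1)),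
    by positivity, fun n S hS => ?_⟩
  have hS0 : 0 ≤ S := (norm_nonneg _).trans (hS 0)
  rw [jet_dotProduct (contDiff_comp_mul (contDiff_symbol v) _) (contDiff_symbol_comp_add _ _),
    vjet_comp_mul _ (contDiff_symbol v), dotProduct, map_sum, Finset.sum_mul, Finset.sum_mul]
  refine norm_sum_le_of_le _ fun i _ => ?_
  rw [PowerSeries.coeff_mul, Finset.sum_mul, Finset.sum_mul]
  refine norm_sum_le_of_le _ fun p hp => ?_
  have hp' : p.1 + p.2 = l := Finset.HasAntidiagonal.mem_antidiagonal.mp hp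
  rw [PowerSeries.coeff_rescale, norm_mul, norm_mul]
  have h1 := norm_coeff_vjet_symbol_le (Nat.one_le_iff_ne_zero.mpr (by positivity)) (hsupp n) hS θ
    p.2 i
  have h2 : ‖((2 ^ n : ℝ) : ℂ) ^ p.1‖ = 2 ^ (n * p.1) := by
    rw [norm_pow, Complex.norm_real, norm_pow, Real.norm_ofNat, pow_mul]
  rw [h2]
  calc _ ≤ 2 ^ (n * p.1) * ‖PowerSeries.coeff p.1 (vjet (symbol v) i)‖
        * (3 * ((2 ^ n * L : ℕ) : ℝ) ^ (p.2 + 1) * S) := by gcongr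
    _ = _ := by
      rw [← hp']; push_cast
      rw [mul_pow, ← pow_mul, show n * (p.1 + p.2 + 1) = n * p.1 + n * (p.2 + 1) by ring, pow_add]
      ring

/-- If `2^n c` is bounded by `C 2^{n(l+1)} sup ‖W_n u‖` with `l ≤ m` and `u` decays like
`o(2^{-mn})`, then `c = 0`. -/
lemma eq_zero_of_decaySeq {a : ℤ →₀ Matrix (Fin r) (Fin r) ℂ} {m l : ℕ} {u : ℤ →₀ (Fin r → ℂ)}
    (hu : DecaySeq a m u) (hl : l ≤ m) {c : ℂ} {C : ℝ} (hC : 0 ≤ C)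
    (h : ∀ n : ℕ, 1 ≤ n → ∀ S : ℝ, (∀ k, ‖W a n u k‖ ≤ S) → ‖2 ^ n * c‖ ≤ C * 2 ^ (n * (l + 1)) * S) :
    c = 0 := by
  by_contra hc
  have hc' : 0 < ‖c‖ := norm_pos_iff.mpr hc
  obtain ⟨n, hn, hn1⟩ := ((hu (‖c‖ / (2 * (C + 1))) (by positivity)).and
    (eventually_ge_atTop 1)).exists
  have h1 := h n hn1 (‖c‖ / (2 * (C + 1)) / 2 ^ (m * n)) fun k => by
    rw [le_div_iff₀ (by positivity), mul_comm]; exact hn k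
  rw [norm_mul, norm_pow, Complex.norm_ofNat] at h1
  have h2 : (2 : ℝ) ^ (n * l) ≤ 2 ^ (m * n) :=
    pow_le_pow_right₀ (by norm_num) (by rw [mul_comm]; exact Nat.mul_le_mul_right n hl)
  have h3 : C * 2 ^ (n * (l + 1)) * (‖c‖ / (2 * (C + 1)) / 2 ^ (m * n))
      = 2 ^ n * ((2 ^ (n * l) / 2 ^ (m * n)) * (C / (C + 1)) * (‖c‖ / 2)) := by
    rw [mul_add, mul_one, pow_add]; field_simp
  rw [h3] at h1
  have h4 := le_of_mul_le_mul_left h1 (by positivity)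
  have h5 : (2 : ℝ) ^ (n * l) / 2 ^ (m * n) ≤ 1 := div_le_one_of_le₀ h2 (by positivity)
  have h6 : C / (C + 1) ≤ 1 := div_le_one_of_le₀ (by linarith) (by positivity)
  have h7 : (2 : ℝ) ^ (n * l) / 2 ^ (m * n) * (C / (C + 1)) ≤ 1 :=
    mul_le_one₀ h5 (by positivity) h6
  nlinarith

/-- Decay of order `m` forces the moments of order up to `m` against a matching filter to
vanish. -/
lemma coeff_rowCol_eq_zero {a : ℤ →₀ Matrix (Fin r) (Fin r) ℂ} {v u : ℤ →₀ (Fin r → ℂ)} {K m l : ℕ}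
    (hv : IsMatchingFilter a v K) (hu : DecaySeq a m u) (hlm : l ≤ m) (hlK : l < K) :
    PowerSeries.coeff l (vjet (symbol v) ⬝ᵥ vjet (symbol u)) = 0 := by
  obtain ⟨C, hC, hb⟩ := exists_coeff_bound a v u 0 l
  refine eq_zero_of_decaySeq hu hlm hC fun n _ S hS => ?_
  convert hb n S hS using 2
  have hF : ContDiff ℝ ∞ fun ξ => symbol v (2 ^ n * ξ) ᵥ* symProd a n ξ :=
    contDiff_vecMul (contDiff_comp_mul (contDiff_symbol v) _) (contDiff_symProd a n)
  have e : (fun ξ => symbol v (2 ^ n * ξ) ⬝ᵥ symbol (W a n u) (ξ + 0))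
      = fun ξ => (2 : ℂ) ^ n * ((symbol v (2 ^ n * ξ) ᵥ* symProd a n ξ) ⬝ᵥ symbol u ξ) := by
    funext ξ
    rw [add_zero, symbol_W, dotProduct_smul, Matrix.dotProduct_mulVec, smul_eq_mul]
  rw [e, jet_const_mul _ (contDiff_dotProduct hF (contDiff_symbol u)), PowerSeries.coeff_C_mul,
    jet_dotProduct hF (contDiff_symbol u)]
  congr 1
  have h1 := PowerSeries.X_pow_dvd_iff.mp
    ((matching_symProd hv n).dotProduct (vjet (symbol u))) l hlK
  rw [map_sub, sub_eq_zero] at h1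
  exact h1.symm

/-- The counterpart of `coeff_rowCol_eq_zero` at `π`: it bounds the alternating moments of the
subdivision data, which involve the sum rule defect `v̂(2ξ) â(ξ + π)`. -/
lemma coeff_pi_eq_zero {a : ℤ →₀ Matrix (Fin r) (Fin r) ℂ} {v u : ℤ →₀ (Fin r → ℂ)} {K m l : ℕ}
    (hv : IsMatchingFilter a v K) (hu : DecaySeq a m u) (hlm : l ≤ m) (hlK : l < K) :
    PowerSeries.coeff l (((fun i => PowerSeries.rescale (2 : ℂ) (vjet (symbol v) i)) ᵥ*
        mjet fun ξ => symbol a (ξ + Real.pi)) ⬝ᵥ vjet fun ξ => symbol u (ξ + Real.pi)) = 0 := by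
  obtain ⟨C, hC, hb⟩ := exists_coeff_bound a v u Real.pi l
  refine eq_zero_of_decaySeq hu hlm hC fun n hn S hS => ?_
  obtain ⟨n, rfl⟩ := Nat.exists_eq_add_of_le' hn
  convert hb (n + 1) S hS using 2
  have hF : ContDiff ℝ ∞ fun ξ => symbol v (2 ^ (n + 1) * ξ) ᵥ* symProd a (n + 1) (ξ + Real.pi) :=
    contDiff_vecMul (contDiff_comp_mul (contDiff_symbol v) _) fun i j =>
      (contDiff_symProd a (n + 1) i j).comp (contDiff_id.add contDiff_const)
  have e : (fun ξ => symbol v (2 ^ (n + 1) * ξ) ⬝ᵥ symbol (W a (n + 1) u) (ξ + Real.pi))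
      = fun ξ => (2 : ℂ) ^ (n + 1) * ((symbol v (2 ^ (n + 1) * ξ) ᵥ*
        symProd a (n + 1) (ξ + Real.pi)) ⬝ᵥ symbol u (ξ + Real.pi)) := by
    funext ξ
    rw [symbol_W, dotProduct_smul, Matrix.dotProduct_mulVec, smul_eq_mul]
  rw [e, jet_const_mul _ (contDiff_dotProduct hF (contDiff_symbol_comp_add u _)),
    PowerSeries.coeff_C_mul, jet_dotProduct hF (contDiff_symbol_comp_add u _)]
  congr 1
  have h1 := PowerSeries.X_pow_dvd_iff.mp
    ((matching_symProd_pi hv n).dotProduct (vjet fun ξ => symbol u (ξ + Real.pi))) l hlK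
  rw [map_sub, sub_eq_zero] at h1
  exact h1.symm

lemma exists_dotProduct_ne_zero {c : Fin r → ℂ} (hc : c ≠ 0) : ∃ y : Fin r → ℂ, c ⬝ᵥ y ≠ 0 := by
  by_contra! h
  exact hc ((dotProduct_eq_zero_iff).mp h)

lemma dotProduct_mul_C (p : Fin r → PowerSeries ℂ) (q : PowerSeries ℂ) (y : Fin r → ℂ) :
    (p ⬝ᵥ fun i => q * PowerSeries.C (y i)) = q * (p ⬝ᵥ fun i => PowerSeries.C (y i)) := by
  simp only [dotProduct, Finset.mul_sum]
  exact Finset.sum_congr rfl fun i _ => by ring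

lemma constantCoeff_dotProduct_C (v : ℤ →₀ (Fin r → ℂ)) (y : Fin r → ℂ) :
    PowerSeries.constantCoeff (vjet (symbol v) ⬝ᵥ fun i => PowerSeries.C (y i))
      = symbol v 0 ⬝ᵥ y := by
  simp only [dotProduct, map_sum, map_mul, PowerSeries.constantCoeff_C, vjet]
  refine Finset.sum_congr rfl fun i _ => ?_
  rw [← PowerSeries.coeff_zero_eq_constantCoeff_apply, coeff_zero_jet]

/-- The sum rules hold as soon as the scheme decays on all sequences with vanishing moments. -/
lemma hasSumRules_of_decay {a : ℤ →₀ Matrix (Fin r) (Fin r) ℂ} {v : ℤ →₀ (Fin r → ℂ)} {m : ℕ}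
    (hv : IsMatchingFilter a v (m + 1)) (h : ∀ u ∈ vanishing v (m + 1), DecaySeq a m u) :
    HasSumRules a v (m + 1) := by
  rw [hasSumRules_iff]
  refine ⟨hv, fun i => ?_⟩
  obtain ⟨g, hg, hj⟩ := exists_jet_diffSeq
  -- `û(ξ) = (1 - e^{-iξ})^{m+1} eᵢ` vanishes to order `m + 1` at `0`, but not at `π`
  set u := smulSeq (diffSeq (m + 1)) (Pi.single i 1) with hu
  have hmem : u ∈ vanishing v (m + 1) := by
    rw [mem_vanishing_iff, hu, vjet_smulSeq, dotProduct_mul_C, hj, mul_assoc]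
    exact dvd_mul_right _ _
  have hd := h u hmem
  set P := ((fun i => PowerSeries.rescale (2 : ℂ) (vjet (symbol v) i)) ᵥ*
        mjet fun ξ => symbol a (ξ + Real.pi)) with hP
  set q : PowerSeries ℂ := jet fun ξ => symbol (diffSeq (m + 1)) (ξ + Real.pi) with hq
  have hcd : ContDiff ℝ ∞ fun ξ => symbol (diffSeq (m + 1)) (ξ + Real.pi) :=
    (contDiff_symbol_scalar _).comp (contDiff_id.add contDiff_const)
  have h1 : vjet (fun ξ => symbol u (ξ + Real.pi))
      = fun j => q * PowerSeries.C ((Pi.single i 1 : Fin r → ℂ) j) := by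
    funext j
    rw [hq, ← jet_const, ← jet_mul hcd contDiff_const]
    exact congrArg jet (funext fun ξ => by simp only [hu, symbol_smulSeq]; rfl)
  have h2 : P ⬝ᵥ vjet (fun ξ => symbol u (ξ + Real.pi)) = q * P i := by
    rw [h1, dotProduct_mul_C]
    congr 1
    rw [dotProduct, Finset.sum_eq_single i]
    · simp
    · intro j _ hji; simp [Pi.single_eq_of_ne hji]
    · simp
  have h3 : PowerSeries.X ^ (m + 1) ∣ q * P i := by
    rw [← h2, PowerSeries.X_pow_dvd_iff]
    exact fun l hl => coeff_pi_eq_zero hv hd (Nat.lt_succ_iff.mp hl) hl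
  -- the value of `(1 - e^{-iξ})^{m+1}` at `π` is `2^{m+1}`
  have hunit : IsUnit q := by
    rw [PowerSeries.isUnit_iff_constantCoeff, ← PowerSeries.coeff_zero_eq_constantCoeff_apply,
      hq, coeff_zero_jet, symbol_diffSeq, zero_add, ek_one_pi]
    exact (by norm_num : (1 - -1 : ℂ) ^ (m + 1) ≠ 0).isUnit
  simpa using (hunit.dvd_mul_left).mp h3

/-- Decay of the scheme on sequences with vanishing moments makes `â(0)^n` decay on the kernel of
`v̂(0)`. -/
lemma decay_pow_of_decay {a : ℤ →₀ Matrix (Fin r) (Fin r) ℂ} {v : ℤ →₀ (Fin r → ℂ)} {m K : ℕ}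
    (hv : symbol v 0 ≠ 0) (h : ∀ u ∈ vanishing v K, DecaySeq a m u) {c : Fin r → ℂ}
    (hc : symbol v 0 ⬝ᵥ c = 0) :
    Tendsto (fun n : ℕ => (2 : ℂ) ^ (m * n) • (symbol a 0 ^ n *ᵥ c)) atTop (𝓝 0) := by
  obtain ⟨y, hy⟩ := exists_dotProduct_ne_zero hv
  set Y := vjet (symbol v) ⬝ᵥ fun i => PowerSeries.C (y i) with hY
  set Z := vjet (symbol v) ⬝ᵥ fun i => PowerSeries.C (c i) with hZ
  have hYu : PowerSeries.constantCoeff Y ≠ 0 := by rw [hY, constantCoeff_dotProduct_C]; exact hy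
  have hZ0 : PowerSeries.constantCoeff Z = 0 := by rw [hZ, constantCoeff_dotProduct_C]; exact hc
  -- `c δ` is corrected by a multiple `p y` with `p̂(0) = 0`, so as to lie in the space of vanishing
  -- moments while keeping `û(0) = c`
  obtain ⟨p, hp⟩ := exists_symbol_jet (-(Z * Y⁻¹)) (K + 1)
  set u := Finsupp.single 0 c + smulSeq p y with hu
  have hmem : u ∈ vanishing v K := by
    rw [mem_vanishing_iff, hu, vjet_symbol_add, vjet_symbol_single_zero, vjet_smulSeq,
      dotProduct_add, dotProduct_mul_C, ← hY, ← hZ]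
    have : Z + jet (symbol p) * Y = (jet (symbol p) - -(Z * Y⁻¹)) * Y := by
      have := PowerSeries.inv_mul_cancel Y hYu
      linear_combination (-Z) * this
    rw [this]
    exact ((pow_dvd_pow _ (Nat.le_succ K)).trans hp).mul_right _
  have hp0 : symbol p 0 = 0 := by
    have := PowerSeries.X_pow_dvd_iff.mp hp 0 (Nat.succ_pos K)
    rw [map_sub, coeff_zero_jet, PowerSeries.coeff_zero_eq_constantCoeff_apply, map_neg, map_mul,
      hZ0] at this
    simpa using this
  have hu0 : symbol u 0 = c := by
    rw [hu, symbol_add, symbol_smulSeq, hp0, symbol_single, ek_zero_left]; simp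
  obtain ⟨L, hL, hsupp⟩ := exists_suppIn_W a u
  have hd := h u hmem
  rw [Metric.tendsto_atTop]
  intro ε hε
  obtain ⟨n₀, hn₀⟩ := eventually_atTop.mp (hd (ε / (6 * L)) (by positivity))
  refine ⟨n₀, fun n hn => ?_⟩
  have hb := hn₀ n hn
  rw [dist_zero_right, pi_norm_lt_iff hε]
  intro i
  have hS : ∀ k, ‖W a n u k‖ ≤ ε / (6 * L) / 2 ^ (m * n) := fun k => by
    rw [le_div_iff₀ (by positivity), mul_comm]; exact hb k
  have h1 := norm_coeff_vjet_symbol_le (Nat.one_le_iff_ne_zero.mpr (by positivity)) (hsupp n) hS 0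
    0 i
  simp only [vjet, coeff_zero_jet, add_zero, symbol_W, hu0, symProd_zero_right] at h1
  rw [Pi.smul_apply, norm_smul, norm_pow, Complex.norm_ofNat] at h1 ⊢
  have h3 : 3 * ((2 ^ n * L : ℕ) : ℝ) ^ (0 + 1) * (ε / (6 * L) / 2 ^ (m * n))
      = 2 ^ n * (ε / 2 / 2 ^ (m * n)) := by
    have : (L : ℝ) ≠ 0 := by positivity
    push_cast; rw [pow_one]; field_simp; norm_num
  rw [h3] at h1
  have h4 := le_of_mul_le_mul_left h1 (by positivity)
  rw [le_div_iff₀ (by positivity), mul_comm] at h4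
  linarith

/-! ### Uniqueness of matching filters -/

lemma symbol_vecMul_zero {a : ℤ →₀ Matrix (Fin r) (Fin r) ℂ} {v : ℤ →₀ (Fin r → ℂ)} {n : ℕ}
    (hv : IsMatchingFilter a v n) (hn : 0 < n) : symbol v 0 ᵥ* symbol a 0 = symbol v 0 := by
  have := hv.2 0 hn
  simpa using this

/-- The lowest-order Taylor coefficient of a vector satisfying the matching relation is an
eigenvector of `â(0)`. -/
lemma matching_lowest_coeff {a : ℤ →₀ Matrix (Fin r) (Fin r) ℂ} {d : Fin r → PowerSeries ℂ}
    {K l : ℕ} (hd : EqMod K ((fun i => PowerSeries.rescale (2 : ℂ) (d i)) ᵥ* mjet (symbol a)) d)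
    (hl : l < K) (h0 : ∀ i < l, ∀ j, PowerSeries.coeff i (d j) = 0) :
    (2 : ℂ) ^ l • ((fun j => PowerSeries.coeff l (d j)) ᵥ* symbol a 0)
      = fun j => PowerSeries.coeff l (d j) := by
  funext j
  have h1 := PowerSeries.X_pow_dvd_iff.mp (hd j) l hl
  rw [map_sub, sub_eq_zero] at h1
  rw [← h1]
  simp only [Matrix.vecMul, dotProduct, map_sum, Pi.smul_apply, smul_eq_mul, Finset.mul_sum]
  refine Finset.sum_congr rfl fun i _ => ?_
  rw [PowerSeries.coeff_mul, Finset.sum_eq_single (l, 0)]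
  · rw [PowerSeries.coeff_rescale, mjet, coeff_zero_jet]; ring
  · rintro ⟨p, q⟩ hpq hne
    have hpq' : p + q = l := Finset.HasAntidiagonal.mem_antidiagonal.mp hpq
    have hp : p < l := by
      rcases Nat.lt_or_ge p l with h | h
      · exact h
      · exact absurd (by ext <;> simp <;> omega) hne
    rw [PowerSeries.coeff_rescale, h0 p hp i]; simp
  · intro h; exact absurd (Finset.HasAntidiagonal.mem_antidiagonal.mpr (by simp)) h

/-- If `â(0)^n c = o(2^{-mn})` on the kernel of `v₀`, then left eigenvectors of `â(0)` with
eigenvalue `2^{-l}`, `l ≤ m`, are multiples of `v₀`. -/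
lemma eigenvector_eq_smul {A : Matrix (Fin r) (Fin r) ℂ} {v₀ d : Fin r → ℂ} {m l : ℕ}
    (hv₀ : v₀ ≠ 0)
    (hdec : ∀ c, v₀ ⬝ᵥ c = 0 →
      Tendsto (fun n : ℕ => (2 : ℂ) ^ (m * n) • (A ^ n *ᵥ c)) atTop (𝓝 0))
    (hl : l ≤ m) (hd : (2 : ℂ) ^ l • (d ᵥ* A) = d) : ∃ μ : ℂ, d = μ • v₀ := by
  have hker : ∀ c, v₀ ⬝ᵥ c = 0 → d ⬝ᵥ c = 0 := by
    intro c hc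
    have h1 : ∀ n : ℕ, (2 : ℂ) ^ (l * n) • (d ᵥ* A ^ n) = d := by
      intro n
      induction n with
      | zero => simp
      | succ n ih =>
        calc (2 : ℂ) ^ (l * (n + 1)) • (d ᵥ* A ^ (n + 1))
            = (2 : ℂ) ^ l • (((2 : ℂ) ^ (l * n) • (d ᵥ* A ^ n)) ᵥ* A) := by
              rw [Matrix.smul_vecMul, smul_smul, Matrix.vecMul_vecMul, ← pow_succ, ← pow_add]
              congr 2; ring
          _ = d := by rw [ih, hd]
    have h2 : ∀ n : ℕ, d ⬝ᵥ c = (2 : ℂ) ^ (l * n) * (d ⬝ᵥ (A ^ n *ᵥ c)) := by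
      intro n
      conv_lhs => rw [← h1 n]
      rw [smul_dotProduct, smul_eq_mul, Matrix.dotProduct_mulVec]
    have h3 : Tendsto (fun n : ℕ => d ⬝ᵥ ((2 : ℂ) ^ (m * n) • (A ^ n *ᵥ c))) atTop (𝓝 0) := by
      have hcont : Continuous fun x : Fin r → ℂ => d ⬝ᵥ x := by
        simp only [dotProduct]; fun_prop
      have := (hcont.tendsto 0).comp (hdec c hc)
      rw [dotProduct_zero] at this
      exact this
    have h4 : ∀ n : ℕ, ‖d ⬝ᵥ c‖ ≤ ‖d ⬝ᵥ ((2 : ℂ) ^ (m * n) • (A ^ n *ᵥ c))‖ := by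
      intro n
      rw [h2 n, dotProduct_smul, smul_eq_mul, norm_mul, norm_mul, norm_pow, norm_pow,
        Complex.norm_ofNat]
      gcongr
      norm_num
    have h5 := le_of_tendsto' (tendsto_const_nhds.sub h3.norm) (b := 0) (a := ‖d ⬝ᵥ c‖ - ‖(0:ℂ)‖)
      fun n => sub_nonpos.mpr (h4 n)
    simpa using h5
  obtain ⟨y, hy⟩ := exists_dotProduct_ne_zero hv₀
  refine ⟨(d ⬝ᵥ y) / (v₀ ⬝ᵥ y), ?_⟩
  rw [← sub_eq_zero, ← dotProduct_eq_zero_iff]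
  intro x
  have h := hker (x - ((v₀ ⬝ᵥ x) / (v₀ ⬝ᵥ y)) • y) (by
    rw [dotProduct_sub, dotProduct_smul, smul_eq_mul, div_mul_cancel₀ _ hy, sub_self])
  rw [dotProduct_sub, dotProduct_smul, smul_eq_mul, sub_eq_zero] at h
  rw [sub_dotProduct, smul_dotProduct, smul_eq_mul, h]
  ring

/-- Under decay of `â(0)^n` on the kernel of `v̂(0)`, matching filters are unique up to a scalar. -/
lemma matching_unique {a : ℤ →₀ Matrix (Fin r) (Fin r) ℂ} {v v' : ℤ →₀ (Fin r → ℂ)} {K m : ℕ}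
    (hv : IsMatchingFilter a v K) (hv' : IsMatchingFilter a v' K) (hK : K ≤ m + 1)
    (hdec : ∀ c, symbol v 0 ⬝ᵥ c = 0 →
      Tendsto (fun n : ℕ => (2 : ℂ) ^ (m * n) • (symbol a 0 ^ n *ᵥ c)) atTop (𝓝 0)) :
    ∃ κ : ℂ, κ ≠ 0 ∧ EqMod K (vjet (symbol v')) fun i => PowerSeries.C κ * vjet (symbol v) i := by
  rcases Nat.eq_zero_or_pos K with rfl | hK0
  · exact ⟨1, one_ne_zero, fun i => by simp⟩
  have hm := (isMatchingFilter_iff.mp hv).2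
  have hm' := (isMatchingFilter_iff.mp hv').2
  have hc0 : ∀ w : ℤ →₀ (Fin r → ℂ), (fun j => PowerSeries.coeff 0 (vjet (symbol w) j))
      = symbol w 0 := fun w => funext fun j => coeff_zero_jet _
  obtain ⟨κ, hκ⟩ := eigenvector_eq_smul hv.1 hdec (Nat.zero_le m)
    (matching_lowest_coeff hm' hK0 (by simp))
  rw [hc0] at hκ
  have hκ0 : κ ≠ 0 := by
    rintro rfl
    exact hv'.1 (by rw [hκ, zero_smul])
  refine ⟨κ, hκ0, ?_⟩
  -- the lowest coefficient of the difference `d` of the two filters, if of order `l ≥ 1`, would be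
  -- an eigenvector for `2^{-l}`, and also a multiple of `v̂(0)`, whose eigenvalue is `1`
  set d : Fin r → PowerSeries ℂ := fun i => vjet (symbol v') i - PowerSeries.C κ * vjet (symbol v) i
    with hd
  have hdm : EqMod K ((fun i => PowerSeries.rescale (2 : ℂ) (d i)) ᵥ* mjet (symbol a)) d := by
    intro j
    have e : ((fun i => PowerSeries.rescale (2 : ℂ) (d i)) ᵥ* mjet (symbol a)) j - d j
        = (((fun i => PowerSeries.rescale (2 : ℂ) (vjet (symbol v') i)) ᵥ* mjet (symbol a)) j
            - vjet (symbol v') j)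
          - PowerSeries.C κ * (((fun i => PowerSeries.rescale (2 : ℂ) (vjet (symbol v) i)) ᵥ*
            mjet (symbol a)) j - vjet (symbol v) j) := by
      have hC : PowerSeries.rescale (2 : ℂ) (PowerSeries.C κ) = PowerSeries.C κ := by
        ext n; rw [PowerSeries.coeff_rescale, PowerSeries.coeff_C]; split_ifs with h <;> simp [h]
      simp only [hd, Matrix.vecMul, dotProduct, map_sub, map_mul, hC, sub_mul, mul_sub,
        Finset.sum_sub_distrib, Finset.mul_sum, mul_assoc]
      ring
    rw [e]
    exact dvd_sub (hm' j) ((hm j).mul_left _)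
  have hall : ∀ l < K, ∀ j, PowerSeries.coeff l (d j) = 0 := by
    intro l
    induction l using Nat.strong_induction_on with
    | _ l ih =>
      intro hl
      have hlow := matching_lowest_coeff hdm hl fun i hi => ih i hi (hi.trans hl)
      rcases Nat.eq_zero_or_pos l with rfl | hl0
      · intro j
        have := congrFun hκ j
        rw [hd, map_sub, PowerSeries.coeff_C_mul, vjet, vjet, coeff_zero_jet, coeff_zero_jet, this]
        simp
      · obtain ⟨μ, hμ⟩ := eigenvector_eq_smul hv.1 hdec (by omega) hlow
        rw [hμ, Matrix.smul_vecMul, symbol_vecMul_zero hv hK0, smul_smul] at hlow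
        have h2 : ((2 : ℂ) ^ l * μ - μ) • symbol v 0 = 0 := by rw [sub_smul, hlow, sub_self]
        have h3 : (2 : ℂ) ^ l * μ - μ = 0 := (smul_eq_zero.mp h2).resolve_right hv.1
        have h4 : (2 : ℂ) ^ l - 1 ≠ 0 := by
          rw [sub_ne_zero]
          have : (2 : ℕ) ^ l ≠ 1 := (Nat.one_lt_two_pow hl0.ne').ne'
          exact_mod_cast this
        have h5 : μ = 0 := by
          have : ((2 : ℂ) ^ l - 1) * μ = 0 := by linear_combination h3
          exact (mul_eq_zero.mp this).resolve_left h4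
        intro j
        have := congrFun hμ j
        simpa [h5] using this
  exact fun i => PowerSeries.X_pow_dvd_iff.mpr fun l hl => hall l hl i

/-- The spaces of vanishing moments only depend on the jet of the filter up to a scalar. -/
lemma vanishing_subset_of_eqMod {v v' : ℤ →₀ (Fin r → ℂ)} {κ : ℂ} {K : ℕ}
    (h : EqMod K (vjet (symbol v')) fun i => PowerSeries.C κ * vjet (symbol v) i) {j : ℕ}
    (hj : j ≤ K) : vanishing v j ⊆ vanishing v' j := by
  intro u hu
  rw [mem_vanishing_iff] at hu ⊢
  have h1 := (h.mono hj).dotProduct (vjet (symbol u))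
  have h2 : (fun i => PowerSeries.C κ * vjet (symbol v) i) ⬝ᵥ vjet (symbol u)
      = PowerSeries.C κ * (vjet (symbol v) ⬝ᵥ vjet (symbol u)) := by
    simp only [dotProduct, Finset.mul_sum, mul_assoc]
  rw [h2] at h1
  have := dvd_add h1 (hu.mul_left (PowerSeries.C κ))
  simpa using this

lemma eqMod_symm_smul {p q : Fin r → PowerSeries ℂ} {κ : ℂ} (hκ : κ ≠ 0) {K : ℕ}
    (h : EqMod K p fun i => PowerSeries.C κ * q i) :
    EqMod K q fun i => PowerSeries.C κ⁻¹ * p i := by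
  intro i
  have e : q i - PowerSeries.C κ⁻¹ * p i
      = -(PowerSeries.C κ⁻¹ * (p i - PowerSeries.C κ * q i)) := by
    have : PowerSeries.C κ⁻¹ * PowerSeries.C κ = (1 : PowerSeries ℂ) := by
      rw [← map_mul, inv_mul_cancel₀ hκ, map_one]
    linear_combination (-(q i)) * this
  rw [e, dvd_neg]
  exact (h i).mul_left _

/-! ### The transition operators under sum rules -/

/-- `[v̂ û]` as a power series. -/
def rc (v u : ℤ →₀ (Fin r → ℂ)) : PowerSeries ℂ := vjet (symbol v) ⬝ᵥ vjet (symbol u)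

lemma rc_add (v u w : ℤ →₀ (Fin r → ℂ)) : rc v (u + w) = rc v u + rc v w := by
  rw [rc, vjet_symbol_add, dotProduct_add]; rfl

lemma rc_smul (v : ℤ →₀ (Fin r → ℂ)) (c : ℂ) (u : ℤ →₀ (Fin r → ℂ)) :
    rc v (c • u) = PowerSeries.C c * rc v u := by
  rw [rc, vjet_symbol_smul, dotProduct_smul]; rfl

/-- Splitting `û(ξ)` into even and odd parts, the sum rules turn the matching relation into one for
`T_0` alone: the Taylor series `p` of `v̂ û` becomes `p(ξ/2)` up to order `J`. -/
lemma rc_T_zero {a : ℤ →₀ Matrix (Fin r) (Fin r) ℂ} {v : ℤ →₀ (Fin r → ℂ)} {J : ℕ}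
    (h : HasSumRules a v J) (u : ℤ →₀ (Fin r → ℂ)) :
    PowerSeries.X ^ J ∣ PowerSeries.rescale 2 (rc v (T a 0 u)) - rc v u := by
  obtain ⟨hm, hs⟩ := hasSumRules_iff.mp h
  have hm := (isMatchingFilter_iff.mp hm).2
  have hv2 := contDiff_comp_mul (contDiff_symbol v) 2
  have e : PowerSeries.rescale 2 (rc v (T a 0 u))
      = jet fun ξ => (symbol v (2 * ξ) ᵥ* symbol a ξ) ⬝ᵥ symbol u ξ
        + (symbol v (2 * ξ) ᵥ* symbol a (ξ + Real.pi)) ⬝ᵥ symbol u (ξ + Real.pi) := by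
    have := jet_comp_mul 2 (contDiff_rowCol v (T a 0 u))
    rw [jet_rowCol] at this
    rw [rc]
    simp only [Complex.ofReal_ofNat] at this
    rw [← this]
    congr 1
    funext ξ
    rw [rowCol, symbol_T_zero, dotProduct_add, Matrix.dotProduct_mulVec, Matrix.dotProduct_mulVec]
  have c1 := contDiff_vecMul hv2 (contDiff_symbol_mat' a)
  have c2 := contDiff_vecMul hv2 (contDiff_symbol_mat a Real.pi)
  rw [e, jet_add (contDiff_dotProduct c1 (contDiff_symbol u))
    (contDiff_dotProduct c2 (contDiff_symbol_comp_add u _)),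
    jet_dotProduct c1 (contDiff_symbol u), jet_dotProduct c2 (contDiff_symbol_comp_add u _),
    vjet_vecMul hv2 (contDiff_symbol_mat' a), vjet_vecMul hv2 (contDiff_symbol_mat a Real.pi),
    vjet_comp_mul 2 (contDiff_symbol v), add_sub_right_comm]
  simp only [Complex.ofReal_ofNat]
  refine dvd_add (hm.dotProduct _) ?_
  simpa using hs.dotProduct (vjet fun ξ => symbol u (ξ + Real.pi))

/-- The analogue of `rc_T_zero` for the odd part, with the phase of the half-integer shift. -/
lemma rc_T_one {a : ℤ →₀ Matrix (Fin r) (Fin r) ℂ} {v : ℤ →₀ (Fin r → ℂ)} {J : ℕ}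
    (h : HasSumRules a v J) (u : ℤ →₀ (Fin r → ℂ)) :
    PowerSeries.X ^ J ∣ jet (ek 1) * PowerSeries.rescale 2 (rc v (T a 1 u)) - rc v u := by
  obtain ⟨hm, hs⟩ := hasSumRules_iff.mp h
  have hm := (isMatchingFilter_iff.mp hm).2
  have hv2 := contDiff_comp_mul (contDiff_symbol v) 2
  have e : jet (ek 1) * PowerSeries.rescale 2 (rc v (T a 1 u))
      = jet fun ξ => (symbol v (2 * ξ) ᵥ* symbol a ξ) ⬝ᵥ symbol u ξ
        - (symbol v (2 * ξ) ᵥ* symbol a (ξ + Real.pi)) ⬝ᵥ symbol u (ξ + Real.pi) := by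
    have := jet_comp_mul 2 (contDiff_rowCol v (T a 1 u))
    rw [jet_rowCol] at this
    rw [rc]
    simp only [Complex.ofReal_ofNat] at this
    rw [← this, ← jet_mul (contDiff_ek 1) (contDiff_comp_mul (contDiff_rowCol v _) 2)]
    congr 1
    funext ξ
    rw [rowCol, ← smul_eq_mul, ← dotProduct_smul, symbol_T_one, dotProduct_sub,
      Matrix.dotProduct_mulVec, Matrix.dotProduct_mulVec]
  have c1 := contDiff_vecMul hv2 (contDiff_symbol_mat' a)
  have c2 := contDiff_vecMul hv2 (contDiff_symbol_mat a Real.pi)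
  rw [e, jet_sub (contDiff_dotProduct c1 (contDiff_symbol u))
    (contDiff_dotProduct c2 (contDiff_symbol_comp_add u _)),
    jet_dotProduct c1 (contDiff_symbol u), jet_dotProduct c2 (contDiff_symbol_comp_add u _),
    vjet_vecMul hv2 (contDiff_symbol_mat' a), vjet_vecMul hv2 (contDiff_symbol_mat a Real.pi),
    vjet_comp_mul 2 (contDiff_symbol v), sub_right_comm]
  simp only [Complex.ofReal_ofNat]
  refine dvd_sub (hm.dotProduct _) ?_
  simpa using hs.dotProduct (vjet fun ξ => symbol u (ξ + Real.pi))

lemma coeff_rc_T_zero {a : ℤ →₀ Matrix (Fin r) (Fin r) ℂ} {v : ℤ →₀ (Fin r → ℂ)} {J : ℕ}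
    (h : HasSumRules a v J) (u : ℤ →₀ (Fin r → ℂ)) {i : ℕ} (hi : i < J) :
    2 ^ i * PowerSeries.coeff i (rc v (T a 0 u)) = PowerSeries.coeff i (rc v u) := by
  have := PowerSeries.X_pow_dvd_iff.mp (rc_T_zero h u) i hi
  rwa [map_sub, PowerSeries.coeff_rescale, sub_eq_zero] at this

lemma coeff_mul_of_X_pow_dvd {p q : PowerSeries ℂ} {j : ℕ} (hq : PowerSeries.X ^ j ∣ q) {i : ℕ}
    (hi : i ≤ j) : PowerSeries.coeff i (p * q)
      = PowerSeries.constantCoeff p * PowerSeries.coeff i q := by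
  obtain ⟨s, rfl⟩ := hq
  rw [mul_left_comm, PowerSeries.coeff_X_pow_mul', PowerSeries.coeff_X_pow_mul']
  split_ifs with h
  · have : i - j = 0 := by omega
    rw [this, PowerSeries.coeff_zero_eq_constantCoeff_apply, map_mul,
      PowerSeries.coeff_zero_eq_constantCoeff_apply]
  · rw [mul_zero]

/-- On sequences whose moments of order less than `j` vanish, `T_γ` scales the moment of order
`j` by `2^{-j}`, and so `T_γ` preserves `𝒱_{j-1,v}`. -/
lemma coeff_rc_T {a : ℤ →₀ Matrix (Fin r) (Fin r) ℂ} {v : ℤ →₀ (Fin r → ℂ)} {J j : ℕ}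
    (h : HasSumRules a v J) {u : ℤ →₀ (Fin r → ℂ)} (hu : u ∈ vanishing v j) {γ : ℤ}
    (hγ : γ = 0 ∨ γ = 1) {i : ℕ} (hi : i < J) (hij : i ≤ j) :
    2 ^ i * PowerSeries.coeff i (rc v (T a γ u)) = PowerSeries.coeff i (rc v u) := by
  rcases hγ with rfl | rfl
  · exact coeff_rc_T_zero h u hi
  · have h1 := (rc_T_one h u).mul_left (jet (ek (-1)))
    have h2 : jet (ek (-1)) * jet (ek 1) = 1 := by
      rw [← jet_mul (contDiff_ek _) (contDiff_ek _), ← jet_one]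
      congr 1; funext ξ; rw [← ek_add]; simp [ek_zero_left]
    have h3 := PowerSeries.X_pow_dvd_iff.mp h1 i hi
    rw [mul_sub, ← mul_assoc, h2, one_mul, map_sub, PowerSeries.coeff_rescale, sub_eq_zero,
      coeff_mul_of_X_pow_dvd (q := rc v u) (mem_vanishing_iff.mp hu) hij,
      ← PowerSeries.coeff_zero_eq_constantCoeff_apply, coeff_zero_jet, ek_zero_right, one_mul] at h3
    exact h3

lemma T_mem_vanishing {a : ℤ →₀ Matrix (Fin r) (Fin r) ℂ} {v : ℤ →₀ (Fin r → ℂ)} {J j : ℕ}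
    (h : HasSumRules a v J) (hj : j ≤ J) {u : ℤ →₀ (Fin r → ℂ)} (hu : u ∈ vanishing v j) {γ : ℤ}
    (hγ : γ = 0 ∨ γ = 1) : T a γ u ∈ vanishing v j := by
  rw [mem_vanishing_iff, PowerSeries.X_pow_dvd_iff]
  intro i hi
  have h1 := coeff_rc_T h hu hγ (hi.trans_le hj) hi.le
  rw [show PowerSeries.coeff i (rc v u) = 0 from
    PowerSeries.X_pow_dvd_iff.mp (mem_vanishing_iff.mp hu) i hi] at h1
  exact (mul_eq_zero.mp h1).resolve_left (pow_ne_zero _ two_ne_zero)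

/-- On the quotient of `vanishing v j` by `vanishing v (j + 1)` both transition operators act as
multiplication by `2^{-j}`. -/
lemma T_sub_smul_mem_vanishing {a : ℤ →₀ Matrix (Fin r) (Fin r) ℂ} {v : ℤ →₀ (Fin r → ℂ)}
    {J j : ℕ} (h : HasSumRules a v J) (hj : j < J) {u : ℤ →₀ (Fin r → ℂ)} (hu : u ∈ vanishing v j)
    {γ : ℤ} (hγ : γ = 0 ∨ γ = 1) : T a γ u - ((2 : ℂ) ^ j)⁻¹ • u ∈ vanishing v (j + 1) := by
  have hmem : T a γ u - ((2 : ℂ) ^ j)⁻¹ • u ∈ vanishingSub v j :=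
    (vanishingSub v j).sub_mem (T_mem_vanishing h hj.le hu hγ) ((vanishingSub v j).smul_mem _ hu)
  rw [mem_vanishingSub, mem_vanishing_iff, PowerSeries.X_pow_dvd_iff] at hmem
  rw [mem_vanishing_iff, PowerSeries.X_pow_dvd_iff]
  intro i hi
  rcases (Nat.lt_succ_iff.mp hi).lt_or_eq with hlt | rfl
  · exact hmem i hlt
  · have h1 := coeff_rc_T h hu hγ hj le_rfl
    have h2 : rc v (T a γ u - ((2 : ℂ) ^ i)⁻¹ • u)
        = rc v (T a γ u) - PowerSeries.C ((2 : ℂ) ^ i)⁻¹ * rc v u := by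
      have : T a γ u - ((2 : ℂ) ^ i)⁻¹ • u = T a γ u + (-((2 : ℂ) ^ i)⁻¹) • u := by
        rw [neg_smul, sub_eq_add_neg]
      rw [this, rc_add, rc_smul, map_neg]; ring
    change PowerSeries.coeff i (rc v _) = 0
    rw [h2, map_sub, PowerSeries.coeff_C_mul, ← h1, inv_mul_cancel_left₀ (pow_ne_zero _ two_ne_zero), sub_self]

/-! ### Boundedness of the order of sum rules -/

/-- Sequences supported in `[-L, L]`. -/
def suppSub (r L : ℕ) : Submodule ℂ (ℤ →₀ (Fin r → ℂ)) where
  carrier := {u | SuppIn L u}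
  add_mem' := by
    intro u w hu hw k hk
    by_cases h : u k = 0
    · exact hw k fun h' => hk (by rw [Finsupp.add_apply, h, h', add_zero])
    · exact hu k h
  zero_mem' := by intro k hk; simp at hk
  smul_mem' := by
    intro c u hu k hk
    exact hu k fun h => hk (by rw [Finsupp.smul_apply, h, smul_zero])

lemma eq_sum_of_suppIn {L : ℕ} {u : ℤ →₀ (Fin r → ℂ)} (hu : SuppIn L u) :
    u = ∑ k ∈ Finset.Icc (-(L : ℤ)) L, ∑ i, u k i • Finsupp.single k (Pi.single i (1 : ℂ)) := by
  classical
  have h1 : ∀ k, ∑ i, u k i • Finsupp.single k (Pi.single i (1 : ℂ)) = Finsupp.single k (u k) := by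
    intro k
    have : u k = ∑ i, u k i • (Pi.single i (1 : ℂ) : Fin r → ℂ) := by
      funext j
      simp [Finset.sum_apply, Pi.single_apply]
    conv_rhs => rw [this, Finsupp.single_finsetSum]
    simp only [Finsupp.smul_single]
  simp only [h1]
  ext1 k
  rw [Finsupp.finsetSum_apply]
  by_cases hk : u k = 0
  · rw [hk, Finset.sum_eq_zero]
    intro j _
    by_cases hj : j = k
    · rw [hj, hk]; simp
    · rw [Finsupp.single_eq_of_ne (Ne.symm hj)]
  · rw [Finset.sum_eq_single k]
    · simp
    · intro j _ hj; rw [Finsupp.single_eq_of_ne (Ne.symm hj)]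
    · intro h; exact absurd (Finset.mem_Icc.mpr (abs_le.mp (hu k hk))) h

instance finiteDimensional_suppSub (L : ℕ) : FiniteDimensional ℂ (suppSub r L) := by
  classical
  let s : Finset (ℤ →₀ (Fin r → ℂ)) := (Finset.Icc (-(L : ℤ)) L ×ˢ Finset.univ).image
    fun p : ℤ × Fin r => Finsupp.single p.1 (Pi.single p.2 (1 : ℂ))
  refine Submodule.finiteDimensional_of_le (S₂ := Submodule.span ℂ (s : Set (ℤ →₀ (Fin r → ℂ)))) ?_
  intro u hu
  rw [eq_sum_of_suppIn hu]
  refine Submodule.sum_mem _ fun k hk => Submodule.sum_mem _ fun i _ => Submodule.smul_mem _ _ ?_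
  refine Submodule.subset_span ?_
  exact Finset.mem_coe.mpr (Finset.mem_image.mpr ⟨(k, i), by simpa using hk, rfl⟩)

lemma suppIn_T_pred {a : ℤ →₀ Matrix (Fin r) (Fin r) ℂ} {N M : ℕ} (ha : SuppIn N a)
    (hM : N + 1 ≤ M) {u : ℤ →₀ (Fin r → ℂ)} (hu : SuppIn (M + 1) u) {γ : ℤ}
    (hγ : γ = 0 ∨ γ = 1) : SuppIn M (T a γ u) := fun k hk => by
  have := T_bound ha hu hγ k hk
  push_cast at this
  omega

/-- The `i`-th moment functional `u ↦ [v̂ û]_i`. -/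
def momentFun (v : ℤ →₀ (Fin r → ℂ)) (i : ℕ) : (ℤ →₀ (Fin r → ℂ)) →ₗ[ℂ] ℂ where
  toFun u := PowerSeries.coeff i (rc v u)
  map_add' u w := by rw [rc_add, map_add]
  map_smul' c u := by rw [rc_smul, PowerSeries.coeff_C_mul]; rfl

/-- Because `v̂(0) ≠ 0`, differences of a constant vector have any prescribed number of vanishing
moments and a nonzero next one. -/
lemma exists_momentFun_ne_zero {v : ℤ →₀ (Fin r → ℂ)} (hv : symbol v 0 ≠ 0) (i : ℕ) :
    ∃ u ∈ vanishing v i, momentFun v i u ≠ 0 := by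
  obtain ⟨y, hy⟩ := exists_dotProduct_ne_zero hv
  obtain ⟨g, hg, hj⟩ := exists_jet_diffSeq
  refine ⟨smulSeq (diffSeq i) y, ?_, ?_⟩
  · rw [mem_vanishing_iff, vjet_smulSeq, dotProduct_mul_C, hj, mul_assoc]
    exact dvd_mul_right _ _
  · change PowerSeries.coeff i (rc v _) ≠ 0
    rw [rc, vjet_smulSeq, dotProduct_mul_C, hj, mul_assoc, PowerSeries.coeff_X_pow_mul', if_pos le_rfl,
      Nat.sub_self, PowerSeries.coeff_zero_eq_constantCoeff_apply, map_mul, map_pow, hg, constantCoeff_dotProduct_C]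
    exact mul_ne_zero (pow_ne_zero _ Complex.I_ne_zero) hy

/-- Eigenvectors for the distinct eigenvalues `2^{-i}` of the dual map are linearly independent. -/
lemma card_le_finrank_of_dual_eigenvectors {U : Type*} [AddCommGroup U] [Module ℂ U]
    [FiniteDimensional ℂ U] (t : U →ₗ[ℂ] U) {n : ℕ} (μ : Fin n → Module.Dual ℂ U)
    (h : ∀ i u, μ i (t u) = ((2 : ℂ) ^ (i : ℕ))⁻¹ * μ i u) (h0 : ∀ i, μ i ≠ 0) :
    n ≤ Module.finrank ℂ (Module.Dual ℂ U) := by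
  have hlin : LinearIndependent ℂ μ := by
    refine Module.End.eigenvectors_linearIndependent' (R := ℂ) t.dualMap
      (fun i : Fin n => ((2 : ℂ) ^ (i : ℕ))⁻¹) ?_ μ fun i => ?_
    · intro i j hij
      have hij' : (2 : ℂ) ^ (i : ℕ) = 2 ^ (j : ℕ) := inv_injective hij
      have h2 : (2 : ℕ) ^ (i : ℕ) = 2 ^ (j : ℕ) := by exact_mod_cast hij'
      exact Fin.ext (Nat.pow_right_injective le_rfl h2)
    · rw [Module.End.hasEigenvector_iff, Module.End.mem_eigenspace_iff]
      exact ⟨LinearMap.ext fun u => h i u, h0 i⟩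
  simpa using hlin.fintype_card_le_finrank

/-- The moment functionals are eigenvectors, with distinct eigenvalues, of the transpose of the
transition operator on a finite-dimensional space; hence the order of sum rules is bounded. -/
lemma bddAbove_sumRules (a : ℤ →₀ Matrix (Fin r) (Fin r) ℂ) :
    BddAbove {n | ∃ v : ℤ →₀ (Fin r → ℂ), HasSumRules a v n} := by
  obtain ⟨N, hN⟩ := exists_suppIn a
  refine ⟨Module.finrank ℂ (Module.Dual ℂ (suppSub r (N + 1))), ?_⟩
  rintro n ⟨v, hv⟩
  let t : suppSub r (N + 1) →ₗ[ℂ] suppSub r (N + 1) :=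
    (T a 0).restrict fun u hu => suppIn_T hN le_rfl hu (.inl rfl)
  let μ : Fin n → Module.Dual ℂ (suppSub r (N + 1)) := fun i =>
    (momentFun v i).comp (suppSub r (N + 1)).subtype
  -- `T_0` shrinks supports and scales moments, so a moment that is not identically zero is already
  -- nonzero on the sequences supported in `[-N - 1, N + 1]`
  have hne : ∀ i : Fin n, ∀ M : ℕ, ∀ u : ℤ →₀ (Fin r → ℂ), SuppIn (N + 1 + M) u →
      momentFun v i u ≠ 0 → μ i ≠ 0 := by
    intro i M
    induction M with
    | zero =>
      intro u hu h h0
      exact h (by simpa [μ] using congrArg (fun f => f ⟨u, hu⟩) h0)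
    | succ M ih =>
      intro u hu h
      refine ih (T a 0 u) (suppIn_T_pred hN (Nat.le_add_right _ _) hu (.inl rfl)) fun h0 => h ?_
      have := coeff_rc_T_zero hv u i.2
      change PowerSeries.coeff (i : ℕ) (rc v u) = 0
      rw [← this]
      change _ * momentFun v i (T a 0 u) = 0
      rw [h0, mul_zero]
  refine card_le_finrank_of_dual_eigenvectors (U := suppSub r (N + 1)) t μ (fun i u => ?_) fun i => ?_
  · have := coeff_rc_T_zero hv (u : ℤ →₀ (Fin r → ℂ)) i.2
    change PowerSeries.coeff (i : ℕ) (rc v (T a 0 u))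
      = ((2 : ℂ) ^ (i : ℕ))⁻¹ * PowerSeries.coeff (i : ℕ) (rc v u)
    rw [← this, inv_mul_cancel_left₀ (pow_ne_zero _ two_ne_zero)]
  · obtain ⟨u, -, hu⟩ := exists_momentFun_ne_zero hv.1.1 i
    obtain ⟨L, hL⟩ := exists_suppIn u
    exact hne i L u (hL.mono (by omega)) hu

/-! ### Exponential decay -/

/-- Exponential decay of the data generated from `u`, with rate `lam`. -/
def ExpDecaySeq (a : ℤ →₀ Matrix (Fin r) (Fin r) ℂ) (lam : ℝ) (u : ℤ →₀ (Fin r → ℂ)) : Prop :=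
  ∃ C : ℝ, ∀ (n : ℕ) (k : ℤ), ‖W a n u k‖ ≤ C * lam ^ n

/-- Exponential decay, at a rate better than `2^{-m}`, on all sequences with vanishing moments up
to order `m`. -/
def ExpDecay (a : ℤ →₀ Matrix (Fin r) (Fin r) ℂ) (v : ℤ →₀ (Fin r → ℂ)) (m : ℕ) : Prop :=
  ∃ lam : ℝ, 0 < lam ∧ 2 ^ m * lam < 1 ∧ ∀ u ∈ vanishing v (m + 1), ExpDecaySeq a lam u

lemma tendsto_decay {m : ℕ} {lam : ℝ} (h0 : 0 < lam) (h1 : 2 ^ m * lam < 1) (C : ℝ) :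
    Tendsto (fun n : ℕ => 2 ^ (m * n) * (C * lam ^ n)) atTop (𝓝 0) := by
  have := (tendsto_pow_atTop_nhds_zero_of_lt_one (by positivity) h1).const_mul C
  rw [mul_zero] at this
  refine this.congr fun n => ?_
  rw [mul_pow, ← pow_mul]; ring

lemma ExpDecaySeq.decaySeq {a : ℤ →₀ Matrix (Fin r) (Fin r) ℂ} {m : ℕ} {lam : ℝ} (h0 : 0 < lam)
    (h1 : 2 ^ m * lam < 1) {u : ℤ →₀ (Fin r → ℂ)} (h : ExpDecaySeq a lam u) : DecaySeq a m u := by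
  obtain ⟨C, hC⟩ := h
  intro ε hε
  filter_upwards [(tendsto_decay h0 h1 C).eventually (gt_mem_nhds hε)] with n hn k
  exact (mul_le_mul_of_nonneg_left (hC n k) (by positivity)).trans hn.le

lemma exists_norm_le {M : Type*} [NormedAddCommGroup M] (u : ℤ →₀ M) : ∃ S : ℝ, 0 ≤ S ∧ ∀ k, ‖u k‖ ≤ S := by
  refine ⟨∑ k ∈ u.support, ‖u k‖, by positivity, fun k => ?_⟩
  by_cases hk : u k = 0
  · rw [hk, norm_zero]; positivity
  · exact Finset.single_le_sum (f := fun k => ‖u k‖) (fun _ _ => norm_nonneg _)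
      (Finsupp.mem_support_iff.mpr hk)

lemma exists_linear_projection {M : Type*} [AddCommGroup M] [Module ℂ M] (V : Submodule ℂ M) :
    ∃ P : M →ₗ[ℂ] M, (∀ x, P x ∈ V) ∧ ∀ x ∈ V, P x = x := by
  obtain ⟨P, hP⟩ := V.subtype.exists_leftInverse_of_injective V.ker_subtype
  refine ⟨V.subtype ∘ₗ P, fun x => (P x).2, fun x hx => ?_⟩
  exact congrArg Subtype.val (LinearMap.congr_fun hP ⟨x, hx⟩)

/-- Coordinates on the sequences of a subspace supported in `[-L, L]`: the data generated from such
a sequence are bounded by those generated from finitely many members of the subspace. -/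
lemma exists_uniform (a : ℤ →₀ Matrix (Fin r) (Fin r) ℂ) (V : Submodule ℂ (ℤ →₀ (Fin r → ℂ)))
    (L : ℕ) : ∃ b : ℤ → Fin r → (ℤ →₀ (Fin r → ℂ)), (∀ k i, b k i ∈ V) ∧
      ∀ u ∈ V, SuppIn L u → ∀ S : ℝ, (∀ k, ‖u k‖ ≤ S) → ∀ (n : ℕ) (j : ℤ),
        ‖W a n u j‖ ≤ S * ∑ k ∈ Finset.Icc (-(L : ℤ)) L, ∑ i, ‖W a n (b k i) j‖ := by
  obtain ⟨P, hPV, hP⟩ := exists_linear_projection V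
  refine ⟨fun k i => P (Finsupp.single k (Pi.single i (1 : ℂ))), fun k i => hPV _,
    fun u hu hL S hS n j => ?_⟩
  have h1 : u = ∑ k ∈ Finset.Icc (-(L : ℤ)) L, ∑ i, u k i •
      P (Finsupp.single k (Pi.single i (1 : ℂ))) := by
    conv_lhs => rw [← hP u hu, eq_sum_of_suppIn hL]
    simp only [map_sum, map_smul]
  conv_lhs => rw [h1]
  simp only [map_sum, map_smul, Finsupp.finsetSum_apply, Finsupp.smul_apply]
  rw [Finset.mul_sum]
  refine norm_sum_le_of_le _ fun k _ => ?_
  rw [Finset.mul_sum]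
  refine norm_sum_le_of_le _ fun i _ => ?_
  rw [norm_smul]
  gcongr
  exact (norm_le_pi_norm (u k) i).trans (hS k)

/-- Decay on a space of sequences is uniform on those supported in a fixed interval, since these
form a finite-dimensional space. -/
lemma uniform_decay {a : ℤ →₀ Matrix (Fin r) (Fin r) ℂ} {m : ℕ}
    {V : Submodule ℂ (ℤ →₀ (Fin r → ℂ))} (hV : ∀ u ∈ V, DecaySeq a m u) (L : ℕ) {ε : ℝ}
    (hε : 0 < ε) : ∀ᶠ n : ℕ in atTop, ∀ u ∈ V, SuppIn L u → ∀ S : ℝ, (∀ k, ‖u k‖ ≤ S) →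
      ∀ j, ‖W a n u j‖ ≤ ε / 2 ^ (m * n) * S := by
  obtain ⟨b, hb, hbound⟩ := exists_uniform a V L
  set c : ℝ := ∑ k ∈ Finset.Icc (-(L : ℤ)) L, ∑ _i : Fin r, (1 : ℝ) with hc
  have hc0 : 0 ≤ c := by positivity
  have hev : ∀ᶠ n : ℕ in atTop, ∀ k ∈ Finset.Icc (-(L : ℤ)) L, ∀ i ∈ Finset.univ,
      ∀ j, 2 ^ (m * n) * ‖W a n (b k i) j‖ ≤ ε / (c + 1) :=
    (Filter.eventually_all_finset _).mpr fun k _ => (Filter.eventually_all_finset _).mpr fun i _ =>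
      hV _ (hb k i) _ (by positivity)
  filter_upwards [hev] with n hn u hu hL S hS j
  have hS0 : 0 ≤ S := (norm_nonneg _).trans (hS 0)
  refine (hbound u hu hL S hS n j).trans ?_
  rw [mul_comm]
  gcongr
  calc _ ≤ ∑ k ∈ Finset.Icc (-(L : ℤ)) L, ∑ _i : Fin r, ε / (c + 1) / 2 ^ (m * n) := by
        refine Finset.sum_le_sum fun k hk => Finset.sum_le_sum fun i hi => ?_
        rw [le_div_iff₀ (by positivity), mul_comm]
        exact hn k hk i hi j
    _ = c * (ε / (c + 1) / 2 ^ (m * n)) := by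
        rw [hc, Finset.sum_mul]
        refine Finset.sum_congr rfl fun k _ => ?_
        rw [Finset.sum_mul]
        simp
    _ = (c / (c + 1)) * (ε / 2 ^ (m * n)) := by ring
    _ ≤ 1 * (ε / 2 ^ (m * n)) := by
        gcongr
        exact div_le_one_of_le₀ (by linarith) (by positivity)
    _ = _ := one_mul _

/-- The exponential version of `uniform_decay`. -/
lemma uniform_expDecay {a : ℤ →₀ Matrix (Fin r) (Fin r) ℂ} {lam : ℝ}
    {V : Submodule ℂ (ℤ →₀ (Fin r → ℂ))} (hV : ∀ u ∈ V, ExpDecaySeq a lam u) (L : ℕ) :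
    ∃ C : ℝ, ∀ u ∈ V, SuppIn L u → ∀ S : ℝ, (∀ k, ‖u k‖ ≤ S) →
      ∀ (n : ℕ) (j : ℤ), ‖W a n u j‖ ≤ C * lam ^ n * S := by
  obtain ⟨b, hb, hbound⟩ := exists_uniform a V L
  choose C hC using fun k i => hV _ (hb k i)
  refine ⟨∑ k ∈ Finset.Icc (-(L : ℤ)) L, ∑ i, C k i, fun u hu hL S hS n j => ?_⟩
  have hS0 : 0 ≤ S := (norm_nonneg _).trans (hS 0)
  refine (hbound u hu hL S hS n j).trans ?_
  rw [mul_comm]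
  refine mul_le_mul_of_nonneg_right ?_ hS0
  rw [Finset.sum_mul]
  refine Finset.sum_le_sum fun k _ => ?_
  rw [Finset.sum_mul]
  exact Finset.sum_le_sum fun i _ => hC k i n j

/-- The data at level `n + p` are data at level `n` of a sequence whose values are data at
level `p`. -/
lemma exists_W_add {a : ℤ →₀ Matrix (Fin r) (Fin r) ℂ} {E : Set (ℤ →₀ (Fin r → ℂ))}
    (hE : ∀ u ∈ E, ∀ γ : ℤ, γ = 0 ∨ γ = 1 → T a γ u ∈ E) (n p : ℕ) : ∀ u ∈ E, ∀ j : ℤ,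
    ∃ u' ∈ E, ∃ j', W a (n + p) u j = W a n u' j' ∧ ∀ k, ∃ k', u' k = W a p u k' := by
  induction p with
  | zero => exact fun u hu j => ⟨u, hu, j, rfl, fun k => ⟨k, rfl⟩⟩
  | succ p ih =>
    intro u hu
    refine int_parity (fun j => ?_) fun j => ?_
    · obtain ⟨u', hu', j', h1, h2⟩ := ih _ (hE u hu 0 (.inl rfl)) j
      refine ⟨u', hu', j', by rw [← h1, ← add_assoc, W_succ_zero], fun k => ?_⟩
      obtain ⟨k', hk'⟩ := h2 k
      exact ⟨2 * k', by rw [hk', W_succ_zero]⟩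
    · obtain ⟨u', hu', j', h1, h2⟩ := ih _ (hE u hu 1 (.inr rfl)) j
      refine ⟨u', hu', j', by rw [← h1, ← add_assoc, W_succ_one], fun k => ?_⟩
      obtain ⟨k', hk'⟩ := h2 k
      exact ⟨2 * k' + 1, by rw [hk', W_succ_one]⟩

/-- The data of `u` at level `n + 1` are, on the even and on the odd integers, those of `T_0 u`
and `T_1 u` at level `n`. -/
lemma expDecaySeq_of_T {a : ℤ →₀ Matrix (Fin r) (Fin r) ℂ} {lam : ℝ} (h0 : 0 < lam)
    {u : ℤ →₀ (Fin r → ℂ)} (hu0 : ExpDecaySeq a lam (T a 0 u)) (hu1 : ExpDecaySeq a lam (T a 1 u)) :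
    ExpDecaySeq a lam u := by
  obtain ⟨C₀, hC₀⟩ := hu0
  obtain ⟨C₁, hC₁⟩ := hu1
  obtain ⟨S, hS0, hS⟩ := exists_norm_le u
  refine ⟨max S (max C₀ C₁ / lam), fun n => ?_⟩
  rcases n with _ | n
  · intro k; rw [pow_zero, mul_one]; exact (hS k).trans (le_max_left _ _)
  · have h2 : max C₀ C₁ * lam ^ n ≤ max S (max C₀ C₁ / lam) * lam ^ (n + 1) := by
      calc _ = max C₀ C₁ / lam * lam ^ (n + 1) := by rw [pow_succ]; field_simp
        _ ≤ _ := by gcongr; exact le_max_right _ _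
    refine int_parity (fun k => ?_) fun k => ?_
    · rw [W_succ_zero]
      refine (hC₀ n k).trans (le_trans ?_ h2)
      gcongr; exact le_max_left _ _
    · rw [W_succ_one]
      refine (hC₁ n k).trans (le_trans ?_ h2)
      gcongr; exact le_max_right _ _

/-- Decay of order `o(2^{-mn})` is automatically exponential with a better rate: on a
finite-dimensional space invariant under both transition operators, a power of the scheme contracts
by the factor `2^{-mn} / 2`. -/
lemma expDecay_of_decay {a : ℤ →₀ Matrix (Fin r) (Fin r) ℂ} {v : ℤ →₀ (Fin r → ℂ)} {m : ℕ}
    (hv : IsMatchingFilter a v (m + 1)) (h : ∀ u ∈ vanishing v (m + 1), DecaySeq a m u) :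
    ExpDecay a v m := by
  have hsr := hasSumRules_of_decay hv h
  obtain ⟨N, hN⟩ := exists_suppIn a
  -- at some level `n₀` all normalized data are below `2^{-m n₀} / 2`; submultiplicativity turns
  -- this into the geometric rate `lam = (2^{-m n₀} / 2)^{1/n₀} < 2^{-m}`
  obtain ⟨n₀, hn₀, hn₀1⟩ := ((uniform_decay (V := vanishingSub v (m + 1)) h (N + 1)
    (by norm_num : (0 : ℝ) < 1 / 2)).and (eventually_ge_atTop 1)).exists
  set θ : ℝ := 1 / 2 / 2 ^ (m * n₀) with hθ
  have hθ0 : 0 < θ := by positivity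
  have hn₀' : (n₀ : ℝ) ≠ 0 := by positivity
  set lam : ℝ := θ ^ (1 / (n₀ : ℝ)) with hlam
  have hlam0 : 0 < lam := Real.rpow_pos_of_pos hθ0 _
  have hlamn : lam ^ n₀ = θ := by
    rw [hlam, ← Real.rpow_natCast, ← Real.rpow_mul hθ0.le, one_div_mul_cancel hn₀', Real.rpow_one]
  have hlam1 : 2 ^ m * lam < 1 := by
    by_contra! hge
    have h1 : (1 : ℝ) ≤ (2 ^ m * lam) ^ n₀ := one_le_pow₀ hge
    rw [mul_pow, hlamn, hθ, ← pow_mul, mul_div_cancel₀ _ (by positivity)] at h1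
    norm_num at h1
  have hlamle : lam ≤ 1 := by
    have : (1 : ℝ) ≤ 2 ^ m := one_le_pow₀ (by norm_num)
    nlinarith
  -- the sequences supported in `[-N - 1, N + 1]` are stable under `T_0` and `T_1`
  set E : Set (ℤ →₀ (Fin r → ℂ)) := {u | u ∈ vanishing v (m + 1) ∧ SuppIn (N + 1) u} with hE
  have hEinv : ∀ u ∈ E, ∀ γ : ℤ, γ = 0 ∨ γ = 1 → T a γ u ∈ E := fun u hu γ hγ =>
    ⟨T_mem_vanishing hsr le_rfl hu.1 hγ, suppIn_T hN le_rfl hu.2 hγ⟩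
  have hpow : ∀ q : ℕ, ∀ u ∈ E, ∀ S : ℝ, (∀ k, ‖u k‖ ≤ S) → ∀ j, ‖W a (q * n₀) u j‖ ≤ θ ^ q * S := by
    intro q
    induction q with
    | zero => intro u _ S hS j; simpa [W] using hS j
    | succ q ih =>
      intro u hu S hS j
      obtain ⟨u', hu', j', h1, h2⟩ := exists_W_add hEinv (q * n₀) n₀ u hu j
      rw [add_mul, one_mul, h1, pow_succ, mul_assoc]
      refine ih u' hu' _ (fun k => ?_) j'
      obtain ⟨k', hk'⟩ := h2 k
      rw [hk']
      exact hn₀ u hu.1 hu.2 S hS k'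
  have hbase : ∀ u ∈ E, ExpDecaySeq a lam u := by
    intro u hu
    choose S hS0 hS using fun s => exists_norm_le (W a s u)
    refine ⟨(∑ s ∈ Finset.range n₀, S s) / θ, fun n k => ?_⟩
    obtain ⟨u', hu', j', h1, h2⟩ := exists_W_add hEinv (n / n₀ * n₀) (n % n₀) u hu k
    rw [Nat.div_add_mod'] at h1
    rw [h1]
    have hs : S (n % n₀) ≤ ∑ s ∈ Finset.range n₀, S s :=
      Finset.single_le_sum (f := S) (fun s _ => hS0 s)
        (Finset.mem_range.mpr (Nat.mod_lt _ (by omega)))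
    refine (hpow _ u' hu' (S (n % n₀)) (fun k => ?_) j').trans ?_
    · obtain ⟨k', hk'⟩ := h2 k
      rw [hk']; exact hS _ k'
    · have h3 : θ ^ (n / n₀) ≤ lam ^ n / θ := by
        rw [le_div_iff₀ hθ0, ← hlamn, ← pow_mul, ← pow_add]
        refine pow_le_pow_of_le_one hlam0.le hlamle ?_
        have := Nat.div_add_mod n n₀
        have := Nat.mod_lt n (show 0 < n₀ by omega)
        omega
      calc _ ≤ lam ^ n / θ * ∑ s ∈ Finset.range n₀, S s :=
            mul_le_mul h3 hs (hS0 _) (by positivity)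
        _ = _ := by ring
  refine ⟨lam, hlam0, hlam1, fun u hu => ?_⟩
  -- the transition operators carry every sequence into `E` after finitely many steps
  have hall : ∀ M : ℕ, ∀ u ∈ vanishing v (m + 1), SuppIn (N + 1 + M) u → ExpDecaySeq a lam u := by
    intro M
    induction M with
    | zero => exact fun u hu hs => hbase u ⟨hu, hs⟩
    | succ M ih =>
      intro u hu hs
      exact expDecaySeq_of_T hlam0
        (ih _ (T_mem_vanishing hsr le_rfl hu (.inl rfl))
          (suppIn_T_pred hN (Nat.le_add_right _ _) hs (.inl rfl)))
        (ih _ (T_mem_vanishing hsr le_rfl hu (.inr rfl))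
          (suppIn_T_pred hN (Nat.le_add_right _ _) hs (.inr rfl)))
  obtain ⟨L, hL⟩ := exists_suppIn u
  exact hall L u hu (hL.mono (by omega))

lemma ExpDecay.decay {a : ℤ →₀ Matrix (Fin r) (Fin r) ℂ} {v : ℤ →₀ (Fin r → ℂ)} {m : ℕ}
    (h : ExpDecay a v m) : ∀ u ∈ vanishing v (m + 1), DecaySeq a m u := by
  obtain ⟨lam, h0, h1, h2⟩ := h
  exact fun u hu => (h2 u hu).decaySeq h0 h1

/-! ### The smoothness exponent -/

/-- The bound `sm_∞(a) > m` in terms of the joint growth rate `ρ` itself. -/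
lemma lt_smInf_iff {a : ℤ →₀ Matrix (Fin r) (Fin r) ℂ} {m : ℕ} : (m : EReal) < smInf a ↔
    ∃ v : ℤ →₀ (Fin r → ℂ), HasSumRules a v (sumRuleOrder a) ∧
      rho a v (sumRuleOrder a) < ENNReal.ofReal (1 / 2 ^ m) := by
  have key : ∀ x : ℝ≥0∞, (m : EReal) < -(ENNReal.log x / ((Real.log 2 : ℝ) : EReal)) ↔
      x < ENNReal.ofReal (1 / 2 ^ m) := by
    intro x
    have hlog : ENNReal.log (ENNReal.ofReal (1 / 2 ^ m)) = ((-(m * Real.log 2) : ℝ) : EReal) := by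
      rw [ENNReal.log_ofReal_of_pos (by positivity), one_div, Real.log_inv, Real.log_pow]
    have hl2 : (0 : ℝ) < Real.log 2 := Real.log_pos (by norm_num)
    rw [← ENNReal.log_lt_log_iff, hlog, EReal.lt_neg_comm, EReal.div_lt_iff
      (by exact_mod_cast hl2) (EReal.coe_ne_top _)]
    have : -(m : EReal) * ((Real.log 2 : ℝ) : EReal) = ((-(m * Real.log 2) : ℝ) : EReal) := by
      rw [← EReal.coe_coe_eq_natCast, ← EReal.coe_neg, ← EReal.coe_mul, neg_mul]
    rw [this]
  simp only [smInf, lt_iSup_iff, key, Set.mem_ofPred_eq, exists_prop]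

lemma conv_eq_W (a : ℤ →₀ Matrix (Fin r) (Fin r) ℂ) (u : ℤ →₀ (Fin r → ℂ)) (n : ℕ) :
    (fun k : ℤ => ‖conv ((sd a)^[n] (deltaId r)) u k‖ₑ) = fun k => ‖W a n u k‖ₑ := by
  funext k; rw [conv_deltaId]

lemma enorm_le_ofReal_iff {E : Type*} [NormedAddCommGroup E] {x : E} {c : ℝ} (hc : 0 ≤ c) :
    ‖x‖ₑ ≤ ENNReal.ofReal c ↔ ‖x‖ ≤ c := by
  rw [← ofReal_norm, ENNReal.ofReal_le_ofReal_iff hc]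

/-- A geometric bound with ratio `lam` gives an exponential rate of at most every `lam' > lam`. -/
lemma limsup_le_of_expDecaySeq {a : ℤ →₀ Matrix (Fin r) (Fin r) ℂ} {lam lam' : ℝ} (h0 : 0 < lam)
    (h : lam < lam') {u : ℤ →₀ (Fin r → ℂ)} (hu : ExpDecaySeq a lam u) :
    limsup (fun n : ℕ => (⨆ k : ℤ, ‖conv ((sd a)^[n] (deltaId r)) u k‖ₑ) ^ (1 / (n : ℝ))) atTop
      ≤ ENNReal.ofReal lam' := by
  obtain ⟨C, hC⟩ := hu
  have h1 : Tendsto (fun n : ℕ => C * (lam / lam') ^ n) atTop (𝓝 (C * 0)) :=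
    (tendsto_pow_atTop_nhds_zero_of_lt_one (div_nonneg h0.le (h0.trans h).le)
      ((div_lt_one (h0.trans h)).mpr h)).const_mul C
  rw [mul_zero] at h1
  refine limsup_le_of_le (by isBoundedDefault) ?_
  filter_upwards [h1.eventually (gt_mem_nhds one_pos), eventually_ge_atTop 1] with n hn hn1
  have hpos : (0 : ℝ) < lam' ^ n := pow_pos (h0.trans h) n
  have h2 : C * lam ^ n ≤ lam' ^ n := by
    rw [div_pow, ← mul_div_assoc, div_lt_one hpos] at hn
    exact hn.le
  have h3 : (⨆ k : ℤ, ‖conv ((sd a)^[n] (deltaId r)) u k‖ₑ) ≤ ENNReal.ofReal lam' ^ (n : ℝ) := by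
    rw [conv_eq_W]
    refine iSup_le fun k => ?_
    rw [ENNReal.rpow_natCast, ← ENNReal.ofReal_pow (h0.trans h).le, enorm_le_ofReal_iff hpos.le]
    exact (hC n k).trans h2
  refine (ENNReal.rpow_le_rpow h3 (by positivity)).trans ?_
  rw [← ENNReal.rpow_mul, mul_one_div_cancel (by positivity), ENNReal.rpow_one]

/-- An exponential rate below `lam` gives a geometric bound with ratio `lam`; the finitely many
levels before it applies go into the constant. -/
lemma expDecaySeq_of_limsup_lt {a : ℤ →₀ Matrix (Fin r) (Fin r) ℂ} {lam : ℝ} (h0 : 0 < lam)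
    {u : ℤ →₀ (Fin r → ℂ)}
    (h : limsup (fun n : ℕ => (⨆ k : ℤ, ‖conv ((sd a)^[n] (deltaId r)) u k‖ₑ) ^ (1 / (n : ℝ))) atTop
      < ENNReal.ofReal lam) : ExpDecaySeq a lam u := by
  obtain ⟨n₀, hn₀⟩ := eventually_atTop.mp (eventually_lt_of_limsup_lt h)
  choose S hS0 hS using fun s => exists_norm_le (W a s u)
  refine ⟨1 + ∑ s ∈ Finset.range (n₀ + 1), S s / lam ^ s, fun n k => ?_⟩
  have hnn : ∀ s, 0 ≤ S s / lam ^ s := fun s => div_nonneg (hS0 s) (by positivity)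
  rcases Nat.lt_or_ge n (n₀ + 1) with hn | hn
  · have h1 := Finset.single_le_sum (f := fun s => S s / lam ^ s) (fun s _ => hnn s)
      (Finset.mem_range.mpr hn)
    refine (hS n k).trans ?_
    rw [← div_le_iff₀ (by positivity)]
    linarith
  · have h1 := hn₀ n (by omega)
    have hn0 : (n : ℝ) ≠ 0 := by
      have : 0 < n := by omega
      positivity
    have h2 := ENNReal.rpow_le_rpow h1.le (by positivity : (0 : ℝ) ≤ n)
    rw [← ENNReal.rpow_mul, one_div_mul_cancel hn0, ENNReal.rpow_one, conv_eq_W,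
      ENNReal.rpow_natCast, ← ENNReal.ofReal_pow h0.le] at h2
    have h3 := (le_iSup _ k).trans h2
    rw [enorm_le_ofReal_iff (by positivity)] at h3
    have h4 : 0 ≤ ∑ s ∈ Finset.range (n₀ + 1), S s / lam ^ s := Finset.sum_nonneg fun s _ => hnn s
    have h5 : 0 < lam ^ n := by positivity
    nlinarith

/-- Decay gives `sr(a) ≥ m + 1`, and a filter realizing `sr(a)` is a multiple of `v` up to order
`m + 1`; hence its space of order `sr(a)` lies in `𝒱_{m,v}`, and the decay there bounds `ρ`. -/
lemma lt_smInf_of_expDecay {a : ℤ →₀ Matrix (Fin r) (Fin r) ℂ} {v : ℤ →₀ (Fin r → ℂ)} {m : ℕ}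
    (hv : IsMatchingFilter a v (m + 1)) (h : ExpDecay a v m) : (m : EReal) < smInf a := by
  have hsr := hasSumRules_of_decay hv h.decay
  have hne : {n | ∃ v : ℤ →₀ (Fin r → ℂ), HasSumRules a v n}.Nonempty := ⟨m + 1, v, hsr⟩
  obtain ⟨v', hv'⟩ : ∃ v', HasSumRules a v' (sumRuleOrder a) :=
    Nat.sSup_mem hne (bddAbove_sumRules a)
  have hle : m + 1 ≤ sumRuleOrder a := le_csSup (bddAbove_sumRules a) ⟨v, hsr⟩
  have hm' : IsMatchingFilter a v' (m + 1) :=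
    ⟨hv'.1.1, fun j hj => hv'.1.2 j (hj.trans_le hle)⟩
  obtain ⟨κ, hκ, hE⟩ := matching_unique hv hm' le_rfl fun c hc =>
    decay_pow_of_decay hv.1 h.decay hc
  obtain ⟨lam, h0, h1, h2⟩ := h
  rw [lt_smInf_iff]
  refine ⟨v', hv', ?_⟩
  have hlt : lam < 1 / 2 ^ m := by
    rw [lt_div_iff₀ (by positivity), mul_comm]; exact h1
  obtain ⟨lam', hl1, hl2⟩ := exists_between hlt
  refine lt_of_le_of_lt (iSup₂_le fun u hu => limsup_le_of_expDecaySeq h0 hl1 (h2 u ?_))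
    ((ENNReal.ofReal_lt_ofReal_iff (by positivity)).mpr hl2)
  refine vanishing_subset_of_eqMod (eqMod_symm_smul hκ hE) le_rfl ?_
  exact fun j hj => hu j (hj.trans_le hle)

lemma vanishing_anti (v : ℤ →₀ (Fin r → ℂ)) {i j : ℕ} (h : i ≤ j) :
    vanishing v j ⊆ vanishing v i := fun _ hu l hl => hu l (hl.trans_le h)

/-- Exponential decay on `vanishing v (j + 1)` passes to `vanishing v j`, provided the rate is
larger than `2^{-j}`. -/
lemma expDecaySeq_descend {a : ℤ →₀ Matrix (Fin r) (Fin r) ℂ} {v : ℤ →₀ (Fin r → ℂ)} {J j : ℕ}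
    (hsr : HasSumRules a v J) (hj : j < J) {lam : ℝ} (hlam : 1 / 2 ^ j < lam)
    (h : ∀ u ∈ vanishing v (j + 1), ExpDecaySeq a lam u) :
    ∀ u ∈ vanishing v j, ExpDecaySeq a lam u := by
  intro u hu
  have h0 : 0 < lam := lt_trans (by positivity) hlam
  obtain ⟨C₀, hC₀⟩ := h _ (T_sub_smul_mem_vanishing hsr hj hu (.inl rfl))
  obtain ⟨C₁, hC₁⟩ := h _ (T_sub_smul_mem_vanishing hsr hj hu (.inr rfl))
  obtain ⟨S, hS0, hS⟩ := exists_norm_le u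
  -- `D` is chosen so that `C + 2^{-j} D ≤ lam D`, which makes the bound `D lam^n` propagate
  set D := max S (max C₀ C₁ / (lam - 1 / 2 ^ j)) with hD
  have hD0 : 0 ≤ D := hS0.trans (le_max_left _ _)
  have hDC : max C₀ C₁ ≤ (lam - 1 / 2 ^ j) * D := by
    rw [mul_comm, ← div_le_iff₀ (sub_pos.mpr hlam)]
    exact le_max_right _ _
  refine ⟨D, fun n => ?_⟩
  have hW : ∀ (n : ℕ) (γ : ℤ) (C : ℝ), C ≤ max C₀ C₁ → (∀ k, ‖W a n u k‖ ≤ D * lam ^ n) →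
      (∀ k, ‖W a n (T a γ u - ((2 : ℂ) ^ j)⁻¹ • u) k‖ ≤ C * lam ^ n) →
      ∀ k, ‖W a n (T a γ u) k‖ ≤ D * lam ^ (n + 1) := by
    intro n γ C hC hu hw k
    have e : W a n (T a γ u) k = ((2 : ℂ) ^ j)⁻¹ • W a n u k
        + W a n (T a γ u - ((2 : ℂ) ^ j)⁻¹ • u) k := by
      rw [map_sub, map_smul, Finsupp.sub_apply, Finsupp.smul_apply]; abel
    rw [e]
    have h3 : ‖((2 : ℂ) ^ j)⁻¹‖ = 1 / 2 ^ j := by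
      rw [norm_inv, norm_pow, Complex.norm_ofNat, one_div]
    calc _ ≤ 1 / 2 ^ j * (D * lam ^ n) + max C₀ C₁ * lam ^ n := by
          refine (norm_add_le _ _).trans (add_le_add ?_ ((hw k).trans ?_))
          · rw [norm_smul, h3]; gcongr; exact hu k
          · gcongr
      _ ≤ 1 / 2 ^ j * (D * lam ^ n) + (lam - 1 / 2 ^ j) * D * lam ^ n := by gcongr
      _ = _ := by ring
  induction n with
  | zero => intro k; rw [pow_zero, mul_one]; exact (hS k).trans (le_max_left _ _)
  | succ n ih =>
    refine int_parity (fun k => ?_) fun k => ?_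
    · rw [W_succ_zero]; exact hW n 0 C₀ (le_max_left _ _) ih (hC₀ n) k
    · rw [W_succ_one]; exact hW n 1 C₁ (le_max_right _ _) ih (hC₁ n) k

/-- Conversely, the rate on the space of order `sr(a)` is carried down to the larger space
`𝒱_{m,v}` by `expDecaySeq_descend`. -/
lemma expDecay_of_lt_smInf {a : ℤ →₀ Matrix (Fin r) (Fin r) ℂ} {v : ℤ →₀ (Fin r → ℂ)} {m : ℕ}
    (hv : IsMatchingFilter a v (m + 1)) (h : (m : EReal) < smInf a) : ExpDecay a v m := by
  obtain ⟨v', hv', hρ⟩ := lt_smInf_iff.mp h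
  set J := sumRuleOrder a with hJ
  -- the rate is chosen above `2^{-(m+1)}`, so that it survives the descent to order `m + 1`
  have hmax : max (rho a v' J) (ENNReal.ofReal (1 / 2 ^ (m + 1))) < ENNReal.ofReal (1 / 2 ^ m) := by
    refine max_lt hρ ((ENNReal.ofReal_lt_ofReal_iff (by positivity)).mpr ?_)
    rw [one_div_lt_one_div (by positivity) (by positivity), pow_succ]
    linarith [show (0 : ℝ) < 2 ^ m by positivity]
  obtain ⟨x, hx1, hx2⟩ := exists_between hmax
  have hxtop : x ≠ ⊤ := (hx2.trans ENNReal.ofReal_lt_top).ne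
  obtain ⟨lam, hlamnn, rfl⟩ : ∃ lam : ℝ, 0 ≤ lam ∧ x = ENNReal.ofReal lam :=
    ⟨x.toReal, ENNReal.toReal_nonneg, (ENNReal.ofReal_toReal hxtop).symm⟩
  have hl1 : 1 / 2 ^ (m + 1) < lam := by
    have := (le_max_right _ _).trans_lt hx1
    exact ENNReal.ofReal_lt_ofReal_iff_of_nonneg (by positivity) |>.mp this
  have hl2 : lam < 1 / 2 ^ m := ENNReal.ofReal_lt_ofReal_iff_of_nonneg hlamnn |>.mp hx2
  have h0 : 0 < lam := lt_trans (by positivity) hl1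
  have hlam1 : 2 ^ m * lam < 1 := by
    rw [lt_div_iff₀ (by positivity)] at hl2; linarith
  have hexp : ∀ u ∈ vanishing v' J, ExpDecaySeq a lam u := fun u hu =>
    expDecaySeq_of_limsup_lt h0
      (((le_iSup₂_of_le u hu le_rfl).trans_lt ((le_max_left _ _).trans_lt hx1)))
  have hdecay : ∀ u ∈ vanishing v' J, DecaySeq a m u := fun u hu => (hexp u hu).decaySeq h0 hlam1
  set K := min J (m + 1) with hK
  have hvK : IsMatchingFilter a v K := ⟨hv.1, fun j hj => hv.2 j (hj.trans_le (min_le_right _ _))⟩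
  have hvK' : IsMatchingFilter a v' K :=
    ⟨hv'.1.1, fun j hj => hv'.1.2 j (hj.trans_le (min_le_left _ _))⟩
  obtain ⟨κ, hκ, hE⟩ := matching_unique hvK' hvK (min_le_right _ _) fun c hc =>
    decay_pow_of_decay hv'.1.1 hdecay hc
  -- the sum rules have order greater than `m`: otherwise a sequence with a nonzero moment of
  -- order `J ≤ m` would decay too fast
  have hJm : m + 1 ≤ J := by
    by_contra! hlt
    have hKJ : K = J := min_eq_left hlt.le
    obtain ⟨u, hu, hu0⟩ := exists_momentFun_ne_zero hv.1 J
    rw [hKJ] at hE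
    have hu' : u ∈ vanishing v' J := vanishing_subset_of_eqMod (eqMod_symm_smul hκ hE) le_rfl hu
    exact hu0 (coeff_rowCol_eq_zero hv (hdecay u hu') (Nat.lt_succ_iff.mp hlt) hlt)
  have hKm : K = m + 1 := min_eq_right hJm
  rw [hKm] at hE
  refine ⟨lam, h0, hlam1, fun u hu => ?_⟩
  have hdesc : ∀ d j, j + d = J → m + 1 ≤ j → ∀ u ∈ vanishing v' j, ExpDecaySeq a lam u := by
    intro d
    induction d with
    | zero => rintro j hj - u hu; rw [add_zero] at hj; exact hexp u (hj ▸ hu)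
    | succ d ih =>
      intro j hj hmj
      refine expDecaySeq_descend hv' (by omega) (lt_of_le_of_lt ?_ hl1)
        (ih (j + 1) (by omega) (by omega))
      exact one_div_le_one_div_of_le (by positivity) (pow_le_pow_right₀ (by norm_num) hmj)
  exact hdesc (J - (m + 1)) (m + 1) (by omega) le_rfl u
    (vanishing_subset_of_eqMod (eqMod_symm_smul hκ hE) le_rfl hu)

/-! ### Convergence of the data and decay -/

/-- Convergence of extended suprema to `0`, in terms of real bounds. -/
lemma tendsto_biSup_enorm_iff {ι E : Type*} [NormedAddCommGroup E] {p : ℕ → ι → Prop}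
    {f : ℕ → ι → E} : Tendsto (fun n : ℕ => ⨆ (k : ι) (_ : p n k), ‖f n k‖ₑ) atTop (𝓝 0) ↔
      ∀ ε > 0, ∀ᶠ n : ℕ in atTop, ∀ k, p n k → ‖f n k‖ ≤ ε := by
  rw [ENNReal.tendsto_nhds_zero]
  constructor
  · intro h ε hε
    filter_upwards [h (ENNReal.ofReal ε) (ENNReal.ofReal_pos.mpr hε)] with n hn k hk
    rw [← enorm_le_ofReal_iff hε.le]
    exact (le_iSup₂_of_le k hk le_rfl).trans hn
  · intro h ε hε
    rcases eq_or_ne ε ⊤ with rfl | hε'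
    · exact Eventually.of_forall fun n => le_top
    · filter_upwards [h ε.toReal (ENNReal.toReal_pos hε.ne' hε')] with n hn
      refine iSup₂_le fun k hk => ?_
      rw [← ENNReal.ofReal_toReal hε', enorm_le_ofReal_iff ENNReal.toReal_nonneg]
      exact hn k hk

lemma tendsto_iSup_enorm_iff {ι E : Type*} [NormedAddCommGroup E]
    {f : ℕ → ι → E} : Tendsto (fun n : ℕ => ⨆ k : ι, ‖f n k‖ₑ) atTop (𝓝 0) ↔
      ∀ ε > 0, ∀ᶠ n : ℕ in atTop, ∀ k, ‖f n k‖ ≤ ε := by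
  have := tendsto_biSup_enorm_iff (p := fun _ _ => True) (f := f)
  simpa using this

lemma basisDataConverges_iff {a : ℤ →₀ Matrix (Fin r) (Fin r) ℂ} {v u : ℤ →₀ (Fin r → ℂ)} {j : ℕ}
    {g : ℝ → (Fin r → ℂ)} : BasisDataConverges a v u j g ↔ ∀ ε > 0, ∀ᶠ n : ℕ in atTop, ∀ k : ℤ,
      ‖(2 : ℂ) ^ (j * n) • W a n u k - beta v u j • iteratedDeriv j g ((k : ℝ) / 2 ^ n)‖ ≤ ε := by
  rw [BasisDataConverges, tendsto_iSup_enorm_iff]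
  simp only [conv_deltaId]

lemma ld_le (m : ℕ) (f : ℝ → ℂ) : ld m f ≤ m := Nat.sInf_le (.inl rfl)

lemma mem_vanishing_ld (v u : ℤ →₀ (Fin r → ℂ)) (m : ℕ) : u ∈ vanishing v (ld m (rowCol v u)) := by
  intro j hj
  by_contra h
  exact Nat.notMem_of_lt_sInf hj (.inr (by simpa using h))

lemma ld_eq_of_mem_vanishing {v u : ℤ →₀ (Fin r → ℂ)} {m : ℕ} (hu : u ∈ vanishing v m) :
    ld m (rowCol v u) = m := by
  refine le_antisymm (ld_le _ _) (le_csInf ⟨m, .inl rfl⟩ fun j hj => ?_)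
  by_contra! hjm
  rcases hj with rfl | hj
  · exact lt_irrefl _ hjm
  · exact hj (by simpa using hu j hjm)

lemma beta_eq (v u : ℤ →₀ (Fin r → ℂ)) (j : ℕ) :
    beta v u j = PowerSeries.coeff j (rc v u) / Complex.I ^ j := by
  rw [rc, ← jet_rowCol, coeff_jet, beta, div_div, mul_comm]

lemma beta_add (v u w : ℤ →₀ (Fin r → ℂ)) (j : ℕ) :
    beta v (u + w) j = beta v u j + beta v w j := by
  simp only [beta_eq, rc_add, map_add, add_div]

lemma beta_smul (v : ℤ →₀ (Fin r → ℂ)) (c : ℂ) (u : ℤ →₀ (Fin r → ℂ)) (j : ℕ) :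
    beta v (c • u) j = c * beta v u j := by
  simp only [beta_eq, rc_smul, PowerSeries.coeff_C_mul, mul_div_assoc]

lemma beta_eq_zero {v u : ℤ →₀ (Fin r → ℂ)} {j : ℕ} (hu : u ∈ vanishing v (j + 1)) :
    beta v u j = 0 := by
  rw [beta_eq, show PowerSeries.coeff j (rc v u) = 0 from
    PowerSeries.X_pow_dvd_iff.mp (mem_vanishing_iff.mp hu) j (Nat.lt_succ_self j), zero_div]

lemma rc_shift (v : ℤ →₀ (Fin r → ℂ)) (l : ℤ) (u : ℤ →₀ (Fin r → ℂ)) :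
    rc v (shift l u) = jet (ek l) * rc v u := by
  rw [rc, rc, dotProduct, dotProduct, Finset.mul_sum]
  refine Finset.sum_congr rfl fun i _ => ?_
  have : vjet (symbol (shift l u)) i = jet (ek l) * vjet (symbol u) i := by
    rw [vjet, vjet, ← jet_mul (contDiff_ek l) (contDiff_pi.mp (contDiff_symbol u) i)]
    exact congrArg jet (funext fun ξ => by rw [symbol_shift]; rfl)
  rw [this]; ring

lemma shift_mem_vanishing {v u : ℤ →₀ (Fin r → ℂ)} {m : ℕ} (l : ℤ) (hu : u ∈ vanishing v m) :
    shift l u ∈ vanishing v m := by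
  rw [mem_vanishing_iff] at hu ⊢
  have := rc_shift v l u
  rw [rc] at this
  rw [this]
  exact hu.mul_left _

lemma beta_shift {v u : ℤ →₀ (Fin r → ℂ)} {m : ℕ} (l : ℤ) (hu : u ∈ vanishing v m) :
    beta v (shift l u) m = beta v u m := by
  rw [beta_eq, beta_eq, rc_shift, coeff_mul_of_X_pow_dvd (q := rc v u) (mem_vanishing_iff.mp hu) le_rfl,
    ← PowerSeries.coeff_zero_eq_constantCoeff_apply, coeff_zero_jet, ek_zero_right, one_mul]

lemma W_shift (a : ℤ →₀ Matrix (Fin r) (Fin r) ℂ) (n : ℕ) (l : ℤ) (u : ℤ →₀ (Fin r → ℂ)) (k : ℤ) :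
    W a n (shift l u) k = W a n u (k - l) := by
  rw [← conv_deltaId, ← conv_deltaId, conv_eq_finsum, conv_eq_finsum]
  refine finsum_congr fun j => ?_
  rw [shift_apply]; congr 2; ring

/-- The data generated from `u` approximate a multiple of `h`, locally uniformly. -/
def Approximates (a : ℤ →₀ Matrix (Fin r) (Fin r) ℂ) (v : ℤ →₀ (Fin r → ℂ)) (m : ℕ)
    (h : ℝ → (Fin r → ℂ)) (u : ℤ →₀ (Fin r → ℂ)) : Prop :=
  ∀ K > (0 : ℝ), ∀ ε > 0, ∀ᶠ n : ℕ in atTop, ∀ k : ℤ, |(k : ℝ)| ≤ 2 ^ n * K →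
    ‖(2 : ℂ) ^ (m * n) • W a n u k - beta v u m • h ((k : ℝ) / 2 ^ n)‖ ≤ ε

lemma Approximates.add {a : ℤ →₀ Matrix (Fin r) (Fin r) ℂ} {v : ℤ →₀ (Fin r → ℂ)} {m : ℕ}
    {h : ℝ → (Fin r → ℂ)} {u w : ℤ →₀ (Fin r → ℂ)} (hu : Approximates a v m h u)
    (hw : Approximates a v m h w) : Approximates a v m h (u + w) := by
  intro K hK ε hε
  filter_upwards [hu K hK (ε / 2) (by positivity), hw K hK (ε / 2) (by positivity)] with n h1 h2 k hk
  rw [map_add, Finsupp.add_apply, beta_add, smul_add, add_smul, add_sub_add_comm]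
  exact (norm_add_le _ _).trans (by linarith [h1 k hk, h2 k hk])

lemma Approximates.smul {a : ℤ →₀ Matrix (Fin r) (Fin r) ℂ} {v : ℤ →₀ (Fin r → ℂ)} {m : ℕ}
    {h : ℝ → (Fin r → ℂ)} {u : ℤ →₀ (Fin r → ℂ)} (c : ℂ) (hu : Approximates a v m h u) :
    Approximates a v m h (c • u) := by
  intro K hK ε hε
  filter_upwards [hu K hK (ε / (‖c‖ + 1)) (by positivity)] with n h1 k hk
  rw [map_smul, Finsupp.smul_apply, beta_smul, smul_comm, mul_smul, ← smul_sub, norm_smul]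
  calc _ ≤ ‖c‖ * (ε / (‖c‖ + 1)) := by gcongr; exact h1 k hk
    _ = ε * (‖c‖ / (‖c‖ + 1)) := by ring
    _ ≤ ε * 1 := by
      gcongr
      exact div_le_one_of_le₀ (by linarith [norm_nonneg c]) (by positivity)
    _ = ε := mul_one _

/-- A shift of `u` moves the sampling points by `2^{-n} l`, which is harmless because `h` is
uniformly continuous on compact sets, and leaves the lowest moment `β_m` unchanged. -/
lemma Approximates.shift {a : ℤ →₀ Matrix (Fin r) (Fin r) ℂ} {v : ℤ →₀ (Fin r → ℂ)} {m : ℕ}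
    {h : ℝ → (Fin r → ℂ)} (hh : Continuous h) {u : ℤ →₀ (Fin r → ℂ)} (hm : u ∈ vanishing v m)
    (l : ℤ) (hu : Approximates a v m h u) : Approximates a v m h (shift l u) := by
  intro K hK ε hε
  set β := beta v u m
  set K' : ℝ := K + |(l : ℝ)| with hK'
  have hK'0 : 0 < K' := by positivity
  have huc := isCompact_Icc.uniformContinuousOn_of_continuous (s := Set.Icc (-K') K')
    hh.continuousOn
  obtain ⟨δ, hδ, hδ'⟩ := Metric.uniformContinuousOn_iff.mp huc (ε / 2 / (‖β‖ + 1)) (by positivity)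
  have hlim : Tendsto (fun n : ℕ => |(l : ℝ)| / 2 ^ n) atTop (𝓝 0) :=
    tendsto_const_nhds.div_atTop (tendsto_pow_atTop_atTop_of_one_lt (by norm_num))
  filter_upwards [hu K' hK'0 (ε / 2) (by positivity), hlim.eventually (gt_mem_nhds hδ)]
    with n h1 h2 k hk
  have h2n : (1 : ℝ) ≤ 2 ^ n := one_le_pow₀ (by norm_num)
  have hkl : |((k - l : ℤ) : ℝ)| ≤ 2 ^ n * K' := by
    push_cast
    refine (abs_sub _ _).trans ?_
    rw [hK', mul_add]
    nlinarith [abs_nonneg (l : ℝ)]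
  have hmem : ∀ j : ℤ, |(j : ℝ)| ≤ 2 ^ n * K' → (j : ℝ) / 2 ^ n ∈ Set.Icc (-K') K' := by
    intro j hj
    rw [Set.mem_Icc, ← abs_le, abs_div, abs_of_pos (by positivity : (0 : ℝ) < 2 ^ n),
      div_le_iff₀ (by positivity), mul_comm]
    exact hj
  have h3 := h1 (k - l) hkl
  have hk' : |(k : ℝ)| ≤ 2 ^ n * K' := hk.trans (by
    rw [hK']; gcongr; linarith [abs_nonneg (l : ℝ)])
  have h4 := (hδ' _ (hmem _ hkl) _ (hmem k hk') (by
    rw [Real.dist_eq, ← sub_div, abs_div, abs_of_pos (by positivity : (0 : ℝ) < 2 ^ n)]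
    push_cast
    rw [sub_sub_cancel_left, abs_neg]; exact h2)).le
  rw [W_shift, beta_shift l hm]
  have e : (2 : ℂ) ^ (m * n) • W a n u (k - l) - β • h (k / 2 ^ n)
      = ((2 : ℂ) ^ (m * n) • W a n u (k - l) - β • h (((k - l : ℤ) : ℝ) / 2 ^ n))
        + β • (h (((k - l : ℤ) : ℝ) / 2 ^ n) - h (k / 2 ^ n)) := by
    rw [smul_sub]; abel
  rw [e]
  rw [dist_eq_norm] at h4
  calc _ ≤ ε / 2 + ‖β‖ * (ε / 2 / (‖β‖ + 1)) := by
        refine (norm_add_le _ _).trans (add_le_add h3 ?_)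
        rw [norm_smul]; gcongr
    _ = ε / 2 + ε / 2 * (‖β‖ / (‖β‖ + 1)) := by ring
    _ ≤ ε / 2 + ε / 2 * 1 := by
        gcongr
        exact div_le_one_of_le₀ (by linarith [norm_nonneg β]) (by positivity)
    _ = ε := by ring

/-- If the data generated from a set `B` whose shifts span all sequences with vanishing moments
approximate multiples of one continuous function, then the scheme decays on the latter. -/
lemma decay_of_approximates {a : ℤ →₀ Matrix (Fin r) (Fin r) ℂ} {v : ℤ →₀ (Fin r → ℂ)} {m : ℕ}
    {B : Set (ℤ →₀ (Fin r → ℂ))} (hB : B ⊆ vanishing v m)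
    (hspan : vanishing v (m + 1) ⊆
      (Submodule.span ℂ {w : ℤ →₀ (Fin r → ℂ) | ∃ u ∈ B, ∃ k : ℤ, ∀ j, w j = u (j - k)} :
        Set (ℤ →₀ (Fin r → ℂ))))
    {h : ℝ → (Fin r → ℂ)} (hh : Continuous h) (hBh : ∀ u ∈ B, Approximates a v m h u) :
    ∀ u ∈ vanishing v (m + 1), DecaySeq a m u := by
  intro u hu
  have key : u ∈ vanishingSub v m ∧ Approximates a v m h u := by
    refine Submodule.span_induction (p := fun u _ => u ∈ vanishingSub v m ∧ Approximates a v m h u)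
      ?_ ?_ ?_ ?_ (hspan hu)
    · rintro w ⟨u, hu, l, hw⟩
      have : w = VectorSubdivision.shift l u := Finsupp.ext fun j => by rw [hw, shift_apply]
      rw [this]
      exact ⟨shift_mem_vanishing l (hB hu), (hBh u hu).shift hh (hB hu) l⟩
    · refine ⟨Submodule.zero_mem _, fun K _ ε hε => Eventually.of_forall fun n k _ => ?_⟩
      have : beta v 0 m = 0 := by simpa using beta_smul v 0 0 m
      rw [map_zero, this]; simpa using hε.le
    · exact fun x y _ _ hx hy => ⟨Submodule.add_mem _ hx.1 hy.1, hx.2.add hy.2⟩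
    · exact fun c x _ hx => ⟨Submodule.smul_mem _ c hx.1, hx.2.smul c⟩
  -- the data at level `n` are supported in `[-2^n L, 2^n L]`, so convergence on compact sets is
  -- global
  obtain ⟨L, hL, hsupp⟩ := exists_suppIn_W a u
  intro ε hε
  filter_upwards [key.2 L (by positivity) ε hε] with n hn k
  by_cases hk : W a n u k = 0
  · rw [hk]; simpa using hε.le
  · have h1 := hn k (by
      have := hsupp n k hk
      exact_mod_cast this)
    rw [beta_eq_zero hu, zero_smul, sub_zero, norm_smul, norm_pow, Complex.norm_ofNat] at h1
    exact h1

/-- The row sequence `δ eᵢᵀ`. -/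
def deltaRow (i : Fin r) : ℤ → Matrix (Fin 1) (Fin r) ℂ :=
  fun k => if k = 0 then Matrix.of fun _ j => if j = i then 1 else 0 else 0

lemma conv_deltaRow (a : ℤ →₀ Matrix (Fin r) (Fin r) ℂ) (n : ℕ) (u : ℤ →₀ (Fin r → ℂ)) (k : ℤ)
    (i : Fin r) : conv ((sd a)^[n] (deltaRow i)) u k 0 = W a n u k i := by
  rw [conv_sd_iterate, finsum_eq_single _ 0]
  · simp [deltaRow, Matrix.mulVec, dotProduct]
  · intro l hl
    simp [deltaRow, hl]

/-- Starting the scheme from the rows `δ eᵢᵀ` gives the `r` components of the data of `δ I_r`. -/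
lemma decay_of_dataConverges {a : ℤ →₀ Matrix (Fin r) (Fin r) ℂ} {v : ℤ →₀ (Fin r → ℂ)} {m : ℕ}
    {B : Set (ℤ →₀ (Fin r → ℂ))} (hB : B ⊆ vanishing v m)
    (hspan : vanishing v (m + 1) ⊆
      (Submodule.span ℂ {w : ℤ →₀ (Fin r → ℂ) | ∃ u ∈ B, ∃ k : ℤ, ∀ j, w j = u (j - k)} :
        Set (ℤ →₀ (Fin r → ℂ))))
    (h : ∀ w₀ : ℤ → Matrix (Fin 1) (Fin r) ℂ, ∃ η : ℝ → ℂ, ContDiff ℝ m η ∧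
          ∀ u ∈ B, DataConverges a v m w₀ u η) :
    ∀ u ∈ vanishing v (m + 1), DecaySeq a m u := by
  choose η hη hd using fun i : Fin r => h (deltaRow i)
  refine decay_of_approximates hB hspan (h := fun x i => iteratedDeriv m (η i) x)
    (continuous_pi fun i => (hη i).continuous_iteratedDeriv m le_rfl) fun u hu K hK ε hε => ?_
  have h1 : ∀ᶠ n : ℕ in atTop, ∀ i ∈ (Finset.univ : Finset (Fin r)), ∀ k : ℤ,
      |(k : ℝ)| ≤ 2 ^ n * K → ‖W a n u k i * 2 ^ (m * n)
        - beta v u m * iteratedDeriv m (η i) ((k : ℝ) / 2 ^ n)‖ ≤ ε := by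
    refine (Filter.eventually_all_finset _).mpr fun i _ => ?_
    have h2 := hd i u hu K hK
    rw [ld_eq_of_mem_vanishing (hB hu)] at h2
    simp only [conv_deltaRow] at h2
    exact tendsto_biSup_enorm_iff.mp h2 ε hε
  filter_upwards [h1] with n hn k hk
  rw [pi_norm_le_iff_of_nonneg hε.le]
  intro i
  have := hn i (Finset.mem_univ i) k hk
  rwa [mul_comm] at this

/-- If every `β_m(u)` vanishes, the limit function does not enter the data, and `0` serves as
well. -/
lemma decay_of_basisDataConverges {a : ℤ →₀ Matrix (Fin r) (Fin r) ℂ} {v : ℤ →₀ (Fin r → ℂ)}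
    {m : ℕ} {B : Set (ℤ →₀ (Fin r → ℂ))} (hB : B ⊆ vanishing v m)
    (hspan : vanishing v (m + 1) ⊆
      (Submodule.span ℂ {w : ℤ →₀ (Fin r → ℂ) | ∃ u ∈ B, ∃ k : ℤ, ∀ j, w j = u (j - k)} :
        Set (ℤ →₀ (Fin r → ℂ)))) {g : ℝ → (Fin r → ℂ)}
    (hg : (∃ u ∈ B, iteratedDeriv m (rowCol v u) 0 ≠ 0) → ContDiff ℝ m g)
    (h : ∀ u ∈ B, BasisDataConverges a v u m g) :
    ∀ u ∈ vanishing v (m + 1), DecaySeq a m u := by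
  by_cases hc : ∃ u ∈ B, iteratedDeriv m (rowCol v u) 0 ≠ 0
  · refine decay_of_approximates hB hspan ((hg hc).continuous_iteratedDeriv m le_rfl)
      fun u hu K _ ε hε => ?_
    filter_upwards [basisDataConverges_iff.mp (h u hu) ε hε] with n hn k _
    exact hn k
  · push Not at hc
    refine decay_of_approximates hB hspan (h := 0) continuous_const fun u hu K _ ε hε => ?_
    filter_upwards [basisDataConverges_iff.mp (h u hu) ε hε] with n hn k _
    have h1 := hn k
    have h2 : beta v u m = 0 := by rw [beta, hc u hu, zero_div]
    rw [h2, zero_smul] at h1 ⊢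
    exact h1

/-! ### From the basis data to arbitrary data -/

lemma exists_support_bound {E : Type*} [NormedAddCommGroup E] {g : ℝ → E}
    (hg : HasCompactSupport g) : ∃ R : ℕ, ∀ x, g x ≠ 0 → |x| ≤ R := by
  obtain ⟨R, hR⟩ := hg.isCompact.isBounded.subset_closedBall 0
  refine ⟨⌈R⌉₊, fun x hx => ?_⟩
  have := hR (subset_tsupport g hx)
  rw [Metric.mem_closedBall, Real.dist_eq, sub_zero] at this
  exact this.trans (Nat.le_ceil R)

lemma finsum_eq_Icc_sum {E : Type*} [AddCommMonoid E] {f : ℤ → E} {M : ℕ}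
    (h : ∀ l : ℤ, f l ≠ 0 → |l| ≤ M) : ∑ᶠ l, f l = ∑ l ∈ Finset.Icc (-(M : ℤ)) M, f l := by
  refine finsum_eq_sum_of_support_subset _ fun l hl => ?_
  rw [Finset.mem_coe, Finset.mem_Icc, ← abs_le]
  exact h l hl

lemma iteratedDeriv_rowMul {m : ℕ} {g : ℝ → (Fin r → ℂ)} (hg : ContDiff ℝ m g) (w : Matrix (Fin 1) (Fin r) ℂ)
    (l : ℝ) (x : ℝ) : iteratedDeriv m (fun x => (w *ᵥ g (x - l)) 0) x
      = (w *ᵥ iteratedDeriv m g (x - l)) 0 := by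
  have hgi : ∀ i, ContDiff ℝ m fun x => g (x - l) i := fun i =>
    (contDiff_pi.mp hg i).comp (contDiff_id.sub contDiff_const)
  have hfun : (fun x => (w *ᵥ g (x - l)) 0) = fun x => ∑ i, w 0 i * g (x - l) i := rfl
  rw [hfun, iteratedDeriv_fun_sum fun i _ => (contDiff_const.mul (hgi i)).contDiffAt]
  refine Finset.sum_congr rfl fun i _ => ?_
  rw [iteratedDeriv_const_mul _ (hgi i).contDiffAt, iteratedDeriv_apply hg]
  have := congrFun (iteratedDeriv_comp_sub_const m (fun x => g x i) l) x
  rw [this]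

/-- The limit for the initial sequence `w₀` is `∑ₗ w₀(l) g(· - l)`. -/
lemma subdivisionConverges_of_basis {a : ℤ →₀ Matrix (Fin r) (Fin r) ℂ} {v : ℤ →₀ (Fin r → ℂ)}
    {m : ℕ} {g : ℝ → (Fin r → ℂ)} (hg : ContDiff ℝ m g) (hgs : HasCompactSupport g)
    (h : ∀ u, BasisDataConverges a v u (ld m (rowCol v u)) g) : SubdivisionConverges a v m := by
  intro w₀
  obtain ⟨R, hR⟩ := exists_support_bound hgs
  set η : ℝ → ℂ := fun x => ∑ᶠ l : ℤ, (w₀ l *ᵥ g (x - l)) 0 with hη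
  -- the sum defining `η` is locally finite
  have hηM : ∀ M : ℕ, ∀ x : ℝ, |x| + R ≤ M →
      η x = ∑ l ∈ Finset.Icc (-(M : ℤ)) M, (w₀ l *ᵥ g (x - l)) 0 := by
    intro M x hx
    refine finsum_eq_Icc_sum fun l hl => ?_
    have h1 : g (x - l) ≠ 0 := fun h => hl (by simp [h])
    have h2 := hR _ h1
    have h3 : |(l : ℝ)| ≤ M := by
      have := abs_sub_abs_le_abs_sub (l : ℝ) x
      rw [abs_sub_comm] at this
      linarith
    exact_mod_cast h3
  have hterm : ∀ l : ℤ, ContDiff ℝ m fun x : ℝ => (w₀ l *ᵥ g (x - l)) 0 := fun l => by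
    simp only [Matrix.mulVec, dotProduct]
    exact ContDiff.sum fun i _ => contDiff_const.mul
      ((contDiff_pi.mp hg i).comp (contDiff_id.sub contDiff_const))
  have hev : ∀ M : ℕ, ∀ x : ℝ, |x| + R < M →
      η =ᶠ[𝓝 x] fun x => ∑ l ∈ Finset.Icc (-(M : ℤ)) M, (w₀ l *ᵥ g (x - l)) 0 := by
    intro M x hx
    have : {y : ℝ | |y| + R < M} ∈ 𝓝 x :=
      (isOpen_lt (by fun_prop) continuous_const).mem_nhds hx
    filter_upwards [this] with y hy
    exact hηM M y (le_of_lt hy)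
  have hηd : ContDiff ℝ m η := by
    rw [contDiff_iff_contDiffAt]
    intro x
    obtain ⟨M, hM⟩ := exists_nat_gt (|x| + R)
    exact (ContDiff.sum fun l _ => hterm l).contDiffAt.congr_of_eventuallyEq (hev M x hM)
  have hηj : ∀ j ≤ m, ∀ M : ℕ, ∀ x : ℝ, |x| + R < M → iteratedDeriv j η x
      = ∑ l ∈ Finset.Icc (-(M : ℤ)) M, (w₀ l *ᵥ iteratedDeriv j g (x - l)) 0 := by
    intro j hj M x hx
    have hjm : (j : WithTop ℕ∞) ≤ m := by exact_mod_cast hj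
    rw [(hev M x hx).iteratedDeriv_eq, iteratedDeriv_fun_sum fun l _ => ((hterm l).of_le hjm).contDiffAt]
    exact Finset.sum_congr rfl fun l _ => iteratedDeriv_rowMul (hg.of_le hjm) _ _ _
  refine ⟨η, hηd, fun u K hK => ?_⟩
  rw [tendsto_biSup_enorm_iff]
  intro ε hε
  set j := ld m (rowCol v u)
  obtain ⟨L, hL, hsupp⟩ := exists_suppIn_W a u
  obtain ⟨M, hM⟩ := exists_nat_gt (K + R + L)
  set c : ℝ := ∑ l ∈ Finset.Icc (-(M : ℤ)) M, ∑ i, ‖w₀ l 0 i‖ with hc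
  have hc0 : 0 ≤ c := by positivity
  filter_upwards [basisDataConverges_iff.mp (h u) (ε / (c + 1)) (by positivity)] with n hn k hk
  have h2n : (0 : ℝ) < 2 ^ n := by positivity
  have hkn : |(k : ℝ) / 2 ^ n| ≤ K := by
    rw [abs_div, abs_of_pos h2n, div_le_iff₀ h2n, mul_comm]; exact hk
  have hconv : conv ((sd a)^[n] w₀) u k
      = ∑ l ∈ Finset.Icc (-(M : ℤ)) M, w₀ l *ᵥ W a n u (k - 2 ^ n * l) := by
    rw [conv_sd_iterate]
    refine finsum_eq_Icc_sum fun l hl => ?_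
    have h1 : W a n u (k - 2 ^ n * l) ≠ 0 := fun h => hl (by simp [h])
    have h2 := hsupp n _ h1
    have h3 : |(k : ℝ) - 2 ^ n * l| ≤ 2 ^ n * L := by exact_mod_cast h2
    have h4 : |2 ^ n * (l : ℝ)| ≤ 2 ^ n * (K + L) := by
      have := abs_sub_abs_le_abs_sub (2 ^ n * (l : ℝ)) k
      rw [abs_sub_comm] at this
      linarith
    rw [abs_mul, abs_of_pos h2n] at h4
    have h5 := le_of_mul_le_mul_left h4 h2n
    have h6 : |(l : ℝ)| ≤ M := by linarith [(Nat.cast_nonneg R : (0 : ℝ) ≤ R)]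
    exact_mod_cast h6
  rw [hconv, hηj j (ld_le _ _) M _ (by linarith [(Nat.cast_nonneg L : (0 : ℝ) ≤ L)]),
    Finset.sum_apply, Finset.sum_mul, Finset.mul_sum, ← Finset.sum_sub_distrib]
  calc _ ≤ ∑ l ∈ Finset.Icc (-(M : ℤ)) M, ∑ i, ‖w₀ l 0 i‖ * (ε / (c + 1)) := by
        refine norm_sum_le_of_le _ fun l _ => ?_
        simp only [Matrix.mulVec, dotProduct]
        rw [Finset.sum_mul, Finset.mul_sum, ← Finset.sum_sub_distrib]
        refine norm_sum_le_of_le _ fun i _ => ?_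
        have h1 := (norm_le_pi_norm _ i).trans (hn (k - 2 ^ n * l))
        have h2 : (((k - 2 ^ n * l : ℤ) : ℝ)) / 2 ^ n = (k : ℝ) / 2 ^ n - l := by
          push_cast; rw [sub_div, mul_div_cancel_left₀ _ h2n.ne']
        rw [h2] at h1
        have h3 : w₀ l 0 i * W a n u (k - 2 ^ n * l) i * 2 ^ (j * n)
            - beta v u j * (w₀ l 0 i * iteratedDeriv j g ((k : ℝ) / 2 ^ n - l) i)
            = w₀ l 0 i * ((2 : ℂ) ^ (j * n) • W a n u (k - 2 ^ n * l)
              - beta v u j • iteratedDeriv j g ((k : ℝ) / 2 ^ n - l)) i := by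
          simp only [Pi.sub_apply, Pi.smul_apply, smul_eq_mul]; ring
        rw [h3, norm_mul]
        gcongr
    _ = ε * (c / (c + 1)) := by
        simp only [← Finset.sum_mul]; rw [← hc]; ring
    _ ≤ ε * 1 := by
        gcongr
        exact div_le_one_of_le₀ (by linarith) (by positivity)
    _ = ε := mul_one _

/-! ### The Fourier transform of compactly supported functions -/

section ft

variable {E : Type*} [NormedAddCommGroup E] [NormedSpace ℂ E]

/-- The Fourier transform `∫ f(x) e^{-ixξ} dx` of a function with values in a complex normed
space. -/
def ft (f : ℝ → E) (ξ : ℝ) : E := ∫ x : ℝ, Complex.exp (-(Complex.I * (x : ℂ) * (ξ : ℂ))) • f x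

lemma fourierFun_eq_ft (f : ℝ → (Fin r → ℂ)) : fourierFun f = ft f := rfl

lemma ft_eq_fourier (f : ℝ → E) (ξ : ℝ) :
    ft f ξ = FourierTransform.fourier f ((2 * Real.pi)⁻¹ * ξ) := by
  rw [Real.fourier_eq', ft]
  refine MeasureTheory.integral_congr_ae (.of_forall fun x => ?_)
  simp only [RCLike.inner_apply, conj_trivial]
  congr 2
  push_cast
  have : (Real.pi : ℂ) ≠ 0 := by exact_mod_cast Real.pi_ne_zero
  field_simp

lemma norm_expKernel (x ξ : ℝ) : ‖Complex.exp (-(Complex.I * (x : ℂ) * (ξ : ℂ)))‖ = 1 := by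
  rw [Complex.norm_exp]; simp

lemma continuous_expKernel (ξ : ℝ) :
    Continuous fun x : ℝ => Complex.exp (-(Complex.I * (x : ℂ) * (ξ : ℂ))) := by fun_prop

lemma integrable_expKernel_smul {f : ℝ → E} (hf : Continuous f) (hs : HasCompactSupport f) (ξ : ℝ) :
    MeasureTheory.Integrable fun x : ℝ => Complex.exp (-(Complex.I * (x : ℂ) * (ξ : ℂ))) • f x :=
  ((continuous_expKernel ξ).smul hf).integrable_of_hasCompactSupport hs.smul_left

lemma ft_add {f g : ℝ → E} (hf : Continuous f) (hfs : HasCompactSupport f) (hg : Continuous g)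
    (hgs : HasCompactSupport g) (ξ : ℝ) : ft (fun x => f x + g x) ξ = ft f ξ + ft g ξ := by
  simp only [ft, smul_add]
  exact MeasureTheory.integral_add (integrable_expKernel_smul hf hfs ξ)
    (integrable_expKernel_smul hg hgs ξ)

lemma ft_const_smul (c : ℂ) (f : ℝ → E) (ξ : ℝ) : ft (fun x => c • f x) ξ = c • ft f ξ := by
  rw [ft, ft, ← MeasureTheory.integral_smul]
  exact MeasureTheory.integral_congr_ae (.of_forall fun x => smul_comm _ _ _)

lemma ft_sum {ι : Type*} (s : Finset ι) {f : ι → ℝ → E} (hf : ∀ i ∈ s, Continuous (f i))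
    (hs : ∀ i ∈ s, HasCompactSupport (f i)) (ξ : ℝ) :
    ft (fun x => ∑ i ∈ s, f i x) ξ = ∑ i ∈ s, ft (f i) ξ := by
  simp only [ft, Finset.smul_sum]
  exact MeasureTheory.integral_finsetSum s fun i hi => integrable_expKernel_smul (hf i hi) (hs i hi) ξ

lemma ft_comp_sub (f : ℝ → E) (l ξ : ℝ) :
    ft (fun x => f (x - l)) ξ = Complex.exp (-(Complex.I * (l : ℂ) * (ξ : ℂ))) • ft f ξ := by
  rw [ft, ft, ← MeasureTheory.integral_smul]
  rw [← MeasureTheory.integral_add_right_eq_self _ l]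
  refine MeasureTheory.integral_congr_ae (.of_forall fun x => ?_)
  simp only [add_sub_cancel_right, smul_smul, ← Complex.exp_add]
  congr 2; push_cast; ring

lemma ft_comp_two_mul (f : ℝ → E) (ξ : ℝ) :
    (2 : ℂ) • ft (fun x => f (2 * x)) (2 * ξ) = ft f ξ := by
  have := MeasureTheory.Measure.integral_comp_mul_left
    (fun x : ℝ => Complex.exp (-(Complex.I * (x : ℂ) * (ξ : ℂ))) • f x) 2
  rw [ft, ft]
  have h2 : ∀ x : ℝ, Complex.exp (-(Complex.I * (x : ℂ) * ((2 * ξ : ℝ) : ℂ))) • f (2 * x)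
      = Complex.exp (-(Complex.I * ((2 * x : ℝ) : ℂ) * (ξ : ℂ))) • f (2 * x) := fun x => by
    congr 2; push_cast; ring
  simp only [h2, this]
  rw [← Complex.coe_smul, smul_smul]
  norm_num

lemma integrable_pow_smul {f : ℝ → E} (hf : Continuous f) (hs : HasCompactSupport f) (n : ℕ) :
    MeasureTheory.Integrable fun x : ℝ => x ^ n • f x :=
  ((continuous_pow n).smul hf).integrable_of_hasCompactSupport hs.smul_left

lemma tendsto_ft_cocompact (f : ℝ → E) : Tendsto (ft f) (cocompact ℝ) (𝓝 0) := by
  have h := Real.zero_at_infty_fourier f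
  have h2 : Tendsto (fun ξ : ℝ => (2 * Real.pi)⁻¹ * ξ) (cocompact ℝ) (cocompact ℝ) :=
    (Homeomorph.mulLeft₀ (2 * Real.pi)⁻¹ (by positivity)).isClosedEmbedding.tendsto_cocompact
  rw [funext (ft_eq_fourier f)]
  exact h.comp h2

lemma ft_deriv {f : ℝ → E} (hf : ContDiff ℝ 1 f) (hs : HasCompactSupport f) (ξ : ℝ) :
    ft (deriv f) ξ = (Complex.I * ξ) • ft f ξ := by
  have h := Real.fourier_deriv (hf.continuous.integrable_of_hasCompactSupport hs)
    (hf.differentiable one_ne_zero)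
    ((hf.continuous_deriv le_rfl).integrable_of_hasCompactSupport hs.deriv)
  rw [ft_eq_fourier, ft_eq_fourier, h]
  push_cast
  have : (Real.pi : ℂ) ≠ 0 := by exact_mod_cast Real.pi_ne_zero
  field_simp

lemma hasCompactSupport_iteratedDeriv {f : ℝ → E} (hs : HasCompactSupport f) (n : ℕ) :
    HasCompactSupport (iteratedDeriv n f) := by
  induction n with
  | zero => simpa using hs
  | succ n ih => rw [iteratedDeriv_succ]; exact ih.deriv

lemma ft_iteratedDeriv {f : ℝ → E} {n : ℕ} (hf : ContDiff ℝ n f) (hs : HasCompactSupport f)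
    (ξ : ℝ) : ft (iteratedDeriv n f) ξ = (Complex.I * ξ) ^ n • ft f ξ := by
  induction n with
  | zero => simp
  | succ n ih =>
    rw [iteratedDeriv_succ, ft_deriv ?_ (hasCompactSupport_iteratedDeriv hs n),
      ih (hf.of_le (by exact_mod_cast n.le_succ)), smul_smul, pow_succ']
    rw [iteratedDeriv_eq_iterate]
    exact ContDiff.iterate_deriv' 1 n (by rwa [add_comm])

lemma contDiff_ft {f : ℝ → E} (hf : Continuous f) (hs : HasCompactSupport f) :
    ContDiff ℝ ∞ (ft f) := by
  have h : ContDiff ℝ ∞ (FourierTransform.fourier f : ℝ → E) :=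
    Real.contDiff_fourier (N := ⊤) fun n _ => by
      simpa [norm_smul] using (integrable_pow_smul hf hs n).norm
  rw [funext (ft_eq_fourier f)]
  exact h.comp (contDiff_const.mul contDiff_id)

lemma iteratedDeriv_ft {f : ℝ → E} (hf : Continuous f) (hs : HasCompactSupport f) (n : ℕ) :
    iteratedDeriv n (ft f) = ft fun x : ℝ => (-(Complex.I * x)) ^ n • f x := by
  have hi : ∀ k : ℕ, (k : ℕ∞) ≤ ⊤ → MeasureTheory.Integrable fun x : ℝ => x ^ k • f x :=
    fun k _ => integrable_pow_smul hf hs k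
  have h : ContDiff ℝ n (FourierTransform.fourier f : ℝ → E) :=
    (Real.contDiff_fourier (N := ⊤) fun n _ => by
      simpa [norm_smul] using (integrable_pow_smul hf hs n).norm).of_le (by exact_mod_cast le_top)
  have h1 := iteratedDeriv_comp_const_smul h (2 * Real.pi)⁻¹
  funext ξ
  rw [funext (ft_eq_fourier f)]
  refine (congrFun h1 ξ).trans ?_
  rw [Real.iteratedDeriv_fourier hi le_top, ft_eq_fourier, Real.fourier_eq', Real.fourier_eq',
    ← Complex.coe_smul, ← MeasureTheory.integral_smul]
  refine MeasureTheory.integral_congr_ae (.of_forall fun x => ?_)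
  simp only [smul_smul]
  congr 1
  rw [mul_left_comm]
  congr 1
  rw [Complex.ofReal_pow, ← mul_pow]
  congr 1
  push_cast
  have : (Real.pi : ℂ) ≠ 0 := by exact_mod_cast Real.pi_ne_zero
  field_simp

/-- The Fourier transform of a `C^m` function and all its derivatives decay faster than
`|ξ|^{-m}`. -/
lemma tendsto_pow_smul_iteratedDeriv_ft {f : ℝ → E} {m : ℕ} (hf : ContDiff ℝ m f)
    (hs : HasCompactSupport f) (n : ℕ) :
    Tendsto (fun ξ : ℝ => (ξ : ℂ) ^ m • iteratedDeriv n (ft f) ξ) (cocompact ℝ) (𝓝 0) := by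
  rw [iteratedDeriv_ft hf.continuous hs]
  set g : ℝ → E := fun x => (-(Complex.I * x)) ^ n • f x with hg
  have hgd : ContDiff ℝ m g :=
    ((contDiff_const.mul (Complex.ofRealCLM.contDiff)).neg.pow n).smul hf
  have hgs : HasCompactSupport g := hs.smul_left
  have h := tendsto_ft_cocompact (iteratedDeriv m g)
  rw [funext (ft_iteratedDeriv hgd hgs)] at h
  have h2 := h.const_smul ((Complex.I)⁻¹ ^ m)
  rw [smul_zero] at h2
  refine h2.congr fun ξ => ?_
  rw [smul_smul, ← mul_pow, inv_mul_cancel_left₀ Complex.I_ne_zero]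

end ft

lemma continuous_coord {f : ℝ → (Fin r → ℂ)} (hf : Continuous f) (i : Fin r) :
    Continuous fun x => f x i := (continuous_apply i).comp hf

lemma hasCompactSupport_coord {f : ℝ → (Fin r → ℂ)} (hs : HasCompactSupport f) (i : Fin r) :
    HasCompactSupport fun x => f x i := hs.comp_left (g := fun c : Fin r → ℂ => c i) rfl

lemma ft_apply {f : ℝ → (Fin r → ℂ)} (hf : Continuous f) (hs : HasCompactSupport f) (ξ : ℝ)
    (i : Fin r) : ft f ξ i = ft (fun x => f x i) ξ := by
  rw [ft, MeasureTheory.eval_integral]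
  · rfl
  · exact fun i => integrable_expKernel_smul (continuous_coord hf i) (hasCompactSupport_coord hs i) ξ

lemma contDiff_ft_comp_add {E : Type*} [NormedAddCommGroup E] [NormedSpace ℂ E] {f : ℝ → E}
    (hf : Continuous f) (hs : HasCompactSupport f) (θ : ℝ) : ContDiff ℝ ∞ fun ξ => ft f (ξ + θ) :=
  (contDiff_ft hf hs).comp (contDiff_id.add contDiff_const)

/-! ### Poisson summation to finite order -/

/-- The Taylor series of `v̂(ξ) f̂(ξ + 2πk)` at the origin. -/
def rf (v : ℤ →₀ (Fin r → ℂ)) (f : ℝ → (Fin r → ℂ)) (k : ℤ) : PowerSeries ℂ :=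
  jet fun ξ => symbol v ξ ⬝ᵥ ft f (ξ + 2 * Real.pi * (k : ℝ))

lemma rf_eq {v : ℤ →₀ (Fin r → ℂ)} {f : ℝ → (Fin r → ℂ)} (hf : Continuous f)
    (hs : HasCompactSupport f) (k : ℤ) :
    rf v f k = vjet (symbol v) ⬝ᵥ vjet fun ξ => ft f (ξ + 2 * Real.pi * (k : ℝ)) :=
  jet_dotProduct (contDiff_symbol v) (contDiff_ft_comp_add hf hs _)

lemma dotProduct_ft_zero_eq_one {v : ℤ →₀ (Fin r → ℂ)} {f : ℝ → (Fin r → ℂ)} {m : ℕ}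
    (h : PowerSeries.X ^ (m + 1) ∣ rf v f 0 - 1) : symbol v 0 ⬝ᵥ ft f 0 = 1 := by
  have := PowerSeries.X_pow_dvd_iff.mp h 0 m.succ_pos
  rwa [map_sub, rf, coeff_zero_jet, Int.cast_zero, mul_zero, add_zero, PowerSeries.coeff_zero_one,
    sub_eq_zero] at this

lemma coeff_jet_ft {f : ℝ → ℂ} (hf : Continuous f) (hs : HasCompactSupport f) (θ : ℝ) (n : ℕ) :
    PowerSeries.coeff n (jet fun ξ => ft f (ξ + θ))
      = ft (fun x : ℝ => (-(Complex.I * x)) ^ n / (n.factorial : ℂ) * f x) θ := by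
  rw [coeff_jet, iteratedDeriv_comp_add_const]
  simp only [zero_add]
  rw [iteratedDeriv_ft hf hs, div_eq_inv_mul,
    ← smul_eq_mul, ← ft_const_smul]
  refine congrFun (congrArg ft (funext fun x => ?_)) θ
  simp only [smul_eq_mul]; ring

/-- The Taylor series of `ξ ↦ e^{-ixξ} v̂(ξ) f(x)`. -/
def pulse (v : ℤ →₀ (Fin r → ℂ)) (f : ℝ → (Fin r → ℂ)) (x : ℝ) : PowerSeries ℂ :=
  jet fun ξ => Complex.exp (-(Complex.I * (x : ℂ) * (ξ : ℂ))) * (symbol v ξ ⬝ᵥ f x)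

lemma contDiff_expKernel (x : ℝ) :
    ContDiff ℝ ∞ fun ξ : ℝ => Complex.exp (-(Complex.I * (x : ℂ) * (ξ : ℂ))) := by
  simpa [neg_mul] using contDiff_cexp_mul (-(Complex.I * (x : ℂ)))

lemma coeff_jet_expKernel (n : ℕ) (x : ℝ) :
    PowerSeries.coeff n (jet fun ξ : ℝ => Complex.exp (-(Complex.I * (x : ℂ) * (ξ : ℂ))))
      = (-(Complex.I * x)) ^ n / (n.factorial : ℂ) := by
  simpa [neg_mul] using coeff_jet_cexp n (-(Complex.I * (x : ℂ)))

lemma contDiff_symbol_dotProduct (v : ℤ →₀ (Fin r → ℂ)) (c : Fin r → ℂ) :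
    ContDiff ℝ ∞ fun ξ => symbol v ξ ⬝ᵥ c :=
  contDiff_dotProduct (contDiff_symbol v) contDiff_const

lemma coeff_pulse (v : ℤ →₀ (Fin r → ℂ)) (f : ℝ → (Fin r → ℂ)) (x : ℝ) (s : ℕ) :
    PowerSeries.coeff s (pulse v f x) = ∑ i, ∑ p ∈ Finset.HasAntidiagonal.antidiagonal s,
      PowerSeries.coeff p.1 (vjet (symbol v) i) *
        ((-(Complex.I * x)) ^ p.2 / (p.2.factorial : ℂ) * f x i) := by
  have h1 : pulse v f x = (∑ i, vjet (symbol v) i * PowerSeries.C (f x i)) *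
      jet fun ξ : ℝ => Complex.exp (-(Complex.I * (x : ℂ) * (ξ : ℂ))) := by
    rw [pulse, jet_mul (contDiff_expKernel x) (contDiff_symbol_dotProduct v _), mul_comm,
      jet_dotProduct (contDiff_symbol v) contDiff_const, dotProduct]
    simp only [vjet, jet_const]
  rw [h1, Finset.sum_mul, map_sum]
  refine Finset.sum_congr rfl fun i _ => ?_
  rw [mul_assoc, PowerSeries.coeff_mul]
  refine Finset.sum_congr rfl fun p _ => ?_
  rw [PowerSeries.coeff_C_mul, coeff_jet_expKernel, mul_comm (f x i)]

lemma continuous_coeff_pulse {v : ℤ →₀ (Fin r → ℂ)} {f : ℝ → (Fin r → ℂ)} (hf : Continuous f)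
    (s : ℕ) : Continuous fun x => PowerSeries.coeff s (pulse v f x) := by
  simp only [coeff_pulse]
  refine continuous_finsetSum _ fun i _ => continuous_finsetSum _ fun p _ => ?_
  have := continuous_coord hf i
  fun_prop

lemma pulse_eq_zero {v : ℤ →₀ (Fin r → ℂ)} {f : ℝ → (Fin r → ℂ)} {x : ℝ} (h : f x = 0) :
    pulse v f x = 0 := by simp [pulse, h, jet_zero]

lemma hasCompactSupport_coeff_pulse {v : ℤ →₀ (Fin r → ℂ)} {f : ℝ → (Fin r → ℂ)}
    (hs : HasCompactSupport f) (s : ℕ) :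
    HasCompactSupport fun x => PowerSeries.coeff s (pulse v f x) := by
  refine hs.mono fun x hx => ?_
  rw [Function.mem_support] at hx ⊢
  exact fun h => hx (by rw [pulse_eq_zero h, map_zero])

lemma ft_coeff_pulse {v : ℤ →₀ (Fin r → ℂ)} {f : ℝ → (Fin r → ℂ)} (hf : Continuous f)
    (hs : HasCompactSupport f) (s : ℕ) (k : ℤ) :
    ft (fun x => PowerSeries.coeff s (pulse v f x)) (2 * Real.pi * (k : ℝ))
      = PowerSeries.coeff s (rf v f k) := by
  have hc := continuous_coord hf
  have hcs : ∀ i (g : ℝ → ℂ), HasCompactSupport fun x => g x * f x i :=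
    fun i g => (hasCompactSupport_coord hs i).mul_left
  simp only [coeff_pulse]
  rw [ft_sum]
  · rw [rf_eq hf hs, dotProduct, map_sum]
    refine Finset.sum_congr rfl fun i _ => ?_
    rw [PowerSeries.coeff_mul, ft_sum]
    · refine Finset.sum_congr rfl fun p _ => ?_
      simp only [← smul_eq_mul (a := PowerSeries.coeff p.1 (vjet (symbol v) i))]
      rw [ft_const_smul, smul_eq_mul]
      congr 1
      rw [← coeff_jet_ft (hc i) (hasCompactSupport_coord hs i)]
      simp only [vjet, ft_apply hf hs]
    · intro p _; have := hc i; fun_prop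
    · intro p _; exact (hcs i _).mul_left
  · intro i _
    have := hc i
    fun_prop
  · intro i _
    simp only [← mul_assoc, ← Finset.sum_mul]
    exact hcs i _

lemma finite_support_translates {E : Type*} [NormedAddCommGroup E] {f : ℝ → E}
    (hs : HasCompactSupport f) (y : ℝ) : (Function.support fun j : ℤ => f (y + j)).Finite := by
  obtain ⟨R, hR⟩ := exists_support_bound hs
  refine (Set.finite_Icc (-⌈(R : ℝ) + |y|⌉) ⌈(R : ℝ) + |y|⌉).subset fun j hj => ?_
  have h1 := hR _ hj
  have h2 : |(j : ℝ)| ≤ R + |y| := by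
    have := abs_sub (y + j) y
    rw [add_sub_cancel_left] at this
    linarith
  rw [abs_le] at h2
  have h3 := Int.le_ceil ((R : ℝ) + |y|)
  constructor
  · have : (-⌈(R : ℝ) + |y|⌉ : ℝ) ≤ j := by linarith
    exact_mod_cast this
  · have : (j : ℝ) ≤ ⌈(R : ℝ) + |y|⌉ := by linarith
    exact_mod_cast this

/-- The samples `j ↦ f(y + j)` of a compactly supported function. -/
def sample (f : ℝ → (Fin r → ℂ)) (hs : HasCompactSupport f) (y : ℝ) : ℤ →₀ (Fin r → ℂ) :=
  Finsupp.ofSupportFinite (fun j : ℤ => f (y + j)) (finite_support_translates hs y)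

lemma sample_apply (f : ℝ → (Fin r → ℂ)) (hs : HasCompactSupport f) (y : ℝ) (j : ℤ) :
    sample f hs y j = f (y + j) := rfl

/-- Poisson summation for a function whose Fourier transform vanishes at the nonzero multiples of
`2π`: its periodization is constant. -/
lemma finsum_translates_eq {G : ℝ → ℂ} (hG : Continuous G) (hs : HasCompactSupport G)
    (h : ∀ k : ℤ, k ≠ 0 → ft G (2 * Real.pi * (k : ℝ)) = 0) (y : ℝ) :
    ∑ᶠ j : ℤ, G (y + j) = ft G 0 := by
  have hF : ∀ k : ℤ, (FourierTransform.fourier ((⟨G, hG⟩ : C(ℝ, ℂ)) : ℝ → ℂ) : ℝ → ℂ) (k : ℝ)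
      = ft G (2 * Real.pi * (k : ℝ)) := fun k => by
    rw [ft_eq_fourier, inv_mul_cancel_left₀ (by positivity)]; rfl
  have h0 : ∀ k : ℤ, k ≠ 0 → (FourierTransform.fourier ((⟨G, hG⟩ : C(ℝ, ℂ)) : ℝ → ℂ) : ℝ → ℂ) (k : ℝ) = 0 :=
    fun k hk => by rw [hF, h k hk]
  have hsum := Real.tsum_eq_tsum_fourier (f := ⟨G, hG⟩) ?_ ?_ y
  · rw [← tsum_eq_finsum (L := SummationFilter.unconditional ℤ)]
    · refine hsum.trans ?_
      rw [tsum_eq_single 0 fun k hk => by rw [h0 k hk, zero_mul], hF]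
      simp
    · exact finite_support_translates hs y
  · intro K
    obtain ⟨R, hR⟩ := exists_support_bound hs
    obtain ⟨R', hR'⟩ := K.isCompact.isBounded.subset_closedBall 0
    refine summable_of_hasFiniteSupport ((Set.finite_Icc (-⌈R + R'⌉) ⌈R + R'⌉).subset fun j hj => ?_)
    by_contra hj2
    refine hj ?_
    rw [norm_eq_zero]
    ext ⟨x, hx⟩
    change G (x + j) = 0
    by_contra hx2
    refine hj2 ?_
    have h1 := hR _ hx2
    have h2 := hR' hx
    rw [Metric.mem_closedBall, Real.dist_eq, sub_zero] at h2
    have h2 : |(j : ℝ)| ≤ R + R' := by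
      have := abs_sub (x + j) x
      rw [add_sub_cancel_left] at this
      linarith
    rw [abs_le] at h2
    have h3 := Int.le_ceil ((R : ℝ) + R')
    constructor
    · have : (-⌈(R : ℝ) + R'⌉ : ℝ) ≤ j := by linarith
      exact_mod_cast this
    · have : (j : ℝ) ≤ ⌈(R : ℝ) + R'⌉ := by linarith
      exact_mod_cast this
  · refine summable_of_hasFiniteSupport ((Set.finite_singleton (0 : ℤ)).subset fun k hk => ?_)
    by_contra hk2
    exact hk (h0 k hk2)

/-- The moments of the samples `f(y + j)` are sums of translates of the coefficients of `pulse`. -/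
lemma jet_mul_rc_sample (v : ℤ →₀ (Fin r → ℂ)) {f : ℝ → (Fin r → ℂ)} (hs : HasCompactSupport f)
    (y : ℝ) : jet (fun ξ : ℝ => Complex.exp (-(Complex.I * (y : ℂ) * (ξ : ℂ)))) *
      rc v (sample f hs y) = ∑ j ∈ (sample f hs y).support, pulse v f (y + j) := by
  rw [rc, ← jet_rowCol, ← jet_mul (contDiff_expKernel y) (contDiff_rowCol _ _)]
  simp only [pulse]
  rw [← jet_sum]
  · refine congrArg jet (funext fun ξ => ?_)
    rw [rowCol, symbol_eq_sum (sample f hs y), Finsupp.sum, dotProduct_sum, Finset.mul_sum]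
    refine Finset.sum_congr rfl fun j _ => ?_
    rw [dotProduct_smul, smul_eq_mul, ← mul_assoc, ek, ← Complex.exp_add, sample_apply]
    congr 2; push_cast; ring
  · exact fun j _ => (contDiff_expKernel _).mul (contDiff_symbol_dotProduct v _)

/-- Poisson summation to finite order: if `v̂(ξ) f̂(ξ + 2πk) = O(|ξ|^K)` for `k ≠ 0`, then
`v̂(ξ) ∑ⱼ f(y + j) e^{-i(y+j)ξ} = v̂(ξ) f̂(ξ) + O(|ξ|^K)`. -/
lemma X_pow_dvd_jet_mul_rc_sample_sub {v : ℤ →₀ (Fin r → ℂ)} {f : ℝ → (Fin r → ℂ)}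
    (hf : Continuous f) (hs : HasCompactSupport f) {K : ℕ}
    (h : ∀ k : ℤ, k ≠ 0 → PowerSeries.X ^ K ∣ rf v f k) (y : ℝ) :
    PowerSeries.X ^ K ∣ jet (fun ξ : ℝ => Complex.exp (-(Complex.I * (y : ℂ) * (ξ : ℂ)))) *
      rc v (sample f hs y) - rf v f 0 := by
  rw [PowerSeries.X_pow_dvd_iff]
  intro s hsK
  rw [map_sub, jet_mul_rc_sample, map_sum, sub_eq_zero, ← ft_coeff_pulse hf hs, Int.cast_zero, mul_zero,
    ← finsum_translates_eq (continuous_coeff_pulse hf s) (hasCompactSupport_coeff_pulse hs s) ?_ y]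
  · symm
    refine finsum_eq_sum_of_support_subset _ fun j hj => ?_
    rw [Finset.mem_coe, Finsupp.mem_support_iff, sample_apply]
    intro h0
    exact hj (by simp only [pulse_eq_zero h0, map_zero])
  · intro k hk
    rw [ft_coeff_pulse hf hs]
    exact PowerSeries.X_pow_dvd_iff.mp (h k hk) s hsK

/-- The samples of `f` have vanishing moments when the Poisson sum vanishes to order `K`. -/
lemma sample_mem_vanishing {v : ℤ →₀ (Fin r → ℂ)} {f : ℝ → (Fin r → ℂ)} (hf : Continuous f)
    (hs : HasCompactSupport f) {K : ℕ} (h : ∀ k : ℤ, PowerSeries.X ^ K ∣ rf v f k) (y : ℝ) :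
    sample f hs y ∈ vanishing v K := by
  rw [mem_vanishing_iff]
  have h1 := (X_pow_dvd_jet_mul_rc_sample_sub hf hs (fun k _ => h k) y).add (h 0) |>.mul_left
    (jet fun ξ : ℝ => Complex.exp (-(Complex.I * ((-y : ℝ) : ℂ) * (ξ : ℂ))))
  rw [sub_add_cancel, ← mul_assoc, ← jet_mul (contDiff_expKernel _) (contDiff_expKernel _)] at h1
  have h2 : (fun ξ : ℝ => Complex.exp (-(Complex.I * ((-y : ℝ) : ℂ) * (ξ : ℂ))) *
      Complex.exp (-(Complex.I * (y : ℂ) * (ξ : ℂ)))) = fun _ => 1 := by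
    funext ξ
    rw [← Complex.exp_add, ← Complex.exp_zero]; congr 1; push_cast; ring
  rwa [h2, jet_one, one_mul] at h1

/-! ### The refinement operator -/

section cascade

variable (a : ℤ →₀ Matrix (Fin r) (Fin r) ℂ)

lemma contDiff_mulVec_const {n : WithTop ℕ∞} (A : Matrix (Fin r) (Fin r) ℂ) {f : ℝ → (Fin r → ℂ)}
    (hf : ContDiff ℝ n f) : ContDiff ℝ n fun x => A *ᵥ f x :=
  contDiff_pi.mpr fun i => by
    simp only [Matrix.mulVec, dotProduct]
    exact ContDiff.sum fun j _ => contDiff_const.mul (contDiff_pi.mp hf j)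

lemma contDiff_comp_two_mul_sub {n : WithTop ℕ∞} {f : ℝ → (Fin r → ℂ)} (hf : ContDiff ℝ n f) (k : ℤ) :
    ContDiff ℝ n fun x : ℝ => f (2 * x - k) :=
  hf.comp ((contDiff_const.mul contDiff_id).sub contDiff_const)

lemma contDiff_cascade {n : WithTop ℕ∞} {f : ℝ → (Fin r → ℂ)} (hf : ContDiff ℝ n f) :
    ContDiff ℝ n (cascade a f) := by
  have h : ContDiff ℝ n fun x : ℝ => ∑ k ∈ a.support, a k *ᵥ f (2 * x - k) :=
    ContDiff.sum fun k _ => contDiff_mulVec_const _ (contDiff_comp_two_mul_sub hf k)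
  exact h.const_smul (2 : ℂ)

lemma contDiff_cascade_iterate {n : WithTop ℕ∞} {f : ℝ → (Fin r → ℂ)} (hf : ContDiff ℝ n f) (j : ℕ) :
    ContDiff ℝ n ((cascade a)^[j] f) := by
  induction j with
  | zero => exact hf
  | succ j ih => rw [Function.iterate_succ_apply']; exact contDiff_cascade a ih

lemma cascade_support {N : ℕ} (ha : SuppIn N a) {f : ℝ → (Fin r → ℂ)} {R : ℝ} (hR : N ≤ R)
    (hf : ∀ x, f x ≠ 0 → |x| ≤ R) (x : ℝ) (hx : cascade a f x ≠ 0) : |x| ≤ R := by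
  by_contra hx2
  refine hx ?_
  rw [cascade, Finsupp.sum, Finset.sum_eq_zero, smul_zero]
  intro k hk
  have h1 := ha k (Finsupp.mem_support_iff.mp hk)
  have h1 : |(k : ℝ)| ≤ N := by exact_mod_cast h1
  have h2 : f (2 * x - k) = 0 := by
    by_contra h
    have h3 := hf _ h
    have h4 := abs_sub_abs_le_abs_sub (2 * x) k
    rw [abs_mul, abs_two] at h4
    linarith
  rw [h2, Matrix.mulVec_zero]

lemma hasCompactSupport_of_bound {E : Type*} [NormedAddCommGroup E] {f : ℝ → E} {R : ℝ}
    (hf : ∀ x, f x ≠ 0 → |x| ≤ R) : HasCompactSupport f :=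
  HasCompactSupport.intro (isCompact_closedBall (0 : ℝ) R) fun x hx => by
    by_contra h
    exact hx (by rw [Metric.mem_closedBall, Real.dist_eq, sub_zero]; exact hf x h)

/-- All cascade iterates of a compactly supported function have support in a common interval. -/
lemma exists_cascade_iterate_support {f : ℝ → (Fin r → ℂ)} (hs : HasCompactSupport f) :
    ∃ R : ℝ, ∀ (n : ℕ) (x : ℝ), (cascade a)^[n] f x ≠ 0 → |x| ≤ R := by
  obtain ⟨N, hN⟩ := exists_suppIn a
  obtain ⟨R, hR⟩ := exists_support_bound hs
  refine ⟨max N R, fun n => ?_⟩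
  induction n with
  | zero => exact fun x hx => (hR x hx).trans (le_max_right _ _)
  | succ n ih =>
    rw [Function.iterate_succ_apply']
    exact cascade_support a hN (le_max_left _ _) ih

lemma hasCompactSupport_cascade_iterate {f : ℝ → (Fin r → ℂ)} (hs : HasCompactSupport f) (n : ℕ) :
    HasCompactSupport ((cascade a)^[n] f) := by
  obtain ⟨R, hR⟩ := exists_cascade_iterate_support a hs
  exact hasCompactSupport_of_bound (hR n)

lemma hasCompactSupport_cascade {f : ℝ → (Fin r → ℂ)} (hs : HasCompactSupport f) :
    HasCompactSupport (cascade a f) := hasCompactSupport_cascade_iterate a hs 1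

/-- Sampling turns the refinement operator into the transition operators. -/
lemma sample_cascade {f : ℝ → (Fin r → ℂ)} (hs : HasCompactSupport f) (y : ℝ) (γ : ℤ) :
    sample (cascade a f) (hasCompactSupport_cascade a hs) ((y + γ) / 2) = T a γ (sample f hs y) := by
  ext1 j
  rw [T_apply, sample_apply, cascade]
  congr 1
  refine Finsupp.sum_congr fun l _ => ?_
  rw [sample_apply]
  congr 2
  push_cast; ring

/-- The cascade iterates are obtained by subdividing the samples of the initial function. -/
lemma cascade_iterate_apply (n : ℕ) : ∀ {f : ℝ → (Fin r → ℂ)} (hs : HasCompactSupport f) (y : ℝ)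
    (k : ℤ), (cascade a)^[n] f ((y + k) / 2 ^ n) = W a n (sample f hs y) k := by
  induction n with
  | zero => intro f hs y k; simp [W_zero, sample_apply]
  | succ n ih =>
    intro f hs y k
    rw [Function.iterate_succ_apply]
    revert k
    refine int_parity (fun k => ?_) fun k => ?_
    · rw [W_succ_zero, ← sample_cascade a hs y 0, ← ih]
      refine congrArg _ ?_
      push_cast; rw [pow_succ]; field_simp; ring
    · rw [W_succ_one, ← sample_cascade a hs y 1, ← ih]
      refine congrArg _ ?_
      push_cast; rw [pow_succ]; field_simp; ring

lemma deriv_cascade {f : ℝ → (Fin r → ℂ)} (hf : ContDiff ℝ 1 f) :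
    deriv (cascade a f) = fun x => (2 : ℂ) • cascade a (deriv f) x := by
  funext x
  refine HasDerivAt.deriv ?_
  have hd : ∀ y, HasDerivAt f (deriv f y) y := fun y =>
    (hf.differentiable one_ne_zero y).hasDerivAt
  have h1 : ∀ k : ℤ, HasDerivAt (fun x : ℝ => f (2 * x - k)) ((2 : ℝ) • deriv f (2 * x - k)) x :=
    fun k => (hd _).scomp x (by simpa using ((hasDerivAt_id x).const_mul (2 : ℝ)).sub_const (k : ℝ))
  have h2 : ∀ (A : Matrix (Fin r) (Fin r) ℂ) (k : ℤ), HasDerivAt (fun x : ℝ => A *ᵥ f (2 * x - k))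
      (A *ᵥ ((2 : ℝ) • deriv f (2 * x - k))) x := fun A k => by
    rw [hasDerivAt_pi]
    intro i
    simp only [Matrix.mulVec, dotProduct]
    exact HasDerivAt.fun_sum fun j _ => ((hasDerivAt_pi.mp (h1 k)) j).const_mul _
  have h3 := (HasDerivAt.fun_sum (u := a.support) fun k _ => h2 (a k) k).const_smul (2 : ℂ)
  refine h3.congr_deriv ?_
  rw [cascade, Finsupp.sum]
  congr 1
  rw [Finset.smul_sum]
  refine Finset.sum_congr rfl fun k _ => ?_
  rw [← Complex.coe_smul, Matrix.mulVec_smul]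
  norm_num

lemma cascade_smul (c : ℂ) (f : ℝ → (Fin r → ℂ)) :
    cascade a (fun x => c • f x) = fun x => c • cascade a f x := by
  funext x
  simp only [cascade, Finsupp.sum, Matrix.mulVec_smul, ← Finset.smul_sum]
  rw [smul_comm]

lemma cascade_add (f g : ℝ → (Fin r → ℂ)) :
    cascade a (fun x => f x + g x) = fun x => cascade a f x + cascade a g x := by
  funext x
  simp only [cascade, Finsupp.sum, Matrix.mulVec_add, Finset.sum_add_distrib, smul_add]

lemma cascade_iterate_smul (n : ℕ) (c : ℂ) (f : ℝ → (Fin r → ℂ)) :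
    (cascade a)^[n] (fun x => c • f x) = fun x => c • (cascade a)^[n] f x := by
  induction n with
  | zero => rfl
  | succ n ih => simp only [Function.iterate_succ_apply', ih, cascade_smul]

lemma cascade_iterate_add (n : ℕ) (f g : ℝ → (Fin r → ℂ)) :
    (cascade a)^[n] (fun x => f x + g x)
      = fun x => (cascade a)^[n] f x + (cascade a)^[n] g x := by
  induction n with
  | zero => rfl
  | succ n ih => simp only [Function.iterate_succ_apply', ih, cascade_add]

lemma cascade_iterate_sub (n : ℕ) (f g : ℝ → (Fin r → ℂ)) :
    (cascade a)^[n] (fun x => f x - g x)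
      = fun x => (cascade a)^[n] f x - (cascade a)^[n] g x := by
  have h : (fun x => f x - g x) = fun x => f x + (-1 : ℂ) • g x := by
    funext x; rw [neg_one_smul, sub_eq_add_neg]
  rw [h, cascade_iterate_add, cascade_iterate_smul]
  funext x; simp only; rw [neg_one_smul, sub_eq_add_neg]

lemma iteratedDeriv_const_smul_fun {f : ℝ → (Fin r → ℂ)} {n : ℕ} (hf : ContDiff ℝ n f) (c : ℂ) :
    iteratedDeriv n (fun x => c • f x) = fun x => c • iteratedDeriv n f x :=
  funext fun _ => iteratedDeriv_fun_const_smul hf.contDiffAt c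

/-- Each refinement step doubles the frequency, hence the factor `2^j`. -/
lemma iteratedDeriv_cascade {f : ℝ → (Fin r → ℂ)} {j : ℕ} (hf : ContDiff ℝ j f) :
    iteratedDeriv j (cascade a f) = fun x => (2 : ℂ) ^ j • cascade a (iteratedDeriv j f) x := by
  induction j with
  | zero => simp
  | succ j ih =>
    have h1 : ContDiff ℝ 1 (iteratedDeriv j f) := by
      rw [iteratedDeriv_eq_iterate]
      exact ContDiff.iterate_deriv' 1 j (by rw [add_comm]; exact_mod_cast hf)
    rw [iteratedDeriv_succ, ih (hf.of_le (by exact_mod_cast j.le_succ)), iteratedDeriv_succ]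
    funext x
    rw [deriv_fun_const_smul _ ((contDiff_cascade a h1).differentiable one_ne_zero x),
      deriv_cascade a h1, smul_smul, pow_succ]

lemma iteratedDeriv_cascade_iterate {f : ℝ → (Fin r → ℂ)} {j : ℕ} (hf : ContDiff ℝ j f) (n : ℕ) :
    iteratedDeriv j ((cascade a)^[n] f)
      = fun x => (2 : ℂ) ^ (j * n) • (cascade a)^[n] (iteratedDeriv j f) x := by
  induction n with
  | zero => simp
  | succ n ih =>
    rw [Function.iterate_succ_apply', Function.iterate_succ_apply',
      iteratedDeriv_cascade a (contDiff_cascade_iterate a hf n), ih, cascade_smul]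
    funext x
    rw [smul_smul, ← pow_add]
    congr 2; ring

lemma ft_mulVec {f : ℝ → (Fin r → ℂ)} (hf : Continuous f) (hs : HasCompactSupport f)
    (A : Matrix (Fin r) (Fin r) ℂ) (ξ : ℝ) : ft (fun x => A *ᵥ f x) ξ = A *ᵥ ft f ξ := by
  have h := (LinearMap.toContinuousLinearMap A.mulVecLin).integral_comp_comm
    (integrable_expKernel_smul hf hs ξ)
  simp only [LinearMap.coe_toContinuousLinearMap', Matrix.mulVecLin_apply, Matrix.mulVec_smul] at h
  exact h

/-- The refinement operator in the Fourier domain. -/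
lemma ft_cascade {f : ℝ → (Fin r → ℂ)} (hf : Continuous f) (hs : HasCompactSupport f) (ξ : ℝ) :
    ft (cascade a f) (2 * ξ) = symbol a ξ *ᵥ ft f ξ := by
  have hk : ∀ k : ℤ, Continuous fun x : ℝ => f (x - k) := fun k => by fun_prop
  have hks : ∀ k : ℤ, HasCompactSupport fun x : ℝ => f (x - k) := fun k =>
    hs.comp_homeomorph (Homeomorph.subRight (k : ℝ))
  have hk2 : ∀ k : ℤ, HasCompactSupport fun x : ℝ => f (2 * x - k) := fun k =>
    (hks k).comp_homeomorph (Homeomorph.mulLeft₀ (2 : ℝ) two_ne_zero)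
  have h1 : cascade a f = fun x => (2 : ℂ) • ∑ k ∈ a.support, a k *ᵥ f (2 * x - k) := rfl
  rw [h1, ft_const_smul, ft_sum, symbol_eq_sum, Finsupp.sum, Matrix.sum_mulVec, Finset.smul_sum]
  · refine Finset.sum_congr rfl fun k _ => ?_
    rw [ft_mulVec (by fun_prop) (hk2 k), ← Matrix.mulVec_smul, ft_comp_two_mul fun x => f (x - k),
      ft_comp_sub, Matrix.mulVec_smul, Matrix.smul_mulVec]
    simp [ek]
  · exact fun k _ => (Continuous.matrix_mulVec continuous_const (by fun_prop))
  · exact fun k _ => (hk2 k).comp_left (g := fun c => a k *ᵥ c) (Matrix.mulVec_zero _)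

end cascade

/-! ### Smooth refinable functions -/

/-- A `C^m` function solving the refinement equation in the Fourier domain, normalized with respect
to `v`. -/
structure IsRefinableFun (a : ℤ →₀ Matrix (Fin r) (Fin r) ℂ) (v : ℤ →₀ (Fin r → ℂ)) (m : ℕ)
    (g : ℝ → (Fin r → ℂ)) : Prop where
  contDiff : ContDiff ℝ m g
  hasCompactSupport : HasCompactSupport g
  refine_eq : ∀ ξ, ft g (2 * ξ) = symbol a ξ *ᵥ ft g ξ
  normalized : symbol v 0 ⬝ᵥ ft g 0 = 1

lemma coeff_rf {v : ℤ →₀ (Fin r → ℂ)} {f : ℝ → (Fin r → ℂ)} (hf : Continuous f)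
    (hs : HasCompactSupport f) (k : ℤ) (s : ℕ) : PowerSeries.coeff s (rf v f k)
      = ∑ i, ∑ p ∈ Finset.HasAntidiagonal.antidiagonal s, PowerSeries.coeff p.1 (vjet (symbol v) i) *
        (iteratedDeriv p.2 (ft f) (2 * Real.pi * k) i / (p.2.factorial : ℂ)) := by
  rw [rf_eq hf hs, dotProduct, map_sum]
  refine Finset.sum_congr rfl fun i _ => ?_
  rw [PowerSeries.coeff_mul]
  refine Finset.sum_congr rfl fun p _ => ?_
  rw [vjet, vjet, coeff_jet p.2,
    ← iteratedDeriv_apply ((contDiff_ft_comp_add hf hs _).of_le (by exact_mod_cast le_top)),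
    iteratedDeriv_comp_add_const]
  simp only [zero_add]

/-- The matching relation in terms of `rf`, for a function `h` refined from `g`: it relates the
frequencies `2πk` of `g` and `4πk` of `h`. -/
lemma rf_rescale {a : ℤ →₀ Matrix (Fin r) (Fin r) ℂ} {v : ℤ →₀ (Fin r → ℂ)} {n : ℕ}
    (hv : IsMatchingFilter a v n) {g h : ℝ → (Fin r → ℂ)} (hg : Continuous g)
    (hs : HasCompactSupport g) (hh : ∀ ξ, ft h (2 * ξ) = symbol a ξ *ᵥ ft g ξ)
    (hhc : Continuous h) (hhs : HasCompactSupport h) (k : ℤ) :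
    PowerSeries.X ^ n ∣ PowerSeries.rescale (2 : ℂ) (rf v h (2 * k)) - rf v g k := by
  have h1 : PowerSeries.rescale (2 : ℂ) (rf v h (2 * k))
      = jet fun ξ => (symbol v (2 * ξ) ᵥ* symbol a ξ) ⬝ᵥ ft g (ξ + 2 * Real.pi * (k : ℝ)) := by
    have h2 := jet_comp_mul (f := fun ξ => symbol v ξ ⬝ᵥ ft h (ξ + 2 * Real.pi * ((2 * k : ℤ) : ℝ)))
      2 (contDiff_dotProduct (contDiff_symbol v) (contDiff_ft_comp_add hhc hhs _))
    rw [Complex.ofReal_ofNat] at h2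
    rw [rf, ← h2]
    refine congrArg jet (funext fun ξ => ?_)
    have h3 : 2 * ξ + 2 * Real.pi * ((2 * k : ℤ) : ℝ) = 2 * (ξ + 2 * Real.pi * (k : ℝ)) := by
      push_cast; ring
    rw [h3, hh, symbol_add_two_pi_mul, Matrix.dotProduct_mulVec]
  have h2 : ContDiff ℝ ∞ fun ξ => symbol v (2 * ξ) ᵥ* symbol a ξ :=
    contDiff_vecMul ((contDiff_symbol v).comp (contDiff_const.mul contDiff_id)) (contDiff_symbol_mat' a)
  rw [h1, jet_dotProduct h2 (contDiff_ft_comp_add hg hs _), rf_eq hg hs]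
  exact EqMod.dotProduct ((agreeAtZero_iff_eqMod h2 (contDiff_symbol v)).mp hv.2) _

/-- The reproduction property of smooth refinable functions: `v̂(ξ) ĝ(ξ + 2πk)` vanishes to order
`m + 1` for `k ≠ 0`. The `s`-th Taylor coefficients `c(k)` satisfy `c(k) = 2^{sn} c(2^n k)`, and the
smoothness of `g` makes the right-hand side tend to zero. -/
lemma IsRefinableFun.rf_of_ne_zero {a : ℤ →₀ Matrix (Fin r) (Fin r) ℂ} {v : ℤ →₀ (Fin r → ℂ)} {m : ℕ}
    (hv : IsMatchingFilter a v (m + 1)) {g : ℝ → (Fin r → ℂ)} (hg : IsRefinableFun a v m g) {k : ℤ}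
    (hk : k ≠ 0) : PowerSeries.X ^ (m + 1) ∣ rf v g k := by
  have hc := hg.contDiff.continuous
  have hs := hg.hasCompactSupport
  rw [PowerSeries.X_pow_dvd_iff]
  intro s hsm
  have step : ∀ l : ℤ, PowerSeries.coeff s (rf v g l) = 2 ^ s * PowerSeries.coeff s (rf v g (2 * l)) := by
    intro l
    have := PowerSeries.X_pow_dvd_iff.mp (rf_rescale hv hc hs hg.refine_eq hc hs l) s hsm
    rw [map_sub, PowerSeries.coeff_rescale, sub_eq_zero] at this
    exact this.symm
  have iter : ∀ n : ℕ, PowerSeries.coeff s (rf v g k)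
      = 2 ^ (s * n) * PowerSeries.coeff s (rf v g (2 ^ n * k)) := by
    intro n
    induction n with
    | zero => simp
    | succ n ih => rw [ih, step, ← mul_assoc, ← pow_add, ← mul_assoc, ← pow_succ', mul_add_one]
  refine tendsto_nhds_unique (tendsto_const_nhds (f := atTop (α := ℕ))) ?_
  refine Tendsto.congr (fun n => (iter n).symm) ?_
  have habs : ∀ n : ℕ, (2 : ℝ) ^ n ≤ |2 * Real.pi * (((2 : ℤ) ^ n * k : ℤ) : ℝ)| := by
    intro n
    have hk1 : (1 : ℝ) ≤ |(k : ℝ)| := by exact_mod_cast Int.one_le_abs hk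
    push_cast
    rw [abs_mul, abs_mul, abs_mul, abs_of_pos Real.pi_pos, abs_two, abs_pow, abs_two]
    have h3 := Real.pi_gt_three
    have h4 : (0 : ℝ) < 2 ^ n := by positivity
    nlinarith [mul_le_mul_of_nonneg_left hk1 h4.le]
  have hpt : Tendsto (fun n : ℕ => 2 * Real.pi * (((2 : ℤ) ^ n * k : ℤ) : ℝ)) atTop (cocompact ℝ) := by
    rw [← Metric.cobounded_eq_cocompact, ← tendsto_norm_atTop_iff_cobounded]
    exact tendsto_atTop_mono habs (tendsto_pow_atTop_atTop_of_one_lt one_lt_two)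
  -- the decay `o(|ξ|^{-m})` of the Fourier transform beats the factor `2^{sn}`, because `s ≤ m`
  have hD : ∀ (q : ℕ) (i : Fin r), Tendsto (fun n : ℕ => (2 : ℂ) ^ (s * n) *
      iteratedDeriv q (ft g) (2 * Real.pi * (((2 : ℤ) ^ n * k : ℤ) : ℝ)) i) atTop (𝓝 0) := by
    intro q i
    have h1 := ((tendsto_pow_smul_iteratedDeriv_ft hg.contDiff hs q).comp hpt).norm
    rw [norm_zero] at h1
    refine squeeze_zero_norm (fun n => ?_) h1
    rw [Function.comp_apply, norm_mul, norm_smul, norm_pow, norm_pow]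
    refine mul_le_mul ?_ (norm_le_pi_norm _ i) (norm_nonneg _) (by positivity)
    rw [Complex.norm_real, RCLike.norm_ofNat, Real.norm_eq_abs, mul_comm s, pow_mul]
    calc ((2 : ℝ) ^ n) ^ s ≤ ((2 : ℝ) ^ n) ^ m :=
          pow_le_pow_right₀ (one_le_pow₀ one_le_two) (by omega)
      _ ≤ _ := pow_le_pow_left₀ (by positivity) (habs n) m
  have hsum : Tendsto (fun n : ℕ => ∑ i, ∑ p ∈ Finset.HasAntidiagonal.antidiagonal s,
      PowerSeries.coeff p.1 (vjet (symbol v) i) * ((2 : ℂ) ^ (s * n) *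
      iteratedDeriv p.2 (ft g) (2 * Real.pi * (((2 : ℤ) ^ n * k : ℤ) : ℝ)) i / (p.2.factorial : ℂ)))
      atTop (𝓝 (∑ i : Fin r, ∑ p ∈ Finset.HasAntidiagonal.antidiagonal s,
        PowerSeries.coeff p.1 (vjet (symbol v) i) * (0 / (p.2.factorial : ℂ)))) :=
    tendsto_finsetSum _ fun i _ => tendsto_finsetSum _ fun p _ =>
      ((hD p.2 i).div_const _).const_mul _
  simp only [zero_div, mul_zero, Finset.sum_const_zero] at hsum
  refine hsum.congr fun n => ?_
  rw [coeff_rf hc hs, Finset.mul_sum]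
  refine Finset.sum_congr rfl fun i _ => ?_
  rw [Finset.mul_sum]
  refine Finset.sum_congr rfl fun p _ => ?_
  ring

/-- The coefficient `c` of order `l` of `v̂ ĝ - 1` satisfies `2^l c = c`, and for `l = 0` it
vanishes by the normalization. -/
lemma IsRefinableFun.rf_zero {a : ℤ →₀ Matrix (Fin r) (Fin r) ℂ} {v : ℤ →₀ (Fin r → ℂ)} {m : ℕ}
    (hv : IsMatchingFilter a v (m + 1)) {g : ℝ → (Fin r → ℂ)} (hg : IsRefinableFun a v m g) :
    PowerSeries.X ^ (m + 1) ∣ rf v g 0 - 1 := by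
  have hc := hg.contDiff.continuous
  have hs := hg.hasCompactSupport
  rw [PowerSeries.X_pow_dvd_iff]
  intro s hsm
  rcases Nat.eq_zero_or_pos s with rfl | hpos
  · rw [map_sub, rf, coeff_zero_jet, Int.cast_zero, mul_zero, add_zero, hg.normalized]
    simp
  · have := PowerSeries.X_pow_dvd_iff.mp (rf_rescale hv hc hs hg.refine_eq hc hs 0) s hsm
    rw [map_sub, PowerSeries.coeff_rescale, mul_zero, ← sub_one_mul, mul_eq_zero] at this
    rw [map_sub, PowerSeries.coeff_one, if_neg hpos.ne', sub_zero]
    refine this.resolve_left fun h => ?_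
    have h2 : (2 : ℝ) ^ s = 1 := by
      have := congrArg (fun z : ℂ => ‖z‖) (sub_eq_zero.mp h)
      simpa using this
    exact (one_lt_pow₀ one_lt_two hpos.ne').ne' h2

/-- Differentiation multiplies the Fourier transform by `iξ`, so that vanishing orders persist. -/
lemma rf_iteratedDeriv {v : ℤ →₀ (Fin r → ℂ)} {f : ℝ → (Fin r → ℂ)} {j : ℕ} (hf : ContDiff ℝ j f)
    (hs : HasCompactSupport f) (k : ℤ) : rf v (iteratedDeriv j f) k
      = jet (fun ξ : ℝ => (Complex.I * ((ξ + 2 * Real.pi * (k : ℝ) : ℝ) : ℂ)) ^ j) * rf v f k := by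
  have hj : ContDiff ℝ ∞ fun ξ : ℝ => (Complex.I * ((ξ + 2 * Real.pi * (k : ℝ) : ℝ) : ℂ)) ^ j :=
    (contDiff_const.mul (Complex.ofRealCLM.contDiff.comp (contDiff_id.add contDiff_const))).pow j
  rw [rf, rf, ← jet_mul hj (contDiff_dotProduct (contDiff_symbol v)
    (contDiff_ft_comp_add hf.continuous hs _))]
  refine congrArg jet (funext fun ξ => ?_)
  rw [ft_iteratedDeriv hf hs, dotProduct_smul, smul_eq_mul]

lemma exists_norm_bound {E : Type*} [NormedAddCommGroup E] {f : ℝ → E} (hf : Continuous f)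
    (hs : HasCompactSupport f) : ∃ C : ℝ, ∀ x, ‖f x‖ ≤ C :=
  hf.bounded_above_of_compact_support hs

lemma floor_add_fract_div (n : ℕ) (x : ℝ) :
    (Int.fract (2 ^ n * x) + (⌊2 ^ n * x⌋ : ℝ)) / 2 ^ n = x := by
  rw [add_comm, Int.floor_add_fract]; field_simp

lemma exists_suppIn_sample {f : ℝ → (Fin r → ℂ)} (hs : HasCompactSupport f) :
    ∃ L : ℕ, ∀ y : ℝ, |y| ≤ 1 → SuppIn L (sample f hs y) := by
  obtain ⟨R, hR⟩ := exists_support_bound hs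
  refine ⟨R + 1, fun y hy j hj => ?_⟩
  have h1 := hR _ hj
  have : |(j : ℝ)| ≤ R + 1 := by
    have := abs_sub (y + j) y
    rw [add_sub_cancel_left] at this
    linarith
  exact_mod_cast this

/-- If `v̂(ξ) f̂(ξ + 2πk) = O(|ξ|^{m+1})` for all `k`, then the samples of `f^{(j)}` have vanishing
moments, and the cascade iterates of `f` decay geometrically. -/
lemma exists_iteratedDeriv_cascade_le {a : ℤ →₀ Matrix (Fin r) (Fin r) ℂ} {v : ℤ →₀ (Fin r → ℂ)}
    {K : ℕ} {lam : ℝ} (hdec : ∀ u ∈ vanishing v K, ExpDecaySeq a lam u)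
    {f : ℝ → (Fin r → ℂ)} {j : ℕ} (hf : ContDiff ℝ j f) (hs : HasCompactSupport f)
    (h : ∀ k : ℤ, PowerSeries.X ^ K ∣ rf v f k) :
    ∃ C : ℝ, ∀ (n : ℕ) (x : ℝ), ‖iteratedDeriv j ((cascade a)^[n] f) x‖ ≤ C * (2 ^ j * lam) ^ n := by
  set F := iteratedDeriv j f with hF
  have hFc : Continuous F := hf.continuous_iteratedDeriv j le_rfl
  have hFs : HasCompactSupport F := hasCompactSupport_iteratedDeriv hs j
  have hFv : ∀ y, sample F hFs y ∈ vanishingSub v K := fun y =>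
    mem_vanishingSub.mpr (sample_mem_vanishing hFc hFs (fun k => by
      rw [hF, rf_iteratedDeriv hf hs]; exact (h k).mul_left _) y)
  obtain ⟨S, hS⟩ := exists_norm_bound hFc hFs
  obtain ⟨L, hL⟩ := exists_suppIn_sample hFs
  obtain ⟨C, hC⟩ := uniform_expDecay (V := vanishingSub v K)
    (fun u hu => hdec u (mem_vanishingSub.mp hu)) L
  refine ⟨C * S, fun n x => ?_⟩
  rw [iteratedDeriv_cascade_iterate a hf, ← floor_add_fract_div n x]
  simp only [← hF]
  rw [cascade_iterate_apply a n hFs, norm_smul, norm_pow, RCLike.norm_ofNat]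
  have h1 : |Int.fract (2 ^ n * x)| ≤ 1 := by
    rw [abs_of_nonneg (Int.fract_nonneg _)]; exact (Int.fract_lt_one _).le
  refine (mul_le_mul_of_nonneg_left (hC _ (hFv _) (hL _ h1) S (fun k => hS _) n _)
    (by positivity)).trans (le_of_eq ?_)
  rw [mul_pow, pow_mul]; ring

lemma hasCompactSupport_comp_sub {E : Type*} [NormedAddCommGroup E] {f : ℝ → E} (hs : HasCompactSupport f) (l : ℝ) :
    HasCompactSupport fun x : ℝ => f (x - l) := hs.comp_homeomorph (Homeomorph.subRight l)

lemma hasCompactSupport_finset_sum {E ι : Type*} [NormedAddCommGroup E] (s : Finset ι) {f : ι → ℝ → E}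
    (hf : ∀ i ∈ s, HasCompactSupport (f i)) : HasCompactSupport fun x => ∑ i ∈ s, f i x := by
  classical
  induction s using Finset.induction_on with
  | empty => simp only [Finset.sum_empty]; exact HasCompactSupport.zero
  | insert i s hi ih =>
    simp only [Finset.sum_insert hi]
    exact (hf i (Finset.mem_insert_self i s)).add
      (ih fun j hj => hf j (Finset.mem_insert_of_mem hj))

/-! ### Admissible initial functions -/

section shiftSum

variable {E : Type*} [NormedAddCommGroup E] [NormedSpace ℂ E]

/-- The finite combination `∑ₗ p(l) f(· - l)` of integer shifts. -/
def shiftSum (p : ℤ →₀ ℂ) (f : ℝ → E) (x : ℝ) : E := p.sum fun l c => c • f (x - l)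

lemma contDiff_shiftSum {n : WithTop ℕ∞} (p : ℤ →₀ ℂ) {f : ℝ → E} (hf : ContDiff ℝ n f) :
    ContDiff ℝ n (shiftSum p f) := by
  unfold shiftSum Finsupp.sum
  exact ContDiff.sum fun l _ => contDiff_const.smul (hf.comp (contDiff_id.sub contDiff_const))

lemma hasCompactSupport_shiftSum (p : ℤ →₀ ℂ) {f : ℝ → E} (hs : HasCompactSupport f) :
    HasCompactSupport (shiftSum p f) :=
  hasCompactSupport_finset_sum _ fun _ _ => (hasCompactSupport_comp_sub hs _).smul_left

lemma ft_shiftSum (p : ℤ →₀ ℂ) {f : ℝ → E} (hf : Continuous f) (hs : HasCompactSupport f) (ξ : ℝ) :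
    ft (shiftSum p f) ξ = symbol p ξ • ft f ξ := by
  have h : shiftSum p f = fun x => ∑ l ∈ p.support, p l • f (x - l) := rfl
  rw [h, ft_sum, symbol_eq_sum, Finsupp.sum, Finset.sum_smul]
  · refine Finset.sum_congr rfl fun l _ => ?_
    rw [ft_const_smul, ft_comp_sub, smul_smul, smul_eq_mul, mul_comm]
    simp [ek]
  · intro _ _; fun_prop
  · exact fun _ _ => (hasCompactSupport_comp_sub hs _).smul_left

end shiftSum

lemma rf_shiftSum {v : ℤ →₀ (Fin r → ℂ)} (p : ℤ →₀ ℂ) {f : ℝ → (Fin r → ℂ)} (hf : Continuous f)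
    (hs : HasCompactSupport f) (k : ℤ) : rf v (shiftSum p f) k = jet (symbol p) * rf v f k := by
  rw [rf, rf, ← jet_mul (contDiff_symbol_scalar p) (contDiff_dotProduct (contDiff_symbol v)
    (contDiff_ft_comp_add hf hs _))]
  refine congrArg jet (funext fun ξ => ?_)
  rw [ft_shiftSum p hf hs, dotProduct_smul, smul_eq_mul, symbol_add_two_pi_mul]

lemma rf_add {v : ℤ →₀ (Fin r → ℂ)} {f g : ℝ → (Fin r → ℂ)} (hf : Continuous f)
    (hs : HasCompactSupport f) (hg : Continuous g) (hgs : HasCompactSupport g) (k : ℤ) :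
    rf v (fun x => f x + g x) k = rf v f k + rf v g k := by
  rw [rf, rf, rf, ← jet_add (contDiff_dotProduct (contDiff_symbol v) (contDiff_ft_comp_add hf hs _))
    (contDiff_dotProduct (contDiff_symbol v) (contDiff_ft_comp_add hg hgs _))]
  refine congrArg jet (funext fun ξ => ?_)
  rw [ft_add hf hs hg hgs, dotProduct_add]

lemma rf_sub {v : ℤ →₀ (Fin r → ℂ)} {f g : ℝ → (Fin r → ℂ)} (hf : Continuous f)
    (hs : HasCompactSupport f) (hg : Continuous g) (hgs : HasCompactSupport g) (k : ℤ) :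
    rf v (fun x => f x - g x) k = rf v f k - rf v g k := by
  rw [eq_sub_iff_add_eq, ← rf_add (f := fun x => f x - g x) (hf.sub hg) (hs.sub hgs) hg hgs]
  simp

/-- Smooth functions of integral `1` concentrated near a given point. -/
lemma exists_smooth_bump (c : ℝ) {ε : ℝ} (hε : 0 < ε) : ∃ b : ℝ → ℂ, ContDiff ℝ ∞ b ∧
    HasCompactSupport b ∧ ft b 0 = 1 ∧ ∀ x, b x ≠ 0 → |x - c| < ε := by
  set B : ContDiffBump c := ⟨ε / 2, ε, by positivity, by linarith⟩ with hB
  refine ⟨fun x => (B.normed MeasureTheory.volume x : ℂ), ?_, ?_, ?_, fun x hx => ?_⟩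
  · exact Complex.ofRealCLM.contDiff.comp B.contDiff_normed
  · exact (B.hasCompactSupport_normed (μ := MeasureTheory.volume)).comp_left
      (g := fun x : ℝ => (x : ℂ)) Complex.ofReal_zero
  · simp only [ft, Complex.ofReal_zero, mul_zero, neg_zero, Complex.exp_zero, one_smul]
    rw [integral_complex_ofReal, B.integral_normed, Complex.ofReal_one]
  · have h1 : x ∈ Function.support (B.normed MeasureTheory.volume) := fun h => hx (by
      simp only [h, Complex.ofReal_zero])
    rw [B.support_normed_eq, Metric.mem_ball, Real.dist_eq] at h1
    exact h1

lemma jet_ofReal : jet (fun ξ : ℝ => (ξ : ℂ)) = PowerSeries.X := by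
  have hd : deriv (fun ξ : ℝ => (ξ : ℂ)) = fun _ => 1 :=
    funext fun x => (Complex.ofRealCLM.hasDerivAt (x := x)).deriv
  ext n
  rw [coeff_jet]
  rcases n with - | n
  · simp
  · rw [iteratedDeriv_succ', hd, iteratedDeriv_const, PowerSeries.coeff_X]
    rcases n with - | n <;> simp

lemma jet_I_mul_add (θ : ℝ) : jet (fun ξ : ℝ => Complex.I * ((ξ + θ : ℝ) : ℂ))
    = PowerSeries.C Complex.I * (PowerSeries.X + PowerSeries.C (θ : ℂ)) := by
  have h : ContDiff ℝ ∞ fun ξ : ℝ => (ξ : ℂ) := Complex.ofRealCLM.contDiff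
  rw [jet_const_mul (f := fun ξ : ℝ => ((ξ + θ : ℝ) : ℂ)) _
    (Complex.ofRealCLM.contDiff.comp (contDiff_id.add contDiff_const))]
  simp only [Complex.ofReal_add]
  rw [jet_add h contDiff_const, jet_ofReal, jet_const]

lemma X_pow_dvd_of_mul {n : ℕ} {p q : PowerSeries ℂ} (hp : PowerSeries.constantCoeff p ≠ 0)
    (h : PowerSeries.X ^ n ∣ p * q) : PowerSeries.X ^ n ∣ q := by
  have hu : IsUnit p := PowerSeries.isUnit_iff_constantCoeff.mpr (isUnit_iff_ne_zero.mpr hp)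
  obtain ⟨s, rfl⟩ := hu
  exact (Units.dvd_mul_left.mp h)

lemma contDiff_I_mul_add (θ : ℝ) : ContDiff ℝ ∞ fun ξ : ℝ => Complex.I * ((ξ + θ : ℝ) : ℂ) :=
  contDiff_const.mul (Complex.ofRealCLM.contDiff.comp (contDiff_id.add contDiff_const))

/-- The average `B(x) = ∫_{x-1}^x b` of a smooth compactly supported function. -/
lemma exists_unit_average {b : ℝ → ℂ} (hb : ContDiff ℝ ∞ b) (hbs : HasCompactSupport b) :
    ∃ B : ℝ → ℂ, ContDiff ℝ ∞ B ∧ HasCompactSupport B ∧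
      ∀ ξ : ℝ, (Complex.I * ξ) * ft B ξ = (1 - ek 1 ξ) * ft b ξ := by
  have hbc := hb.continuous
  set B : ℝ → ℂ := fun x => ∫ t in (x - 1)..x, b t with hB
  have hderiv : ∀ x, HasDerivAt B (b x - b (x - 1)) x := by
    intro x
    have h1 : B = fun x => (∫ t in (0 : ℝ)..x, b t) - ∫ t in (0 : ℝ)..(x - 1), b t := by
      funext x
      rw [intervalIntegral.integral_interval_sub_left (hbc.intervalIntegrable _ _)
        (hbc.intervalIntegrable _ _)]
    rw [h1]
    exact (hbc.integral_hasStrictDerivAt 0 x).hasDerivAt.fun_sub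
      ((hbc.integral_hasStrictDerivAt 0 (x - 1)).hasDerivAt.comp_sub_const x 1)
  have hd : deriv B = fun x => b x - b (x - 1) := funext fun x => (hderiv x).deriv
  have hBd : ContDiff ℝ ∞ B := by
    rw [contDiff_infty_iff_deriv, hd]
    exact ⟨fun x => (hderiv x).differentiableAt, hb.sub (hb.comp (contDiff_id.sub contDiff_const))⟩
  have hBs : HasCompactSupport B := by
    obtain ⟨R, hR⟩ := exists_support_bound hbs
    refine hasCompactSupport_of_bound (R := R + 1) fun x hx => ?_
    by_contra hx2
    refine hx (intervalIntegral.integral_zero_ae (.of_forall fun t ht => ?_))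
    by_contra ht2
    have h1 := abs_le.mp (hR t ht2)
    rw [Set.uIoc_of_le (by linarith)] at ht
    exact hx2 (abs_le.mpr ⟨by linarith [ht.2, ht.1], by linarith [ht.1, ht.2]⟩)
  refine ⟨B, hBd, hBs, fun ξ => ?_⟩
  have h1 := ft_deriv (hBd.of_le (by exact_mod_cast le_top)) hBs ξ
  rw [hd, smul_eq_mul] at h1
  have h2 := ft_add hbc hbs (g := fun x => (-1 : ℂ) • b (x - 1)) (by fun_prop)
    ((hasCompactSupport_comp_sub hbs 1).comp_left (g := fun c => (-1 : ℂ) • c) (smul_zero _)) ξ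
  rw [ft_const_smul, ft_comp_sub] at h2
  have h3 : (fun x => b x - b (x - 1)) = fun x => b x + (-1 : ℂ) • b (x - 1) :=
    funext fun x => by rw [neg_one_smul, sub_eq_add_neg]
  rw [← h1, h3, h2]
  simp only [ek, Complex.ofReal_one, Int.cast_one, smul_eq_mul]
  ring

/-- Smooth compactly supported functions whose integer shifts reproduce polynomials up to a given
degree. The order is raised by averaging over unit intervals. -/
lemma exists_smooth_reproducing (n : ℕ) : ∃ b : ℝ → ℂ, ContDiff ℝ ∞ b ∧ HasCompactSupport b ∧
    ft b 0 = 1 ∧ ∀ k : ℤ, k ≠ 0 →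
      PowerSeries.X ^ n ∣ jet fun ξ => ft b (ξ + 2 * Real.pi * (k : ℝ)) := by
  induction n with
  | zero =>
    obtain ⟨b, h1, h2, h3, -⟩ := exists_smooth_bump 0 one_pos
    exact ⟨b, h1, h2, h3, fun k _ => by simp⟩
  | succ n ih =>
    obtain ⟨b, hb, hbs, hb1, hbk⟩ := ih
    obtain ⟨B, hBd, hBs, hB⟩ := exists_unit_average hb hbs
    obtain ⟨g, hg, hj⟩ := exists_jet_diffSeq
    have hj1 : jet (fun ξ => 1 - ek 1 ξ) = PowerSeries.X * g := by
      have h1 := hj 1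
      have h2 : symbol (diffSeq 1) = fun ξ => 1 - ek 1 ξ :=
        funext fun ξ => by rw [symbol_diffSeq, pow_one]
      rwa [pow_one, pow_one, h2] at h1
    -- `iξ B̂(ξ) = (1 - e^{-iξ}) b̂(ξ)`: the factor `1 - e^{-iξ}` vanishes at all multiples of `2π`,
    -- while `iξ` vanishes only at the origin
    have hjet : ∀ k : ℤ, PowerSeries.C Complex.I * (PowerSeries.X + PowerSeries.C
        ((2 * Real.pi * (k : ℝ) : ℝ) : ℂ)) * jet (fun ξ => ft B (ξ + 2 * Real.pi * (k : ℝ)))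
        = PowerSeries.X * g * jet (fun ξ => ft b (ξ + 2 * Real.pi * (k : ℝ))) := by
      intro k
      rw [← jet_I_mul_add, ← hj1, ← jet_mul (contDiff_I_mul_add _)
        (contDiff_ft_comp_add hBd.continuous hBs _),
        ← jet_mul (contDiff_const.sub (contDiff_ek 1)) (contDiff_ft_comp_add hb.continuous hbs _)]
      refine congrArg jet (funext fun ξ => ?_)
      rw [hB, ek_add_right, ek_two_pi_mul, mul_one]
    refine ⟨B, hBd, hBs, ?_, fun k hk => ?_⟩
    · have h1 := congrArg (PowerSeries.coeff 1) (hjet 0)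
      rw [Int.cast_zero, mul_zero, Complex.ofReal_zero, map_zero, add_zero, mul_assoc, mul_assoc,
        PowerSeries.coeff_C_mul, ← zero_add 1, PowerSeries.coeff_succ_X_mul,
        PowerSeries.coeff_succ_X_mul, PowerSeries.coeff_zero_eq_constantCoeff_apply,
        PowerSeries.coeff_zero_eq_constantCoeff_apply, map_mul, hg,
        ← PowerSeries.coeff_zero_eq_constantCoeff_apply,
        ← PowerSeries.coeff_zero_eq_constantCoeff_apply, coeff_zero_jet, coeff_zero_jet, add_zero,
        hb1] at h1
      exact mul_left_cancel₀ Complex.I_ne_zero h1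
    · refine X_pow_dvd_of_mul (p := PowerSeries.C Complex.I * (PowerSeries.X + PowerSeries.C
        ((2 * Real.pi * (k : ℝ) : ℝ) : ℂ))) ?_ ?_
      · simp [Real.pi_ne_zero, hk]
      · rw [hjet, pow_succ', mul_assoc]
        exact mul_dvd_mul_left _ ((hbk k hk).mul_left g)

/-- Smooth initial functions for the cascade algorithm, normalized to high order. -/
lemma exists_normalized_initial {v : ℤ →₀ (Fin r → ℂ)} (hv : symbol v 0 ≠ 0) (n : ℕ) :
    ∃ f : ℝ → (Fin r → ℂ), ContDiff ℝ ∞ f ∧ HasCompactSupport f ∧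
      PowerSeries.X ^ n ∣ rf v f 0 - 1 ∧ ∀ k : ℤ, k ≠ 0 → PowerSeries.X ^ n ∣ rf v f k := by
  obtain ⟨b, hb, hbs, hb1, hbk⟩ := exists_smooth_reproducing n
  obtain ⟨y, hy⟩ := exists_dotProduct_ne_zero hv
  set F : ℝ → (Fin r → ℂ) := fun x => b x • y with hF
  have hFd : ContDiff ℝ ∞ F := hb.smul contDiff_const
  have hFs : HasCompactSupport F := hbs.smul_right
  have hft : ∀ ξ, ft F ξ = ft b ξ • y := fun ξ => by
    rw [ft, ft, ← integral_smul_const]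
    exact MeasureTheory.integral_congr_ae (.of_forall fun x => by simp only [hF, smul_assoc])
  have hrf : ∀ k, rf v F k = jet (fun ξ => symbol v ξ ⬝ᵥ y) *
      jet fun ξ => ft b (ξ + 2 * Real.pi * (k : ℝ)) := fun k => by
    rw [← jet_mul (contDiff_symbol_dotProduct v y) (contDiff_ft_comp_add hb.continuous hbs _), rf]
    refine congrArg jet (funext fun ξ => ?_)
    rw [hft, dotProduct_smul, smul_eq_mul, mul_comm]
  have hunit : PowerSeries.constantCoeff (rf v F 0) ≠ 0 := by
    rw [← PowerSeries.coeff_zero_eq_constantCoeff_apply, rf, coeff_zero_jet, hft, Int.cast_zero,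
      mul_zero, add_zero, hb1, one_smul]
    exact hy
  obtain ⟨p, hp⟩ := exists_symbol_jet (rf v F 0)⁻¹ n
  refine ⟨shiftSum p F, contDiff_shiftSum p hFd, hasCompactSupport_shiftSum p hFs, ?_, fun k hk => ?_⟩
  · rw [rf_shiftSum p hFd.continuous hFs]
    have := hp.mul_right (rf v F 0)
    rwa [sub_mul, PowerSeries.inv_mul_cancel _ hunit] at this
  · rw [rf_shiftSum p hFd.continuous hFs, hrf]
    exact ((hbk k hk).mul_left _).mul_left _

/-! ### Convergence to a refinable function -/

lemma X_pow_dvd_of_rescale_two {n : ℕ} {p : PowerSeries ℂ}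
    (h : PowerSeries.X ^ n ∣ PowerSeries.rescale (2 : ℂ) p) : PowerSeries.X ^ n ∣ p := by
  have h1 := X_pow_dvd_rescale (2⁻¹ : ℂ) h
  rwa [PowerSeries.rescale_rescale, mul_inv_cancel₀ two_ne_zero, PowerSeries.rescale_one] at h1

section

variable {a : ℤ →₀ Matrix (Fin r) (Fin r) ℂ} {v : ℤ →₀ (Fin r → ℂ)}

lemma continuous_cascade {f : ℝ → (Fin r → ℂ)} (hf : Continuous f) : Continuous (cascade a f) :=
  contDiff_zero.mp (contDiff_cascade a (contDiff_zero.mpr hf))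

/-- The sum rules annihilate the refined function at the odd multiples of `2π`, whatever the
initial function. -/
lemma rf_cascade_odd {n : ℕ} (hsr : HasSumRules a v n) {f : ℝ → (Fin r → ℂ)} (hf : Continuous f)
    (hs : HasCompactSupport f) (l : ℤ) : PowerSeries.X ^ n ∣ rf v (cascade a f) (2 * l + 1) := by
  refine X_pow_dvd_of_rescale_two ?_
  have h0 : ContDiff ℝ ∞ fun ξ : ℝ => symbol v (2 * ξ) :=
    (contDiff_symbol v).comp (contDiff_const.mul contDiff_id)
  have h1 : PowerSeries.rescale (2 : ℂ) (rf v (cascade a f) (2 * l + 1))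
      = jet fun ξ => (symbol v (2 * ξ) ᵥ* symbol a (ξ + Real.pi)) ⬝ᵥ
        ft f (ξ + (Real.pi + 2 * Real.pi * (l : ℝ))) := by
    have h2 := jet_comp_mul (f := fun ξ => symbol v ξ ⬝ᵥ
      ft (cascade a f) (ξ + 2 * Real.pi * ((2 * l + 1 : ℤ) : ℝ)))
      2 (contDiff_dotProduct (contDiff_symbol v)
        (contDiff_ft_comp_add (continuous_cascade hf) (hasCompactSupport_cascade a hs) _))
    rw [Complex.ofReal_ofNat] at h2
    rw [rf, ← h2]
    refine congrArg jet (funext fun ξ => ?_)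
    have h3 : 2 * ξ + 2 * Real.pi * ((2 * l + 1 : ℤ) : ℝ)
        = 2 * ((ξ + Real.pi) + 2 * Real.pi * (l : ℝ)) := by push_cast; ring
    rw [h3, ft_cascade a hf hs, symbol_add_two_pi_mul, Matrix.dotProduct_mulVec, add_assoc]
  have h2 := contDiff_vecMul h0 (contDiff_symbol_mat a Real.pi)
  rw [h1, jet_dotProduct h2 (contDiff_ft_comp_add hf hs _)]
  have h3 := ((agreeAtZero_iff_eqMod h2 contDiff_const).mp hsr.2).dotProduct
    (vjet fun ξ => ft f (ξ + (Real.pi + 2 * Real.pi * (l : ℝ))))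
  have h4 : vjet (fun _ : ℝ => (0 : Fin r → ℂ)) = 0 := funext fun i => by simp [vjet, jet_zero]
  rwa [h4, zero_dotProduct, sub_zero] at h3

/-- Under sum rules, one cascade step changes a normalized initial function by a function whose
samples have vanishing moments. -/
lemma rf_cascade_sub {n : ℕ} (hsr : HasSumRules a v n) {f : ℝ → (Fin r → ℂ)} (hf : Continuous f)
    (hs : HasCompactSupport f) (h0 : PowerSeries.X ^ n ∣ rf v f 0 - 1)
    (hk : ∀ k : ℤ, k ≠ 0 → PowerSeries.X ^ n ∣ rf v f k) (k : ℤ) :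
    PowerSeries.X ^ n ∣ rf v (fun x => cascade a f x - f x) k := by
  have hc := continuous_cascade (a := a) hf
  have hcs := hasCompactSupport_cascade a hs
  rw [rf_sub hc hcs hf hs]
  have hstep := rf_rescale hsr.1 hf hs (ft_cascade a hf hs) hc hcs
  revert k
  refine int_parity (fun l => ?_) fun l => ?_
  · rcases eq_or_ne l 0 with rfl | hl
    · have h1 := (hstep 0).add h0
      rw [mul_zero] at h1 ⊢
      have h2 : PowerSeries.X ^ n ∣ PowerSeries.rescale (2 : ℂ) (rf v (cascade a f) 0 - 1) := by
        rw [map_sub, map_one]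
        convert h1 using 1; ring
      have h3 := (X_pow_dvd_of_rescale_two h2).sub h0
      convert h3 using 1; ring
    · have h1 := (hstep l).add (hk l hl)
      rw [sub_add_cancel] at h1
      exact (X_pow_dvd_of_rescale_two h1).sub (hk _ (by omega))
  · exact (rf_cascade_odd hsr hf hs l).sub (hk _ (by omega))

/-- The normalization is preserved since `v̂(0)` is a left eigenvector of `â(0)`. -/
lemma dotProduct_ft_cascade_iterate {m : ℕ} (hv : IsMatchingFilter a v (m + 1)) {f : ℝ → (Fin r → ℂ)}
    (hf : Continuous f) (hs : HasCompactSupport f) (n : ℕ) :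
    symbol v 0 ⬝ᵥ ft ((cascade a)^[n] f) 0 = symbol v 0 ⬝ᵥ ft f 0 := by
  induction n with
  | zero => rfl
  | succ n ih =>
    have h1 := ft_cascade a (contDiff_zero.mp (contDiff_cascade_iterate a (contDiff_zero.mpr hf) n))
      (hasCompactSupport_cascade_iterate a hs n) 0
    rw [mul_zero] at h1
    rw [Function.iterate_succ_apply', h1, Matrix.dotProduct_mulVec, symbol_vecMul_zero hv m.succ_pos, ih]

/-- Under exponential decay, the cascade iterates of a smooth normalized initial function converge
to a `C^m` refinable function. -/
lemma exists_isRefinableFun {m : ℕ} (hv : IsMatchingFilter a v (m + 1)) (h : ExpDecay a v m) :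
    ∃ g, IsRefinableFun a v m g := by
  have hsr := hasSumRules_of_decay hv h.decay
  obtain ⟨lam, hl0, hl1, hdec⟩ := h
  obtain ⟨f, hf, hfs, hf0, hfk⟩ := exists_normalized_initial hv.1 (m + 1)
  have hfc := hf.continuous
  -- the limit is the telescoping series `f + ∑ᵢ C_a^i (C_a f - f)`
  set H : ℝ → (Fin r → ℂ) := fun x => cascade a f x - f x with hH
  have hHd : ContDiff ℝ ∞ H := (contDiff_cascade a hf).sub hf
  have hHs : HasCompactSupport H := (hasCompactSupport_cascade a hfs).sub hfs
  choose C hC using fun j : ℕ => exists_iteratedDeriv_cascade_le (j := j) hdec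
    (hHd.of_le (by exact_mod_cast le_top)) hHs (rf_cascade_sub hsr hfc hfs hf0 hfk)
  have hsum : ∀ k : ℕ, k ≤ m → Summable fun i : ℕ => C k * (2 ^ k * lam) ^ i := fun k hk =>
    (summable_geometric_of_lt_one (by positivity) (lt_of_le_of_lt (mul_le_mul_of_nonneg_right
      (pow_le_pow_right₀ one_le_two hk) hl0.le) hl1)).mul_left _
  have hbound : ∀ (n : ℕ) (x : ℝ), ‖(cascade a)^[n] H x‖ ≤ C 0 * (2 ^ 0 * lam) ^ n := fun n x => by
    simpa using hC 0 n x
  set G : ℝ → (Fin r → ℂ) := fun x => ∑' i, (cascade a)^[i] H x with hG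
  have hGd : ContDiff ℝ m G := contDiff_tsum
    (fun i => (contDiff_cascade_iterate a hHd i).of_le (by exact_mod_cast le_top))
    (fun k hk => hsum k (by exact_mod_cast hk))
    (fun k i x _ => by rw [norm_iteratedFDeriv_eq_norm_iteratedDeriv]; exact hC k i x)
  have hpart : ∀ (n : ℕ) (x : ℝ), ∑ i ∈ Finset.range n, (cascade a)^[i] H x
      = (cascade a)^[n] f x - f x := by
    intro n x
    have h1 : ∀ i, (cascade a)^[i] H x = (cascade a)^[i + 1] f x - (cascade a)^[i] f x := fun i => by
      rw [hH, cascade_iterate_sub, Function.iterate_succ_apply]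
    simp only [h1]
    rw [Finset.sum_range_sub (fun i => (cascade a)^[i] f x), Function.iterate_zero, id]
  have hlim : ∀ x, Tendsto (fun n => (cascade a)^[n] f x) atTop (𝓝 (f x + G x)) := by
    intro x
    have h1 := (Summable.of_norm_bounded (hsum 0 (Nat.zero_le _)) fun i =>
      hbound i x).hasSum.tendsto_sum_nat
    simp only [hpart] at h1
    simpa using h1.const_add (f x)
  set g : ℝ → (Fin r → ℂ) := fun x => f x + G x with hg
  have hgd : ContDiff ℝ m g := (hf.of_le (by exact_mod_cast le_top)).add hGd
  obtain ⟨R, hR⟩ := exists_cascade_iterate_support a hfs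
  have hgR : ∀ x, g x ≠ 0 → |x| ≤ R := by
    intro x hx
    by_contra hx2
    refine hx (tendsto_nhds_unique (hlim x) ?_)
    have : ∀ n, (cascade a)^[n] f x = 0 := fun n => by
      by_contra h
      exact hx2 (hR n x h)
    simp only [this]
    exact tendsto_const_nhds
  have hgs : HasCompactSupport g := hasCompactSupport_of_bound hgR
  have hfix : cascade a g = g := by
    funext x
    refine tendsto_nhds_unique (f := fun n => (cascade a)^[n + 1] f x) (l := atTop) ?_
      ((tendsto_add_atTop_iff_nat 1).mpr (hlim x))
    simp only [Function.iterate_succ_apply']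
    refine Tendsto.const_smul (tendsto_finsetSum _ fun k _ => ?_) _
    exact ((continuous_const.matrix_mulVec continuous_id).tendsto _).comp (hlim (2 * x - k))
  refine ⟨g, hgd, hgs, fun ξ => ?_, ?_⟩
  · have h1 := ft_cascade a hgd.continuous hgs ξ
    rwa [hfix] at h1
  · obtain ⟨S, hS⟩ := exists_norm_bound hfc hfs
    set M := S + ∑' i, C 0 * (2 ^ 0 * lam) ^ i with hM
    have hfn : ∀ n x, ‖(cascade a)^[n] f x‖ ≤ M := by
      intro n x
      have h1 : (cascade a)^[n] f x = f x + ∑ i ∈ Finset.range n, (cascade a)^[i] H x := by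
        rw [hpart]; abel
      rw [h1]
      refine (norm_add_le _ _).trans (add_le_add (hS x) ?_)
      refine (norm_sum_le _ _).trans ((Finset.sum_le_sum fun i _ => hbound i x).trans ?_)
      exact (hsum 0 (Nat.zero_le _)).sum_le_tsum _ fun i _ => (norm_nonneg _).trans (hbound i 0)
    -- the normalization passes to the limit by dominated convergence
    have hft : Tendsto (fun n => ft ((cascade a)^[n] f) 0) atTop (𝓝 (ft g 0)) := by
      refine MeasureTheory.tendsto_integral_of_dominated_convergence
        (Set.indicator (Set.Icc (-R) R) fun _ => M) (fun n => ?_) ?_ (fun n => .of_forall fun x => ?_)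
        (.of_forall fun x => (hlim x).const_smul _)
      · exact (integrable_expKernel_smul
          (contDiff_cascade_iterate a hf n).continuous
          (hasCompactSupport_cascade_iterate a hfs n) 0).aestronglyMeasurable
      · exact (MeasureTheory.integrable_indicator_iff measurableSet_Icc).mpr
          (MeasureTheory.integrableOn_const (by simp))
      · rw [norm_smul, norm_expKernel, one_mul]
        by_cases hx : x ∈ Set.Icc (-R) R
        · rw [Set.indicator_of_mem hx]; exact hfn n x
        · rw [Set.indicator_of_notMem hx]
          have : (cascade a)^[n] f x = 0 := by
            by_contra h
            exact hx (abs_le.mp (hR n x h))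
          rw [this, norm_zero]
    have hlim2 : Tendsto (fun n => symbol v 0 ⬝ᵥ ft ((cascade a)^[n] f) 0) atTop
        (𝓝 (symbol v 0 ⬝ᵥ ft g 0)) :=
      ((continuous_const.dotProduct continuous_id).tendsto _).comp hft
    simp only [dotProduct_ft_cascade_iterate hv hfc hfs] at hlim2
    rw [dotProduct_ft_zero_eq_one hf0] at hlim2
    exact (tendsto_nhds_unique hlim2 tendsto_const_nhds)

lemma eq_of_ft_eq {f g : ℝ → (Fin r → ℂ)} (hf : Continuous f) (hs : HasCompactSupport f)
    (hg : Continuous g) (hgs : HasCompactSupport g) (h : ∀ ξ, ft f ξ = ft g ξ) : f = g := by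
  have hzero : FourierTransform.fourier (fun x => f x - g x) = fun _ => (0 : Fin r → ℂ) := by
    funext ξ
    have h1 := ft_add (f := fun x => f x - g x) (hf.sub hg) (hs.sub hgs) hg hgs (2 * Real.pi * ξ)
    simp only [sub_add_cancel] at h1
    have h2 := ft_eq_fourier (fun x => f x - g x) (2 * Real.pi * ξ)
    rw [inv_mul_cancel_left₀ (by positivity)] at h2
    rw [← h2, ← sub_eq_zero.mpr (h (2 * Real.pi * ξ)), eq_sub_iff_add_eq, ← h1]
  have h1 := Continuous.fourierInv_fourier_eq (f := fun x => f x - g x) (hf.sub hg)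
    ((hf.sub hg).integrable_of_hasCompactSupport (hs.sub hgs)) (by rw [hzero]; simp)
  rw [hzero] at h1
  funext x
  have h2 := congrFun h1 x
  rw [Real.fourierInv_eq'] at h2
  simp only [smul_zero, MeasureTheory.integral_zero] at h2
  exact (sub_eq_zero.mp h2.symm)

lemma IsRefinableFun.cascade_eq {m : ℕ} {g : ℝ → (Fin r → ℂ)} (hg : IsRefinableFun a v m g) :
    cascade a g = g := by
  have hc := hg.contDiff.continuous
  have hs := hg.hasCompactSupport
  refine eq_of_ft_eq (continuous_cascade hc) (hasCompactSupport_cascade a hs) hc hs fun ξ => ?_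
  have h1 := ft_cascade a hc hs (ξ / 2)
  rwa [← hg.refine_eq, mul_div_cancel₀ _ two_ne_zero] at h1

lemma IsRefinableFun.cascade_iterate_eq {m : ℕ} {g : ℝ → (Fin r → ℂ)} (hg : IsRefinableFun a v m g)
    (n : ℕ) : (cascade a)^[n] g = g := Function.iterate_fixed hg.cascade_eq n

end

/-! ### Convergence of the cascade algorithm -/

/-- Uniform convergence to zero. -/
def UnifZero {ι E : Type*} [NormedAddCommGroup E] (F : ℕ → ι → E) : Prop :=
  ∀ ε > 0, ∀ᶠ n : ℕ in atTop, ∀ x, ‖F n x‖ ≤ ε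

section UnifZero

variable {ι E : Type*} [NormedAddCommGroup E]

lemma UnifZero.add {F G : ℕ → ι → E} (hF : UnifZero F) (hG : UnifZero G) :
    UnifZero fun n x => F n x + G n x := fun ε hε => by
  filter_upwards [hF (ε / 2) (half_pos hε), hG (ε / 2) (half_pos hε)] with n h1 h2 x
  exact (norm_add_le _ _).trans ((add_le_add (h1 x) (h2 x)).trans (add_halves ε).le)

lemma UnifZero.sum {κ : Type*} (s : Finset κ) {F : κ → ℕ → ι → E} (hF : ∀ i ∈ s, UnifZero (F i)) :
    UnifZero fun n x => ∑ i ∈ s, F i n x := by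
  classical
  induction s using Finset.induction_on with
  | empty => exact fun ε hε => .of_forall fun n x => by simpa using hε.le
  | insert i s hi ih =>
    simp only [Finset.sum_insert hi]
    exact (hF i (Finset.mem_insert_self i s)).add
      (ih fun j hj => hF j (Finset.mem_insert_of_mem hj))

lemma UnifZero.of_le {F : ℕ → ι → E} {b : ℕ → ℝ} (hb : Tendsto b atTop (𝓝 0))
    (h : ∀ n x, ‖F n x‖ ≤ b n) : UnifZero F := fun ε hε => by
  filter_upwards [hb.eventually (gt_mem_nhds hε)] with n hn x
  exact (h n x).trans hn.le

lemma UnifZero.const_smul [NormedSpace ℂ E] {F : ℕ → ι → E} (hF : UnifZero F) (c : ℂ) :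
    UnifZero fun n x => c • F n x := fun ε hε => by
  filter_upwards [hF (ε / (‖c‖ + 1)) (by positivity)] with n hn x
  rw [norm_smul]
  calc ‖c‖ * ‖F n x‖ ≤ (‖c‖ + 1) * (ε / (‖c‖ + 1)) :=
        mul_le_mul (by linarith) (hn x) (norm_nonneg _) (by positivity)
    _ = ε := by field_simp

end UnifZero

section

variable {a : ℤ →₀ Matrix (Fin r) (Fin r) ℂ} {v : ℤ →₀ (Fin r → ℂ)} {m : ℕ}

lemma cascade_comp_sub (f : ℝ → (Fin r → ℂ)) (t : ℝ) :
    cascade a (fun x => f (x - t)) = fun x => cascade a f (x - t / 2) := by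
  funext x
  simp only [cascade]
  congr 1
  refine Finsupp.sum_congr fun k _ => ?_
  congr 2; ring

lemma cascade_iterate_comp_sub (n : ℕ) (f : ℝ → (Fin r → ℂ)) (t : ℝ) :
    (cascade a)^[n] (fun x => f (x - t)) = fun x => (cascade a)^[n] f (x - t / 2 ^ n) := by
  induction n with
  | zero => simp
  | succ n ih =>
    simp only [Function.iterate_succ_apply', ih, cascade_comp_sub]
    funext x; congr 1; rw [pow_succ]; field_simp

lemma cascade_iterate_sum {ι : Type*} (n : ℕ) (s : Finset ι) (f : ι → ℝ → (Fin r → ℂ)) :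
    (cascade a)^[n] (fun x => ∑ i ∈ s, f i x) = fun x => ∑ i ∈ s, (cascade a)^[n] (f i) x := by
  classical
  induction s using Finset.induction_on with
  | empty =>
    have := cascade_iterate_smul a n 0 (fun _ => (0 : Fin r → ℂ))
    simpa using this
  | insert i s hi ih => simp only [Finset.sum_insert hi, cascade_iterate_add, ih]

lemma cascade_iterate_shiftSum (n : ℕ) (p : ℤ →₀ ℂ) (f : ℝ → (Fin r → ℂ)) :
    (cascade a)^[n] (shiftSum p f)
      = fun x => ∑ l ∈ p.support, p l • (cascade a)^[n] f (x - l / 2 ^ n) := by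
  have h : shiftSum p f = fun x => ∑ l ∈ p.support, p l • f (x - l) := rfl
  rw [h, cascade_iterate_sum]
  funext x
  refine Finset.sum_congr rfl fun l _ => ?_
  rw [cascade_iterate_smul, cascade_iterate_comp_sub]

lemma iteratedDeriv_smul_comp_sub {f : ℝ → (Fin r → ℂ)} {j : ℕ} (hf : ContDiff ℝ j f) (c : ℂ)
    (t x : ℝ) : iteratedDeriv j (fun x => c • f (x - t)) x = c • iteratedDeriv j f (x - t) := by
  have h1 : ContDiff ℝ j fun x => f (x - t) := hf.comp (contDiff_id.sub contDiff_const)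
  rw [iteratedDeriv_const_smul_fun h1, iteratedDeriv_comp_sub_const]

/-- Uniform continuity of a compactly supported function. -/
lemma unifZero_comp_sub {f : ℝ → (Fin r → ℂ)} (hf : Continuous f) (hs : HasCompactSupport f) (l : ℝ) :
    UnifZero fun (n : ℕ) (x : ℝ) => f (x - l / 2 ^ n) - f x := by
  intro ε hε
  obtain ⟨δ, hδ, h⟩ := Metric.uniformContinuous_iff.mp (hs.uniformContinuous_of_continuous hf) ε hε
  have h1 : Tendsto (fun n : ℕ => l * (2⁻¹ : ℝ) ^ n) atTop (𝓝 (l * 0)) :=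
    (tendsto_pow_atTop_nhds_zero_of_lt_one (by norm_num) (by norm_num)).const_mul l
  rw [mul_zero] at h1
  filter_upwards [h1.eventually (Metric.ball_mem_nhds 0 hδ)] with n hn x
  rw [← dist_eq_norm]
  refine (h ?_).le
  rw [Real.dist_eq, sub_sub_cancel_left, abs_neg]
  rwa [Real.dist_eq, sub_zero, inv_pow, ← div_eq_mul_inv] at hn

/-- Under exponential decay, the cascade iterates of every admissible initial function converge to
the refinable function, together with their derivatives up to order `m`. -/
lemma unifZero_cascade_sub (h : ExpDecay a v m) (hv : IsMatchingFilter a v (m + 1))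
    {g : ℝ → (Fin r → ℂ)} (hg : IsRefinableFun a v m g) {f : ℝ → (Fin r → ℂ)} (hf : ContDiff ℝ m f)
    (hs : HasCompactSupport f) (h0 : symbol v 0 ⬝ᵥ ft f 0 = 1)
    (hk : ∀ k : ℤ, k ≠ 0 → PowerSeries.X ^ (m + 1) ∣ rf v f k) {j : ℕ} (hj : j ≤ m) :
    UnifZero fun n x => iteratedDeriv j ((cascade a)^[n] f) x - iteratedDeriv j g x := by
  obtain ⟨lam, hl0, hl1, hdec⟩ := h
  have hgd := hg.contDiff
  have hgs := hg.hasCompactSupport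
  -- a combination `S` of integer shifts of `g` has the same Taylor series `v̂ Ŝ` as `f`, so that
  -- the iterates of `f - S` decay, whereas those of `S` are combinations of the `g(· - 2^{-n} l)`
  obtain ⟨p, hp⟩ := exists_symbol_jet (rf v f 0) (m + 1)
  set S := shiftSum p g with hS
  have hSd : ContDiff ℝ m S := contDiff_shiftSum p hgd
  have hSs : HasCompactSupport S := hasCompactSupport_shiftSum p hgs
  set H : ℝ → (Fin r → ℂ) := fun x => f x - S x with hH
  have hjm : (j : WithTop ℕ∞) ≤ m := by exact_mod_cast hj
  have hHd : ContDiff ℝ j H := (hf.sub hSd).of_le hjm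
  have hHs : HasCompactSupport H := hs.sub hSs
  have hHv : ∀ k : ℤ, PowerSeries.X ^ (m + 1) ∣ rf v H k := by
    intro k
    rw [hH, rf_sub hf.continuous hs hSd.continuous hSs, hS, rf_shiftSum p hgd.continuous hgs]
    rcases eq_or_ne k 0 with rfl | hk0
    · have h1 := ((hg.rf_zero hv).mul_left (jet (symbol p))).add hp
      convert h1.neg_right using 1; ring
    · exact (hk k hk0).sub ((hg.rf_of_ne_zero hv hk0).mul_left _)
  obtain ⟨C, hC⟩ := exists_iteratedDeriv_cascade_le hdec hHd hHs hHv
  have hp1 : ∑ l ∈ p.support, p l = 1 := by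
    have h1 := PowerSeries.X_pow_dvd_iff.mp hp 0 m.succ_pos
    rw [map_sub, coeff_zero_jet, rf, coeff_zero_jet, Int.cast_zero, mul_zero, add_zero, h0,
      sub_eq_zero] at h1
    rw [← h1, symbol_eq_sum, Finsupp.sum]
    simp [ek_zero_right]
  have h1 : UnifZero fun n x => iteratedDeriv j ((cascade a)^[n] H) x := by
    refine UnifZero.of_le (b := fun n => C * (2 ^ j * lam) ^ n) ?_ hC
    have := (tendsto_pow_atTop_nhds_zero_of_lt_one (r := 2 ^ j * lam) (by positivity)
      (lt_of_le_of_lt (mul_le_mul_of_nonneg_right (pow_le_pow_right₀ one_le_two hj) hl0.le)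
        hl1)).const_mul C
    rwa [mul_zero] at this
  have hgj : ContDiff ℝ j g := hgd.of_le hjm
  have h2 : UnifZero fun (n : ℕ) (x : ℝ) => ∑ l ∈ p.support,
      p l • (iteratedDeriv j g (x - l / 2 ^ n) - iteratedDeriv j g x) :=
    UnifZero.sum _ fun l _ => (unifZero_comp_sub (hgj.continuous_iteratedDeriv j le_rfl)
      (hasCompactSupport_iteratedDeriv hgs j) l).const_smul (p l)
  have key : ∀ n x, iteratedDeriv j ((cascade a)^[n] f) x - iteratedDeriv j g x
      = iteratedDeriv j ((cascade a)^[n] H) x + ∑ l ∈ p.support,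
        p l • (iteratedDeriv j g (x - l / 2 ^ n) - iteratedDeriv j g x) := by
    intro n x
    have h3 : f = fun x => H x + S x := by funext x; simp [hH]
    have h4 : iteratedDeriv j ((cascade a)^[n] S) x
        = ∑ l ∈ p.support, p l • iteratedDeriv j g (x - l / 2 ^ n) := by
      rw [hS, cascade_iterate_shiftSum, hg.cascade_iterate_eq, iteratedDeriv_fun_sum]
      · exact Finset.sum_congr rfl fun l _ => iteratedDeriv_smul_comp_sub hgj _ _ _
      · intro l _
        have h5 : ContDiff ℝ j fun x : ℝ => g (x - l / 2 ^ n) :=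
          hgj.comp (contDiff_id.sub contDiff_const)
        exact (h5.const_smul (p l)).contDiffAt
    conv_lhs => rw [h3]
    rw [cascade_iterate_add, iteratedDeriv_fun_add
      (contDiff_cascade_iterate a hHd n).contDiffAt
      ((contDiff_cascade_iterate a hSd n).of_le hjm).contDiffAt, h4]
    simp only [smul_sub, Finset.sum_sub_distrib, ← Finset.sum_smul, hp1, one_smul]
    abel
  intro ε hε
  filter_upwards [(h1.add h2) ε hε] with n hn x
  rw [key]
  exact hn x

lemma isAdmissibleInitial_iff {f : ℝ → (Fin r → ℂ)} : IsAdmissibleInitial v m f ↔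
    ContDiff ℝ m f ∧ HasCompactSupport f ∧ symbol v 0 ⬝ᵥ ft f 0 = 1 ∧
      ∀ k : ℤ, k ≠ 0 → PowerSeries.X ^ (m + 1) ∣ rf v f k := by
  simp only [IsAdmissibleInitial, rf, ← agreeAtZero_zero_iff, fourierFun_eq_ft]

/-- `C^m` convergence of the cascade algorithm in terms of real bounds on each derivative. -/
lemma cascadeConverges_iff : CascadeConverges a v m ↔ ∀ f : ℝ → (Fin r → ℂ),
    IsAdmissibleInitial v m f → ∀ ε > 0, ∃ N : ℕ, ∀ n ≥ N, ∀ n' ≥ N, ∀ j ≤ m, ∀ x,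
      ‖iteratedDeriv j ((cascade a)^[n] f) x - iteratedDeriv j ((cascade a)^[n'] f) x‖ ≤ ε := by
  have hsub : ∀ f : ℝ → (Fin r → ℂ), IsAdmissibleInitial v m f → ∀ n n' : ℕ, ∀ j ≤ m, ∀ x,
      iteratedDeriv j (fun x => (cascade a)^[n] f x - (cascade a)^[n'] f x) x
        = iteratedDeriv j ((cascade a)^[n] f) x - iteratedDeriv j ((cascade a)^[n'] f) x := by
    intro f hf n n' j hj x
    have hd := fun n => ((contDiff_cascade_iterate a hf.1 n).of_le
      (by exact_mod_cast hj : (j : WithTop ℕ∞) ≤ m)).contDiffAt (x := x)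
    exact iteratedDeriv_fun_sub (hd n) (hd n')
  refine forall₂_congr fun f hf => ⟨fun h ε hε => ?_, fun h ε hε => ?_⟩
  · obtain ⟨N, hN⟩ := h (ENNReal.ofReal ε) (ENNReal.ofReal_pos.mpr hε)
    refine ⟨N, fun n hn n' hn' j hj x => ?_⟩
    rw [← hsub f hf n n' j hj, ← enorm_le_ofReal_iff hε.le]
    refine le_trans ?_ (hN n hn n' hn').le
    rw [cmNorm]
    refine le_trans ?_ (Finset.single_le_sum (fun _ _ => zero_le) (Finset.mem_range.mpr
      (Nat.lt_succ_of_le hj)))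
    exact le_iSup (fun x => ‖iteratedDeriv j (fun x => (cascade a)^[n] f x
      - (cascade a)^[n'] f x) x‖ₑ) x
  · obtain ⟨ε', hε', hlt⟩ := ENNReal.lt_iff_exists_nnreal_btwn.mp hε
    have hε'0 : (0 : ℝ) < ε' := by exact_mod_cast hε'
    obtain ⟨N, hN⟩ := h (ε' / (m + 1)) (by positivity)
    refine ⟨N, fun n hn n' hn' => lt_of_le_of_lt ?_ hlt⟩
    have h1 : ∀ j ∈ Finset.range (m + 1), ⨆ x : ℝ, ‖iteratedDeriv j (fun x => (cascade a)^[n] f x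
        - (cascade a)^[n'] f x) x‖ₑ ≤ ENNReal.ofReal (ε' / (m + 1)) := fun j hj => by
      refine iSup_le fun x => ?_
      have hj := Nat.lt_succ_iff.mp (Finset.mem_range.mp hj)
      rw [hsub f hf n n' j hj, enorm_le_ofReal_iff (by positivity)]
      exact hN n hn n' hn' j hj x
    refine (Finset.sum_le_sum h1).trans (le_of_eq ?_)
    rw [Finset.sum_const, Finset.card_range, nsmul_eq_mul, ← ENNReal.ofReal_natCast,
      ← ENNReal.ofReal_mul (by positivity), ← ENNReal.ofReal_coe_nnreal]
    congr 1
    push_cast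
    field_simp

/-- The iterates of an admissible function converge uniformly, and are thus a Cauchy sequence. -/
lemma cascadeConverges_of_expDecay (h : ExpDecay a v m) (hv : IsMatchingFilter a v (m + 1)) :
    CascadeConverges a v m := by
  obtain ⟨g, hg⟩ := exists_isRefinableFun hv h
  rw [cascadeConverges_iff]
  intro f hf ε hε
  obtain ⟨hfd, hfs, hf0, hfk⟩ := isAdmissibleInitial_iff.mp hf
  have h1 : ∀ᶠ n : ℕ in atTop, ∀ j ∈ Finset.range (m + 1), ∀ x,
      ‖iteratedDeriv j ((cascade a)^[n] f) x - iteratedDeriv j g x‖ ≤ ε / 2 :=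
    (Filter.eventually_all_finset _).mpr fun j hj => unifZero_cascade_sub h hv hg hfd hfs hf0 hfk
      (Nat.lt_succ_iff.mp (Finset.mem_range.mp hj)) _ (half_pos hε)
  obtain ⟨N, hN⟩ := eventually_atTop.mp h1
  refine ⟨N, fun n hn n' hn' j hj x => ?_⟩
  have hj' := Finset.mem_range.mpr (Nat.lt_succ_of_le hj)
  have h2 := hN n hn j hj' x
  have h3 := hN n' hn' j hj' x
  rw [← sub_sub_sub_cancel_right _ _ (iteratedDeriv j g x)]
  exact (norm_sub_le _ _).trans (by linarith)

/-! ### From cascade convergence to decay -/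

/-- The combination `∑ₗ b(· - l) u(l)` of shifts of a scalar function. -/
def spread (b : ℝ → ℂ) (u : ℤ →₀ (Fin r → ℂ)) (x : ℝ) : Fin r → ℂ :=
  ∑ l ∈ u.support, b (x - l) • u l

lemma contDiff_spread {n : WithTop ℕ∞} {b : ℝ → ℂ} (hb : ContDiff ℝ n b) (u : ℤ →₀ (Fin r → ℂ)) :
    ContDiff ℝ n (spread b u) :=
  ContDiff.sum fun _ _ => (hb.comp (contDiff_id.sub contDiff_const)).smul contDiff_const

lemma hasCompactSupport_spread {b : ℝ → ℂ} (hs : HasCompactSupport b) (u : ℤ →₀ (Fin r → ℂ)) :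
    HasCompactSupport (spread b u) :=
  hasCompactSupport_finset_sum _ fun _ _ => (hasCompactSupport_comp_sub hs _).smul_right

lemma ft_smul_const (b : ℝ → ℂ) (y : Fin r → ℂ) (ξ : ℝ) : ft (fun x => b x • y) ξ = ft b ξ • y := by
  rw [ft, ft, ← integral_smul_const]
  exact MeasureTheory.integral_congr_ae (.of_forall fun x => by simp only [smul_assoc])

lemma ft_spread {b : ℝ → ℂ} (hb : Continuous b) (hs : HasCompactSupport b) (u : ℤ →₀ (Fin r → ℂ))
    (ξ : ℝ) : ft (spread b u) ξ = ft b ξ • symbol u ξ := by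
  have h : spread b u = fun x => ∑ l ∈ u.support, b (x - l) • u l := rfl
  rw [h, ft_sum, symbol_eq_sum, Finsupp.sum, Finset.smul_sum]
  · refine Finset.sum_congr rfl fun l _ => ?_
    rw [ft_smul_const (fun x => b (x - l)), ft_comp_sub, smul_eq_mul, smul_smul, mul_comm]
    simp [ek]
  · intro _ _; fun_prop
  · exact fun _ _ => (hasCompactSupport_comp_sub hs _).smul_right

lemma rf_spread {b : ℝ → ℂ} (hb : Continuous b) (hs : HasCompactSupport b) (u : ℤ →₀ (Fin r → ℂ))
    (k : ℤ) : rf v (spread b u) k = rc v u * jet fun ξ => ft b (ξ + 2 * Real.pi * (k : ℝ)) := by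
  rw [rc, ← jet_rowCol, ← jet_mul (contDiff_rowCol _ _) (contDiff_ft_comp_add hb hs _), rf]
  refine congrArg jet (funext fun ξ => ?_)
  rw [ft_spread hb hs, dotProduct_smul, smul_eq_mul, symbol_add_two_pi_mul, mul_comm, rowCol]

lemma iteratedDeriv_spread {b : ℝ → ℂ} {j : ℕ} (hb : ContDiff ℝ j b) (u : ℤ →₀ (Fin r → ℂ)) :
    iteratedDeriv j (spread b u) = spread (iteratedDeriv j b) u := by
  have h : spread b u = fun x => ∑ l ∈ u.support, b (x - l) • u l := rfl
  have hd : ∀ l : ℤ, ContDiff ℝ j fun x : ℝ => b (x - l) := fun l =>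
    hb.comp (contDiff_id.sub contDiff_const)
  have hd2 : ∀ l : ℤ, ContDiff ℝ j fun x : ℝ => b (x - l) • u l := fun l =>
    (hd l).smul contDiff_const
  funext x
  rw [h, iteratedDeriv_fun_sum fun l _ => (hd2 l).contDiffAt]
  refine Finset.sum_congr rfl fun l _ => ?_
  funext i
  rw [iteratedDeriv_apply (hd2 l)]
  simp only [Pi.smul_apply, smul_eq_mul, mul_comm _ (u l i)]
  rw [iteratedDeriv_const_mul _ (hd l).contDiffAt, iteratedDeriv_comp_sub_const]

/-- A function with `b^{(j)} = 0` is a polynomial; with compact support, its integral is `0`. -/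
lemma exists_iteratedDeriv_ne_zero {b : ℝ → ℂ} (hb : ContDiff ℝ ∞ b) (hs : HasCompactSupport b)
    (h : ft b 0 = 1) (j : ℕ) : ∃ x, iteratedDeriv j b x ≠ 0 := by
  by_contra! h0
  have h1 : ∀ ξ : ℝ, ξ ≠ 0 → ft b ξ = 0 := by
    intro ξ hξ
    have h2 := ft_iteratedDeriv (n := j) (hb.of_le (by exact_mod_cast le_top)) hs ξ
    rw [funext h0, ft] at h2
    simp only [smul_zero, MeasureTheory.integral_zero] at h2
    refine (smul_eq_zero.mp h2.symm).resolve_left (pow_ne_zero _ ?_)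
    exact mul_ne_zero Complex.I_ne_zero (by exact_mod_cast hξ)
  have h2 : Tendsto (ft b) (𝓝[≠] 0) (𝓝 (ft b 0)) :=
    ((contDiff_ft hb.continuous hs).continuous.tendsto 0).mono_left nhdsWithin_le_nhds
  have h3 : Tendsto (ft b) (𝓝[≠] 0) (𝓝 0) :=
    tendsto_const_nhds.congr' (by filter_upwards [self_mem_nhdsWithin] with ξ hξ; exact (h1 ξ hξ).symm)
  exact one_ne_zero (h.symm.trans (tendsto_nhds_unique h2 h3))

/-- Cascade convergence applied to two initial functions that differ by `∑ₗ b(· - l) u(l)`, with a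
bump `b` supported between two integers, shows that the data of `u` decay: the `m`-th derivatives of
the cascade iterates of the difference vanish at more and more dyadic points. -/
lemma decay_of_cascadeConverges (hv : IsMatchingFilter a v (m + 1)) (hc : CascadeConverges a v m) :
    ∀ u ∈ vanishing v (m + 1), DecaySeq a m u := by
  intro u hu
  rw [cascadeConverges_iff] at hc
  obtain ⟨f, hf, hfs, hf0, hfk⟩ := exists_normalized_initial hv.1 (m + 1)
  -- `G = ∑ₗ u(l) b(· - l)` with a bump `b` supported inside `(0, 1)`; both `f` and `f + G` are
  -- admissible, so the iterates of `G` form a Cauchy sequence in `C^m`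
  obtain ⟨b, hb, hbs, hb1, hbsupp⟩ := exists_smooth_bump (1 / 2) (ε := 1 / 4) (by norm_num)
  set G := spread b u with hG
  have hGd : ContDiff ℝ ∞ G := contDiff_spread hb u
  have hGs : HasCompactSupport G := hasCompactSupport_spread hbs u
  have hGv : ∀ k : ℤ, PowerSeries.X ^ (m + 1) ∣ rf v G k := fun k => by
    rw [hG, rf_spread hb.continuous hbs]
    exact (mem_vanishing_iff.mp hu).mul_right _
  have hdm : ∀ {F : ℝ → (Fin r → ℂ)}, ContDiff ℝ ∞ F → ContDiff ℝ m F := fun h =>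
    h.of_le (by exact_mod_cast le_top)
  have hadm1 : IsAdmissibleInitial v m f :=
    isAdmissibleInitial_iff.mpr ⟨hdm hf, hfs, dotProduct_ft_zero_eq_one hf0, hfk⟩
  have hrf : ∀ k, rf v (fun x => f x + G x) k = rf v f k + rf v G k :=
    rf_add hf.continuous hfs hGd.continuous hGs
  have hadm2 : IsAdmissibleInitial v m fun x => f x + G x :=
    isAdmissibleInitial_iff.mpr ⟨(hdm hf).add (hdm hGd), hfs.add hGs, dotProduct_ft_zero_eq_one (m := m) (by
      rw [hrf, add_sub_right_comm]; exact hf0.add (hGv 0)), fun k hk => by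
      rw [hrf]; exact (hfk k hk).add (hGv k)⟩
  have hGm : iteratedDeriv m G = spread (iteratedDeriv m b) u :=
    iteratedDeriv_spread (hb.of_le (by exact_mod_cast le_top)) u
  have hbm : ∀ x, iteratedDeriv m b x ≠ 0 → |x - 1 / 2| ≤ 1 / 4 := by
    intro x hx
    by_contra! hx2
    refine hx ?_
    have h1 : b =ᶠ[𝓝 x] fun _ => 0 := by
      have h2 : IsOpen {x : ℝ | 1 / 4 < |x - 1 / 2|} :=
        isOpen_lt continuous_const (by fun_prop)
      filter_upwards [h2.mem_nhds hx2] with y hy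
      by_contra hb0
      exact lt_asymm (hbsupp y hb0) hy
    rw [h1.iteratedDeriv_eq]
    simp
  have hGmc : Continuous (iteratedDeriv m G) := (hdm hGd).continuous_iteratedDeriv m le_rfl
  have hGms : HasCompactSupport (iteratedDeriv m G) := hasCompactSupport_iteratedDeriv hGs m
  -- `b^{(m)}` vanishes at the integers, so the derivatives of the iterates of `G` vanish at the
  -- dyadic points
  have hzero : sample (iteratedDeriv m G) hGms 0 = 0 := by
    ext1 j
    rw [sample_apply, hGm, spread, Finset.sum_eq_zero, Finsupp.zero_apply]
    intro l _
    have : iteratedDeriv m b (0 + j - l) = 0 := by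
      by_contra h
      have h1 := hbm _ h
      rw [zero_add, abs_le] at h1
      have h2 : (0 : ℝ) < ((j - l : ℤ) : ℝ) := by push_cast; linarith
      have h3 : ((j - l : ℤ) : ℝ) < 1 := by push_cast; linarith
      have h4 : 0 < j - l := by exact_mod_cast h2
      have h5 : j - l < 1 := by exact_mod_cast h3
      omega
    rw [this, zero_smul]
  -- at a suitable offset `y`, the samples of `G^{(m)}` are a nonzero multiple of `u`
  obtain ⟨y, hy⟩ := exists_iteratedDeriv_ne_zero hb hbs hb1 m
  have hy2 := abs_le.mp (hbm y hy)
  have hsample : sample (iteratedDeriv m G) hGms y = iteratedDeriv m b y • u := by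
    ext1 j
    rw [sample_apply, hGm, spread, Finsupp.smul_apply, Finset.sum_eq_single j]
    · rw [add_sub_cancel_right]
    · intro l _ hlj
      have : iteratedDeriv m b (y + j - l) = 0 := by
        by_contra h
        have h1 := abs_le.mp (hbm _ h)
        have h2 : (-1 : ℝ) < ((j - l : ℤ) : ℝ) := by push_cast; linarith
        have h3 : ((j - l : ℤ) : ℝ) < 1 := by push_cast; linarith
        have h4 : -1 < j - l := by exact_mod_cast h2
        have h5 : j - l < 1 := by exact_mod_cast h3
        omega
      rw [this, zero_smul]
    · intro hj
      rw [Finsupp.notMem_support_iff.mp hj, smul_zero]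
  have hcauchy : ∀ ε > 0, ∃ N : ℕ, ∀ n ≥ N, ∀ n' ≥ N, ∀ x,
      ‖iteratedDeriv m ((cascade a)^[n] G) x - iteratedDeriv m ((cascade a)^[n'] G) x‖ ≤ ε := by
    intro ε hε
    obtain ⟨N1, hN1⟩ := hc f hadm1 (ε / 2) (half_pos hε)
    obtain ⟨N2, hN2⟩ := hc _ hadm2 (ε / 2) (half_pos hε)
    refine ⟨max N1 N2, fun n hn n' hn' x => ?_⟩
    have h1 := hN1 n (le_of_max_le_left hn) n' (le_of_max_le_left hn') m le_rfl x
    have h2 := hN2 n (le_of_max_le_right hn) n' (le_of_max_le_right hn') m le_rfl x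
    have hadd : ∀ n, iteratedDeriv m ((cascade a)^[n] fun x => f x + G x) x
        = iteratedDeriv m ((cascade a)^[n] f) x + iteratedDeriv m ((cascade a)^[n] G) x := fun n => by
      rw [cascade_iterate_add]
      exact iteratedDeriv_fun_add (contDiff_cascade_iterate a (hdm hf) n).contDiffAt
        (contDiff_cascade_iterate a (hdm hGd) n).contDiffAt
    rw [hadd, hadd] at h2
    have h3 := (norm_sub_le _ _).trans (add_le_add h2 h1)
    rw [add_halves] at h3
    refine le_trans (le_of_eq (congrArg _ ?_)) h3
    abel
  have hdyadic : ∀ (n' : ℕ) (k : ℤ), iteratedDeriv m ((cascade a)^[n'] G) ((k : ℝ) / 2 ^ n') = 0 := by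
    intro n' k
    have := cascade_iterate_apply a n' hGms 0 k
    rw [zero_add, hzero, map_zero, Finsupp.zero_apply] at this
    rw [iteratedDeriv_cascade_iterate a (hdm hGd)]
    simp only [this, smul_zero]
  intro ε hε
  obtain ⟨N, hN⟩ := hcauchy (ε * ‖iteratedDeriv m b y‖) (mul_pos hε (norm_pos_iff.mpr hy))
  filter_upwards [eventually_ge_atTop N] with n hn k
  -- the derivative of the iterate of order `n` is small at all dyadic points, hence everywhere
  have hsmall : ∀ x, ‖iteratedDeriv m ((cascade a)^[n] G) x‖ ≤ ε * ‖iteratedDeriv m b y‖ := by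
    intro x
    have hlim : Tendsto (fun n' : ℕ => ((⌊2 ^ n' * x⌋ : ℤ) : ℝ) / 2 ^ n') atTop (𝓝 x) := by
      have h1 : Tendsto (fun n' : ℕ => x - (2⁻¹ : ℝ) ^ n') atTop (𝓝 (x - 0)) :=
        tendsto_const_nhds.sub (tendsto_pow_atTop_nhds_zero_of_lt_one (by norm_num) (by norm_num))
      rw [sub_zero] at h1
      refine tendsto_of_tendsto_of_tendsto_of_le_of_le h1 tendsto_const_nhds (fun n' => ?_)
        fun n' => ?_
      · simp only
        rw [le_div_iff₀ (by positivity), sub_mul, ← mul_pow, inv_mul_cancel₀ two_ne_zero, one_pow,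
          mul_comm x]
        exact (Int.sub_one_lt_floor _).le
      · simp only
        rw [div_le_iff₀ (by positivity), mul_comm x]
        exact Int.floor_le _
    have hcont : Continuous fun x => ‖iteratedDeriv m ((cascade a)^[n] G) x‖ :=
      ((contDiff_cascade_iterate a (hdm hGd) n).continuous_iteratedDeriv m le_rfl).norm
    refine le_of_tendsto ((hcont.tendsto x).comp hlim) ?_
    filter_upwards [eventually_ge_atTop N] with n' hn'
    have := hN n hn n' hn' (((⌊2 ^ n' * x⌋ : ℤ) : ℝ) / 2 ^ n')
    rwa [hdyadic, sub_zero] at this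
  have h1 := hsmall ((y + k) / 2 ^ n)
  rw [iteratedDeriv_cascade_iterate a (hdm hGd)] at h1
  simp only [cascade_iterate_apply a n hGms] at h1
  rw [hsample, map_smul, Finsupp.smul_apply, norm_smul, norm_smul, norm_pow, RCLike.norm_ofNat] at h1
  refine le_of_mul_le_mul_right (le_trans (le_of_eq ?_) h1) (norm_pos_iff.mpr hy)
  ring

end

/-! ### Convergence of the basis data -/

lemma jet_pow {f : ℝ → ℂ} (hf : ContDiff ℝ ∞ f) (n : ℕ) : jet (fun ξ => f ξ ^ n) = jet f ^ n := by
  induction n with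
  | zero => simp only [pow_zero, jet_one]
  | succ n ih => simp only [pow_succ]; rw [jet_mul (hf.pow n) hf, ih]

section

variable {a : ℤ →₀ Matrix (Fin r) (Fin r) ℂ} {v : ℤ →₀ (Fin r → ℂ)} {m : ℕ}

lemma rc_sum {ι : Type*} (s : Finset ι) (u : ι → (ℤ →₀ (Fin r → ℂ))) :
    rc v (∑ i ∈ s, u i) = ∑ i ∈ s, rc v (u i) := by
  classical
  induction s using Finset.induction_on with
  | empty =>
    have := rc_smul v 0 0
    simpa using this
  | insert i s hi ih => rw [Finset.sum_insert hi, Finset.sum_insert hi, rc_add, ih]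

/-- The integer samples of the derivatives of a refinable function have prescribed moments. -/
lemma IsRefinableFun.rc_sample (hv : IsMatchingFilter a v (m + 1)) {g : ℝ → (Fin r → ℂ)}
    (hg : IsRefinableFun a v m g) {i : ℕ} (hi : i ≤ m)
    (hs : HasCompactSupport (iteratedDeriv i g)) :
    PowerSeries.X ^ (m + 1) ∣
      rc v (sample (iteratedDeriv i g) hs 0) - (PowerSeries.C Complex.I * PowerSeries.X) ^ i := by
  have hgi : ContDiff ℝ i g := hg.contDiff.of_le (by exact_mod_cast hi)
  have hgs := hg.hasCompactSupport
  have h1 := X_pow_dvd_jet_mul_rc_sample_sub (hgi.continuous_iteratedDeriv i le_rfl) hs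
    (fun k hk => by
      rw [rf_iteratedDeriv hgi hgs]; exact (hg.rf_of_ne_zero hv hk).mul_left _) 0
  rw [rf_iteratedDeriv hgi hgs, jet_pow (contDiff_I_mul_add _), jet_I_mul_add] at h1
  simp only [Complex.ofReal_zero, mul_zero, zero_mul, neg_zero, Complex.exp_zero, jet_one, one_mul,
    Int.cast_zero, map_zero, add_zero] at h1
  have h2 := h1.add ((hg.rf_zero hv).mul_left ((PowerSeries.C Complex.I * PowerSeries.X) ^ i))
  convert h2 using 1
  ring

/-- Under exponential decay, the basis data converge for every `u`: after subtracting the samples of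
the derivatives of `g` with the right coefficients, `u` has vanishing moments. -/
lemma basisDataConverges_of_expDecay (h : ExpDecay a v m) (hv : IsMatchingFilter a v (m + 1))
    {g : ℝ → (Fin r → ℂ)} (hg : IsRefinableFun a v m g) (u : ℤ →₀ (Fin r → ℂ)) :
    BasisDataConverges a v u (ld m (rowCol v u)) g := by
  set j := ld m (rowCol v u) with hj
  have hjm : j ≤ m := ld_le _ _
  have hgs := fun i => hasCompactSupport_iteratedDeriv hg.hasCompactSupport i
  have hgi : ∀ i ≤ m, ContDiff ℝ i g := fun i hi => hg.contDiff.of_le (by exact_mod_cast hi)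
  set c : ℕ → ℂ := fun i => beta v u i with hc
  have hc0 : ∀ i < j, c i = 0 := fun i hi => by
    have h1 : u ∈ vanishing v j := mem_vanishing_ld v u m
    exact beta_eq_zero (vanishing_anti _ (Nat.succ_le_of_lt hi) h1)
  -- the samples of `g^{(i)}` have the moments `(iξ)^i`; subtracting the right combination from `u`
  -- leaves a sequence `w` in `𝒱_{m,v}`
  set w := u + (-1 : ℂ) • ∑ i ∈ Finset.range (m + 1), c i • sample (iteratedDeriv i g) (hgs i) 0 with hw
  have hwv : w ∈ vanishing v (m + 1) := by
    rw [mem_vanishing_iff]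
    change _ ∣ rc v w
    have h1 : PowerSeries.X ^ (m + 1) ∣ ∑ i ∈ Finset.range (m + 1), PowerSeries.C (c i) *
        (rc v (sample (iteratedDeriv i g) (hgs i) 0) -
          (PowerSeries.C Complex.I * PowerSeries.X) ^ i) :=
      Finset.dvd_sum fun i hi =>
        (hg.rc_sample hv (Nat.lt_succ_iff.mp (Finset.mem_range.mp hi)) _).mul_left _
    have h2 : PowerSeries.X ^ (m + 1) ∣ rc v u - ∑ i ∈ Finset.range (m + 1),
        PowerSeries.C (c i) * (PowerSeries.C Complex.I * PowerSeries.X) ^ i := by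
      rw [PowerSeries.X_pow_dvd_iff]
      intro s hs
      rw [map_sub, map_sum, Finset.sum_eq_single s, show c s = _ from beta_eq v u s, mul_pow, ← map_pow,
        PowerSeries.coeff_C_mul, PowerSeries.coeff_C_mul, PowerSeries.coeff_X_pow_self, mul_one,
        div_mul_cancel₀ _ (pow_ne_zero _ Complex.I_ne_zero), sub_self]
      · intro i _ his
        rw [mul_pow, ← map_pow, PowerSeries.coeff_C_mul, PowerSeries.coeff_C_mul,
          PowerSeries.coeff_X_pow, if_neg his.symm, mul_zero, mul_zero]
      · intro h; exact absurd (Finset.mem_range.mpr hs) h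
    convert h2.sub h1 using 1
    rw [hw, rc_add, rc_smul, rc_sum]
    simp only [rc_smul, mul_sub, Finset.sum_sub_distrib, map_neg, map_one]
    ring
  obtain ⟨lam, hl0, hl1, hdec⟩ := h
  have hw2 : UnifZero fun (n : ℕ) (k : ℤ) => (2 : ℂ) ^ (j * n) • W a n w k := by
    intro ε hε
    filter_upwards [(hdec w hwv).decaySeq hl0 hl1 ε hε] with n hn k
    refine le_trans ?_ (hn k)
    rw [norm_smul, norm_pow, RCLike.norm_ofNat]
    exact mul_le_mul_of_nonneg_right (pow_le_pow_right₀ one_le_two (Nat.mul_le_mul_right n hjm))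
      (norm_nonneg _)
  have hsamp : ∀ i ≤ m, ∀ (n : ℕ) (k : ℤ), W a n (sample (iteratedDeriv i g) (hgs i) 0) k
      = ((2 : ℂ) ^ (i * n))⁻¹ • iteratedDeriv i g ((k : ℝ) / 2 ^ n) := by
    intro i hi n k
    have h1 := iteratedDeriv_cascade_iterate a (hgi i hi) n
    rw [hg.cascade_iterate_eq] at h1
    have h2 := cascade_iterate_apply a n (hgs i) 0 k
    rw [zero_add] at h2
    conv_rhs => rw [h1]
    rw [← h2, smul_smul, inv_mul_cancel₀ (pow_ne_zero _ two_ne_zero), one_smul]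
  -- the samples of `g^{(i)}` contribute `2^{(j-i)n} g^{(i)}(2^{-n} k)`: the coefficient vanishes
  -- for `i < j`, the limit is attained exactly for `i = j`, and the factor tends to `0` for `i > j`
  have hterm : ∀ i ∈ Finset.range (m + 1), UnifZero fun (n : ℕ) (k : ℤ) =>
      c i • ((2 : ℂ) ^ (j * n) • W a n (sample (iteratedDeriv i g) (hgs i) 0) k
        - if i = j then iteratedDeriv j g ((k : ℝ) / 2 ^ n) else 0) := by
    intro i hi
    have him := Nat.lt_succ_iff.mp (Finset.mem_range.mp hi)
    rcases lt_trichotomy i j with hij | hij | hij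
    · intro ε hε
      filter_upwards with n k
      rw [hc0 i hij, zero_smul, norm_zero]
      exact hε.le
    · intro ε hε
      filter_upwards with n k
      rw [if_pos hij, hsamp i him, hij, smul_smul, mul_inv_cancel₀ (pow_ne_zero _ two_ne_zero), one_smul,
        sub_self, smul_zero, norm_zero]
      exact hε.le
    · refine UnifZero.const_smul ?_ (c i)
      obtain ⟨S, hS⟩ := exists_norm_bound ((hgi i him).continuous_iteratedDeriv i le_rfl) (hgs i)
      have h1 : Tendsto (fun n : ℕ => (2⁻¹ : ℝ) ^ n * S) atTop (𝓝 (0 * S)) :=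
        (tendsto_pow_atTop_nhds_zero_of_lt_one (by norm_num) (by norm_num)).mul_const S
      rw [zero_mul] at h1
      refine UnifZero.of_le h1 fun n k => ?_
      have hS0 : 0 ≤ S := (norm_nonneg _).trans (hS 0)
      rw [if_neg hij.ne', sub_zero, hsamp i him, smul_smul, norm_smul, norm_mul, norm_inv, norm_pow,
        norm_pow, RCLike.norm_ofNat]
      refine mul_le_mul ?_ (hS _) (norm_nonneg _) (by positivity)
      rw [inv_pow, ← div_eq_mul_inv, div_le_iff₀ (by positivity), ← div_eq_inv_mul,
        le_div_iff₀ (by positivity), ← pow_add]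
      refine pow_le_pow_right₀ one_le_two ?_
      nlinarith
  rw [basisDataConverges_iff]
  intro ε hε
  filter_upwards [(hw2.add (UnifZero.sum _ hterm)) ε hε] with n hn k
  refine le_trans (le_of_eq (congrArg _ ?_)) (hn k)
  have h1 : u = w + ∑ i ∈ Finset.range (m + 1), c i • sample (iteratedDeriv i g) (hgs i) 0 := by
    rw [hw, neg_one_smul]; abel
  have h2 : W a n u k = W a n w k +
      ∑ i ∈ Finset.range (m + 1), c i • W a n (sample (iteratedDeriv i g) (hgs i) 0) k := by
    conv_lhs => rw [h1]
    rw [map_add, map_sum, Finsupp.add_apply, Finsupp.finsetSum_apply]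
    simp only [map_smul, Finsupp.smul_apply]
  rw [h2, smul_add, add_sub_assoc]
  congr 1
  simp only [smul_sub, Finset.sum_sub_distrib, Finset.smul_sum]
  congr 1
  · exact Finset.sum_congr rfl fun i _ => smul_comm _ _ _
  · rw [Finset.sum_eq_single j]
    · rw [if_pos rfl]
    · intro i _ hij; rw [if_neg hij, smul_zero]
    · intro h; exact absurd (Finset.mem_range.mpr (Nat.lt_succ_of_le hjm)) h

end

/-! ### Taylor approximation with uniform remainder -/

/-- Taylor's formula with the modulus of continuity of the highest derivative. -/
lemma norm_sub_taylor_le {E : Type*} [NormedAddCommGroup E] [NormedSpace ℝ E] (m : ℕ) :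
    ∀ {f : ℝ → E}, ContDiff ℝ m f → ∀ {x M δ : ℝ},
      (∀ t, |t| ≤ δ → ‖iteratedDeriv m f (x + t) - iteratedDeriv m f x‖ ≤ M) → ∀ h, |h| ≤ δ →
      ‖f (x + h) - ∑ s ∈ Finset.range (m + 1), (h ^ s / (s.factorial : ℝ)) • iteratedDeriv s f x‖
        ≤ M * |h| ^ m := by
  induction m with
  | zero =>
    intro f _ x M δ hM h hh
    simpa using hM h hh
  | succ m ih =>
    intro f hf x M δ hM h hh
    have hf1 : ContDiff ℝ 1 f := hf.of_le (by exact_mod_cast Nat.succ_le_succ m.zero_le)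
    have hfd : ContDiff ℝ m (deriv f) :=
      (contDiff_succ_iff_deriv.mp (by exact_mod_cast hf)).2.2
    have hM0 : 0 ≤ M := (norm_nonneg _).trans (hM h hh)
    set F : ℝ → E := fun t => f (x + t) - ∑ s ∈ Finset.range (m + 1 + 1),
      (t ^ s / (s.factorial : ℝ)) • iteratedDeriv s f x with hF
    have hpow : ∀ (s : ℕ) (t : ℝ), HasDerivAt (fun t : ℝ => t ^ (s + 1) / ((s + 1).factorial : ℝ))
        (t ^ s / (s.factorial : ℝ)) t := by
      intro s t
      refine ((hasDerivAt_pow (s + 1) t).div_const _).congr_deriv ?_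
      have h1 : ((s + 1 : ℕ) : ℝ) ≠ 0 := by positivity
      have h2 : (s.factorial : ℝ) ≠ 0 := by positivity
      rw [Nat.factorial_succ, Nat.add_sub_cancel]
      push_cast at h1 ⊢
      field_simp
    have hFd : ∀ t, HasDerivAt F (deriv f (x + t) - ∑ s ∈ Finset.range (m + 1),
        (t ^ s / (s.factorial : ℝ)) • iteratedDeriv s (deriv f) x) t := by
      intro t
      have h1 : HasDerivAt (fun t => f (x + t)) (deriv f (x + t)) t :=
        ((hf1.differentiable one_ne_zero) _).hasDerivAt.comp_const_add x t
      have h2 : HasDerivAt (fun t : ℝ => ∑ s ∈ Finset.range (m + 1 + 1),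
          (t ^ s / (s.factorial : ℝ)) • iteratedDeriv s f x)
          (∑ s ∈ Finset.range (m + 1), (t ^ s / (s.factorial : ℝ)) • iteratedDeriv s (deriv f) x) t := by
        simp only [Finset.sum_range_succ' _ (m + 1), pow_zero, iteratedDeriv_succ']
        exact (HasDerivAt.fun_sum fun s _ => (hpow s t).smul_const _).add_const _
      exact h1.fun_sub h2
    have hbound : ∀ t ∈ Set.Icc (-|h|) |h|, ‖deriv f (x + t) - ∑ s ∈ Finset.range (m + 1),
        (t ^ s / (s.factorial : ℝ)) • iteratedDeriv s (deriv f) x‖ ≤ M * |h| ^ m := by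
      intro t ht
      have hth : |t| ≤ |h| := abs_le.mpr ht
      refine (ih (M := M) (δ := δ) hfd (fun t ht => ?_) t (hth.trans hh)).trans ?_
      · simpa only [iteratedDeriv_succ'] using hM t ht
      · gcongr
    have hmv := (convex_Icc (-|h|) |h|).norm_image_sub_le_of_norm_hasDerivWithin_le
      (fun t _ => (hFd t).hasDerivWithinAt) hbound (x := 0) (y := h)
      (by simp) ⟨neg_abs_le h, le_abs_self h⟩
    have hF0 : F 0 = 0 := by
      simp [hF, Finset.sum_range_succ' _ (m + 1)]
    rw [hF0, sub_zero, sub_zero, Real.norm_eq_abs, mul_assoc, ← pow_succ] at hmv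
    exact hmv

/-! ### Periodization -/

/-- The `2π`-periodization of a compactly supported function. -/
def per (p : ℝ → ℂ) (ξ : ℝ) : ℂ := ∑ᶠ k : ℤ, p (ξ + 2 * Real.pi * (k : ℝ))

lemma abs_le_of_translate {R R₀ ξ : ℝ} {k : ℤ} (hξ : |ξ| ≤ R₀)
    (h : |ξ + 2 * Real.pi * (k : ℝ)| ≤ R) : |(k : ℝ)| ≤ R + R₀ := by
  have h1 := abs_sub (ξ + 2 * Real.pi * (k : ℝ)) ξ
  rw [add_sub_cancel_left, abs_mul, abs_of_pos Real.two_pi_pos] at h1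
  have h2 := Real.pi_gt_three
  nlinarith [abs_nonneg (k : ℝ)]

lemma exists_translates_zero {p : ℝ → ℂ} (hs : HasCompactSupport p) (R₀ : ℝ) :
    ∃ M : ℕ, ∀ ξ, |ξ| ≤ R₀ → ∀ k : ℤ, p (ξ + 2 * Real.pi * (k : ℝ)) ≠ 0 → |k| ≤ M := by
  obtain ⟨R, hR⟩ := exists_support_bound hs
  refine ⟨⌈(R : ℝ) + R₀⌉₊, fun ξ hξ k hk => ?_⟩
  have := (abs_le_of_translate hξ (hR _ hk)).trans (Nat.le_ceil _)
  exact_mod_cast this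

lemma per_eq_sum {p : ℝ → ℂ} {ξ : ℝ} {M : ℕ}
    (hM : ∀ k : ℤ, p (ξ + 2 * Real.pi * (k : ℝ)) ≠ 0 → |k| ≤ M) :
    per p ξ = ∑ k ∈ Finset.Icc (-(M : ℤ)) M, p (ξ + 2 * Real.pi * (k : ℝ)) := finsum_eq_Icc_sum hM

lemma per_eventuallyEq {p : ℝ → ℂ} (hs : HasCompactSupport p) (x : ℝ) : ∃ M : ℕ,
    per p =ᶠ[𝓝 x] fun ξ => ∑ k ∈ Finset.Icc (-(M : ℤ)) M, p (ξ + 2 * Real.pi * (k : ℝ)) := by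
  obtain ⟨M, hM⟩ := exists_translates_zero hs (|x| + 1)
  refine ⟨M, ?_⟩
  have h1 : {ξ : ℝ | |ξ| < |x| + 1} ∈ 𝓝 x :=
    (isOpen_lt continuous_abs continuous_const).mem_nhds
      (show |x| < |x| + 1 from lt_add_one _)
  filter_upwards [h1] with ξ hξ
  exact per_eq_sum (hM ξ (le_of_lt hξ))

lemma contDiff_per {p : ℝ → ℂ} (hp : ContDiff ℝ ∞ p) (hs : HasCompactSupport p) :
    ContDiff ℝ ∞ (per p) := by
  rw [contDiff_iff_contDiffAt]
  intro x
  obtain ⟨M, hM⟩ := per_eventuallyEq hs x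
  refine ContDiffAt.congr_of_eventuallyEq ?_ hM
  exact (ContDiff.sum fun k _ => hp.comp (contDiff_id.add contDiff_const)).contDiffAt

lemma per_add_two_pi_mul (p : ℝ → ℂ) (ξ : ℝ) (l : ℤ) : per p (ξ + 2 * Real.pi * (l : ℝ)) = per p ξ := by
  rw [per, per]
  conv_rhs => rw [← finsum_comp_equiv (Equiv.addRight l)]
  refine finsum_congr fun k => ?_
  congr 1
  simp only [Equiv.coe_addRight]
  push_cast; ring

/-- Unfolding an integral over the line. -/
lemma integral_eq_integral_per {F : ℝ → ℂ} (hF : Continuous F) (hs : HasCompactSupport F) :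
    ∫ ξ, F ξ = 2 * Real.pi * ∫ x in (0 : ℝ)..1, per F (2 * Real.pi * x) := by
  obtain ⟨M, hM⟩ := exists_translates_zero hs (2 * Real.pi)
  have h2π := Real.two_pi_pos
  have hFc : Continuous fun x : ℝ => F (2 * Real.pi * x) := by fun_prop
  have hFs : HasCompactSupport fun x : ℝ => F (2 * Real.pi * x) :=
    hs.comp_homeomorph (Homeomorph.mulLeft₀ (2 * Real.pi) h2π.ne')
  have h1 := (hFc.integrable_of_hasCompactSupport hFs).hasSum_intervalIntegral_comp_add_int
  have hx : ∀ x ∈ Set.uIcc (0 : ℝ) 1, |2 * Real.pi * x| ≤ 2 * Real.pi := by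
    intro x hx
    rw [Set.uIcc_of_le zero_le_one] at hx
    rw [abs_mul, abs_of_pos h2π, abs_of_nonneg hx.1]
    nlinarith [hx.2]
  have h2 : ∀ n ∉ Finset.Icc (-(M : ℤ)) M, ∫ x in (0 : ℝ)..1, F (2 * Real.pi * (x + n)) = 0 := by
    intro n hn
    rw [intervalIntegral.integral_congr (g := fun _ => 0), intervalIntegral.integral_zero]
    intro x hx'
    by_contra h
    change ¬ F (2 * Real.pi * (x + n)) = 0 at h
    rw [mul_add] at h
    exact hn (Finset.mem_Icc.mpr (abs_le.mp (hM _ (hx x hx') n h)))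
  have h3 := h1.unique (hasSum_sum_of_ne_finset_zero h2)
  rw [MeasureTheory.Measure.integral_comp_mul_left F, abs_of_pos (inv_pos.mpr h2π)] at h3
  rw [intervalIntegral.integral_congr (g := fun x => ∑ n ∈ Finset.Icc (-(M : ℤ)) M,
    F (2 * Real.pi * (x + n))), intervalIntegral.integral_finsetSum, ← h3, ← Complex.coe_smul, smul_eq_mul]
  · push_cast
    have : (Real.pi : ℂ) ≠ 0 := by exact_mod_cast Real.pi_ne_zero
    field_simp
  · intro n _
    exact Continuous.intervalIntegrable (by fun_prop) _ _
  · intro x hx'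
    simp only [mul_add]
    exact per_eq_sum (hM _ (hx x hx'))

/-! ### Dual symbols of stable functions -/

/-- By compactness of `[0, 2π]` times the unit sphere, finitely many translates suffice for
stability. -/
lemma exists_uniform_stability {Φ : ℝ → (Fin r → ℂ)} (hΦ : Continuous Φ)
    (hst : ∀ ξ : ℝ, Submodule.span ℂ (Set.range fun k : ℤ => Φ (ξ + 2 * Real.pi * (k : ℝ))) = ⊤) :
    ∃ K : ℕ, ∀ ξ ∈ Set.Icc 0 (2 * Real.pi), ∀ x : Fin r → ℂ, x ≠ 0 →
      ∃ k : ℤ, |k| ≤ K ∧ Φ (ξ + 2 * Real.pi * (k : ℝ)) ⬝ᵥ x ≠ 0 := by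
  have hpt : ∀ (ξ : ℝ) (x : Fin r → ℂ), x ≠ 0 →
      ∃ k : ℤ, Φ (ξ + 2 * Real.pi * (k : ℝ)) ⬝ᵥ x ≠ 0 := by
    intro ξ x hx
    by_contra! h
    let L : (Fin r → ℂ) →ₗ[ℂ] ℂ :=
      { toFun := fun w => w ⬝ᵥ x
        map_add' := fun w z => add_dotProduct w z x
        map_smul' := fun c w => smul_dotProduct c w x }
    have h1 : Submodule.span ℂ (Set.range fun k : ℤ => Φ (ξ + 2 * Real.pi * (k : ℝ)))
        ≤ LinearMap.ker L := Submodule.span_le.mpr (by rintro _ ⟨k, rfl⟩; exact h k)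
    rw [hst ξ] at h1
    exact hx (dotProduct_eq_zero_iff.mp fun w => by
      rw [dotProduct_comm]; exact h1 (Submodule.mem_top (x := w)))
  set U : ℕ → Set (ℝ × (Fin r → ℂ)) := fun K =>
    {p | ∃ k : ℤ, |k| ≤ K ∧ Φ (p.1 + 2 * Real.pi * (k : ℝ)) ⬝ᵥ p.2 ≠ 0} with hU
  have hUo : ∀ K, IsOpen (U K) := by
    intro K
    have : U K = ⋃ k : ℤ, ⋃ _ : |k| ≤ K,
        {p : ℝ × (Fin r → ℂ) | Φ (p.1 + 2 * Real.pi * (k : ℝ)) ⬝ᵥ p.2 ≠ 0} := by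
      ext p; simp [hU]
    rw [this]
    refine isOpen_iUnion fun k => isOpen_iUnion fun _ => ?_
    exact isOpen_ne_fun ((hΦ.comp (continuous_fst.add continuous_const)).dotProduct continuous_snd)
      continuous_const
  have hmono : Monotone U := by
    rintro K K' hK p ⟨k, hk, h⟩
    exact ⟨k, hk.trans (by exact_mod_cast hK), h⟩
  obtain ⟨K, hK⟩ := ((isCompact_Icc (a := (0 : ℝ)) (b := 2 * Real.pi)).prod
    (isCompact_sphere (0 : Fin r → ℂ) 1)).elim_directed_cover U hUo (by
      rintro ⟨ξ, x⟩ ⟨_, hx⟩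
      obtain ⟨k, hk⟩ := hpt ξ x (ne_zero_of_mem_unit_sphere (⟨x, hx⟩ : Metric.sphere _ _))
      exact Set.mem_iUnion.mpr ⟨k.natAbs, k, by simp, hk⟩) hmono.directed_le
  refine ⟨K, fun ξ hξ x hx => ?_⟩
  have hn : ‖x‖ ≠ 0 := norm_ne_zero_iff.mpr hx
  obtain ⟨k, hk, h⟩ := hK (a := (ξ, ((‖x‖⁻¹ : ℝ) : ℂ) • x)) ⟨hξ, by
    rw [mem_sphere_zero_iff_norm, norm_smul, Complex.norm_real, norm_inv, norm_norm,
      inv_mul_cancel₀ hn]⟩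
  refine ⟨k, hk, fun h0 => h ?_⟩
  simp only [dotProduct_smul, h0, smul_zero]

lemma contDiff_det {A : ℝ → Matrix (Fin r) (Fin r) ℂ} (hA : ∀ i j, ContDiff ℝ ∞ fun x => A x i j) :
    ContDiff ℝ ∞ fun x => (A x).det := by
  simp only [Matrix.det_apply]
  exact ContDiff.sum fun σ _ => (contDiff_prod fun i _ => hA _ _).const_smul _

lemma contDiff_inv_entry {A : ℝ → Matrix (Fin r) (Fin r) ℂ}
    (hA : ∀ i j, ContDiff ℝ ∞ fun x => A x i j) (hdet : ∀ x, (A x).det ≠ 0) (i j : Fin r) :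
    ContDiff ℝ ∞ fun x => (A x)⁻¹ i j := by
  simp only [Matrix.inv_def, Matrix.smul_apply, smul_eq_mul, Ring.inverse_eq_inv',
    Matrix.adjugate_apply]
  refine ((contDiff_det hA).inv hdet).mul (contDiff_det fun k l => ?_)
  by_cases hk : k = j
  · subst hk; simp only [Matrix.updateRow_self]; exact contDiff_const
  · simp only [Matrix.updateRow_ne hk]; exact hA k l

/-- For a stable smooth symbol `Φ`, every trigonometric polynomial vector is of the form
`∑ₖ Φ(ξ + 2πk) Ψ(ξ + 2πk)` with a smooth compactly supported scalar function `Ψ`: invert the Gram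
matrix `∑ₖ (χ Φ Φ*)(ξ + 2πk)`, where `χ` is a cutoff function. -/
lemma exists_dual_symbol {Φ : ℝ → (Fin r → ℂ)} (hΦ : ContDiff ℝ ∞ Φ)
    (hst : ∀ ξ : ℝ, Submodule.span ℂ (Set.range fun k : ℤ => Φ (ξ + 2 * Real.pi * (k : ℝ))) = ⊤)
    (u : ℤ →₀ (Fin r → ℂ)) : ∃ Ψ : ℝ → ℂ, ContDiff ℝ ∞ Ψ ∧ HasCompactSupport Ψ ∧
      ∀ ξ i, per (fun ξ => Φ ξ i * Ψ ξ) ξ = symbol u ξ i := by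
  obtain ⟨K, hK⟩ := exists_uniform_stability hΦ.continuous hst
  have h2π := Real.two_pi_pos
  set χ : ContDiffBump (0 : ℝ) := ⟨2 * Real.pi * (K + 1), 2 * Real.pi * (K + 1) + 1, by positivity,
    by linarith⟩ with hχ
  have hχd : ContDiff ℝ ∞ fun ξ => (χ ξ : ℂ) := Complex.ofRealCLM.contDiff.comp χ.contDiff
  have hχs : HasCompactSupport fun ξ => (χ ξ : ℂ) :=
    χ.hasCompactSupport.comp_left (g := fun x : ℝ => (x : ℂ)) Complex.ofReal_zero
  have hΦi : ∀ i, ContDiff ℝ ∞ fun ξ => Φ ξ i := contDiff_pi.mp hΦ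
  have hΦs : ∀ i, ContDiff ℝ ∞ fun ξ => star (Φ ξ i) := fun i =>
    Complex.conjCLE.contDiff.comp (hΦi i)
  set p : Fin r → Fin r → ℝ → ℂ := fun i j ξ => (χ ξ : ℂ) * (Φ ξ i * star (Φ ξ j)) with hp
  have hpd : ∀ i j, ContDiff ℝ ∞ (p i j) := fun i j => hχd.mul ((hΦi i).mul (hΦs j))
  have hps : ∀ i j, HasCompactSupport (p i j) := fun i j => hχs.mul_right
  -- the Gram matrix `G = ∑ₖ (χ Φ Φ*)(· + 2πk)` of the translates, cut off by `χ`, is invertible by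
  -- stability; `Ψ = χ Φ* G⁻¹ û` is then the required symbol
  set G : ℝ → Matrix (Fin r) (Fin r) ℂ := fun ξ => Matrix.of fun i j => per (p i j) ξ with hG
  have hGd : ∀ i j, ContDiff ℝ ∞ fun ξ => G ξ i j := fun i j => contDiff_per (hpd i j) (hps i j)
  have hGp : ∀ (ξ : ℝ) (l : ℤ), G (ξ + 2 * Real.pi * (l : ℝ)) = G ξ := fun ξ l => by
    ext i j; exact per_add_two_pi_mul _ _ _
  -- the action of the Gram matrix, as a finite sum
  have hGsum : ∀ ξ : ℝ, ∃ M : ℕ, K ≤ M ∧ (∀ k : ℤ, (χ (ξ + 2 * Real.pi * (k : ℝ)) : ℂ) ≠ 0 → |k| ≤ M) ∧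
      ∀ (z : Fin r → ℂ) (i : Fin r), (G ξ *ᵥ z) i = ∑ k ∈ Finset.Icc (-(M : ℤ)) M,
        (χ (ξ + 2 * Real.pi * (k : ℝ)) : ℂ) * (Φ (ξ + 2 * Real.pi * (k : ℝ)) i *
          (star (Φ (ξ + 2 * Real.pi * (k : ℝ))) ⬝ᵥ z)) := by
    intro ξ
    obtain ⟨M, hM⟩ := exists_translates_zero hχs |ξ|
    have hM' : ∀ k : ℤ, (χ (ξ + 2 * Real.pi * (k : ℝ)) : ℂ) ≠ 0 → |k| ≤ ((max M K : ℕ) : ℤ) :=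
      fun k hk => (hM ξ le_rfl k hk).trans (by exact_mod_cast le_max_left M K)
    refine ⟨max M K, le_max_right _ _, hM', fun z i => ?_⟩
    have h1 : ∀ j, G ξ i j = ∑ k ∈ Finset.Icc (-((max M K : ℕ) : ℤ)) (max M K : ℕ),
        p i j (ξ + 2 * Real.pi * (k : ℝ)) :=
      fun j => per_eq_sum fun k hk => hM' k fun h => hk (by simp only [hp, h, zero_mul])
    simp only [Matrix.mulVec, dotProduct, h1, Finset.sum_mul]
    rw [Finset.sum_comm]
    refine Finset.sum_congr rfl fun k _ => ?_
    rw [Finset.mul_sum, Finset.mul_sum]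
    refine Finset.sum_congr rfl fun j _ => ?_
    simp only [hp, Pi.star_apply]; ring
  have hdet : ∀ ξ, (G ξ).det ≠ 0 := by
    have hbase : ∀ ξ ∈ Set.Icc 0 (2 * Real.pi), (G ξ).det ≠ 0 := by
      intro ξ hξ h0
      obtain ⟨z, hz, hGz⟩ := Matrix.exists_mulVec_eq_zero_iff.mpr h0
      obtain ⟨M, hKM, -, hsum⟩ := hGsum ξ
      obtain ⟨k, hkK, hk⟩ := hK ξ hξ (star z) (star_ne_zero.mpr hz)
      -- `z* G z` is a sum of squares, in which the term of the index `k` does not vanish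
      have hquad : star z ⬝ᵥ (G ξ *ᵥ z) = ((∑ k ∈ Finset.Icc (-(M : ℤ)) M,
          χ (ξ + 2 * Real.pi * (k : ℝ)) *
            ‖Φ (ξ + 2 * Real.pi * (k : ℝ)) ⬝ᵥ star z‖ ^ 2 : ℝ) : ℂ) := by
        simp only [dotProduct, hsum, Finset.mul_sum]
        rw [Finset.sum_comm, Complex.ofReal_sum]
        refine Finset.sum_congr rfl fun k _ => ?_
        rw [Complex.ofReal_mul, Complex.ofReal_pow, ← Complex.mul_conj', map_sum, Finset.sum_mul,
          Finset.mul_sum]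
        refine Finset.sum_congr rfl fun i _ => ?_
        simp only [Pi.star_apply, map_mul, RCLike.star_def, Complex.conj_conj, Finset.mul_sum]
        refine Finset.sum_congr rfl fun j _ => ?_
        ring
      rw [hGz, dotProduct_zero] at hquad
      have hzero := Complex.ofReal_eq_zero.mp hquad.symm
      rw [Finset.sum_eq_zero_iff_of_nonneg fun k _ => mul_nonneg χ.nonneg (by positivity)] at hzero
      have hmem : k ∈ Finset.Icc (-(M : ℤ)) M :=
        Finset.mem_Icc.mpr (abs_le.mp (hkK.trans (by exact_mod_cast hKM)))
      have h1 := hzero k hmem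
      have hχ1 : χ (ξ + 2 * Real.pi * (k : ℝ)) = 1 := by
        refine χ.one_of_mem_closedBall ?_
        rw [Metric.mem_closedBall, Real.dist_eq, sub_zero]
        change _ ≤ 2 * Real.pi * (K + 1)
        have h2 : |(k : ℝ)| ≤ K := by exact_mod_cast hkK
        calc |ξ + 2 * Real.pi * (k : ℝ)| ≤ |ξ| + |2 * Real.pi * (k : ℝ)| := abs_add_le _ _
          _ ≤ 2 * Real.pi + 2 * Real.pi * K := by
              rw [abs_of_nonneg hξ.1, abs_mul, abs_of_pos h2π]
              exact add_le_add hξ.2 (mul_le_mul_of_nonneg_left h2 h2π.le)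
          _ = _ := by ring
      rw [hχ1, one_mul] at h1
      exact hk (norm_eq_zero.mp (pow_eq_zero_iff two_ne_zero |>.mp h1))
    intro ξ
    have h1 := hbase (ξ + 2 * Real.pi * ((-⌊ξ / (2 * Real.pi)⌋ : ℤ) : ℝ)) (by
      have h2 := Int.floor_le (ξ / (2 * Real.pi))
      have h3 := (Int.lt_floor_add_one (ξ / (2 * Real.pi))).le
      rw [le_div_iff₀ h2π] at h2
      rw [div_le_iff₀ h2π] at h3
      push_cast
      constructor <;> nlinarith)
    rwa [hGp] at h1
  set z : ℝ → (Fin r → ℂ) := fun ξ => (G ξ)⁻¹ *ᵥ symbol u ξ with hz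
  have hzd : ContDiff ℝ ∞ z := contDiff_mulVec (contDiff_symbol u) (contDiff_inv_entry hGd hdet)
  have hzp : ∀ (ξ : ℝ) (l : ℤ), z (ξ + 2 * Real.pi * (l : ℝ)) = z ξ := fun ξ l => by
    simp only [hz, hGp, symbol_add_two_pi_mul]
  refine ⟨fun ξ => (χ ξ : ℂ) * (star (Φ ξ) ⬝ᵥ z ξ), ?_, hχs.mul_right, fun ξ i => ?_⟩
  · exact hχd.mul (contDiff_dotProduct (contDiff_pi.mpr hΦs) hzd)
  · obtain ⟨M, -, hM, hsum⟩ := hGsum ξ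
    have h1 : G ξ *ᵥ z ξ = symbol u ξ := by
      rw [hz, Matrix.mulVec_mulVec, Matrix.mul_nonsing_inv _ (isUnit_iff_ne_zero.mpr (hdet ξ)),
        Matrix.one_mulVec]
    rw [← h1, hsum, per_eq_sum (M := M)]
    · refine Finset.sum_congr rfl fun k _ => ?_
      simp only [hzp]; ring
    · intro k hk
      exact hM k fun h => hk (by simp [h])

/-! ### Smooth symbols and their kernels -/

lemma jet_congr {f g : ℝ → ℂ} (h : f =ᶠ[𝓝 0] g) : jet f = jet g := by
  ext n
  rw [coeff_jet, coeff_jet, h.iteratedDeriv_eq]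

/-- If `v̂ û` vanishes to order `m + 1`, so does a dual symbol of `u`, as `v̂(ξ) φ̂(ξ + 2πk)` is
`δ_{k0}` up to this order. -/
lemma X_pow_dvd_jet_of_dual {a : ℤ →₀ Matrix (Fin r) (Fin r) ℂ} {v : ℤ →₀ (Fin r → ℂ)} {m : ℕ}
    (hv : IsMatchingFilter a v (m + 1)) {g : ℝ → (Fin r → ℂ)} (hg : IsRefinableFun a v m g)
    {u : ℤ →₀ (Fin r → ℂ)} (hu : u ∈ vanishing v (m + 1)) {Ψ : ℝ → ℂ} (hΨ : ContDiff ℝ ∞ Ψ)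
    (hs : HasCompactSupport Ψ) (hper : ∀ ξ i, per (fun ξ => ft g ξ i * Ψ ξ) ξ = symbol u ξ i) :
    PowerSeries.X ^ (m + 1) ∣ jet Ψ := by
  have hc := hg.contDiff.continuous
  have hgs := hg.hasCompactSupport
  obtain ⟨M, hM⟩ := exists_translates_zero hs 1
  have hΨk : ∀ k : ℤ, ContDiff ℝ ∞ fun ξ => Ψ (ξ + 2 * Real.pi * (k : ℝ)) := fun k =>
    hΨ.comp (contDiff_id.add contDiff_const)
  have hgk : ∀ k : ℤ, ContDiff ℝ ∞ fun ξ => symbol v ξ ⬝ᵥ ft g (ξ + 2 * Real.pi * (k : ℝ)) :=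
    fun k => contDiff_dotProduct (contDiff_symbol v) (contDiff_ft_comp_add hc hgs _)
  have h1 : jet (rowCol v u) = ∑ k ∈ Finset.Icc (-(M : ℤ)) M,
      rf v g k * jet fun ξ => Ψ (ξ + 2 * Real.pi * (k : ℝ)) := by
    simp only [rf]
    simp only [← jet_mul (hgk _) (hΨk _)]
    rw [← jet_sum _ fun k _ => (hgk k).mul (hΨk k)]
    refine jet_congr ?_
    have h2 : {ξ : ℝ | |ξ| < 1} ∈ 𝓝 (0 : ℝ) :=
      (isOpen_lt continuous_abs continuous_const).mem_nhds (by simp)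
    filter_upwards [h2] with ξ hξ
    have h3 : ∀ i, symbol u ξ i = ∑ k ∈ Finset.Icc (-(M : ℤ)) M,
        ft g (ξ + 2 * Real.pi * (k : ℝ)) i * Ψ (ξ + 2 * Real.pi * (k : ℝ)) := fun i => by
      rw [← hper ξ i]
      exact per_eq_sum fun k hk => hM ξ (le_of_lt hξ) k (right_ne_zero_of_mul hk)
    simp only [rowCol, dotProduct, h3, Finset.mul_sum, Finset.sum_mul]
    rw [Finset.sum_comm]
    exact Finset.sum_congr rfl fun k _ => Finset.sum_congr rfl fun i _ => by ring
  have h0 : (0 : ℤ) ∈ Finset.Icc (-(M : ℤ)) M := by simp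
  rw [← Finset.add_sum_erase _ _ h0] at h1
  simp only [Int.cast_zero, mul_zero, add_zero] at h1
  have h4 : jet Ψ = jet (rowCol v u) - (∑ k ∈ (Finset.Icc (-(M : ℤ)) M).erase 0,
      rf v g k * jet fun ξ => Ψ (ξ + 2 * Real.pi * (k : ℝ))) - (rf v g 0 - 1) * jet Ψ := by
    rw [h1]; ring
  rw [h4]
  refine dvd_sub (dvd_sub ?_ (Finset.dvd_sum fun k hk => ?_)) ((hg.rf_zero hv).mul_right _)
  · rw [jet_rowCol]; exact mem_vanishing_iff.mp hu
  · exact (hg.rf_of_ne_zero hv (Finset.ne_of_mem_erase hk)).mul_right _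

lemma ft_eq_schwartz {f : ℝ → ℂ} (hf : ContDiff ℝ ∞ f) (hs : HasCompactSupport f) (y : ℝ) :
    ft f y = (FourierTransform.fourier (hs.toSchwartzMap hf) : SchwartzMap ℝ ℂ)
      ((2 * Real.pi)⁻¹ * y) := by
  rw [ft_eq_fourier, SchwartzMap.fourier_coe]; rfl

lemma integrable_pow_mul_norm_ft {f : ℝ → ℂ} (hf : ContDiff ℝ ∞ f) (hs : HasCompactSupport f)
    (n : ℕ) : MeasureTheory.Integrable fun y : ℝ => |y| ^ n * ‖ft f y‖ := by
  have h := (SchwartzMap.integrable_pow_mul MeasureTheory.volume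
    (FourierTransform.fourier (hs.toSchwartzMap hf) : SchwartzMap ℝ ℂ) n).comp_mul_left'
    (R := (2 * Real.pi)⁻¹) (by positivity)
  refine (h.const_mul ((2 * Real.pi) ^ n)).congr (.of_forall fun y => ?_)
  simp only [ft_eq_schwartz hf hs, norm_mul, Real.norm_eq_abs, mul_pow]
  rw [abs_of_pos (by positivity : 0 < (2 * Real.pi)⁻¹), inv_pow, ← mul_assoc, ← mul_assoc, ← mul_pow,
    mul_inv_cancel₀ (by positivity), one_mul]

lemma continuous_ft {f : ℝ → ℂ} (hf : Continuous f) (hs : HasCompactSupport f) :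
    Continuous (ft f) := (contDiff_ft hf hs).continuous

/-- Fourier inversion at the origin. -/
lemma integral_ft {f : ℝ → ℂ} (hf : ContDiff ℝ ∞ f) (hs : HasCompactSupport f) :
    ∫ y, ft f y = 2 * Real.pi * f 0 := by
  have h1 : FourierTransformInv.fourierInv (FourierTransform.fourier f : ℝ → ℂ) = f :=
    hf.continuous.fourierInv_fourier_eq (hf.continuous.integrable_of_hasCompactSupport hs)
      (SchwartzMap.integrable (FourierTransform.fourier (hs.toSchwartzMap hf) : SchwartzMap ℝ ℂ))
  have h2 := congrFun h1 0
  rw [Real.fourierInv_eq'] at h2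
  simp only [inner_zero_right, mul_zero, Complex.ofReal_zero, zero_mul, Complex.exp_zero,
    one_smul] at h2
  rw [funext (ft_eq_fourier f), MeasureTheory.Measure.integral_comp_mul_left, h2, inv_inv,
    abs_of_pos Real.two_pi_pos, ← Complex.coe_smul, smul_eq_mul]
  push_cast; ring

/-- The vanishing moments of the kernel of a symbol that vanishes to high order at the origin. -/
lemma integral_pow_mul_ft_eq_zero {f : ℝ → ℂ} (hf : ContDiff ℝ ∞ f) (hs : HasCompactSupport f)
    {m : ℕ} (h : PowerSeries.X ^ (m + 1) ∣ jet f) {s : ℕ} (hsm : s ≤ m) :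
    ∫ y : ℝ, (y : ℂ) ^ s * ft f y = 0 := by
  have hfs : ContDiff ℝ s f := hf.of_le (by exact_mod_cast le_top)
  have hd : ContDiff ℝ ∞ (iteratedDeriv s f) := by
    rw [contDiff_infty]
    intro n
    rw [iteratedDeriv_eq_iterate]
    exact ContDiff.iterate_deriv' n s (hf.of_le (by exact_mod_cast le_top))
  have h1 := integral_ft hd (hasCompactSupport_iteratedDeriv hs s)
  rw [(X_pow_dvd_jet_iff _ _).mp h s (by omega), mul_zero] at h1
  simp only [ft_iteratedDeriv hfs hs, mul_pow, smul_eq_mul, mul_assoc] at h1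
  rw [MeasureTheory.integral_const_mul] at h1
  exact (mul_eq_zero.mp h1).resolve_left (pow_ne_zero _ Complex.I_ne_zero)

lemma integral_ek_two_pi (k : ℤ) :
    ∫ x in (0 : ℝ)..1, ek k (2 * Real.pi * x) = if k = 0 then 1 else 0 := by
  split_ifs with h
  · simp [h, ek_zero_left]
  · have hc : -(Complex.I * (k : ℂ) * (2 * Real.pi)) ≠ 0 := by
      have : (Real.pi : ℂ) ≠ 0 := by exact_mod_cast Real.pi_ne_zero
      have hk : (k : ℂ) ≠ 0 := by exact_mod_cast h
      simp [this, hk]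
    have h1 := integral_exp_mul_complex (a := 0) (b := 1) hc
    have h2 : ∀ x : ℝ, Complex.exp (-(Complex.I * (k : ℂ) * (2 * Real.pi)) * x)
        = ek k (2 * Real.pi * x) := fun x => by rw [ek]; congr 1; push_cast; ring
    simp only [h2] at h1
    rw [h1, mul_one, mul_zero, ek_two_pi, ek_zero_right, sub_self, zero_div]

/-- The coefficients of a trigonometric polynomial. -/
lemma integral_ek_mul_symbol (u : ℤ →₀ (Fin r → ℂ)) (j : ℤ) (i : Fin r) :
    ∫ x in (0 : ℝ)..1, ek (-j) (2 * Real.pi * x) * symbol u (2 * Real.pi * x) i = u j i := by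
  have h1 : ∀ x : ℝ, ek (-j) (2 * Real.pi * x) * symbol u (2 * Real.pi * x) i
      = ∑ k ∈ u.support, u k i * ek (-j + k) (2 * Real.pi * x) := fun x => by
    rw [symbol_eq_sum, Finsupp.sum, Finset.sum_apply, Finset.mul_sum]
    refine Finset.sum_congr rfl fun k _ => ?_
    rw [ek_add, Pi.smul_apply, smul_eq_mul]; ring
  simp only [h1]
  rw [intervalIntegral.integral_finsetSum]
  · simp only [intervalIntegral.integral_const_mul, integral_ek_two_pi]
    rw [Finset.sum_eq_single j]
    · simp
    · intro k _ hk
      rw [if_neg (by omega), mul_zero]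
    · intro h; simp [Finsupp.notMem_support_iff.mp h]
  · intro k _
    refine Continuous.intervalIntegrable ?_ _ _
    have := (contDiff_ek (-j + k)).continuous
    fun_prop

/-- Parseval's formula for two compactly supported functions. -/
lemma integral_ft_mul {f g : ℝ → ℂ} (hf : Continuous f) (hs : HasCompactSupport f)
    (hg : Continuous g) (hgs : HasCompactSupport g) :
    ∫ y, ft f y * g y = ∫ x, f x * ft g x := by
  have h1 : ∀ y, ft f y * g y
      = ∫ x : ℝ, Complex.exp (-(Complex.I * (x : ℂ) * (y : ℂ))) * (f x * g y) := fun y => by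
    rw [ft, ← MeasureTheory.integral_mul_const]
    simp only [smul_eq_mul, mul_assoc]
  have h2 : ∀ x, f x * ft g x
      = ∫ y : ℝ, Complex.exp (-(Complex.I * (x : ℂ) * (y : ℂ))) * (f x * g y) := fun x => by
    rw [ft, ← MeasureTheory.integral_const_mul]
    refine MeasureTheory.integral_congr_ae (.of_forall fun y => ?_)
    simp only [smul_eq_mul]
    rw [mul_right_comm Complex.I]; ring
  simp only [h1, h2]
  refine MeasureTheory.integral_integral_swap_of_hasCompactSupport
    (f := fun y x : ℝ => Complex.exp (-(Complex.I * (x : ℂ) * (y : ℂ))) * (f x * g y)) ?_ ?_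
  · simp only [Function.uncurry_def]
    fun_prop
  · refine HasCompactSupport.of_support_subset_isCompact (hgs.isCompact.prod hs.isCompact) ?_
    rintro ⟨y, x⟩ h
    rw [Function.mem_support, Function.uncurry_apply_pair] at h
    exact ⟨subset_tsupport g (right_ne_zero_of_mul (right_ne_zero_of_mul h)),
      subset_tsupport f (left_ne_zero_of_mul (right_ne_zero_of_mul h))⟩

/-- A sequence `u` with the dual symbol `Ψ` is obtained by testing the shifts of `g` against the
kernel of `Ψ`. -/
lemma integral_kernel_mul_shift {g : ℝ → (Fin r → ℂ)} (hg : Continuous g)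
    (hgs : HasCompactSupport g) {u : ℤ →₀ (Fin r → ℂ)} {Ψ : ℝ → ℂ} (hΨ : ContDiff ℝ ∞ Ψ)
    (hs : HasCompactSupport Ψ) (hper : ∀ ξ i, per (fun ξ => ft g ξ i * Ψ ξ) ξ = symbol u ξ i)
    (j : ℤ) (i : Fin r) : ∫ y, ft Ψ y * g (y + j) i = 2 * Real.pi * u j i := by
  have hgi := continuous_coord hg i
  have hgis := hasCompactSupport_coord hgs i
  have hsh : HasCompactSupport fun y => g (y + j) i := hgis.comp_homeomorph (Homeomorph.addRight (j : ℝ))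
  rw [integral_ft_mul hΨ.continuous hs (g := fun y => g (y + j) i) (by fun_prop) hsh]
  have h1 : ∀ x, ft (fun y => g (y + j) i) x = ek (-j) x * ft g x i := fun x => by
    have h := ft_comp_sub (fun y => g y i) (-(j : ℝ)) x
    simp only [sub_neg_eq_add] at h
    rw [h, ft_apply hg hgs, smul_eq_mul, ek]
    push_cast; rfl
  simp only [h1]
  have hF : Continuous fun x => Ψ x * (ek (-j) x * ft g x i) := by
    have h2 := (contDiff_ek (-j)).continuous
    have h3 := continuous_coord (contDiff_ft hg hgs).continuous i
    have h4 := hΨ.continuous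
    fun_prop
  rw [integral_eq_integral_per hF hs.mul_right, ← integral_ek_mul_symbol u j i]
  congr 1
  refine intervalIntegral.integral_congr fun x _ => ?_
  rw [← hper, per, per]
  refine Eq.trans ?_ (smul_finsum (ek (-j) (2 * Real.pi * x)) _).symm
  refine finsum_congr fun k => ?_
  rw [ek_add_right, ek_two_pi_mul, smul_eq_mul]; ring

/-! ### Stability implies decay -/

lemma integrable_mul_comp {H : ℝ → ℂ} (hH : MeasureTheory.Integrable H) {g : ℝ → (Fin r → ℂ)}
    (hg : Continuous g) (hgs : HasCompactSupport g) {β : ℝ → ℝ} (hβ : Continuous β) (i : Fin r) :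
    MeasureTheory.Integrable fun y => H y * g (β y) i := by
  obtain ⟨C, hC⟩ := exists_norm_bound (continuous_coord hg i) (hasCompactSupport_coord hgs i)
  exact hH.mul_bdd ((continuous_coord hg i).comp hβ).aestronglyMeasurable
    (.of_forall fun y => hC (β y))

/-- If the initial data test the shifts of a refinable function against a kernel, then so do the
data of level `n`, at the scale `2^{-n}`. -/
lemma W_eq_integral {a : ℤ →₀ Matrix (Fin r) (Fin r) ℂ} {v : ℤ →₀ (Fin r → ℂ)} {m : ℕ}
    {g : ℝ → (Fin r → ℂ)} (hg : IsRefinableFun a v m g) {H : ℝ → ℂ}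
    (hH : MeasureTheory.Integrable H) (n : ℕ) :
    ∀ {u : ℤ →₀ (Fin r → ℂ)} {α : ℝ → ℝ}, Continuous α →
      (∀ j i, u j i = ∫ y, H y * g (α y + j) i) →
      ∀ k i, W a n u k i = ∫ y, H y * g ((α y + k) / 2 ^ n) i := by
  have hc := hg.contDiff.continuous
  have hs := hg.hasCompactSupport
  induction n with
  | zero => intro u α _ h k i; simpa [W_zero] using h k i
  | succ n ih =>
    intro u α hα h
    have hT : ∀ (γ : ℤ) (k : ℤ) (i : Fin r),
        T a γ u k i = ∫ y, H y * g ((α y + γ) / 2 + k) i := by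
      intro γ k i
      have h1 : ∀ y, H y * g ((α y + γ) / 2 + k) i = (2 : ℂ) * ∑ l ∈ a.support, ∑ i', a l i i' *
          (H y * g (α y + ((2 * k + γ - l : ℤ) : ℝ)) i') := fun y => by
        conv_lhs => rw [← hg.cascade_eq]
        have h2 : ∀ l : ℤ, 2 * ((α y + γ) / 2 + k) - (l : ℝ) = α y + ((2 * k + γ - l : ℤ) : ℝ) :=
          fun l => by push_cast; ring
        simp only [cascade, Finsupp.sum, h2, Pi.smul_apply, smul_eq_mul, Finset.sum_apply,
          Matrix.mulVec, dotProduct, Finset.mul_sum]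
        exact Finset.sum_congr rfl fun l _ => Finset.sum_congr rfl fun i' _ => by ring
      have hint : ∀ (l : ℤ) (i' : Fin r), MeasureTheory.Integrable fun y =>
          a l i i' * (H y * g (α y + ((2 * k + γ - l : ℤ) : ℝ)) i') := fun l i' =>
        (integrable_mul_comp hH hc hs (hα.add continuous_const) i').const_mul _
      simp only [h1]
      rw [MeasureTheory.integral_const_mul, MeasureTheory.integral_finsetSum _ fun l _ =>
        MeasureTheory.integrable_finsetSum _ fun i' _ => hint l i', T_apply]
      simp only [Pi.smul_apply, smul_eq_mul, Finsupp.sum, Finset.sum_apply, Matrix.mulVec, dotProduct]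
      congr 1
      refine Finset.sum_congr rfl fun l _ => ?_
      rw [MeasureTheory.integral_finsetSum _ fun i' _ => hint l i']
      refine Finset.sum_congr rfl fun i' _ => ?_
      rw [MeasureTheory.integral_const_mul, h]
    have hstep : ∀ (γ : ℤ) (k : ℤ) (i : Fin r), W a n (T a γ u) k i
        = ∫ y, H y * g ((α y + ((2 * k + γ : ℤ) : ℝ)) / 2 ^ (n + 1)) i := by
      intro γ k i
      rw [ih (α := fun y => (α y + γ) / 2) (by fun_prop) (hT γ)]
      refine MeasureTheory.integral_congr_ae (.of_forall fun y => ?_)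
      have h2 : ((α y + γ) / 2 + k) / 2 ^ n = (α y + ((2 * k + γ : ℤ) : ℝ)) / 2 ^ (n + 1) := by
        push_cast; field_simp; ring
      simp only [h2]
    refine int_parity (fun k i => ?_) fun k i => ?_
    · rw [W_succ_zero, hstep, add_zero]
    · rw [W_succ_one, hstep]

/-- For increments below the modulus of continuity of `g^{(m)}` the remainder is at most
`ε |h|^m`; larger increments are covered by the term `C |h|^{m+1}`. -/
lemma exists_taylor_remainder_le {m : ℕ} {g : ℝ → (Fin r → ℂ)}
    (hg : ContDiff ℝ m g) (hs : HasCompactSupport g) {ε : ℝ} (hε : 0 < ε) :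
    ∃ C : ℝ, 0 ≤ C ∧ ∀ x h : ℝ,
      ‖g (x + h) - ∑ s ∈ Finset.range (m + 1), (h ^ s / (s.factorial : ℝ)) • iteratedDeriv s g x‖
        ≤ ε * |h| ^ m + C * |h| ^ (m + 1) := by
  have hc : Continuous (iteratedDeriv m g) := hg.continuous_iteratedDeriv m le_rfl
  have hcs := hasCompactSupport_iteratedDeriv hs m
  obtain ⟨D, hD⟩ := exists_norm_bound hc hcs
  obtain ⟨δ, hδ, hδ'⟩ := Metric.uniformContinuous_iff.mp
    (hcs.uniformContinuous_of_continuous hc) ε hε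
  have hD0 : 0 ≤ D := (norm_nonneg _).trans (hD 0)
  refine ⟨2 * D / δ, by positivity, fun x h => ?_⟩
  by_cases hh : |h| < δ
  · refine (norm_sub_taylor_le m hg (M := ε) (δ := |h|) (fun t ht => ?_) h le_rfl).trans ?_
    · rw [← dist_eq_norm]
      refine (hδ' ?_).le
      rw [Real.dist_eq, add_sub_cancel_left]
      exact ht.trans_lt hh
    · have : 0 ≤ 2 * D / δ * |h| ^ (m + 1) := by positivity
      linarith
  · refine (norm_sub_taylor_le m hg (M := 2 * D) (δ := |h|) (fun t ht => ?_) h le_rfl).trans ?_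
    · refine (norm_sub_le _ _).trans ?_
      linarith [hD (x + t), hD x]
    · have h1 : 2 * D * |h| ^ m ≤ 2 * D / δ * |h| ^ (m + 1) := by
        rw [pow_succ, div_mul_eq_mul_div, le_div_iff₀ hδ, mul_comm (|h| ^ m), ← mul_assoc,
          mul_right_comm]
        have := not_lt.mp hh
        gcongr
      have : 0 ≤ ε * |h| ^ m := by positivity
      linarith

/-- Data that test the shifts of a refinable `C^m` function against a kernel with `m + 1` vanishing
moments decay faster than `2^{-mn}`. -/
lemma decaySeq_of_kernel {a : ℤ →₀ Matrix (Fin r) (Fin r) ℂ} {v : ℤ →₀ (Fin r → ℂ)} {m : ℕ}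
    {g : ℝ → (Fin r → ℂ)} (hg : IsRefinableFun a v m g) {H : ℝ → ℂ} (hHc : Continuous H)
    (hH : ∀ s, MeasureTheory.Integrable fun y : ℝ => |y| ^ s * ‖H y‖)
    (hmom : ∀ s ≤ m, ∫ y : ℝ, (y : ℂ) ^ s * H y = 0) {u : ℤ →₀ (Fin r → ℂ)}
    (hu : ∀ j i, u j i = ∫ y, H y * g (y + j) i) : DecaySeq a m u := by
  have hc := hg.contDiff.continuous
  have hs := hg.hasCompactSupport
  have hHi : MeasureTheory.Integrable H := by
    have := hH 0
    simp only [pow_zero, one_mul] at this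
    exact (MeasureTheory.integrable_norm_iff hHc.aestronglyMeasurable).mp this
  have hHs : ∀ s : ℕ, MeasureTheory.Integrable fun y : ℝ => (y : ℂ) ^ s * H y := fun s => by
    refine (MeasureTheory.integrable_norm_iff (by fun_prop)).mp ?_
    simpa using hH s
  have hW := fun n => W_eq_integral hg hHi n continuous_id hu
  simp only [id] at hW
  set I : ℕ → ℝ := fun s => ∫ y : ℝ, |y| ^ s * ‖H y‖ with hI
  have hI0 : ∀ s, 0 ≤ I s := fun s => MeasureTheory.integral_nonneg fun y => by positivity
  intro ε hε
  obtain ⟨C, hC0, hC⟩ := exists_taylor_remainder_le hg.contDiff hs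
    (ε := ε / 2 / (I m + 1)) (by have := hI0 m; positivity)
  have hkey : ∀ (n : ℕ) (k : ℤ), 2 ^ (m * n) * ‖W a n u k‖ ≤ ε / 2 + C * I (m + 1) / 2 ^ n := by
    intro n k
    have h2n : (0 : ℝ) < 2 ^ n := by positivity
    rw [← le_div_iff₀' (by positivity)]
    have hrhs : 0 ≤ (ε / 2 + C * I (m + 1) / 2 ^ n) / 2 ^ (m * n) := by
      have := hI0 (m + 1); positivity
    rw [pi_norm_le_iff_of_nonneg hrhs]
    intro i
    -- the Taylor polynomial of `g` at `2^{-n} k` integrates to `0` against `H`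
    set P : ℝ → ℂ := fun y => ∑ s ∈ Finset.range (m + 1),
      ((y / 2 ^ n) ^ s / (s.factorial : ℝ)) • iteratedDeriv s g (k / 2 ^ n) i with hP
    have hPint : ∀ s, MeasureTheory.Integrable fun y : ℝ =>
        H y * (((y / 2 ^ n) ^ s / (s.factorial : ℝ)) • iteratedDeriv s g (k / 2 ^ n) i) := fun s => by
      refine ((hHs s).mul_const (iteratedDeriv s g (k / 2 ^ n) i / (2 ^ n) ^ s / s.factorial)).congr
        (.of_forall fun y => ?_)
      simp only [Complex.real_smul]; push_cast; rw [div_pow]; ring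
    have hPsum : ∀ y, H y * P y = ∑ s ∈ Finset.range (m + 1),
        H y * (((y / 2 ^ n) ^ s / (s.factorial : ℝ)) • iteratedDeriv s g (k / 2 ^ n) i) := fun y => by
      rw [hP]; exact Finset.mul_sum _ _ _
    have hPi : MeasureTheory.Integrable fun y => H y * P y := by
      simp only [hPsum]
      exact MeasureTheory.integrable_finsetSum _ fun s _ => hPint s
    have hP0 : ∫ y, H y * P y = 0 := by
      simp only [hPsum]
      rw [MeasureTheory.integral_finsetSum _ fun s _ => hPint s]
      refine Finset.sum_eq_zero fun s hsm => ?_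
      rw [MeasureTheory.integral_congr_ae (g := fun y : ℝ => ((y : ℂ) ^ s * H y) *
        (iteratedDeriv s g (k / 2 ^ n) i / (2 ^ n) ^ s / s.factorial)) (.of_forall fun y => by
          simp only [Complex.real_smul]; push_cast; rw [div_pow]; ring),
        MeasureTheory.integral_mul_const, hmom s (Nat.lt_succ_iff.mp (Finset.mem_range.mp hsm)),
        zero_mul]
    have hgi := integrable_mul_comp hHi hc hs (β := fun y : ℝ => (y + k) / 2 ^ n) (by fun_prop) i
    have h1 : W a n u k i = ∫ y, H y * (g ((y + k) / 2 ^ n) i - P y) := by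
      simp only [mul_sub]
      rw [MeasureTheory.integral_sub hgi hPi, hP0, sub_zero, hW]
    have hIi : ∀ s, MeasureTheory.Integrable fun y : ℝ => |y| ^ s * ‖H y‖ := hH
    rw [h1]
    set c₁ : ℝ := ε / 2 / (I m + 1) / (2 ^ n) ^ m with hc₁
    set c₂ : ℝ := C / (2 ^ n) ^ (m + 1) with hc₂
    refine (MeasureTheory.norm_integral_le_of_norm_le
      (((hIi m).const_mul c₁).add ((hIi (m + 1)).const_mul c₂)) (.of_forall fun y => ?_)).trans ?_
    · have h2 := hC (k / 2 ^ n) (y / 2 ^ n)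
      have h3 := (norm_le_pi_norm _ i).trans h2
      rw [Pi.sub_apply, Finset.sum_apply, ← add_div, add_comm (k : ℝ) y] at h3
      simp only [Pi.smul_apply, abs_div, abs_of_pos h2n, div_pow] at h3
      rw [norm_mul]
      have h4 := mul_le_mul_of_nonneg_left h3 (norm_nonneg (H y))
      simp only [hP, div_pow]
      refine h4.trans (le_of_eq ?_)
      simp only [Pi.add_apply, hc₁, hc₂]
      ring
    · rw [MeasureTheory.integral_add' ((hIi m).const_mul c₁) ((hIi (m + 1)).const_mul c₂),
        MeasureTheory.integral_const_mul, MeasureTheory.integral_const_mul]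
      change c₁ * I m + c₂ * I (m + 1) ≤ _
      rw [le_div_iff₀ (by positivity), add_mul]
      have h5 : c₁ * I m * 2 ^ (m * n) ≤ ε / 2 := by
        have h6 : c₁ * I m * 2 ^ (m * n) = ε / 2 * (I m / (I m + 1)) := by
          rw [hc₁, ← pow_mul, mul_comm n m]; field_simp
        rw [h6]
        exact mul_le_of_le_one_right (by positivity)
          ((div_le_one (by have := hI0 m; positivity)).mpr (by linarith))
      have h7 : c₂ * I (m + 1) * 2 ^ (m * n) = C * I (m + 1) / 2 ^ n := by
        rw [hc₂, pow_succ (2 ^ n : ℝ), ← pow_mul, mul_comm n m]; field_simp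
      linarith
  have hlim : Tendsto (fun n : ℕ => C * I (m + 1) / 2 ^ n) atTop (𝓝 0) :=
    tendsto_const_nhds.div_atTop (tendsto_pow_atTop_atTop_of_one_lt one_lt_two)
  filter_upwards [hlim.eventually_le_const (half_pos hε)] with n hn k
  linarith [hkey n k]

/-- A refinable `C^m` function with stable integer shifts forces the decay of the subdivision data
on `𝒱_{m,v}`. -/
theorem decay_of_stable {a : ℤ →₀ Matrix (Fin r) (Fin r) ℂ} {v : ℤ →₀ (Fin r → ℂ)} {m : ℕ}
    (hv : IsMatchingFilter a v (m + 1)) {g : ℝ → (Fin r → ℂ)} (hg : IsRefinableFun a v m g)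
    (hst : ∀ ξ : ℝ, Submodule.span ℂ
      (Set.range fun k : ℤ => ft g (ξ + 2 * Real.pi * (k : ℝ))) = ⊤) :
    ∀ u ∈ vanishing v (m + 1), DecaySeq a m u := by
  intro u hu
  have hc := hg.contDiff.continuous
  have hs := hg.hasCompactSupport
  obtain ⟨Ψ, hΨ, hΨs, hper⟩ := exists_dual_symbol (contDiff_ft hc hs) hst u
  have hjet := X_pow_dvd_jet_of_dual hv hg hu hΨ hΨs hper
  have hπ : (2 * Real.pi : ℂ) ≠ 0 := by
    exact_mod_cast Real.two_pi_pos.ne'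
  refine decaySeq_of_kernel hg (H := fun y => (2 * Real.pi : ℂ)⁻¹ * ft Ψ y)
    (continuous_const.mul (continuous_ft hΨ.continuous hΨs)) (fun s => ?_) (fun s hsm => ?_)
    fun j i => ?_
  · refine ((integrable_pow_mul_norm_ft hΨ hΨs s).const_mul ‖(2 * Real.pi : ℂ)⁻¹‖).congr
      (.of_forall fun y => ?_)
    simp only [norm_mul]; ring
  · simp only [mul_left_comm _ (2 * Real.pi : ℂ)⁻¹]
    rw [MeasureTheory.integral_const_mul, integral_pow_mul_ft_eq_zero hΨ hΨs hjet hsm, mul_zero]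
  · simp only [mul_assoc]
    rw [MeasureTheory.integral_const_mul, integral_kernel_mul_shift hc hs hΨ hΨs hper,
      inv_mul_cancel_left₀ hπ]

/-! ### Smooth test functions -/

lemma contDiff_coe (f : SmoothFun) : ContDiff ℝ ∞ (f : ℝ → ℂ) := f.2

/-- The functional `f ↦ f^{(j)}(x)`. -/
def evalD (j : ℕ) (x : ℝ) : SmoothFun →ₗ[ℂ] ℂ where
  toFun f := iteratedDeriv j (f : ℝ → ℂ) x
  map_add' f g := iteratedDeriv_add ((contDiff_coe f).of_le (by exact_mod_cast le_top)).contDiffAt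
    ((contDiff_coe g).of_le (by exact_mod_cast le_top)).contDiffAt
  map_smul' c f := iteratedDeriv_const_smul (x := x)
    ((contDiff_coe f).of_le (by exact_mod_cast le_top)).contDiffAt c

lemma evalD_apply (j : ℕ) (x : ℝ) (f : SmoothFun) : evalD j x f = iteratedDeriv j (f : ℝ → ℂ) x := rfl

lemma evalD_zero (x : ℝ) (f : SmoothFun) : evalD 0 x f = (f : ℝ → ℂ) x := by
  rw [evalD_apply, iteratedDeriv_zero]

/-- The derivative of a smooth function. -/
def derivS : SmoothFun →ₗ[ℂ] SmoothFun where
  toFun f := ⟨deriv (f : ℝ → ℂ), (contDiff_infty_iff_deriv.mp (contDiff_coe f)).2⟩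
  map_add' f g := Subtype.ext <| funext fun x =>
    deriv_add ((contDiff_coe f).differentiable (by simp) x) ((contDiff_coe g).differentiable (by simp) x)
  map_smul' c f := Subtype.ext <| funext fun x =>
    deriv_const_smul (x := x) c ((contDiff_coe f).differentiable (by simp) x)

lemma evalD_succ (j : ℕ) (x : ℝ) (f : SmoothFun) : evalD (j + 1) x f = evalD j x (derivS f) := by
  rw [evalD_apply, iteratedDeriv_succ']; rfl

lemma hasDerivAt_smoothFun (f : SmoothFun) (x : ℝ) :
    HasDerivAt (f : ℝ → ℂ) (evalD 1 x f) x := by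
  rw [evalD_succ, evalD_zero]
  exact ((contDiff_coe f).differentiable (by simp) x).hasDerivAt

/-- The monomial `x ↦ x^j`. -/
def mono (j : ℕ) : SmoothFun := ⟨fun x => (x : ℂ) ^ j, by
  have h : ContDiff ℝ ∞ fun x : ℝ => (x : ℂ) := Complex.ofRealCLM.contDiff
  exact h.pow j⟩

lemma mono_apply (j : ℕ) (x : ℝ) : (mono j : ℝ → ℂ) x = (x : ℂ) ^ j := rfl

lemma derivS_mono (j : ℕ) : derivS (mono (j + 1)) = ((j : ℂ) + 1) • mono j := by
  refine Subtype.ext (funext fun x => ?_)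
  have h1 : HasDerivAt (fun x : ℝ => (x : ℂ)) 1 x := Complex.ofRealCLM.hasDerivAt
  have h := (h1.fun_pow (j + 1)).deriv
  change deriv (fun x : ℝ => (x : ℂ) ^ (j + 1)) x = ((j : ℂ) + 1) * (x : ℂ) ^ j
  rw [h]; simp

lemma derivS_mono_zero : derivS (mono 0) = 0 := by
  refine Subtype.ext (funext fun x => ?_)
  change deriv (fun x : ℝ => (x : ℂ) ^ 0) x = 0
  simp

lemma evalD_mono (s j : ℕ) (x : ℝ) :
    evalD s x (mono j) = (j.descFactorial s : ℂ) * (x : ℂ) ^ (j - s) := by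
  induction s generalizing j with
  | zero => simp [evalD_zero, mono_apply]
  | succ s ih =>
    rw [evalD_succ]
    cases j with
    | zero => simp [derivS_mono_zero]
    | succ j =>
      rw [derivS_mono, map_smul, ih, smul_eq_mul, Nat.succ_descFactorial_succ, Nat.succ_sub_succ]
      push_cast; ring

/-- The mean value inequality for a function that vanishes at the origin. -/
lemma norm_le_of_norm_evalD_one_le {h : SmoothFun} {R M : ℝ} (h0 : (h : ℝ → ℂ) 0 = 0)
    (hM : ∀ x, |x| ≤ R → ‖evalD 1 x h‖ ≤ M) {x : ℝ} (hx : |x| ≤ R) :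
    ‖(h : ℝ → ℂ) x‖ ≤ R * M := by
  have hR : 0 ≤ R := (abs_nonneg x).trans hx
  have hM0 : 0 ≤ M := (norm_nonneg _).trans (hM x hx)
  have h1 := (convex_Icc (-R) R).norm_image_sub_le_of_norm_hasDerivWithin_le
    (fun t _ => (hasDerivAt_smoothFun h t).hasDerivWithinAt) (fun t (ht : t ∈ Set.Icc (-R) R) => hM t (abs_le.mpr ht))
    (x := 0) (y := x) (by simp [hR]) (abs_le.mp hx)
  rw [h0, sub_zero, sub_zero, Real.norm_eq_abs] at h1
  exact h1.trans (by rw [mul_comm]; gcongr)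

/-- The polynomials, as smooth functions. -/
def polyS : Submodule ℂ SmoothFun := Submodule.span ℂ (Set.range mono)

lemma mono_mem_polyS (j : ℕ) : mono j ∈ polyS := Submodule.subset_span ⟨j, rfl⟩

lemma exists_antideriv {Q : SmoothFun} (hQ : Q ∈ polyS) : ∃ P ∈ polyS, derivS P = Q := by
  induction hQ using Submodule.span_induction with
  | mem x hx =>
    obtain ⟨j, rfl⟩ := hx
    have : (j : ℂ) + 1 ≠ 0 := Nat.cast_add_one_ne_zero j
    exact ⟨((j : ℂ) + 1)⁻¹ • mono (j + 1), polyS.smul_mem _ (mono_mem_polyS _), by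
      rw [map_smul, derivS_mono, smul_smul, inv_mul_cancel₀ this, one_smul]⟩
  | zero => exact ⟨0, polyS.zero_mem, map_zero _⟩
  | add x y _ _ hx hy =>
    obtain ⟨P, hP, rfl⟩ := hx
    obtain ⟨P', hP', rfl⟩ := hy
    exact ⟨P + P', polyS.add_mem hP hP', map_add _ _ _⟩
  | smul c x _ hx =>
    obtain ⟨P, hP, rfl⟩ := hx
    exact ⟨c • P, polyS.smul_mem c hP, map_smul _ _ _⟩

lemma exists_polyS_of_polynomial (p : Polynomial ℝ) :
    ∃ P ∈ polyS, ∀ x : ℝ, (P : ℝ → ℂ) x = ((p.eval x : ℝ) : ℂ) := by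
  induction p using Polynomial.induction_on' with
  | add p q hp hq =>
    obtain ⟨P, hP, h⟩ := hp
    obtain ⟨Q, hQ, h'⟩ := hq
    refine ⟨P + Q, polyS.add_mem hP hQ, fun x => ?_⟩
    rw [Polynomial.eval_add, Complex.ofReal_add, ← h, ← h']; rfl
  | monomial n c =>
    refine ⟨(c : ℂ) • mono n, polyS.smul_mem _ (mono_mem_polyS n), fun x => ?_⟩
    rw [Polynomial.eval_monomial, Complex.ofReal_mul, Complex.ofReal_pow]; rfl

/-- The polynomials are dense in `C^N[-R, R]`. -/
lemma exists_polyS_approx (R : ℝ) (N : ℕ) : ∀ (f : SmoothFun) {ε : ℝ}, 0 < ε →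
    ∃ P ∈ polyS, ∀ j ≤ N, ∀ x, |x| ≤ R → ‖evalD j x (f - P)‖ ≤ ε := by
  induction N with
  | zero =>
    intro f ε hε
    have hf := (contDiff_coe f).continuous
    obtain ⟨p, hp⟩ := exists_polynomial_near_of_continuousOn (-R) R (fun x => ((f : ℝ → ℂ) x).re)
      (Complex.continuous_re.comp hf).continuousOn (ε / 2) (half_pos hε)
    obtain ⟨q, hq⟩ := exists_polynomial_near_of_continuousOn (-R) R (fun x => ((f : ℝ → ℂ) x).im)
      (Complex.continuous_im.comp hf).continuousOn (ε / 2) (half_pos hε)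
    obtain ⟨P, hP, hPp⟩ := exists_polyS_of_polynomial p
    obtain ⟨Q, hQ, hQq⟩ := exists_polyS_of_polynomial q
    refine ⟨P + Complex.I • Q, polyS.add_mem hP (polyS.smul_mem _ hQ), fun j hj x hx => ?_⟩
    obtain rfl : j = 0 := Nat.le_zero.mp hj
    have h1 : evalD 0 x (f - (P + Complex.I • Q)) = -((p.eval x - ((f : ℝ → ℂ) x).re : ℝ) : ℂ)
        - Complex.I * ((q.eval x - ((f : ℝ → ℂ) x).im : ℝ) : ℂ) := by
      rw [evalD_zero]
      change (f : ℝ → ℂ) x - ((P : ℝ → ℂ) x + Complex.I * (Q : ℝ → ℂ) x) = _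
      rw [hPp, hQq]
      conv_lhs => rw [← Complex.re_add_im ((f : ℝ → ℂ) x)]
      push_cast; ring
    rw [h1]
    refine (norm_sub_le _ _).trans ?_
    rw [norm_neg, norm_mul, Complex.norm_I, one_mul, Complex.norm_real, Complex.norm_real,
      Real.norm_eq_abs, Real.norm_eq_abs]
    linarith [hp x (abs_le.mp hx), hq x (abs_le.mp hx)]
  | succ N ih =>
    intro f ε hε
    set ε' := ε / (|R| + 1) with hε'
    have hε'0 : 0 < ε' := by positivity
    have hε'1 : ε' ≤ ε := div_le_self hε.le (by linarith [abs_nonneg R])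
    -- approximate the derivative, integrate, and match the value at `0`
    obtain ⟨Q, hQ, hQf⟩ := ih (derivS f) hε'0
    obtain ⟨P, hP, rfl⟩ := exists_antideriv hQ
    refine ⟨P + ((f : ℝ → ℂ) 0 - (P : ℝ → ℂ) 0) • mono 0,
      polyS.add_mem hP (polyS.smul_mem _ (mono_mem_polyS 0)), ?_⟩
    set h := f - (P + ((f : ℝ → ℂ) 0 - (P : ℝ → ℂ) 0) • mono 0) with hh
    have hd : derivS h = derivS f - derivS P := by
      rw [hh, map_sub, map_add, map_smul, derivS_mono_zero, smul_zero, add_zero]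
    have h0 : (h : ℝ → ℂ) 0 = 0 := by
      change (f : ℝ → ℂ) 0 - ((P : ℝ → ℂ) 0 + ((f : ℝ → ℂ) 0 - (P : ℝ → ℂ) 0)
        * ((0 : ℝ) : ℂ) ^ 0) = 0
      ring
    have h1 : ∀ j ≤ N, ∀ x, |x| ≤ R → ‖evalD (j + 1) x h‖ ≤ ε' := fun j hj x hx => by
      rw [evalD_succ, hd]; exact hQf j hj x hx
    intro j hj x hx
    cases j with
    | zero =>
      rw [evalD_zero]
      refine (norm_le_of_norm_evalD_one_le h0 (h1 0 N.zero_le) hx).trans ?_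
      rw [hε', mul_div_left_comm]
      exact mul_le_of_le_one_right hε.le
        ((div_le_one (by positivity)).mpr (by linarith [le_abs_self R]))
    | succ j => exact (h1 j (by omega) x hx).trans hε'1

/-- The radius and the constant of the seminorm bound can be enlarged to `R ≥ 1` and `C ≥ 0`. -/
lemma CompactDistribution.exists_bound (D : CompactDistribution) : ∃ (N : ℕ) (R C : ℝ), 1 ≤ R ∧
    0 ≤ C ∧ ∀ (f : SmoothFun) (M : ℝ), 0 ≤ M → (∀ j ≤ N, ∀ x : ℝ, |x| ≤ R → ‖evalD j x f‖ ≤ M) →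
      ‖D.toLin f‖ ≤ C * M := by
  obtain ⟨N, R, C, h⟩ := D.bound
  refine ⟨N, max R 1, |C|, le_max_right _ _, abs_nonneg _, fun f M hM hf => ?_⟩
  exact (h f M fun j hj x hx => hf j hj x (hx.trans (le_max_left _ _))).trans
    (mul_le_mul_of_nonneg_right (le_abs_self C) hM)

/-- A compactly supported distribution is determined by its moments. -/
lemma CompactDistribution.ext_of_moments {D D' : CompactDistribution}
    (h : ∀ j, D.toLin (mono j) = D'.toLin (mono j)) : D = D' := by
  have hpoly : ∀ P ∈ polyS, D.toLin P = D'.toLin P := fun P hP =>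
    LinearMap.eqOn_span (s := Set.range mono) (by rintro _ ⟨j, rfl⟩; exact h j) hP
  obtain ⟨N, R, C, -, hC, hb⟩ := D.exists_bound
  obtain ⟨N', R', C', -, hC', hb'⟩ := D'.exists_bound
  refine CompactDistribution.ext (LinearMap.ext fun f => ?_)
  refine sub_eq_zero.mp (norm_le_zero_iff.mp (le_of_forall_pos_le_add fun ε hε => ?_))
  set ε' := ε / (C + C' + 1) with hε'
  have hε'0 : 0 < ε' := by positivity
  obtain ⟨P, hP, hPf⟩ := exists_polyS_approx (max R R') (max N N') f hε'0
  have h1 := hb (f - P) ε' hε'0.le fun j hj x hx =>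
    hPf j (hj.trans (le_max_left _ _)) x (hx.trans (le_max_left _ _))
  have h2 := hb' (f - P) ε' hε'0.le fun j hj x hx =>
    hPf j (hj.trans (le_max_right _ _)) x (hx.trans (le_max_right _ _))
  have h3 : D.toLin f - D'.toLin f = D.toLin (f - P) - D'.toLin (f - P) := by
    rw [map_sub, map_sub, hpoly P hP]; ring
  rw [h3, zero_add]
  refine (norm_sub_le _ _).trans ((add_le_add h1 h2).trans ?_)
  rw [← add_mul, hε', mul_div_left_comm]
  exact mul_le_of_le_one_right hε.le ((div_le_one (by positivity)).mpr (by linarith))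

/-! ### Uniqueness of the normalized refinable distribution -/

/-- The remainder of the Taylor expansion of `e^{-ixξ}`. -/
def expRem (J : ℕ) (ξ : ℝ) : SmoothFun :=
  expFun ξ - ∑ k ∈ Finset.range J, ((-(Complex.I * ξ)) ^ k / (k.factorial : ℂ)) • mono k

lemma derivS_expFun (ξ : ℝ) : derivS (expFun ξ) = (-(Complex.I * ξ)) • expFun ξ := by
  refine Subtype.ext (funext fun x => ?_)
  have h : HasDerivAt (fun x : ℝ => -(Complex.I * (x : ℂ) * (ξ : ℂ))) (-(Complex.I * 1 * ξ)) x :=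
    ((Complex.ofRealCLM.hasDerivAt.const_mul Complex.I).mul_const _).neg
  change deriv (fun x : ℝ => Complex.exp (-(Complex.I * (x : ℂ) * (ξ : ℂ)))) x
    = -(Complex.I * ξ) * Complex.exp (-(Complex.I * (x : ℂ) * (ξ : ℂ)))
  rw [h.cexp.deriv]; ring

lemma derivS_expRem (J : ℕ) (ξ : ℝ) :
    derivS (expRem J ξ) = (-(Complex.I * ξ)) • expRem (J - 1) ξ := by
  cases J with
  | zero => simp [expRem, derivS_expFun]
  | succ J =>
    rw [expRem, map_sub, derivS_expFun, map_sum, Finset.sum_range_succ']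
    simp only [map_smul, derivS_mono, derivS_mono_zero, smul_zero, add_zero]
    rw [Nat.add_sub_cancel, expRem, smul_sub, Finset.smul_sum]
    congr 1
    refine Finset.sum_congr rfl fun k _ => ?_
    rw [smul_smul, smul_smul, Nat.factorial_succ]
    congr 1
    have h1 : (k : ℂ) + 1 ≠ 0 := Nat.cast_add_one_ne_zero k
    have h2 : (k.factorial : ℂ) ≠ 0 := by exact_mod_cast k.factorial_ne_zero
    push_cast
    field_simp
    ring

lemma evalD_expRem (j J : ℕ) (ξ x : ℝ) :
    evalD j x (expRem J ξ) = (-(Complex.I * ξ)) ^ j * (Complex.exp (-(Complex.I * x * ξ)) -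
      ∑ k ∈ Finset.range (J - j), (-(Complex.I * x * ξ)) ^ k / (k.factorial : ℂ)) := by
  induction j generalizing J with
  | zero =>
    rw [expRem, map_sub, map_sum, evalD_zero, pow_zero, one_mul]
    congr 1
    refine Finset.sum_congr rfl fun k _ => ?_
    rw [map_smul, evalD_zero, mono_apply, smul_eq_mul, div_mul_eq_mul_div, ← mul_pow]
    congr 2; ring
  | succ j ih =>
    rw [evalD_succ, derivS_expRem, map_smul, ih, smul_eq_mul, Nat.sub_sub, add_comm 1 j, pow_succ]
    ring

/-- The Taylor remainder of `e^{-ixξ}` is `O(|ξ|^J)`, locally uniformly in `x` and together with its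
derivatives. -/
lemma norm_evalD_expRem_le {j J : ℕ} {ξ x R : ℝ} (hR : 1 ≤ R) (hξ : |ξ| ≤ 1) (hx : |x| ≤ R) :
    ‖evalD j x (expRem J ξ)‖ ≤ R ^ J * Real.exp R * |ξ| ^ J := by
  have hz : ‖-(Complex.I * (x : ℂ) * (ξ : ℂ))‖ = |x| * |ξ| := by simp
  have h1 := Complex.norm_exp_sub_sum_le_norm_mul_exp (-(Complex.I * (x : ℂ) * (ξ : ℂ))) (J - j)
  rw [hz] at h1
  rw [evalD_expRem, norm_mul]
  have h2 : ‖(-(Complex.I * (ξ : ℂ))) ^ j‖ = |ξ| ^ j := by simp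
  have h3 : |x| * |ξ| ≤ R := by
    calc |x| * |ξ| ≤ R * 1 := mul_le_mul hx hξ (abs_nonneg _) (by linarith)
      _ = R := mul_one R
  rw [h2]
  calc |ξ| ^ j * _ ≤ |ξ| ^ j * ((|x| * |ξ|) ^ (J - j) * Real.exp (|x| * |ξ|)) := by gcongr
    _ = |x| ^ (J - j) * Real.exp (|x| * |ξ|) * |ξ| ^ (j + (J - j)) := by rw [mul_pow, pow_add]; ring
    _ ≤ R ^ J * Real.exp R * |ξ| ^ J := by
        have h4 : |x| ^ (J - j) ≤ R ^ J :=
          (pow_le_pow_left₀ (abs_nonneg x) hx _).trans (pow_le_pow_right₀ hR (Nat.sub_le J j))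
        have h5 : |ξ| ^ (j + (J - j)) ≤ |ξ| ^ J :=
          pow_le_pow_of_le_one (abs_nonneg _) hξ (by omega)
        gcongr

/-- The Taylor expansion of the Fourier transform of a compactly supported distribution. -/
lemma CompactDistribution.exists_expRem_bound (D : CompactDistribution) (J : ℕ) :
    ∃ C : ℝ, ∀ ξ : ℝ, |ξ| ≤ 1 → ‖D.toLin (expRem J ξ)‖ ≤ C * |ξ| ^ J := by
  obtain ⟨N, R, C, hR, -, h⟩ := D.exists_bound
  refine ⟨C * (R ^ J * Real.exp R), fun ξ hξ => ?_⟩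
  rw [mul_assoc]
  exact h _ _ (by positivity) fun j _ x hx => norm_evalD_expRem_le hR hξ hx

lemma eq_zero_of_mulVec_eq_smul {A : Matrix (Fin r) (Fin r) ℂ} {μ : ℂ} (hμ : μ ∉ spectrum ℂ A)
    {c : Fin r → ℂ} (h : A *ᵥ c = μ • c) : c = 0 := by
  by_contra hc
  refine hμ ?_
  rw [spectrum.mem_iff, Matrix.isUnit_iff_isUnit_det, isUnit_iff_ne_zero, not_not,
    ← Matrix.exists_mulVec_eq_zero_iff]
  refine ⟨c, hc, ?_⟩
  rw [Matrix.sub_mulVec, h, Algebra.algebraMap_eq_smul_one, Matrix.smul_mulVec, Matrix.one_mulVec,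
    sub_self]

/-- Left and right eigenvectors of a simple eigenvalue are not orthogonal. -/
lemma eq_zero_of_dotProduct_eq_zero {A : Matrix (Fin r) (Fin r) ℂ}
    (hA : A.charpoly.rootMultiplicity 1 = 1) {w c : Fin r → ℂ} (hw : w ≠ 0) (hwA : w ᵥ* A = w)
    (hc : A *ᵥ c = c) (hwc : w ⬝ᵥ c = 0) : c = 0 := by
  by_contra hc0
  set L := Matrix.toLin' A with hL
  have hmult : Module.finrank ℂ (Module.End.maxGenEigenspace L 1) = 1 := by
    rw [LinearMap.finrank_maxGenEigenspace_eq, hL, Matrix.charpoly_toLin', hA]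
  have hmem : ∀ {x : Fin r → ℂ}, L x = x → x ∈ Module.End.maxGenEigenspace L 1 := fun {x} hx => by
    rw [Module.End.mem_maxGenEigenspace]
    exact ⟨1, by simp [hx]⟩
  have hspan : ∀ x ∈ Module.End.maxGenEigenspace L 1, ∃ t : ℂ, t • c = x := fun x hx => by
    obtain ⟨t, ht⟩ := (finrank_eq_one_iff_of_nonzero' (⟨c, hmem hc⟩ : Module.End.maxGenEigenspace L 1)
      (by simpa using hc0)).mp hmult ⟨x, hx⟩
    exact ⟨t, congrArg Subtype.val ht⟩
  -- the range of `A - 1` is the whole kernel of `w`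
  set B := L - 1 with hB
  have hBx : ∀ x, B x = A *ᵥ x - x := fun x => rfl
  have hker : Module.finrank ℂ (LinearMap.ker B) = 1 := by
    refine le_antisymm ?_ (Submodule.one_le_finrank_iff.mpr fun h => hc0 ?_)
    · rw [← hmult]
      exact Submodule.finrank_mono fun x hx => hmem (sub_eq_zero.mp hx)
    · have : c ∈ LinearMap.ker B := by rw [LinearMap.mem_ker, hBx, hc, sub_self]
      rwa [h, Submodule.mem_bot] at this
  let W : (Fin r → ℂ) →ₗ[ℂ] ℂ :=
    { toFun := fun x => w ⬝ᵥ x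
      map_add' := fun x y => dotProduct_add w x y
      map_smul' := fun t x => dotProduct_smul t w x }
  have hW : W ≠ 0 := fun h => hw (dotProduct_eq_zero_iff.mp fun x => LinearMap.congr_fun h x)
  have hWrange : Module.finrank ℂ (LinearMap.range W) = 1 := by
    rw [LinearMap.range_eq_top.mpr (LinearMap.surjective_of_ne_zero hW), finrank_top,
      Module.finrank_self]
  have hle : LinearMap.range B ≤ LinearMap.ker W := by
    rintro _ ⟨x, rfl⟩
    change w ⬝ᵥ B x = 0
    rw [hBx, dotProduct_sub, Matrix.dotProduct_mulVec, hwA, sub_self]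
  have heq : LinearMap.range B = LinearMap.ker W := by
    refine Submodule.eq_of_le_of_finrank_eq hle ?_
    have h1 := LinearMap.finrank_range_add_finrank_ker B
    have h2 := LinearMap.finrank_range_add_finrank_ker W
    omega
  -- `c = A d - d` makes `d` a generalized eigenvector, hence a multiple of `c`, so `A d = d`
  obtain ⟨d, hd⟩ : c ∈ LinearMap.range B := by rw [heq]; exact hwc
  have hd2 : d ∈ Module.End.maxGenEigenspace L 1 := by
    rw [Module.End.mem_maxGenEigenspace]
    refine ⟨2, ?_⟩
    rw [one_smul, pow_two]
    change B (B d) = 0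
    rw [hd, hBx, hc, sub_self]
  obtain ⟨t, rfl⟩ := hspan d hd2
  refine hc0 ?_
  rw [← hd, hBx, Matrix.mulVec_smul, hc, sub_self]

lemma fourierDist_zero (φ : Fin r → CompactDistribution) (i : Fin r) :
    fourierDist φ 0 i = (φ i).toLin (mono 0) := by
  rw [fourierDist]
  congr 1
  refine Subtype.ext (funext fun x => ?_)
  change Complex.exp (-(Complex.I * (x : ℂ) * ((0 : ℝ) : ℂ))) = (x : ℂ) ^ 0
  simp

/-- The Taylor coefficient of order `j` of the difference `δ` of two normalized solutions, if it is
the first nonzero one, is an eigenvector of `â(0)` for the eigenvalue `2^j`, by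
`δ(2ξ) = â(ξ) δ(ξ)`. -/
theorem IsNormalizedRefinable.unique {a : ℤ →₀ Matrix (Fin r) (Fin r) ℂ} {v : ℤ →₀ (Fin r → ℂ)}
    {m : ℕ} (hv : IsMatchingFilter a v (m + 1))
    (hsimple : (symbol a 0).charpoly.rootMultiplicity 1 = 1)
    (hpow : ∀ k : ℕ, 1 ≤ k → (2 : ℂ) ^ k ∉ spectrum ℂ (symbol a 0))
    {φ ψ : Fin r → CompactDistribution} (hφ : IsNormalizedRefinable a v φ)
    (hψ : IsNormalizedRefinable a v ψ) : φ = ψ := by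
  suffices h : ∀ n i, (φ i).toLin (mono n) = (ψ i).toLin (mono n) from
    funext fun i => CompactDistribution.ext_of_moments fun j => h j i
  set δ : ℝ → (Fin r → ℂ) := fun ξ => fourierDist φ ξ - fourierDist ψ ξ with hδ
  have hδ2 : ∀ ξ, δ (2 * ξ) = symbol a ξ *ᵥ δ ξ := fun ξ => by
    simp only [hδ, hφ.1, hψ.1, Matrix.mulVec_sub]
  intro n
  induction n using Nat.strong_induction_on with
  | _ n ih =>
    obtain ⟨d, hd⟩ : ∃ d : Fin r → ℂ, d = fun i => (φ i).toLin (mono n) - (ψ i).toLin (mono n) :=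
      ⟨_, rfl⟩
    suffices hd0 : d = 0 from fun i => sub_eq_zero.mp (congrFun (hd.symm.trans hd0) i)
    set z : ℂ := (-Complex.I) ^ n / (n.factorial : ℂ) with hz
    have hz0 : z ≠ 0 := div_ne_zero (pow_ne_zero _ (neg_ne_zero.mpr Complex.I_ne_zero))
      (by exact_mod_cast n.factorial_ne_zero)
    have hexp : ∃ C : ℝ, ∀ ξ : ℝ, |ξ| ≤ 1 → ∀ i,
        ‖δ ξ i - (ξ : ℂ) ^ n * (z * d i)‖ ≤ C * |ξ| ^ (n + 1) := by
      choose C hC using fun i => (φ i).exists_expRem_bound (n + 1)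
      choose C' hC' using fun i => (ψ i).exists_expRem_bound (n + 1)
      refine ⟨∑ i, (|C i| + |C' i|), fun ξ hξ i => ?_⟩
      have h1 : δ ξ i - (ξ : ℂ) ^ n * (z * d i)
          = (φ i).toLin (expRem (n + 1) ξ) - (ψ i).toLin (expRem (n + 1) ξ) := by
        rw [expRem, map_sub, map_sub, map_sum, map_sum, Finset.sum_range_succ,
          Finset.sum_range_succ, Finset.sum_congr rfl fun k hk => by
            rw [map_smul, ih k (Finset.mem_range.mp hk) i, ← map_smul]]
        simp only [map_smul, smul_eq_mul, hδ, hd, hz, Pi.sub_apply, fourierDist]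
        rw [neg_mul_eq_neg_mul, mul_pow]; ring
      rw [h1]
      refine (norm_sub_le _ _).trans ((add_le_add (hC i ξ hξ) (hC' i ξ hξ)).trans ?_)
      rw [← add_mul]
      refine mul_le_mul_of_nonneg_right ?_ (by positivity)
      exact (add_le_add (le_abs_self _) (le_abs_self _)).trans
        (Finset.single_le_sum (f := fun i => |C i| + |C' i|) (fun i _ => by positivity)
          (Finset.mem_univ i))
    obtain ⟨C, hC⟩ := hexp
    have hlim : Tendsto (fun ξ : ℝ => ((ξ : ℂ) ^ n)⁻¹ • δ ξ) (𝓝[≠] 0) (𝓝 (z • d)) := by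
      rw [tendsto_pi_nhds]
      intro i
      rw [tendsto_iff_norm_sub_tendsto_zero]
      have h0 : Tendsto (fun ξ : ℝ => C * |ξ|) (𝓝[≠] 0) (𝓝 0) := by
        have : Continuous fun ξ : ℝ => C * |ξ| := by fun_prop
        simpa using (this.tendsto 0).mono_left nhdsWithin_le_nhds
      refine squeeze_zero' (.of_forall fun ξ => norm_nonneg _) ?_ h0
      have h1 : ∀ᶠ ξ : ℝ in 𝓝[≠] 0, |ξ| ≤ 1 :=
        nhdsWithin_le_nhds ((continuous_abs.tendsto (0 : ℝ)).eventually_le_const (by simp))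
      filter_upwards [h1, self_mem_nhdsWithin] with ξ hξ hξ0
      have hne : (ξ : ℂ) ^ n ≠ 0 := pow_ne_zero _ (Complex.ofReal_ne_zero.mpr hξ0)
      have hpos : 0 < |ξ| ^ n := pow_pos (abs_pos.mpr hξ0) n
      have h2 : ((ξ : ℂ) ^ n)⁻¹ * δ ξ i - z * d i
          = ((ξ : ℂ) ^ n)⁻¹ * (δ ξ i - (ξ : ℂ) ^ n * (z * d i)) := by
        rw [mul_sub, inv_mul_cancel_left₀ hne]
      rw [Pi.smul_apply, Pi.smul_apply, smul_eq_mul, smul_eq_mul, h2, norm_mul, norm_inv, norm_pow,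
        Complex.norm_real, Real.norm_eq_abs, inv_mul_le_iff₀ hpos]
      refine (hC ξ hξ i).trans (le_of_eq ?_)
      rw [pow_succ]; ring
    have htwo : Tendsto (fun ξ : ℝ => 2 * ξ) (𝓝[≠] 0) (𝓝[≠] 0) := by
      refine tendsto_nhdsWithin_iff.mpr ⟨?_, ?_⟩
      · have : Continuous fun ξ : ℝ => 2 * ξ := by fun_prop
        simpa using (this.tendsto 0).mono_left nhdsWithin_le_nhds
      · filter_upwards [self_mem_nhdsWithin] with ξ hξ
        exact mul_ne_zero two_ne_zero hξ
    have hA : Tendsto (fun ξ : ℝ => symbol a ξ *ᵥ (((ξ : ℂ) ^ n)⁻¹ • δ ξ)) (𝓝[≠] 0)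
        (𝓝 (symbol a 0 *ᵥ (z • d))) := by
      rw [tendsto_pi_nhds]
      intro i
      simp only [Matrix.mulVec, dotProduct]
      exact tendsto_finsetSum _ fun j _ => Tendsto.mul
        (((contDiff_symbol_mat' a i j).continuous.tendsto 0).mono_left nhdsWithin_le_nhds)
        (tendsto_pi_nhds.mp hlim j)
    have hB : Tendsto (fun ξ : ℝ => symbol a ξ *ᵥ (((ξ : ℂ) ^ n)⁻¹ • δ ξ)) (𝓝[≠] 0)
        (𝓝 ((2 : ℂ) ^ n • z • d)) := by
      refine ((hlim.comp htwo).const_smul ((2 : ℂ) ^ n)).congr fun ξ => ?_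
      simp only [Function.comp_apply]
      rw [hδ2, Matrix.mulVec_smul, smul_smul]
      congr 1
      push_cast
      rw [mul_pow, mul_inv, ← mul_assoc, mul_inv_cancel₀ (pow_ne_zero n two_ne_zero), one_mul]
    have heig := tendsto_nhds_unique hA hB
    rw [Matrix.mulVec_smul, smul_comm] at heig
    have heig := smul_right_injective _ hz0 heig
    rcases Nat.eq_zero_or_pos n with hn | hn
    · subst hn
      rw [pow_zero, one_smul] at heig
      refine eq_zero_of_dotProduct_eq_zero hsimple hv.1 (symbol_vecMul_zero hv m.succ_pos) heig ?_
      have h1 : d = fourierDist φ 0 - fourierDist ψ 0 := funext fun i => by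
        rw [hd, Pi.sub_apply, fourierDist_zero, fourierDist_zero]
      rw [h1, dotProduct_sub, hφ.2, hψ.2, sub_self]
    · exact eq_zero_of_mulVec_eq_smul (hpow n hn) heig

/-! ### Existence of the normalized refinable distribution -/

/-- The dilated translate `x ↦ f((x + k) / 2)`. -/
def dilS (k : ℤ) : SmoothFun →ₗ[ℂ] SmoothFun where
  toFun f := ⟨fun x => (f : ℝ → ℂ) ((x + k) / 2), by
    have h : ContDiff ℝ ∞ fun x : ℝ => (x + k) / 2 := (contDiff_id.add contDiff_const).div_const 2
    exact (contDiff_coe f).comp h⟩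
  map_add' _ _ := rfl
  map_smul' _ _ := rfl

lemma dilS_apply (k : ℤ) (f : SmoothFun) (x : ℝ) :
    (dilS k f : ℝ → ℂ) x = (f : ℝ → ℂ) ((x + k) / 2) := rfl

lemma derivS_dilS (k : ℤ) (f : SmoothFun) : derivS (dilS k f) = (1 / 2 : ℂ) • dilS k (derivS f) := by
  refine Subtype.ext (funext fun x => ?_)
  have h1 : HasDerivAt (fun x : ℝ => (x + k) / 2) (1 / 2) x :=
    ((hasDerivAt_id x).add_const _).div_const 2
  have h2 := (hasDerivAt_smoothFun f ((x + k) / 2)).scomp x h1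
  rw [evalD_succ, evalD_zero] at h2
  refine h2.deriv.trans ?_
  rw [Complex.real_smul]
  change _ = (1 / 2 : ℂ) * (derivS f : ℝ → ℂ) ((x + k) / 2)
  push_cast; rfl

lemma evalD_dilS (j : ℕ) (x : ℝ) (k : ℤ) (f : SmoothFun) :
    evalD j x (dilS k f) = (1 / 2) ^ j * evalD j ((x + k) / 2) f := by
  induction j generalizing f with
  | zero => rw [evalD_zero, evalD_zero, dilS_apply, pow_zero, one_mul]
  | succ j ih => rw [evalD_succ, derivS_dilS, map_smul, ih, evalD_succ, smul_eq_mul, pow_succ]; ring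

lemma dilS_expFun (k : ℤ) (ξ : ℝ) : dilS k (expFun (2 * ξ)) = ek k ξ • expFun ξ := by
  refine Subtype.ext (funext fun x => ?_)
  change Complex.exp (-(Complex.I * (((x + k) / 2 : ℝ) : ℂ) * ((2 * ξ : ℝ) : ℂ)))
    = ek k ξ * Complex.exp (-(Complex.I * (x : ℂ) * (ξ : ℂ)))
  rw [ek, ← Complex.exp_add]
  congr 1
  push_cast; ring

/-- The transpose of the refinement operator, acting on vectors of test functions. -/
def cascadeAdj (a : ℤ →₀ Matrix (Fin r) (Fin r) ℂ) : (Fin r → SmoothFun) →ₗ[ℂ] (Fin r → SmoothFun) where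
  toFun F := fun i' => ∑ k ∈ a.support, ∑ i, a k i i' • dilS k (F i)
  map_add' F G := by
    funext i'
    simp only [Pi.add_apply, map_add, smul_add, Finset.sum_add_distrib]
  map_smul' c F := by
    funext i'
    simp only [Pi.smul_apply, map_smul, Finset.smul_sum, RingHom.id_apply, smul_comm c]

lemma cascadeAdj_apply (a : ℤ →₀ Matrix (Fin r) (Fin r) ℂ) (F : Fin r → SmoothFun) (i' : Fin r) :
    cascadeAdj a F i' = ∑ k ∈ a.support, ∑ i, a k i i' • dilS k (F i) := rfl

lemma evalD_cascadeAdj (a : ℤ →₀ Matrix (Fin r) (Fin r) ℂ) (F : Fin r → SmoothFun) (j : ℕ) (x : ℝ)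
    (i' : Fin r) : evalD j x (cascadeAdj a F i')
      = (1 / 2) ^ j * ∑ k ∈ a.support, ∑ i, a k i i' * evalD j ((x + k) / 2) (F i) := by
  simp only [cascadeAdj_apply, map_sum, map_smul, evalD_dilS, smul_eq_mul, Finset.mul_sum]
  exact Finset.sum_congr rfl fun k _ => Finset.sum_congr rfl fun i _ => by ring

/-- The sum of the moduli of all entries of the mask. -/
def maskSum (a : ℤ →₀ Matrix (Fin r) (Fin r) ℂ) : ℝ := ∑ k ∈ a.support, ∑ i, ∑ i', ‖a k i i'‖

lemma maskSum_nonneg (a : ℤ →₀ Matrix (Fin r) (Fin r) ℂ) : 0 ≤ maskSum a :=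
  Finset.sum_nonneg fun _ _ => Finset.sum_nonneg fun _ _ => Finset.sum_nonneg fun _ _ => norm_nonneg _

/-- Each application of the transposed refinement operator gains a factor `2^{-j}` on the derivatives
of order `j`. -/
lemma norm_evalD_cascadeAdj_le {a : ℤ →₀ Matrix (Fin r) (Fin r) ℂ} {N : ℕ} (ha : SuppIn N a) {R : ℝ}
    (hN : N ≤ R) {j : ℕ} {M : ℝ} {F : Fin r → SmoothFun}
    (hM : ∀ i x, |x| ≤ R → ‖evalD j x (F i)‖ ≤ M) (i : Fin r) {x : ℝ} (hx : |x| ≤ R) :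
    ‖evalD j x (cascadeAdj a F i)‖ ≤ maskSum a * (1 / 2) ^ j * M := by
  rw [evalD_cascadeAdj, norm_mul, norm_pow, mul_comm (maskSum a), mul_assoc]
  have h2 : ‖(1 / 2 : ℂ)‖ = 1 / 2 := by simp
  rw [h2, maskSum, Finset.sum_mul]
  refine mul_le_mul_of_nonneg_left (norm_sum_le_of_le _ fun k hk => ?_) (by positivity)
  rw [Finset.sum_mul]
  refine norm_sum_le_of_le _ fun i' _ => ?_
  rw [norm_mul]
  have hk : |(k : ℝ)| ≤ N := by exact_mod_cast ha k (Finsupp.mem_support_iff.mp hk)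
  have hx' : |(x + k) / 2| ≤ R := by
    rw [abs_div, abs_two, div_le_iff₀ two_pos]
    linarith [abs_add_le x k]
  refine mul_le_mul ?_ (hM i' _ hx') (norm_nonneg _) (Finset.sum_nonneg fun _ _ => norm_nonneg _)
  exact Finset.single_le_sum (f := fun i => ‖a k i' i‖) (fun _ _ => norm_nonneg _) (Finset.mem_univ i)

lemma norm_evalD_iterate_cascadeAdj_le {a : ℤ →₀ Matrix (Fin r) (Fin r) ℂ} {N : ℕ} (ha : SuppIn N a)
    {R : ℝ} (hN : N ≤ R) {j : ℕ} {M : ℝ} {F : Fin r → SmoothFun}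
    (hM : ∀ i x, |x| ≤ R → ‖evalD j x (F i)‖ ≤ M) (n : ℕ) : ∀ i x, |x| ≤ R →
      ‖evalD j x ((cascadeAdj a)^[n] F i)‖ ≤ M * (maskSum a * (1 / 2) ^ j) ^ n := by
  have h0 := maskSum_nonneg a
  induction n with
  | zero => simpa using hM
  | succ n ih =>
    intro i x hx
    rw [Function.iterate_succ_apply', pow_succ']
    exact (norm_evalD_cascadeAdj_le ha hN ih i hx).trans (le_of_eq (by ring))

/-- A function with vanishing derivatives of order less than `J` at `0` is controlled, together
with its derivatives, by the one of order `J`. -/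
lemma norm_evalD_le_of_vanish {R : ℝ} (hR : 1 ≤ R) {M : ℝ} (J : ℕ) : ∀ {h : SmoothFun},
    (∀ j < J, evalD j 0 h = 0) → (∀ x, |x| ≤ R → ‖evalD J x h‖ ≤ M) →
      ∀ j ≤ J, ∀ x, |x| ≤ R → ‖evalD j x h‖ ≤ R ^ J * M := by
  induction J with
  | zero =>
    intro h _ hM j hj x hx
    obtain rfl : j = 0 := Nat.le_zero.mp hj
    simpa using hM x hx
  | succ J ih =>
    intro h h0 hM
    have hM0 : 0 ≤ M := (norm_nonneg _).trans (hM 0 (by rw [abs_zero]; linarith))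
    have h1 := ih (h := derivS h) (fun j hj => by rw [← evalD_succ]; exact h0 _ (by omega))
      fun x hx => by rw [← evalD_succ]; exact hM x hx
    simp only [← evalD_succ] at h1
    intro j hj x hx
    cases j with
    | zero =>
      rw [evalD_zero, pow_succ', mul_assoc]
      exact norm_le_of_norm_evalD_one_le (by rw [← evalD_zero]; exact h0 0 J.succ_pos)
        (h1 0 J.zero_le) hx
    | succ j =>
      refine (h1 j (by omega) x hx).trans ?_
      gcongr
      exact J.le_succ

/-- The distribution `∑_{j < J} c_j (-1)^j δ^{(j)}`, acting on vectors of test functions. -/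
def jetFun (c : ℕ → Fin r → ℂ) (J : ℕ) : (Fin r → SmoothFun) →ₗ[ℂ] ℂ :=
  ∑ j ∈ Finset.range J, ∑ i, c j i • (evalD j 0 ∘ₗ LinearMap.proj i)

lemma jetFun_apply (c : ℕ → Fin r → ℂ) (J : ℕ) (F : Fin r → SmoothFun) :
    jetFun c J F = ∑ j ∈ Finset.range J, ∑ i, c j i * evalD j 0 (F i) := by
  simp [jetFun]

lemma norm_jetFun_le (c : ℕ → Fin r → ℂ) (J : ℕ) {F : Fin r → SmoothFun} {M : ℝ}
    (hM : ∀ j < J, ∀ i, ‖evalD j 0 (F i)‖ ≤ M) :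
    ‖jetFun c J F‖ ≤ (∑ j ∈ Finset.range J, ∑ i, ‖c j i‖) * M := by
  rw [jetFun_apply, Finset.sum_mul]
  refine norm_sum_le_of_le _ fun j hj => ?_
  rw [Finset.sum_mul]
  refine norm_sum_le_of_le _ fun i _ => ?_
  rw [norm_mul]
  exact mul_le_mul_of_nonneg_left (hM j (Finset.mem_range.mp hj) i) (norm_nonneg _)

/-- The normalized moments `∑ₖ k^p a(k) / p!` of the mask. -/
def maskMoment (a : ℤ →₀ Matrix (Fin r) (Fin r) ℂ) (p : ℕ) : Matrix (Fin r) (Fin r) ℂ :=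
  ∑ k ∈ a.support, ((k : ℂ) ^ p / (p.factorial : ℂ)) • a k

lemma maskMoment_zero (a : ℤ →₀ Matrix (Fin r) (Fin r) ℂ) : maskMoment a 0 = symbol a 0 := by
  simp [maskMoment, symbol_eq_sum, Finsupp.sum, ek_zero_right]

/-- The solution of the recursion for the moments of a refinable distribution. -/
def momentSeq (a : ℤ →₀ Matrix (Fin r) (Fin r) ℂ) (c₀ : Fin r → ℂ) : ℕ → (Fin r → ℂ)
  | 0 => c₀
  | j + 1 => ((2 : ℂ) ^ (j + 1) • (1 : Matrix (Fin r) (Fin r) ℂ) - symbol a 0)⁻¹ *ᵥ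
      ∑ q : Fin (j + 1), maskMoment a (j + 1 - q) *ᵥ momentSeq a c₀ q

/-- The recursion is solvable since `2^j - â(0)` is invertible for `j ≥ 1`; for `j = 0` it says that
`c₀` is an eigenvector. -/
lemma momentSeq_spec {a : ℤ →₀ Matrix (Fin r) (Fin r) ℂ}
    (hpow : ∀ k : ℕ, 1 ≤ k → (2 : ℂ) ^ k ∉ spectrum ℂ (symbol a 0)) {c₀ : Fin r → ℂ}
    (h0 : symbol a 0 *ᵥ c₀ = c₀) (j : ℕ) :
    ∑ q ∈ Finset.range (j + 1), maskMoment a (j - q) *ᵥ momentSeq a c₀ q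
      = (2 : ℂ) ^ j • momentSeq a c₀ j := by
  cases j with
  | zero => simp [maskMoment_zero, momentSeq, h0]
  | succ j =>
    have hu : IsUnit ((2 : ℂ) ^ (j + 1) • (1 : Matrix (Fin r) (Fin r) ℂ) - symbol a 0) := by
      have := spectrum.notMem_iff.mp (hpow (j + 1) (by omega))
      rwa [Algebra.algebraMap_eq_smul_one] at this
    have h1 : ((2 : ℂ) ^ (j + 1) • (1 : Matrix (Fin r) (Fin r) ℂ) - symbol a 0) *ᵥ
        momentSeq a c₀ (j + 1)
          = ∑ q ∈ Finset.range (j + 1), maskMoment a (j + 1 - q) *ᵥ momentSeq a c₀ q := by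
      rw [momentSeq, Matrix.mulVec_mulVec, Matrix.mul_nonsing_inv _
        ((Matrix.isUnit_iff_isUnit_det _).mp hu), Matrix.one_mulVec,
        Finset.sum_range fun q => maskMoment a (j + 1 - q) *ᵥ momentSeq a c₀ q]
    rw [Finset.sum_range_succ, ← h1, Nat.sub_self, maskMoment_zero, Matrix.sub_mulVec,
      Matrix.smul_mulVec, Matrix.one_mulVec, sub_add_cancel]

/-- The vector polynomial `b x^j`. -/
def monoV (j : ℕ) (b : Fin r → ℂ) : Fin r → SmoothFun := fun i => b i • mono j

lemma evalD_zero_mono (s j : ℕ) : evalD s 0 (mono j) = if s = j then (j.factorial : ℂ) else 0 := by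
  rw [evalD_mono]
  split_ifs with h
  · simp [h, Nat.descFactorial_self]
  · rcases lt_or_gt_of_ne h with h | h
    · simp [Nat.sub_ne_zero_of_lt h]
    · simp [Nat.descFactorial_of_lt h]

lemma jetFun_monoV (c : ℕ → Fin r → ℂ) {J j : ℕ} (hj : j < J) (b : Fin r → ℂ) :
    jetFun c J (monoV j b) = (j.factorial : ℂ) * (b ⬝ᵥ c j) := by
  rw [jetFun_apply, Finset.sum_eq_single j]
  · simp only [monoV, map_smul, evalD_zero_mono, if_true, smul_eq_mul, dotProduct, Finset.mul_sum]
    exact Finset.sum_congr rfl fun i _ => by ring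
  · intro s _ hs
    simp [monoV, evalD_zero_mono, hs]
  · intro h; exact absurd (Finset.mem_range.mpr hj) h

/-- On polynomials of degree less than `J`, the functional built from the moment recursion is
invariant under the refinement operator. -/
lemma jetFun_cascadeAdj_monoV {a : ℤ →₀ Matrix (Fin r) (Fin r) ℂ} {c : ℕ → Fin r → ℂ}
    (hc : ∀ j, ∑ q ∈ Finset.range (j + 1), maskMoment a (j - q) *ᵥ c q = (2 : ℂ) ^ j • c j)
    {J j : ℕ} (hj : j < J) (b : Fin r → ℂ) :
    jetFun c J (cascadeAdj a (monoV j b)) = jetFun c J (monoV j b) := by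
  have h1 : ∀ q, ∑ i', c q i' * evalD q 0 (cascadeAdj a (monoV j b) i')
      = (1 / 2) ^ q * ((j.descFactorial q : ℂ) * ∑ i, b i * ∑ k ∈ a.support, ∑ i',
        a k i i' * ((k : ℂ) / 2) ^ (j - q) * c q i') := by
    intro q
    simp only [evalD_cascadeAdj, monoV, map_smul, evalD_mono, smul_eq_mul, Finset.mul_sum]
    rw [Finset.sum_comm]
    conv_rhs => rw [Finset.sum_comm]
    refine Finset.sum_congr rfl fun k _ => ?_
    rw [Finset.sum_comm]
    refine Finset.sum_congr rfl fun i _ => Finset.sum_congr rfl fun i' _ => ?_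
    push_cast; ring
  have h2 : ∀ q ∈ Finset.range (j + 1), ∑ i', c q i' * evalD q 0 (cascadeAdj a (monoV j b) i')
      = (1 / 2) ^ j * ((j.factorial : ℂ) * (b ⬝ᵥ (maskMoment a (j - q) *ᵥ c q))) := by
    intro q hq
    have hqj : q ≤ j := Nat.lt_succ_iff.mp (Finset.mem_range.mp hq)
    have hf : (((j - q).factorial : ℕ) : ℂ) ≠ 0 := by exact_mod_cast (j - q).factorial_ne_zero
    have hfact : (j.factorial : ℂ) = ((j - q).factorial : ℂ) * (j.descFactorial q : ℂ) := by
      exact_mod_cast (Nat.factorial_mul_descFactorial hqj).symm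
    have hpow2 : (1 / 2 : ℂ) ^ j = (1 / 2) ^ q * (1 / 2) ^ (j - q) := by
      rw [← pow_add, Nat.add_sub_cancel' hqj]
    rw [h1, hfact, hpow2]
    simp only [dotProduct, Matrix.mulVec, maskMoment, Matrix.sum_apply, Matrix.smul_apply,
      smul_eq_mul, Finset.mul_sum, Finset.sum_mul]
    refine Finset.sum_congr rfl fun i _ => ?_
    conv_rhs => rw [Finset.sum_comm]
    refine Finset.sum_congr rfl fun k _ => Finset.sum_congr rfl fun i' _ => ?_
    simp only [div_pow, one_pow]
    field_simp
  rw [jetFun_apply, jetFun_monoV c hj,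
    ← Finset.sum_subset (Finset.range_mono (Nat.succ_le_of_lt hj)), Finset.sum_congr rfl h2,
    ← Finset.mul_sum, ← Finset.mul_sum]
  · have h3 : ∑ q ∈ Finset.range (j + 1), b ⬝ᵥ (maskMoment a (j - q) *ᵥ c q)
        = (2 : ℂ) ^ j * (b ⬝ᵥ c j) := by
      rw [← smul_eq_mul, ← dotProduct_smul, ← hc, dotProduct_sum]
    rw [h3, mul_left_comm, ← mul_assoc ((1 / 2 : ℂ) ^ j), ← mul_pow]
    norm_num
  · intro q _ hq
    have hq : j < q := by
      by_contra h; exact hq (Finset.mem_range.mpr (by omega))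
    rw [h1, Nat.descFactorial_of_lt hq]; simp

/-- The vector of Taylor polynomials of degree less than `J` at the origin. -/
def taylorV (J : ℕ) (F : Fin r → SmoothFun) : Fin r → SmoothFun :=
  ∑ j ∈ Finset.range J, monoV j fun i => evalD j 0 (F i) / (j.factorial : ℂ)

lemma evalD_taylorV (s : ℕ) (x : ℝ) (J : ℕ) (F : Fin r → SmoothFun) (i : Fin r) :
    evalD s x (taylorV J F i)
      = ∑ j ∈ Finset.range J, evalD j 0 (F i) / (j.factorial : ℂ) * evalD s x (mono j) := by
  simp [taylorV, Finset.sum_apply, monoV]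

/-- On the Taylor polynomial of `F` the jet functional is invariant, by the recursion for the
moments; what remains is controlled by the derivatives of order `J`. -/
lemma exists_jetFun_cascadeAdj_sub_le {a : ℤ →₀ Matrix (Fin r) (Fin r) ℂ} {N : ℕ} (ha : SuppIn N a)
    {R : ℝ} (hN : N ≤ R) (hR : 1 ≤ R) {c : ℕ → Fin r → ℂ}
    (hc : ∀ j, ∑ q ∈ Finset.range (j + 1), maskMoment a (j - q) *ᵥ c q = (2 : ℂ) ^ j • c j)
    (J : ℕ) : ∃ C : ℝ, 0 ≤ C ∧ ∀ (F : Fin r → SmoothFun) (M : ℝ), 0 ≤ M →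
      (∀ i x, |x| ≤ R → ‖evalD J x (F i)‖ ≤ M) →
        ‖jetFun c J (cascadeAdj a F) - jetFun c J F‖ ≤ C * M := by
  have hΛ := maskSum_nonneg a
  have hcs : 0 ≤ ∑ j ∈ Finset.range J, ∑ i, ‖c j i‖ :=
    Finset.sum_nonneg fun _ _ => Finset.sum_nonneg fun _ _ => norm_nonneg _
  refine ⟨(∑ j ∈ Finset.range J, ∑ i, ‖c j i‖) * (maskSum a * R ^ J), by positivity,
    fun F M hM0 hM => ?_⟩
  set G := F - taylorV J F with hG
  have hpoly : jetFun c J (cascadeAdj a (taylorV J F)) = jetFun c J (taylorV J F) := by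
    rw [taylorV, map_sum, map_sum, map_sum]
    exact Finset.sum_congr rfl fun j hj => jetFun_cascadeAdj_monoV hc (Finset.mem_range.mp hj) _
  have hG0 : ∀ i, ∀ j < J, evalD j 0 (G i) = 0 := by
    intro i j hj
    rw [hG, Pi.sub_apply, map_sub, evalD_taylorV, Finset.sum_eq_single j]
    · rw [evalD_zero_mono, if_pos rfl, div_mul_cancel₀ _ (by exact_mod_cast j.factorial_ne_zero),
        sub_self]
    · intro s _ hs
      rw [evalD_zero_mono, if_neg (Ne.symm hs), mul_zero]
    · intro h; exact absurd (Finset.mem_range.mpr hj) h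
  have hGJ : ∀ i x, |x| ≤ R → ‖evalD J x (G i)‖ ≤ M := by
    intro i x hx
    rw [hG, Pi.sub_apply, map_sub, evalD_taylorV, Finset.sum_eq_zero, sub_zero]
    · exact hM i x hx
    · intro j hj
      rw [evalD_mono, Nat.descFactorial_of_lt (Finset.mem_range.mp hj)]; simp
  have hGb : ∀ j < J, ∀ i x, |x| ≤ R → ‖evalD j x (G i)‖ ≤ R ^ J * M := fun j hj i x hx =>
    norm_evalD_le_of_vanish hR J (hG0 i) (hGJ i) j hj.le x hx
  have h1 : jetFun c J (cascadeAdj a F) - jetFun c J F = jetFun c J (cascadeAdj a G) := by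
    have hz : jetFun c J G = 0 := by
      rw [jetFun_apply]
      exact Finset.sum_eq_zero fun j hj => Finset.sum_eq_zero fun i _ => by
        rw [hG0 i j (Finset.mem_range.mp hj), mul_zero]
    rw [hG, map_sub] at hz
    rw [hG, map_sub, map_sub, hpoly, sub_eq_zero.mp hz]
  rw [h1, mul_assoc]
  refine norm_jetFun_le c J fun j hj i => ?_
  refine (norm_evalD_cascadeAdj_le ha hN (hGb j hj) i
    (by rw [abs_zero]; linarith)).trans ?_
  rw [mul_assoc, mul_assoc]
  refine mul_le_mul_of_nonneg_left (mul_le_of_le_one_left (by positivity) ?_) hΛ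
  exact pow_le_one₀ (by norm_num) (by norm_num)

/-- The iterates of the refinement operator, applied to a functional that reproduces the prescribed
moments up to a high order, converge to an invariant functional. -/
lemma exists_invariant_functional {a : ℤ →₀ Matrix (Fin r) (Fin r) ℂ} {c : ℕ → Fin r → ℂ}
    (hc : ∀ j, ∑ q ∈ Finset.range (j + 1), maskMoment a (j - q) *ᵥ c q = (2 : ℂ) ^ j • c j) :
    ∃ (L : (Fin r → SmoothFun) →ₗ[ℂ] ℂ) (J : ℕ) (R C : ℝ), 1 ≤ J ∧ 1 ≤ R ∧ 0 ≤ C ∧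
      (∀ F, L (cascadeAdj a F) = L F) ∧ ∀ (F : Fin r → SmoothFun) (M : ℝ), 0 ≤ M →
        (∀ i x, |x| ≤ R → ‖evalD J x (F i)‖ ≤ M) → ‖L F - jetFun c J F‖ ≤ C * M := by
  obtain ⟨N, hN⟩ := exists_suppIn a
  set R : ℝ := N + 1 with hR
  have hR1 : 1 ≤ R := by simp [hR]
  have hNR : (N : ℝ) ≤ R := by simp [hR]
  have hΛ := maskSum_nonneg a
  -- the order `J` is taken so large that the operator contracts the derivatives of order `J`
  obtain ⟨J₀, hJ₀⟩ := exists_pow_lt_of_lt_one (show 0 < 1 / (maskSum a + 1) by positivity)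
    (show (1 / 2 : ℝ) < 1 by norm_num)
  set J := J₀ + 1 with hJ
  set θ := maskSum a * (1 / 2 : ℝ) ^ J with hθ
  have hθ0 : 0 ≤ θ := by positivity
  have hθ1 : θ < 1 := by
    have h1 : (1 / 2 : ℝ) ^ J ≤ (1 / 2) ^ J₀ :=
      pow_le_pow_of_le_one (by norm_num) (by norm_num) J₀.le_succ
    have h2 := h1.trans_lt hJ₀
    rw [lt_div_iff₀ (by positivity)] at h2
    have h3 : (0 : ℝ) < (1 / 2) ^ J := by positivity
    rw [hθ]; linarith
  obtain ⟨C, hC, hCb⟩ := exists_jetFun_cascadeAdj_sub_le hN hNR hR1 hc J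
  have hgeo : ∀ (F : Fin r → SmoothFun) (M : ℝ), 0 ≤ M →
      (∀ i x, |x| ≤ R → ‖evalD J x (F i)‖ ≤ M) → ∀ n,
        dist (jetFun c J ((cascadeAdj a)^[n] F)) (jetFun c J ((cascadeAdj a)^[n + 1] F))
          ≤ C * M * θ ^ n := by
    intro F M hM0 hM n
    rw [dist_comm, dist_eq_norm, Function.iterate_succ_apply', mul_assoc]
    exact hCb _ _ (by positivity) (norm_evalD_iterate_cascadeAdj_le hN hNR hM n)
  have hbd : ∀ F : Fin r → SmoothFun, ∃ M, 0 ≤ M ∧ ∀ i x, |x| ≤ R → ‖evalD J x (F i)‖ ≤ M := by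
    intro F
    have h1 : ∀ i, ∃ M, ∀ x ∈ Set.Icc (-R) R, ‖evalD J x (F i)‖ ≤ M := fun i =>
      isCompact_Icc.exists_bound_of_continuousOn
        ((contDiff_coe (F i)).continuous_iteratedDeriv J (by exact_mod_cast le_top)).continuousOn
    choose M hM using h1
    refine ⟨∑ i, |M i|, by positivity, fun i x hx => (hM i x (abs_le.mp hx)).trans ?_⟩
    exact (le_abs_self _).trans (Finset.single_le_sum (f := fun i => |M i|)
      (fun _ _ => abs_nonneg _) (Finset.mem_univ i))
  have hlim : ∀ F : Fin r → SmoothFun, ∃ l, Tendsto (fun n => jetFun c J ((cascadeAdj a)^[n] F))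
      atTop (𝓝 l) := by
    intro F
    obtain ⟨M, hM0, hM⟩ := hbd F
    exact cauchySeq_tendsto_of_complete (cauchySeq_of_le_geometric θ (C * M) hθ1 (hgeo F M hM0 hM))
  choose L hL using hlim
  let L' : (Fin r → SmoothFun) →ₗ[ℂ] ℂ :=
    linearMapOfTendsto L (fun n => jetFun c J ∘ₗ (cascadeAdj a) ^ n) (l := atTop) (by
      rw [tendsto_pi_nhds]
      intro F
      refine (hL F).congr fun n => ?_
      rw [LinearMap.comp_apply, Module.End.pow_apply])
  refine ⟨L', J, R, C / (1 - θ), by omega, hR1, div_nonneg hC (by linarith), fun F => ?_,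
    fun F M hM0 hM => ?_⟩
  · refine tendsto_nhds_unique (hL (cascadeAdj a F)) ?_
    exact ((hL F).comp (tendsto_add_atTop_nat 1)).congr fun n => by
      rw [Function.comp_apply, Function.iterate_succ_apply]
  · have h1 := dist_le_of_le_geometric_of_tendsto₀ θ (C * M) hθ1 (hgeo F M hM0 hM) (hL F)
    rw [dist_comm, dist_eq_norm] at h1
    refine h1.trans (le_of_eq ?_)
    ring

/-- The invariant functional of `exists_invariant_functional`, for the moments determined by the
normalized right eigenvector of `â(0)`, is the normalized refinable distribution. -/
theorem exists_isNormalizedRefinable {a : ℤ →₀ Matrix (Fin r) (Fin r) ℂ} {v : ℤ →₀ (Fin r → ℂ)}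
    {m : ℕ} (hv : IsMatchingFilter a v (m + 1))
    (hsimple : (symbol a 0).charpoly.rootMultiplicity 1 = 1)
    (hpow : ∀ k : ℕ, 1 ≤ k → (2 : ℂ) ^ k ∉ spectrum ℂ (symbol a 0)) :
    ∃ φ : Fin r → CompactDistribution, IsNormalizedRefinable a v φ := by
  have hvA := symbol_vecMul_zero hv m.succ_pos
  obtain ⟨y, hy0, hy⟩ : ∃ y : Fin r → ℂ, y ≠ 0 ∧ symbol a 0 *ᵥ y = y := by
    have h1 : (symbol a 0 - 1).det = 0 :=
      Matrix.exists_vecMul_eq_zero_iff.mp ⟨symbol v 0, hv.1, by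
        rw [Matrix.vecMul_sub, hvA, Matrix.vecMul_one, sub_self]⟩
    obtain ⟨y, hy0, hy⟩ := Matrix.exists_mulVec_eq_zero_iff.mpr h1
    rw [Matrix.sub_mulVec, Matrix.one_mulVec] at hy
    exact ⟨y, hy0, sub_eq_zero.mp hy⟩
  -- simplicity of the eigenvalue makes the left and right eigenvectors non-orthogonal
  have hvy : symbol v 0 ⬝ᵥ y ≠ 0 := fun h =>
    hy0 (eq_zero_of_dotProduct_eq_zero hsimple hv.1 hvA hy h)
  set c₀ : Fin r → ℂ := (symbol v 0 ⬝ᵥ y)⁻¹ • y with hc₀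
  have hc₀A : symbol a 0 *ᵥ c₀ = c₀ := by rw [hc₀, Matrix.mulVec_smul, hy]
  obtain ⟨L, J, R, C, hJ, hR, hC, hinv, hL⟩ :=
    exists_invariant_functional (momentSeq_spec hpow hc₀A)
  set c := momentSeq a c₀ with hc
  set S : ℝ := ∑ j ∈ Finset.range J, ∑ i, ‖c j i‖ with hS
  have hsingle : ∀ (i : Fin r) (f : SmoothFun) (j : ℕ) (x M : ℝ), 0 ≤ M → ‖evalD j x f‖ ≤ M →
      ∀ i', ‖evalD j x ((Pi.single i f : Fin r → SmoothFun) i')‖ ≤ M := by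
    intro i f j x M hM0 hM i'
    by_cases h : i' = i
    · subst h; rwa [Pi.single_eq_same]
    · rwa [Pi.single_eq_of_ne h, map_zero, norm_zero]
  -- the components of the invariant functional are distributions of order at most `J`
  let φ : Fin r → CompactDistribution := fun i =>
    { toLin := L ∘ₗ LinearMap.single ℂ (fun _ : Fin r => SmoothFun) i
      bound := by
        refine ⟨J, R, S + C, fun f M hM => ?_⟩
        have h0 : |(0 : ℝ)| ≤ R := by rw [abs_zero]; linarith
        have hM0 : 0 ≤ M := (norm_nonneg _).trans (hM 0 J.zero_le 0 h0)
        have h1 := hL (Pi.single i f) M hM0 fun i' x hx =>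
          hsingle i f J x M hM0 (hM J le_rfl x hx) i'
        have h2 := norm_jetFun_le c J (F := Pi.single i f) fun j hj i' =>
          hsingle i f j 0 M hM0 (hM j hj.le 0 h0) i'
        have h3 := norm_add_le (L (Pi.single i f) - jetFun c J (Pi.single i f))
          (jetFun c J (Pi.single i f))
        rw [sub_add_cancel] at h3
        refine h3.trans ?_
        rw [add_mul]
        linarith }
  have hφ : ∀ i f, (φ i).toLin f = L (Pi.single i f) := fun _ _ => rfl
  refine ⟨φ, fun ξ => funext fun i => ?_, ?_⟩
  · have h1 : cascadeAdj a (Pi.single i (expFun (2 * ξ)))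
        = ∑ i', symbol a ξ i i' • (Pi.single i' (expFun ξ) : Fin r → SmoothFun) := by
      funext i'
      rw [cascadeAdj_apply, Finset.sum_apply, Finset.sum_eq_single i']
      · rw [Pi.smul_apply, Pi.single_eq_same, symbol_eq_sum, Finsupp.sum, Matrix.sum_apply,
          Finset.sum_smul]
        refine Finset.sum_congr rfl fun k _ => ?_
        rw [Finset.sum_eq_single i]
        · rw [Pi.single_eq_same, dilS_expFun, smul_smul, Matrix.smul_apply, smul_eq_mul, mul_comm]
        · intro i'' _ h; rw [Pi.single_eq_of_ne h, map_zero, smul_zero]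
        · intro h; exact absurd (Finset.mem_univ _) h
      · intro i'' _ h
        rw [Pi.smul_apply, Pi.single_eq_of_ne h.symm, smul_zero]
      · intro h; exact absurd (Finset.mem_univ _) h
    rw [fourierDist, hφ, ← hinv, h1, map_sum]
    simp only [map_smul, Matrix.mulVec, dotProduct, fourierDist, hφ, smul_eq_mul]
  · have h1 : fourierDist φ 0 = c₀ := funext fun i => by
      rw [fourierDist_zero, hφ]
      have h2 := hL (Pi.single i (mono 0)) 0 le_rfl fun i' x _ =>
        hsingle i (mono 0) J x 0 le_rfl (by
          rw [evalD_mono, Nat.descFactorial_of_lt (by omega)]; simp) i'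
      rw [mul_zero, norm_le_zero_iff, sub_eq_zero] at h2
      have h3 : (Pi.single i (mono 0) : Fin r → SmoothFun) = monoV 0 (Pi.single i 1) := by
        funext i'
        by_cases h : i' = i
        · subst h; simp [monoV]
        · simp [monoV, h]
      rw [h2, h3, jetFun_monoV c (by omega), Nat.factorial_zero, Nat.cast_one, one_mul,
        single_dotProduct, one_mul, hc, momentSeq]
    rw [h1, hc₀, dotProduct_smul, smul_eq_mul, inv_mul_cancel₀ hvy]

/-! ### Continuous functions as distributions -/

/-- The vector of compactly supported distributions given by a continuous compactly supported
function. -/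
def toDist {g : ℝ → (Fin r → ℂ)} (hg : Continuous g) (hs : HasCompactSupport g) :
    Fin r → CompactDistribution := fun i =>
  have hint : ∀ f : SmoothFun, MeasureTheory.Integrable fun x => g x i * (f : ℝ → ℂ) x := fun f =>
    ((continuous_coord hg i).mul (contDiff_coe f).continuous).integrable_of_hasCompactSupport
      (hasCompactSupport_coord hs i).mul_right
  { toLin :=
      { toFun := fun f => ∫ x : ℝ, g x i * (f : ℝ → ℂ) x
        map_add' := fun f f' => by
          rw [← MeasureTheory.integral_add (hint f) (hint f')]
          exact MeasureTheory.integral_congr_ae (.of_forall fun x => mul_add _ _ _)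
        map_smul' := fun c f => by
          rw [RingHom.id_apply, smul_eq_mul, ← MeasureTheory.integral_const_mul]
          exact MeasureTheory.integral_congr_ae (.of_forall fun x => mul_left_comm _ _ _) }
    bound := by
      obtain ⟨R, hR⟩ := exists_support_bound (hasCompactSupport_coord hs i)
      refine ⟨0, R, ∫ x, ‖g x i‖, fun f M hM => ?_⟩
      have hgi : MeasureTheory.Integrable fun x => g x i := (continuous_coord hg i).integrable_of_hasCompactSupport
        (hasCompactSupport_coord hs i)
      rw [← MeasureTheory.integral_mul_const]
      refine MeasureTheory.norm_integral_le_of_norm_le (hgi.norm.mul_const M)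
        (.of_forall fun x => ?_)
      rw [norm_mul]
      by_cases hx : g x i = 0
      · simp [hx]
      · have := hM 0 le_rfl x (hR x hx)
        rw [iteratedDeriv_zero] at this
        exact mul_le_mul_of_nonneg_left this (norm_nonneg _) }

lemma isCmFunction_toDist {m : ℕ} {g : ℝ → (Fin r → ℂ)} (hg : ContDiff ℝ m g)
    (hs : HasCompactSupport g) : IsCmFunction m (toDist hg.continuous hs) g :=
  ⟨hg, hs, fun _ _ => rfl⟩

lemma IsCmFunction.fourierDist_eq {m : ℕ} {φ : Fin r → CompactDistribution} {g : ℝ → (Fin r → ℂ)}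
    (h : IsCmFunction m φ g) : fourierDist φ = ft g := by
  funext ξ i
  rw [fourierDist, h.2.2, ft_apply h.1.continuous h.2.1, ft]
  refine MeasureTheory.integral_congr_ae (.of_forall fun x => ?_)
  exact mul_comm _ _

variable {a : ℤ →₀ Matrix (Fin r) (Fin r) ℂ} {v : ℤ →₀ (Fin r → ℂ)} {m : ℕ}

lemma IsCmFunction.isRefinableFun {φ : Fin r → CompactDistribution} {g : ℝ → (Fin r → ℂ)}
    (h : IsCmFunction m φ g) (hφ : IsNormalizedRefinable a v φ) : IsRefinableFun a v m g where
  contDiff := h.1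
  hasCompactSupport := h.2.1
  refine_eq := by rw [← h.fourierDist_eq]; exact hφ.1
  normalized := by rw [← h.fourierDist_eq]; exact hφ.2

lemma IsRefinableFun.isNormalizedRefinable {g : ℝ → (Fin r → ℂ)} (hg : IsRefinableFun a v m g) :
    IsNormalizedRefinable a v (toDist hg.contDiff.continuous hg.hasCompactSupport) := by
  have h := (isCmFunction_toDist hg.contDiff hg.hasCompactSupport).fourierDist_eq
  exact ⟨by rw [h]; exact hg.refine_eq, by rw [h]; exact hg.normalized⟩

end VectorSubdivision

end

theorem mainTheorem1 (r m : ℕ)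
    (a : ℤ →₀ Matrix (Fin r) (Fin r) ℂ)
    (v : ℤ →₀ (Fin r → ℂ)) (hv : IsMatchingFilter a v (m + 1))
    (B : Set (ℤ →₀ (Fin r → ℂ)))
    (hB : B ⊆ vanishing v m)
    (hspan : vanishing v (m + 1) ⊆
      (Submodule.span ℂ {w : ℤ →₀ (Fin r → ℂ) | ∃ u ∈ B, ∃ k : ℤ, ∀ j, w j = u (j - k)} :
        Set (ℤ →₀ (Fin r → ℂ))))
    (hsimple : (symbol a 0).charpoly.rootMultiplicity 1 = 1)
    (hpow : ∀ k : ℕ, 1 ≤ k → (2 : ℂ) ^ k ∉ spectrum ℂ (symbol a 0)) :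
    (∃! φ : Fin r → CompactDistribution, IsNormalizedRefinable a v φ) ∧
    ∀ φ : Fin r → CompactDistribution, IsNormalizedRefinable a v φ →
      List.TFAE [
        (m : EReal) < smInf a,
        CascadeConverges a v m,
        ∃ g, IsCmFunction m φ g ∧ ∀ u, BasisDataConverges a v u (ld m (rowCol v u)) g,
        SubdivisionConverges a v m,
        ∀ w₀ : ℤ → Matrix (Fin 1) (Fin r) ℂ, ∃ η : ℝ → ℂ, ContDiff ℝ m η ∧
          ∀ u ∈ B, DataConverges a v m w₀ u η,
        -- if all the numbers `[v̂ û]^{(m)}(0)`, `u ∈ B`, vanish, then `φ ∈ (C^m)^r` is not required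
        ∃ g, ((∃ u ∈ B, iteratedDeriv m (rowCol v u) 0 ≠ 0) → IsCmFunction m φ g) ∧
          ∀ u ∈ B, BasisDataConverges a v u m g] ∧
      -- smoothness of `φ` and stability of its shifts imply all of the above
      ((∃ g, IsCmFunction m φ g) → StableShifts φ → (m : EReal) < smInf a) := by
  have huniq : ∀ {φ ψ : Fin r → CompactDistribution}, IsNormalizedRefinable a v φ →
      IsNormalizedRefinable a v ψ → φ = ψ := fun h h' => h.unique hv hsimple hpow h'
  refine ⟨?_, fun φ hφ => ⟨?_, ?_⟩⟩
  · obtain ⟨φ, hφ⟩ := exists_isNormalizedRefinable hv hsimple hpow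
    exact ⟨φ, hφ, fun ψ hψ => huniq hψ hφ⟩
  · -- every statement is compared with the exponential decay on `𝒱_{m,v}`
    have h3 : ExpDecay a v m → ∃ g, IsCmFunction m φ g ∧
        ∀ u, BasisDataConverges a v u (ld m (rowCol v u)) g := fun h => by
      obtain ⟨g, hg⟩ := exists_isRefinableFun hv h
      refine ⟨g, ?_, basisDataConverges_of_expDecay h hv hg⟩
      rw [huniq hφ hg.isNormalizedRefinable]
      exact isCmFunction_toDist hg.contDiff hg.hasCompactSupport
    tfae_have 1 → 2 := fun h => cascadeConverges_of_expDecay (expDecay_of_lt_smInf hv h) hv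
    tfae_have 2 → 3 := fun h => h3 (expDecay_of_decay hv (decay_of_cascadeConverges hv h))
    tfae_have 3 → 4 := fun ⟨_, hg, h⟩ => subdivisionConverges_of_basis hg.1 hg.2.1 h
    tfae_have 4 → 5 := fun h w₀ => by
      obtain ⟨η, hη, hd⟩ := h w₀
      exact ⟨η, hη, fun u _ => hd u⟩
    tfae_have 5 → 6 := fun h => by
      obtain ⟨g, hg, hd⟩ := h3 (expDecay_of_decay hv (decay_of_dataConverges hB hspan h))
      refine ⟨g, fun _ => hg, fun u hu => ?_⟩
      have := hd u
      rwa [ld_eq_of_mem_vanishing (hB hu)] at this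
    tfae_have 6 → 1 := fun ⟨_, hg, h⟩ => lt_smInf_of_expDecay hv (expDecay_of_decay hv
      (decay_of_basisDataConverges hB hspan (fun hu => (hg hu).1) h))
    tfae_finish
  · rintro ⟨g, hg⟩ hst
    refine lt_smInf_of_expDecay hv (expDecay_of_decay hv
      (decay_of_stable hv (hg.isRefinableFun hφ) ?_))
    rw [← hg.fourierDist_eq]
    exact hst
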